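/- **Definitions.** Let $\Sigma$ be a finite non-empty alphabet and $\mathcal V$ an infinite set of variables. A *variable-set automaton* (VA) is a tuple $\mathcal A=(Q,q_0,F,\delta)$ with $Q$ a finite set of states, $q_0\in Q$, $F\subseteq Q$, and $\delta$ a finite set of letter transitions $(q,a,q')$ with $a\in\Sigma$ and variable transitions $(q,x{\vdash},q')$, $(q,{\dashv}x,q')$ with $x\in\mathcal V$ (opening and closing $x$); $\mathrm{var}(\mathcal A)$ is the set of variables occurring in $\delta$. A run over a document $d=a_1\cdots a_n\in\Sigma^*$ is a sequence of transitions that starts in $q_0$ at position $1$ and ends at position $n+1$; a letter transition executed at position $i$ reads $a_i$ and leads to position $i+1$, and a variable transition does not change the position. A run is *accepting* if it ends in $F$. It is *valid* if each variable is opened at most once and closed at most once, and is opened at some position $i$ if and only if it is closed at some position $j\ge i$. An accepting valid run defines the mapping that sends each variable $x$ opened at $i$ and closed at $j$ to the span $[i,j\rangle$, and is undefined on all other variables; $[\![\mathcal A]\!]_d$ is the set of mappings defined by the accepting valid runs of $\mathcal A$ over $d$. The VA $\mathcal A$ is *functional* if every accepting run over every document is valid and mentions every variable in $\mathrm{var}(\mathcal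 A)$. The problem $\mathrm{Count}[\mathrm{fVA}]$ is: given a functional VA $\mathcal A$ (not necessarily extended or deterministic) and a document $d$, compute $|[\![\mathcal A]\!]_d|$. Instances are written as words over a finite alphabet that list $Q$, $q_0$, $F$, $\delta$ (states and variables being named by binary words) and $d$. A *log-space machine with output* is a Turing machine with a two-way read-only input tape, finitely many work tapes of which, on inputs of length $n$, it only uses $O(\log n)$ cells in any run, and a one-way write-only output tape that is not charged for space. $\mathrm{SpanL}$ is the class of functions $f:\Gamma^*\to\mathbb N$ ($\Gamma$ a finite alphabet) for which there is a nondeterministic log-space machine with output such that, for every $w\in\Gamma^*$, the number of different words that it outputs in its accepting runs on $w$ is finite and equal to $f(w)$. **Theorem.** For every finite non-empty alphabet $\Sigma$, $\mathrm{Count}[\mathrm{fVA}]$ is $\mathrm{SpanL}$-complete under log-space parsimonious reductions, that is: 1. (Membership) there is a function $f\in\mathrm{SpanL}$ such that $f(w)=|[\![\mathcal A]\!]_d|$ for every word $w$ that represents a functional VA $\mathcal A$ and a document $d$; 2. (Hardness) for every finite alphabet $\Gamma'$ and every $g:\Gamma'^*\to\mathbb N$ in $\mathrm{SpanL}$ there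 is a function $r$, computable by a deterministic log-space machine with output, such that for every $w\in\Gamma'^*$ the word $r(w)$ represents a functional VA $\mathcal A$ and a document $d$ with $|[\![\mathcal A]\!]_d|=g(w)$. -/

import Mathlib

/-! ## Turing machines with output, logarithmic space, and the class SpanL -/

namespace Machine

/-- Head moves. -/
inductive Move where
  | left
  | stay
  | right

/-- New position of a head on a one-way infinite tape (a left move in cell `0` does nothing). -/
def Move.apply : Move → ℕ → ℕ
  | .left, p => p - 1
  | .stay, p => p
  | .right, p => p + 1

/-- Contents of an input cell: a letter or one of the two end markers. -/
inductive InSym (Γ : Type) where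
  | leftEnd
  | sym (a : Γ)
  | rightEnd

/-- The input tape: the left end marker in cell `0`, the word in cells `1, …, |w|`, and the right
end marker afterwards (heads never move beyond cell `|w| + 1`). -/
def readInput {Γ : Type} (w : List Γ) : ℕ → InSym Γ
  | 0 => .leftEnd
  | p + 1 =>
    match w[p]? with
    | some a => .sym a
    | none => .rightEnd

/-- One instruction: new state, move of the input head, symbols written and moves made on the `k`
work tapes, and at most one symbol that is appended to the output tape. -/
structure Action (Q W Δ : Type) (k : ℕ) where
  next : Q
  inMove : Move
  write : Fin k → W
  move : Fin k → Move
  out : Option Δ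

/-- A nondeterministic Turing machine with a two-way read-only input tape over `Γ`, finitely many
work tapes and a one-way write-only output tape over `Δ`. -/
structure TM (Γ Δ : Type) where
  /-- number of work tapes -/
  k : ℕ
  /-- states -/
  Q : Type
  /-- work alphabet -/
  W : Type
  finite_Q : Finite Q
  finite_W : Finite W
  blank : W
  start : Q
  /-- accepting states; the machine halts there -/
  accept : Set Q
  /-- the instructions available for a state, an input symbol and the scanned work symbols -/
  trans : Q → InSym Γ → (Fin k → W) → Set (Action Q W Δ k)

namespace TM

variable {Γ Δ : Type}

/-- Configurations. -/
structure Cfg (M : TM Γ Δ) where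
  state : M.Q
  inHead : ℕ
  tapes : Fin M.k → ℕ → M.W
  heads : Fin M.k → ℕ
  out : List Δ

/-- The initial configuration. -/
def initCfg (M : TM Γ Δ) : M.Cfg where
  state := M.start
  inHead := 0
  tapes := fun _ _ => M.blank
  heads := fun _ => 0
  out := []

/-- The result of executing one instruction on input `w`. -/
def exec (M : TM Γ Δ) (w : List Γ) (c : M.Cfg) (act : Action M.Q M.W Δ M.k) : M.Cfg where
  state := act.next
  inHead := min (act.inMove.apply c.inHead) (w.length + 1)
  tapes := fun i => Function.update (c.tapes i) (c.heads i) (act.write i)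
  heads := fun i => (act.move i).apply (c.heads i)
  out := c.out ++ act.out.toList

/-- The one-step relation on input `w`. -/
def Step (M : TM Γ Δ) (w : List Γ) (c c' : M.Cfg) : Prop :=
  c.state ∉ M.accept ∧
    ∃ act ∈ M.trans c.state (readInput w c.inHead) (fun i => c.tapes i (c.heads i)),
      c' = M.exec w c act

/-- Configurations that occur in some run on input `w`. -/
def Reachable (M : TM Γ Δ) (w : List Γ) (c : M.Cfg) : Prop :=
  Relation.ReflTransGen (M.Step w) M.initCfg c

/-- The set of words produced by the accepting runs on input `w`. -/
def outputs (M : TM Γ Δ) (w : List Γ) : Set (List Δ) :=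
  {y | ∃ c : M.Cfg, M.Reachable w c ∧ c.state ∈ M.accept ∧ c.out = y}

/-- `M` works in space `O(log n)`: on inputs of length `n`, no work head ever leaves the first
`O(log n)` cells of its tape, in any run. The output tape is not charged. -/
def LogSpace (M : TM Γ Δ) : Prop :=
  ∃ C : ℕ, ∀ (w : List Γ) (c : M.Cfg), M.Reachable w c →
    ∀ i, c.heads i ≤ C * (Nat.log 2 w.length + 1)

/-- At most one instruction is available in every situation. -/
def Deterministic (M : TM Γ Δ) : Prop :=
  ∀ q a u, (M.trans q a u).Subsingleton

end TM

/-- The class SpanL over the alphabet `Γ`: the functions `f : Γ* → ℕ` such that some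
nondeterministic logarithmic-space machine with output has, on every input `w`, exactly `f w`
different outputs. -/
def SpanL (Γ : Type) : Set (List Γ → ℕ) :=
  {f | ∃ (Δ : Type) (_ : Finite Δ) (M : TM Γ Δ),
    M.LogSpace ∧ ∀ w, (M.outputs w).encard = (f w : ℕ∞)}

/-- Word functions that are computed by a deterministic logarithmic-space machine with output. -/
def LogSpaceComputable {Γ Δ : Type} (r : List Γ → List Δ) : Prop :=
  ∃ M : TM Γ Δ, M.Deterministic ∧ M.LogSpace ∧ ∀ w, M.outputs w = {r w}

/-- A counting problem: its instances, the words over `Γ` that represent an instance, and the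
number to be computed. -/
structure CountingProblem (Γ : Type) where
  Inst : Type
  IsCode : List Γ → Inst → Prop
  value : Inst → ℕ∞

namespace CountingProblem

variable {Γ : Type}

/-- Membership in SpanL: some function in SpanL has the right value on every word that represents
an instance. -/
def MemSpanL (P : CountingProblem Γ) : Prop :=
  ∃ f ∈ SpanL Γ, ∀ w x, P.IsCode w x → (f w : ℕ∞) = P.value x

/-- Hardness for SpanL: every function in SpanL, over any finite alphabet, has a log-space
computable parsimonious reduction to `P`. -/
def SpanLHard (P : CountingProblem Γ) : Prop :=
  ∀ (Γ' : Type) [Finite Γ'] (g : List Γ' → ℕ), g ∈ SpanL Γ' →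
    ∃ r : List Γ' → List Γ, LogSpaceComputable r ∧
      ∀ w, ∃ x : P.Inst, P.IsCode (r w) x ∧ P.value x = (g w : ℕ∞)

/-- Completeness for SpanL under log-space parsimonious reductions. -/
def SpanLComplete [Finite Γ] (P : CountingProblem Γ) : Prop :=
  P.MemSpanL ∧ P.SpanLHard

end CountingProblem

end Machine

/-! ## Variable-set automata -/

namespace Spanner

/-- Labels of transitions: letters and the variable markers that open or close a variable. -/
inductive Op (σ V : Type) where
  | letter (a : σ)
  | opn (x : V)
  | cls (x : V)

/-- Spans `[lo, hi⟩`. -/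
@[ext]
structure Span where
  lo : ℕ
  hi : ℕ
  one_le_lo : 1 ≤ lo
  lo_le_hi : lo ≤ hi

/-- Mappings from a finite set of variables to spans. -/
@[ext]
structure Mapping (V : Type) where
  toFun : V → Option Span
  finite_dom : {x | toFun x ≠ none}.Finite

/-- Variable-set automata over the alphabet `σ` with variables from `V`; the states form a finite
subset of the type `S`. -/
@[ext]
structure VA (σ V S : Type) where
  states : Finset S
  init : S
  final : Finset S
  trans : Finset (S × Op σ V × S)
  init_mem : init ∈ states
  final_subset : final ⊆ states
  trans_mem : ∀ t ∈ trans, t.1 ∈ states ∧ t.2.2 ∈ states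

namespace VA

variable {σ V S : Type}

/-- The variables mentioned in some transition. -/
def vars (A : VA σ V S) : Set V :=
  {x | ∃ p q, (p, Op.opn x, q) ∈ A.trans ∨ (p, Op.cls x, q) ∈ A.trans}

/-- `A.Run d p i ρ q j`: there is a sequence of transitions from the configuration `(p, i)` to the
configuration `(q, j)` over the document `d`, and `ρ` lists the executed labels, each with the
position of the document (counted from `1`) at which it is executed. -/
inductive Run (A : VA σ V S) (d : List σ) : S → ℕ → List (Op σ V × ℕ) → S → ℕ → Prop
  | nil (p : S) (i : ℕ) : Run A d p i [] p i
  | letter {p p' q : S} {a : σ} {i j : ℕ} {ρ : List (Op σ V × ℕ)} :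
      (p, Op.letter a, p') ∈ A.trans → d[i - 1]? = some a → Run A d p' (i + 1) ρ q j →
      Run A d p i ((Op.letter a, i) :: ρ) q j
  | opn {p p' q : S} {x : V} {i j : ℕ} {ρ : List (Op σ V × ℕ)} :
      (p, Op.opn x, p') ∈ A.trans → Run A d p' i ρ q j →
      Run A d p i ((Op.opn x, i) :: ρ) q j
  | cls {p p' q : S} {x : V} {i j : ℕ} {ρ : List (Op σ V × ℕ)} :
      (p, Op.cls x, p') ∈ A.trans → Run A d p' i ρ q j →
      Run A d p i ((Op.cls x, i) :: ρ) q j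

/-- `ρ` is the label sequence of an accepting run over `d`. -/
def Accepting (A : VA σ V S) (d : List σ) (ρ : List (Op σ V × ℕ)) : Prop :=
  ∃ q ∈ A.final, A.Run d A.init 1 ρ q (d.length + 1)

end VA

/-- Valid runs: no marker is executed twice, and a variable is opened at some position `i` if and
only if it is closed at some position `j ≥ i`. -/
def Valid {σ V : Type} (ρ : List (Op σ V × ℕ)) : Prop :=
  ρ.Pairwise (fun s t => s.1 = t.1 → ∃ a, s.1 = Op.letter a) ∧
  (∀ x i, (Op.opn x, i) ∈ ρ → ∃ j, i ≤ j ∧ (Op.cls x, j) ∈ ρ) ∧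
  (∀ x j, (Op.cls x, j) ∈ ρ → ∃ i, i ≤ j ∧ (Op.opn x, i) ∈ ρ)

/-- `μ` is the mapping defined by the (valid) run `ρ`. -/
def Defines {σ V : Type} (ρ : List (Op σ V × ℕ)) (μ : Mapping V) : Prop :=
  ∀ (x : V) (s : Span),
    μ.toFun x = some s ↔ (Op.opn x, s.lo) ∈ ρ ∧ (Op.cls x, s.hi) ∈ ρ

namespace VA

variable {σ V S : Type}

/-- The set of output mappings of `A` over the document `d`. -/
def sem (A : VA σ V S) (d : List σ) : Set (Mapping V) :=
  {μ | ∃ ρ, A.Accepting d ρ ∧ Valid ρ ∧ Defines ρ μ}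

/-- Functional automata: every accepting run, over any document, is valid and mentions all
variables of the automaton. -/
def Functional (A : VA σ V S) : Prop :=
  ∀ d ρ, A.Accepting d ρ →
    Valid ρ ∧ ∀ x ∈ A.vars, ∃ i, (Op.opn x, i) ∈ ρ ∨ (Op.cls x, i) ∈ ρ

end VA

/-! ## Instances as words; states and variables are named by binary words -/

/-- The alphabet in which instances are written. -/
inductive Sym (σ : Type) where
  | bit (b : Bool)
  | letter (a : σ)
  | opn
  | cls
  /-- end of a name -/
  | sep
  /-- end of a block -/
  | bar

instance {σ : Type} [Finite σ] : Finite (Sym σ) :=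
  Finite.of_injective
    (fun s : Sym σ => (match s with
      | .bit b => .inl b
      | .letter a => .inr (.inl a)
      | .opn => .inr (.inr 0)
      | .cls => .inr (.inr 1)
      | .sep => .inr (.inr 2)
      | .bar => .inr (.inr 3) : Bool ⊕ σ ⊕ Fin 4))
    (by rintro (_ | _) (_ | _) h <;> simp_all)

/-- Code of the name of a state or variable. -/
def encName {σ : Type} (q : List Bool) : List (Sym σ) :=
  q.map Sym.bit ++ [Sym.sep]

/-- Code of a label. -/
def encOp {σ : Type} : Op σ (List Bool) → List (Sym σ)
  | .letter a => [Sym.letter a]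
  | .opn x => Sym.opn :: encName x
  | .cls x => Sym.cls :: encName x

/-- Code of a transition. -/
def encTrans {σ : Type} (t : List Bool × Op σ (List Bool) × List Bool) : List (Sym σ) :=
  encName t.1 ++ encOp t.2.1 ++ encName t.2.2

/-- The word that lists states, initial state, final states, transitions and document. -/
def encInput {σ : Type} (qs : List (List Bool)) (q₀ : List Bool) (fs : List (List Bool))
    (ts : List (List Bool × Op σ (List Bool) × List Bool)) (d : List σ) : List (Sym σ) :=
  qs.flatMap encName ++ [Sym.bar] ++ encName q₀ ++ [Sym.bar] ++ fs.flatMap encName ++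
    [Sym.bar] ++ ts.flatMap encTrans ++ [Sym.bar] ++ d.map Sym.letter

/-- `w` represents the automaton `A` and the document `d`; the elements of the finite sets that
make up `A` may be listed in any order. -/
def IsCode {σ : Type} (w : List (Sym σ)) (A : VA σ (List Bool) (List Bool)) (d : List σ) : Prop :=
  ∃ qs fs ts, (∀ q, q ∈ qs ↔ q ∈ A.states) ∧ (∀ q, q ∈ fs ↔ q ∈ A.final) ∧
    (∀ t, t ∈ ts ↔ t ∈ A.trans) ∧ w = encInput qs A.init fs ts d

/-- The problem `Count[fVA]`: given a functional variable-set automaton and a document, compute the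
number of output mappings. -/
noncomputable def CountFVA (σ : Type) : Machine.CountingProblem (Sym σ) where
  Inst := {A : VA σ (List Bool) (List Bool) // A.Functional} × List σ
  IsCode := fun w x => IsCode w x.1.1 x.2
  value := fun x => (x.1.1.sem x.2).encard

end Spanner

/-! Membership. An accepting run over a document splits at its letters into segments; inside a
segment only variable transitions are executed, all at the same position. The machine guesses the
run segment by segment. Being in state `p` at some position, it guesses the state `q` in which the
next letter will be read, and then emits, for every variable transition of the input list, one bit
that says whether its operation is executed between `p` and `q`. The set of operations already
executed does not fit into logarithmic space, so every bit is justified by a path of its own from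
`p` to `q`: a path that avoids the operation for the bit 0, a path through it for the bit 1 (`Bits`,
`Acc`). The paths need not agree a priori, but in a functional automaton they must: replacing one by
another inside an accepting run gives an accepting run again, both runs execute every marker exactly
once, and the rest of the run is unchanged (`mem_of_vPath`). Hence the output is the characteristic
vector of the pairs of an operation and a position of the run (`Acc.eq_bitsOf`), which determines
the mapping and is determined by it (`encard_acc`).

The machine only keeps pointers to occurrences of names in the input. It is written as a regular
program for a two-way automaton with pebbles; names are compared with two scratch pebbles. A program
has finitely many continuations and so becomes a pebble automaton; positions written in binary turn
this into repeated sweeps over a string of logarithmic length, and such sweeps are executed by a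
one-tape Turing machine (`FM.exists_TM`, `PA.exists_TM`, `Prog.exists_TM`). Correctness is shown
through relations on views of positions and a bisimulation with abstract states that contain the
names themselves (`Simulates`, `eval_iff`).

Hardness. The configurations of a log-space machine, without the output tape, are the vertices of a
graph whose edges carry at most one output symbol. A vertex is a string of length `L = strLen b |w|`
over a finite alphabet `D`, and an edge is recognized by a finite automaton that reads both strings
in parallel with the binary digits of an input position whose symbol it knows
(`TM.LogSpace.exists_auts`). Let `n + 1 = |D| ^ L` be the number of strings. If the set of outputs
is finite, every output has at most `n` symbols, since otherwise a vertex repeats around a nonempty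
piece of output and that piece can be pumped (`length_lt_of_finite`); silent stretches can be cut to
at most `n` steps (`sil_of_path`). So outputs correspond to words of exactly `n + 1` blocks, each an
output symbol or the padding symbol `none` (`encard_words`).

The constructed automaton has `n + 1` variables, one for each block, and reads a document that
repeats a single letter. Before each block it reads exactly `n` letters while making silent steps or
waiting; then it opens the variable, reads `j` letters and closes the variable, where `j` encodes
the symbol of the block. All positions are then functions of the word of blocks, so runs with the
same word give the same mapping and different words give different span lengths; every accepting run
is valid and uses all variables (`Spells.functional`, `Spells.encard_sem`). Each kind of transition
is again recognized by a finite automaton on columns (`Hit.sound`, `Hit.complete`). A deterministic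
log-space machine can run through all strings of logarithmic length and print the accepted ones
(`logSpaceComputable_enum`), which writes down the automaton; one letter per enumerated string makes
the document long enough. -/

set_option linter.unusedSectionVars false


/-! ### Log-space execution, level 1: sweeping transducers on a Turing tape. -/

namespace Machine

/-! ## Sweeping machines -/

/-- A machine whose storage is a string over `D`. In every round it sweeps once over the whole
string as a sequential transducer, and then moves the input head, emits at most one symbol and
appends at most one symbol to the string. -/
structure SM (Γ Δ D Q : Type) where
  start : Q
  accept : Set Q
  cell : Q → InSym Γ → D → Q × D × Option Δ
  fin : Q → InSym Γ → Set (Q × Move × Option Δ × Option D)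

/-- Final state, new string and output of one sweep. -/
def sweep {Δ D Q : Type} (f : Q → D → Q × D × Option Δ) : Q → List D → Q × List D × List Δ
  | q, [] => (q, [], [])
  | q, d :: xs =>
    ((sweep f (f q d).1 xs).1, (f q d).2.1 :: (sweep f (f q d).1 xs).2.1,
      (f q d).2.2.toList ++ (sweep f (f q d).1 xs).2.2)

theorem sweep_append {Δ D Q : Type} (f : Q → D → Q × D × Option Δ) (q : Q) (xs ys : List D) :
    sweep f q (xs ++ ys) = ((sweep f (sweep f q xs).1 ys).1,
      (sweep f q xs).2.1 ++ (sweep f (sweep f q xs).1 ys).2.1,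
      (sweep f q xs).2.2 ++ (sweep f (sweep f q xs).1 ys).2.2) := by
  induction xs generalizing q with
  | nil => simp [sweep]
  | cons d xs ih => simp [sweep, ih]

@[simp] theorem sweep_length {Δ D Q : Type} (f : Q → D → Q × D × Option Δ) (q : Q) (xs : List D) :
    (sweep f q xs).2.1.length = xs.length := by
  induction xs generalizing q with
  | nil => simp [sweep]
  | cons d xs ih => simp [sweep, ih]

namespace SM

variable {Γ Δ D Q : Type}

/-- Configurations between two sweeps. -/
structure Cfg (Δ D Q : Type) where
  state : Q
  head : ℕ
  str : List D
  out : List Δ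

def initCfg (S : SM Γ Δ D Q) : Cfg Δ D Q := ⟨S.start, 0, [], []⟩

/-- The sweep performed in a configuration. -/
def sw (S : SM Γ Δ D Q) (w : List Γ) (c : Cfg Δ D Q) : Q × List D × List Δ :=
  sweep (fun q => S.cell q (readInput w c.head)) c.state c.str

def Step (S : SM Γ Δ D Q) (w : List Γ) (c c' : Cfg Δ D Q) : Prop :=
  c.state ∉ S.accept ∧ ∃ t ∈ S.fin (S.sw w c).1 (readInput w c.head),
    c' = ⟨t.1, min (t.2.1.apply c.head) (w.length + 1), (S.sw w c).2.1 ++ t.2.2.2.toList,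
      c.out ++ (S.sw w c).2.2 ++ t.2.2.1.toList⟩

def Reachable (S : SM Γ Δ D Q) (w : List Γ) (c : Cfg Δ D Q) : Prop :=
  Relation.ReflTransGen (S.Step w) S.initCfg c

def outputs (S : SM Γ Δ D Q) (w : List Γ) : Set (List Δ) :=
  {y | ∃ c, S.Reachable w c ∧ c.state ∈ S.accept ∧ c.out = y}

/-- Control states of the Turing machine that simulates a sweeping machine. -/
inductive Ctl (Q : Type) where
  | boot
  | rw (q : Q)
  | sw (q : Q)

/-- Work symbols of the simulating Turing machine. -/
inductive Cell (D : Type) where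
  | blank
  | left
  | dig (d : D)

instance [Finite Q] : Finite (Ctl Q) :=
  Finite.of_injective
    (fun s : Ctl Q => (match s with
      | .boot => none
      | .rw q => some (true, q)
      | .sw q => some (false, q) : Option (Bool × Q)))
    (by rintro (_ | _ | _) (_ | _ | _) h <;> simp_all)

instance [Finite D] : Finite (Cell D) :=
  Finite.of_injective
    (fun s : Cell D => (match s with
      | .blank => .inl true
      | .left => .inl false
      | .dig d => .inr d : Bool ⊕ D))
    (by rintro (_ | _ | _) (_ | _ | _) h <;> simp_all)

/-- The tape that holds a string. -/
def tp (xs : List D) : ℕ → Cell D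
  | 0 => .left
  | n + 1 => match xs[n]? with
    | some d => .dig d
    | none => .blank

/-- An instruction of a one-tape machine. -/
def act1 {Q W : Type} (q : Q) (m : Move) (x : W) (tm : Move) (o : Option Δ) : Action Q W Δ 1 :=
  ⟨q, m, fun _ => x, fun _ => tm, o⟩

/-- Instructions of the simulating Turing machine. -/
def tmTrans (S : SM Γ Δ D Q) (q : Ctl Q) (a : InSym Γ) (u : Cell D) :
    Set (Action (Ctl Q) (Cell D) Δ 1) :=
  match q, u with
  | .boot, _ => {act1 (.rw S.start) .stay .left .stay none}
  | .rw q, .left => {act1 (.sw q) .stay .left .right none}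
  | .rw q, x => {act1 (.rw q) .stay x .left none}
  | .sw q, .dig d =>
    {act1 (.sw (S.cell q a d).1) .stay (.dig (S.cell q a d).2.1) .right (S.cell q a d).2.2}
  | .sw q, x => {act | ∃ t ∈ S.fin q a,
      act = act1 (.rw t.1) t.2.1 (t.2.2.2.elim x .dig) .left t.2.2.1}

/-- The Turing machine that simulates a sweeping machine. -/
def toTM [Finite D] [Finite Q] (S : SM Γ Δ D Q) : TM Γ Δ where
  k := 1
  Q := Ctl Q
  W := Cell D
  finite_Q := inferInstance
  finite_W := inferInstance
  blank := .blank
  start := .boot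
  accept := {q | ∃ q' ∈ S.accept, q = .rw q'}
  trans := fun q a u => S.tmTrans q a (u 0)

variable [Finite D] [Finite Q] (S : SM Γ Δ D Q) (w : List Γ)

/-- Configurations of the simulating Turing machine. -/
def tcfg (q : Ctl Q) (h : ℕ) (t : ℕ → Cell D) (p : ℕ) (o : List Δ) : (S.toTM).Cfg :=
  ⟨q, h, fun _ => t, fun _ => p, o⟩

/-- The configuration after an instruction of the simulating Turing machine. -/
def texec (h : ℕ) (t : ℕ → Cell D) (p : ℕ) (o : List Δ) (act : Action (Ctl Q) (Cell D) Δ 1) :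
    (S.toTM).Cfg :=
  S.tcfg act.next (min (act.inMove.apply h) (w.length + 1)) (Function.update t p (act.write 0))
    ((act.move 0).apply p) (o ++ act.out.toList)

/-- There is one work tape, so families indexed by `Fin 1` collapse to a single tape and a single
head. All later steps are computed in this form. -/
theorem tm_step_iff (q : Ctl Q) (h : ℕ) (t : ℕ → Cell D) (p : ℕ) (o : List Δ)
    (c' : (S.toTM).Cfg) :
    (S.toTM).Step w (S.tcfg q h t p o) c' ↔ (¬ ∃ q' ∈ S.accept, q = .rw q') ∧
      ∃ act ∈ S.tmTrans q (readInput w h) (t p), c' = S.texec w h t p o act := by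
  have : ∀ act : Action (Ctl Q) (Cell D) Δ 1,
      (S.toTM).exec w (S.tcfg q h t p o) act = S.texec w h t p o act := by
    intro act
    refine congrArg₂ (fun a b => (⟨_, _, a, b, _⟩ : (S.toTM).Cfg)) ?_ ?_ <;> funext i <;>
      obtain rfl : i = (0 : Fin 1) := Subsingleton.elim (α := Fin 1) _ _ <;> rfl
  refine and_congr Iff.rfl ⟨?_, ?_⟩
  · rintro ⟨act, h, rfl⟩
    exact ⟨act, h, this act⟩
  · rintro ⟨act, h, rfl⟩
    exact ⟨act, h, (this act).symm⟩

theorem exec_act1 (q' : Ctl Q) (h : ℕ) (t : ℕ → Cell D) (p : ℕ) (o : List Δ) (m tm : Move)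
    (x : Cell D) (b : Option Δ) :
    S.texec w h t p o (act1 q' m x tm b) =
      S.tcfg q' (min (m.apply h) (w.length + 1)) (Function.update t p x) (tm.apply p)
        (o ++ b.toList) := rfl

theorem tp_append_cons (ys zs : List D) (d : D) : tp (ys ++ d :: zs) (ys.length + 1) = .dig d := by
  simp [tp]

theorem tp_end (ys : List D) : tp ys (ys.length + 1) = .blank := by
  simp [tp]

theorem update_tp_dig (ys zs : List D) (d d' : D) :
    Function.update (tp (ys ++ d :: zs)) (ys.length + 1) (.dig d') = tp (ys ++ d' :: zs) := by
  funext n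
  rcases n with _ | n
  · simp [tp]
  · rcases lt_trichotomy n ys.length with h | h | h
    · rw [Function.update_of_ne (by omega)]
      simp [tp, List.getElem?_append_left h]
    · subst h; simp [tp]
    · rw [Function.update_of_ne (by omega)]
      obtain ⟨m, rfl⟩ := Nat.exists_eq_add_of_lt h
      have : ys.length + m + 1 - ys.length = m + 1 := by omega
      simp only [tp, List.getElem?_append_right (show ys.length ≤ ys.length + m + 1 by omega), this,
        List.getElem?_cons_succ]

/-- The cell behind the string is blank, so appending a symbol and appending nothing are both a
single write there; the default `.blank` is the second case. -/
theorem update_tp_end (ys : List D) (o : Option D) :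
    Function.update (tp ys) (ys.length + 1) (o.elim .blank .dig) = tp (ys ++ o.toList) := by
  cases o with
  | none => simpa using (tp_end ys).symm
  | some d =>
    funext n
    rcases n with _ | n
    · simp [tp]
    · rcases lt_trichotomy n ys.length with h | h | h
      · rw [Function.update_of_ne (by omega)]
        simp [tp, List.getElem?_append_left h]
      · subst h; simp [tp]
      · rw [Function.update_of_ne (by omega)]
        have : ys[n]? = none := by simp [h.le]
        have h2 : (ys ++ (some d).toList)[n]? = none := by simp; omega
        simp only [tp, this, h2]

/-- The simulation relation between configurations. -/
inductive Sim : (S.toTM).Cfg → Cfg Δ D Q → Prop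
  | boot : Sim (S.toTM).initCfg S.initCfg
  | rw (c : Cfg Δ D Q) (p : ℕ) (hp : p ≤ c.str.length) :
      Sim (S.tcfg (.rw c.state) c.head (tp c.str) p c.out) c
  | sw (c : Cfg Δ D Q) (hc : c.state ∉ S.accept) (q : Q) (pre ys zs : List D) (o : List Δ)
      (hs : c.str = pre ++ zs)
      (hq : sweep (fun q => S.cell q (readInput w c.head)) c.state pre = (q, ys, o)) :
      Sim (S.tcfg (.sw q) c.head (tp (ys ++ zs)) (ys.length + 1) (c.out ++ o)) c

theorem tp_init : Function.update (fun _ => Cell.blank) 0 .left = tp ([] : List D) := by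
  funext n
  rcases n with _ | n <;> simp [tp]

theorem initCfg_eq : (S.toTM).initCfg = S.tcfg .boot 0 (fun _ => .blank) 0 [] := rfl

/-- Input heads stay on the input. -/
theorem head_le {c : Cfg Δ D Q} (h : S.Reachable w c) : c.head ≤ w.length + 1 := by
  cases h with
  | refl => simp [initCfg]
  | tail _ h => obtain ⟨_, t, _, rfl⟩ := h; simp

/-- Rewinding, and sweeping over a nonblank cell, leave the abstract configuration unchanged; only
the instruction executed on the blank behind the string performs an abstract step. In the middle of
a sweep the tape holds the rewritten prefix `ys` followed by the untouched rest `zs`. -/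
theorem sim_step {c c' : (S.toTM).Cfg} {p : Cfg Δ D Q} (hp : p.head ≤ w.length + 1)
    (h : S.Sim w c p) (hs : (S.toTM).Step w c c') :
    ∃ p', (p' = p ∨ S.Step w p p') ∧ S.Sim w c' p' := by
  cases h with
  | boot =>
    rw [initCfg_eq, tm_step_iff] at hs
    obtain ⟨-, act, hact, rfl⟩ := hs
    obtain rfl := hact
    refine ⟨_, .inl rfl, ?_⟩
    rw [exec_act1, tp_init]
    simpa [Move.apply, initCfg] using Sim.rw (S := S) (w := w) S.initCfg 0 (by simp)
  | rw _ n hn =>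
    rw [tm_step_iff] at hs
    obtain ⟨hna, act, hact, rfl⟩ := hs
    have hna : p.state ∉ S.accept := fun h => hna ⟨_, h, rfl⟩
    refine ⟨p, .inl rfl, ?_⟩
    have hh : min (Move.stay.apply p.head) (w.length + 1) = p.head := by simpa [Move.apply]
    rcases n with _ | n
    · obtain rfl := hact
      rw [exec_act1, hh]
      have : Function.update (tp p.str) 0 Cell.left = tp p.str := by
        rw [Function.update_eq_self_iff]; rfl
      rw [this]
      simpa [Move.apply] using Sim.sw (S := S) (w := w) p hna p.state [] [] p.str [] rfl rfl
    · have hd : tp p.str (n + 1) = .dig (p.str[n]'(by omega)) := by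
        simp [tp, List.getElem?_eq_getElem (show n < p.str.length by omega)]
      rw [hd] at hact
      obtain rfl := hact
      rw [exec_act1, hh, ← hd, Function.update_eq_self]
      simpa [Move.apply] using Sim.rw (S := S) (w := w) p n (by omega)
  | sw _ hc q pre ys zs o hstr hq =>
    rw [tm_step_iff] at hs
    obtain ⟨-, act, hact, rfl⟩ := hs
    rcases zs with _ | ⟨d, zs⟩
    · rw [List.append_nil, tp_end] at hact
      obtain ⟨t, ht, rfl⟩ := hact
      have hsw : S.sw w p = (q, ys, o) := by rw [SM.sw, hstr, List.append_nil, hq]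
      refine ⟨_, .inr ⟨hc, t, by rw [hsw]; exact ht, rfl⟩, ?_⟩
      rw [exec_act1, List.append_nil, update_tp_end, hsw]
      exact Sim.rw (S := S) (w := w) ⟨t.1, _, _, _⟩ _ (by simp [Move.apply])
    · rw [tp_append_cons] at hact
      obtain rfl := hact
      refine ⟨p, .inl rfl, ?_⟩
      rw [exec_act1, update_tp_dig]
      have hh : min (Move.stay.apply p.head) (w.length + 1) = p.head := by simpa [Move.apply]
      rw [hh]
      have := Sim.sw (S := S) (w := w) p hc (S.cell q (readInput w p.head) d).1 (pre ++ [d])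
        (ys ++ [(S.cell q (readInput w p.head) d).2.1]) zs
        (o ++ (S.cell q (readInput w p.head) d).2.2.toList) (by simp [hstr])
        (by rw [sweep_append, hq]; simp [sweep])
      simpa [Move.apply] using this

theorem sim_reachable {c : (S.toTM).Cfg} (h : (S.toTM).Reachable w c) :
    ∃ p, S.Reachable w p ∧ S.Sim w c p := by
  induction h with
  | refl => exact ⟨_, .refl, .boot⟩
  | tail _ hs ih =>
    obtain ⟨p, hp, hsim⟩ := ih
    obtain ⟨p', h | h, hsim'⟩ := S.sim_step w (S.head_le w hp) hsim hs
    · exact ⟨p', h ▸ hp, hsim'⟩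
    · exact ⟨p', hp.tail h, hsim'⟩

theorem run_rewind (c : Cfg Δ D Q) (hc : c.state ∉ S.accept) (hh : c.head ≤ w.length + 1) (p : ℕ)
    (hp : p ≤ c.str.length) :
    Relation.ReflTransGen ((S.toTM).Step w) (S.tcfg (.rw c.state) c.head (tp c.str) p c.out)
      (S.tcfg (.sw c.state) c.head (tp c.str) 1 c.out) := by
  have hh : min (Move.stay.apply c.head) (w.length + 1) = c.head := by simpa [Move.apply]
  have hna : ¬ ∃ q' ∈ S.accept, Ctl.rw c.state = .rw q' := by
    rintro ⟨q, hq, h⟩; cases h; exact hc hq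
  induction p with
  | zero =>
    refine .single ((S.tm_step_iff w ..).mpr ⟨hna, _, rfl, ?_⟩)
    rw [exec_act1, hh]
    have : Function.update (tp c.str) 0 Cell.left = tp c.str := by
      rw [Function.update_eq_self_iff]; rfl
    rw [this]; simp [Move.apply]
  | succ n ih =>
    refine .head ((S.tm_step_iff w ..).mpr
      ⟨hna, act1 (.rw c.state) .stay (tp c.str (n + 1)) .left none, ?_, ?_⟩)
      (ih (by omega))
    · have hd : tp c.str (n + 1) = .dig (c.str[n]'(by omega)) := by
        simp [tp, List.getElem?_eq_getElem (show n < c.str.length by omega)]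
      rw [hd]; rfl
    · rw [exec_act1, hh, Function.update_eq_self]; simp [Move.apply]

theorem run_sweep (h : ℕ) (hh : h ≤ w.length + 1) (q : Q) (ys zs : List D) (o : List Δ) :
    Relation.ReflTransGen ((S.toTM).Step w) (S.tcfg (.sw q) h (tp (ys ++ zs)) (ys.length + 1) o)
      (S.tcfg (.sw (sweep (fun q => S.cell q (readInput w h)) q zs).1) h
        (tp (ys ++ (sweep (fun q => S.cell q (readInput w h)) q zs).2.1)) (ys.length + zs.length + 1)
        (o ++ (sweep (fun q => S.cell q (readInput w h)) q zs).2.2)) := by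
  have hh : min (Move.stay.apply h) (w.length + 1) = h := by simpa [Move.apply]
  induction zs generalizing q ys o with
  | nil => simpa [sweep] using Relation.ReflTransGen.refl
  | cons d zs ih =>
    have := ih (S.cell q (readInput w h) d).1 (ys ++ [(S.cell q (readInput w h) d).2.1])
      (o ++ (S.cell q (readInput w h) d).2.2.toList)
    refine .head ((S.tm_step_iff w ..).mpr ⟨by simp, ?_⟩)
      (b := S.tcfg (.sw (S.cell q (readInput w h) d).1) h
        (tp (ys ++ (S.cell q (readInput w h) d).2.1 :: zs)) (ys.length + 2)
        (o ++ (S.cell q (readInput w h) d).2.2.toList)) ?_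
    · refine ⟨_, by rw [tp_append_cons]; exact rfl, ?_⟩
      rw [exec_act1, update_tp_dig, hh]
      rfl
    · simpa [sweep, add_assoc, add_comm, add_left_comm] using this

theorem run_step {c c' : Cfg Δ D Q} (hh : c.head ≤ w.length + 1) (h : S.Step w c c') (p : ℕ)
    (hp : p ≤ c.str.length) :
    ∃ p' ≤ c'.str.length, Relation.ReflTransGen ((S.toTM).Step w)
      (S.tcfg (.rw c.state) c.head (tp c.str) p c.out)
      (S.tcfg (.rw c'.state) c'.head (tp c'.str) p' c'.out) := by
  obtain ⟨hc, t, ht, rfl⟩ := h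
  refine ⟨c.str.length, by simp [SM.sw], (S.run_rewind w c hc hh p hp).trans ?_⟩
  have := S.run_sweep w c.head hh c.state [] c.str c.out
  simp only [List.nil_append, List.length_nil, zero_add] at this
  refine (this.tail ((S.tm_step_iff w ..).mpr ⟨by simp, ?_⟩))
  have hlen : (sweep (fun q => S.cell q (readInput w c.head)) c.state c.str).2.1.length =
    c.str.length := sweep_length ..
  refine ⟨act1 (.rw t.1) t.2.1 (t.2.2.2.elim .blank .dig) .left t.2.2.1, ?_, ?_⟩
  · rw [← hlen, tp_end]; exact ⟨t, ht, rfl⟩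
  · rw [exec_act1, ← hlen, update_tp_end]; rfl

theorem run_reachable {c : Cfg Δ D Q} (h : S.Reachable w c) :
    ∃ p ≤ c.str.length, (S.toTM).Reachable w
      (S.tcfg (.rw c.state) c.head (tp c.str) p c.out) := by
  induction h with
  | refl =>
    refine ⟨0, by simp, .single ((S.tm_step_iff w ..).mpr ⟨?_, _, rfl, ?_⟩)⟩
    · rintro ⟨_, _, h⟩; cases h
    · change _ = S.texec w 0 (fun _ => .blank) 0 [] (act1 (.rw S.start) .stay .left .stay none)
      rw [exec_act1, tp_init]; simp [Move.apply, initCfg]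
  | tail hr hs ih =>
    obtain ⟨p, hp, hr'⟩ := ih
    obtain ⟨p', hp', h⟩ := S.run_step w (S.head_le w hr) hs p hp
    exact ⟨p', hp', hr'.trans h⟩

/-- Acceptance is tested in rewinding states only. Hence the start-up and the middle of a sweep
contribute nothing, and in an accepting configuration the output agrees with that of the abstract
one. -/
theorem toTM_outputs : (S.toTM).outputs w = S.outputs w := by
  ext y
  constructor
  · rintro ⟨c, hc, ha, rfl⟩
    obtain ⟨p, hp, hsim⟩ := S.sim_reachable w hc
    obtain ⟨q, hq, hcq⟩ := ha
    cases hsim with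
    | boot => simp [TM.initCfg, toTM] at hcq
    | rw _ n hn =>
      cases hcq
      exact ⟨p, hp, hq, rfl⟩
    | sw => cases hcq
  · rintro ⟨c, hc, ha, rfl⟩
    obtain ⟨p, -, h⟩ := S.run_reachable w hc
    exact ⟨_, h, ⟨_, ha, rfl⟩, rfl⟩

theorem toTM_logSpace (C : ℕ) (hC : ∀ w c, S.Reachable w c →
    c.str.length + 1 ≤ C * (Nat.log 2 w.length + 1)) : (S.toTM).LogSpace := by
  refine ⟨C, fun w c hc i => ?_⟩
  obtain ⟨p, hp, hsim⟩ := S.sim_reachable w hc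
  refine le_trans ?_ (hC w p hp)
  cases hsim with
  | boot => simp [TM.initCfg]
  | rw _ n hn => exact hn.trans (by simp)
  | sw _ hc q pre ys zs o hstr hq =>
    have : ys.length = pre.length := by
      rw [← sweep_length (fun q => S.cell q (readInput w p.head)) p.state pre, hq]
    simp [tcfg, hstr, this]

theorem toTM_deterministic (h : ∀ q a, (S.fin q a).Subsingleton) : (S.toTM).Deterministic := by
  intro q a u
  change (S.tmTrans q a (u (0 : Fin 1))).Subsingleton
  generalize u (0 : Fin 1) = x
  change Ctl Q at q
  change Cell D at x
  have key : ∀ (q : Q) (x : Cell D), {act : Action (Ctl Q) (Cell D) Δ 1 | ∃ t ∈ S.fin q a,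
      act = act1 (Ctl.rw t.1) t.2.1 (t.2.2.2.elim x Cell.dig) Move.left t.2.2.1}.Subsingleton := by
    rintro q x _ ⟨t, ht, rfl⟩ _ ⟨t', ht', rfl⟩
    rw [h _ _ ht ht']
  cases q <;> cases x <;> first
    | exact Set.subsingleton_singleton
    | exact key _ _

end SM

end Machine


/-! ### Log-space execution, level 2: marking out a work string of logarithmic length. -/

namespace Machine

/-! ## Sweeping machines with strings of fixed length -/

/-- A sweeping machine that never extends its string. -/
structure FM (Γ Δ D Q : Type) where
  start : Q
  accept : Set Q
  dflt : D
  cell : Q → InSym Γ → D → Q × D × Option Δ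
  fin : Q → InSym Γ → Set (Q × Move × Option Δ)

/-- The length of the string on inputs of length `n`. -/
def strLen (b n : ℕ) : ℕ := (b + 1) * Nat.size (n + 2)

/-- `Nat.size (n + 2)` is what a machine can mark out by counting the `n + 2` input cells, end
markers included, in binary. It agrees with `Nat.log 2 n + 1` up to a constant: this bound provides
the room, `strLen_le` the space bound. -/
theorem le_strLen (b n : ℕ) : (b + 1) * (Nat.log 2 n + 1) ≤ strLen b n := by
  refine Nat.mul_le_mul_left _ ?_
  rw [Nat.succ_le_iff, Nat.lt_size]
  rcases Nat.eq_zero_or_pos n with rfl | h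
  · simp
  · exact (Nat.pow_log_le_self 2 h.ne').trans (by omega)

theorem strLen_le (b n : ℕ) : strLen b n ≤ 3 * (b + 1) * (Nat.log 2 n + 1) := by
  have : Nat.size (n + 2) ≤ 3 * (Nat.log 2 n + 1) := by
    rw [Nat.size_le]
    have h1 : n < 2 ^ (Nat.log 2 n + 1) := Nat.lt_pow_succ_log_self (by norm_num) n
    have h2 : 2 ^ 1 ≤ 2 ^ (Nat.log 2 n + 1) := Nat.pow_le_pow_right (by norm_num) (by omega)
    calc n + 2 < 2 ^ (Nat.log 2 n + 1) * 2 ^ (Nat.log 2 n + 1) := by nlinarith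
      _ ≤ 2 ^ (3 * (Nat.log 2 n + 1)) := by
        rw [← pow_add]; exact Nat.pow_le_pow_right (by norm_num) (by omega)
  calc strLen b n ≤ (b + 1) * (3 * (Nat.log 2 n + 1)) := Nat.mul_le_mul_left _ this
    _ = _ := by ring

theorem lt_two_pow_strLen (b n : ℕ) : n + 2 < 2 ^ strLen b n :=
  (Nat.lt_size_self _).trans_le (Nat.pow_le_pow_right (by norm_num)
    (Nat.le_mul_of_pos_left _ (by omega)))

theorem strLen_pos (b n : ℕ) : 0 < strLen b n :=
  lt_of_lt_of_le (by positivity) (le_strLen b n)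

/-- Addition of a carry bit to a list of binary digits, least significant digit first. -/
def addCarry : Bool → List Bool → List Bool × Bool
  | c, [] => ([], c)
  | c, x :: xs => ((c ^^ x) :: (addCarry (c && x) xs).1, (addCarry (c && x) xs).2)

theorem addCarry_false (xs : List Bool) : addCarry false xs = (xs, false) := by
  induction xs with
  | nil => rfl
  | cons x xs ih => simp [addCarry, ih]

/-- An increment changes the digits in place and lengthens the number by one digit exactly when a
carry is left over. This fits the sweeping machine, which rewrites its string and appends at most
one symbol per round. -/
theorem bits_succ (n : ℕ) : Nat.bits (n + 1) =
    (addCarry true (Nat.bits n)).1 ++ if (addCarry true (Nat.bits n)).2 then [true] else [] := by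
  induction n using Nat.strong_induction_on with
  | _ n ih =>
    rcases Nat.even_or_odd' n with ⟨m, rfl | rfl⟩
    · rcases Nat.eq_zero_or_pos m with rfl | hm
      · simp [addCarry]
      · rw [Nat.bit1_bits, Nat.bit0_bits _ hm.ne']
        simp [addCarry, addCarry_false]
    · rw [show 2 * m + 1 + 1 = 2 * (m + 1) by ring, Nat.bit0_bits _ (by omega), Nat.bit1_bits,
        ih m (by omega)]
      simp [addCarry]

namespace FM

variable {Γ Δ D Q : Type}

def initCfg (S : FM Γ Δ D Q) (L : ℕ) : SM.Cfg Δ D Q := ⟨S.start, 0, List.replicate L S.dflt, []⟩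

/-- The sweep performed in a configuration. -/
def sw (S : FM Γ Δ D Q) (w : List Γ) (c : SM.Cfg Δ D Q) : Q × List D × List Δ :=
  sweep (fun q => S.cell q (readInput w c.head)) c.state c.str

def Step (S : FM Γ Δ D Q) (w : List Γ) (c c' : SM.Cfg Δ D Q) : Prop :=
  c.state ∉ S.accept ∧ ∃ t ∈ S.fin (S.sw w c).1 (readInput w c.head),
    c' = ⟨t.1, min (t.2.1.apply c.head) (w.length + 1), (S.sw w c).2.1,
      c.out ++ (S.sw w c).2.2 ++ t.2.2.toList⟩

/-- Configurations reached on input `w` with a string of length `L`. -/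
def Reachable (S : FM Γ Δ D Q) (L : ℕ) (w : List Γ) (c : SM.Cfg Δ D Q) : Prop :=
  Relation.ReflTransGen (S.Step w) (S.initCfg L) c

def outputs (S : FM Γ Δ D Q) (L : ℕ) (w : List Γ) : Set (List Δ) :=
  {y | ∃ c, S.Reachable L w c ∧ c.state ∈ S.accept ∧ c.out = y}

theorem length_str {S : FM Γ Δ D Q} {L : ℕ} {w : List Γ} {c : SM.Cfg Δ D Q}
    (h : S.Reachable L w c) : c.str.length = L := by
  induction h with
  | refl => simp [initCfg]
  | tail _ h ih => obtain ⟨_, t, _, rfl⟩ := h; simpa [sw] using ih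

/-- Control states: the string is built by counting the input cells in binary. -/
inductive ICtl (b : ℕ) (Q : Type) where
  | cnt (carry : Bool)
  | fill (j : Fin (b + 1))
  | back
  | run (q : Q)

instance {b : ℕ} [Finite Q] : Finite (ICtl b Q) :=
  Finite.of_injective
    (fun s : ICtl b Q => (match s with
      | .cnt c => .inl (some c)
      | .fill j => .inr (.inl j)
      | .back => .inl none
      | .run q => .inr (.inr q) : Option Bool ⊕ Fin (b + 1) ⊕ Q))
    (by rintro (_ | _ | _ | _) (_ | _ | _ | _) h <;> simp_all)

/-- Move to the next input cell, or to the next stage at the end of the input. -/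
def proceed {b : ℕ} : InSym Γ → ICtl b Q × Move × Option Δ × Option (D × Option Bool)
  | .rightEnd => (.back, .stay, none, none)
  | _ => (.cnt true, .right, none, none)

def iback {b : ℕ} (S : FM Γ Δ D Q) :
    InSym Γ → ICtl b Q × Move × Option Δ × Option (D × Option Bool)
  | .leftEnd => (.run S.start, .stay, none, none)
  | _ => (.back, .left, none, none)

/-- The sweeping machine that first builds its string and then runs the given machine. -/
def toSM (S : FM Γ Δ D Q) (b : ℕ) : SM Γ Δ (D × Option Bool) (ICtl b Q) where
  start := .cnt true
  accept := {q | ∃ q' ∈ S.accept, q = .run q'}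
  cell := fun q a d =>
    match q, d with
    | .cnt c, (d, some x) => (.cnt (c && x), (d, some (c ^^ x)), none)
    | .run q, (d, x) => (.run (S.cell q a d).1, ((S.cell q a d).2.1, x), (S.cell q a d).2.2)
    | q, d => (q, d, none)
  fin := fun q a =>
    match q with
    | .cnt true => {(.fill (Fin.last b), .stay, none, some (S.dflt, some true))}
    | .cnt false => {proceed a}
    | .fill j => Fin.cases {proceed a}
        (fun j => {(.fill j.castSucc, .stay, none, some (S.dflt, none))}) j
    | .back => {iback S a}
    | .run q => {t | ∃ t' ∈ S.fin q a, t = (.run t'.1, t'.2.1, t'.2.2, none)}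

theorem toSM_fin_subsingleton (S : FM Γ Δ D Q) (b : ℕ) (h : ∀ q a, (S.fin q a).Subsingleton)
    (q : ICtl b Q) (a : InSym Γ) : ((S.toSM b).fin q a).Subsingleton := by
  match q with
  | .cnt true => exact Set.subsingleton_singleton
  | .cnt false => exact Set.subsingleton_singleton
  | .fill j => cases j using Fin.cases <;> exact Set.subsingleton_singleton
  | .back => exact Set.subsingleton_singleton
  | .run q =>
    rintro _ ⟨t, ht, rfl⟩ _ ⟨t', ht', rfl⟩
    rw [h _ _ ht ht']

variable (S : FM Γ Δ D Q) (b : ℕ) (w : List Γ)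

/-- The string built for a list of binary digits. -/
def grp (bs : List Bool) : List (D × Option Bool) :=
  bs.flatMap (fun x => (S.dflt, some x) :: List.replicate b (S.dflt, none))

theorem map_fst_grp (bs : List Bool) :
    (S.grp b bs).map Prod.fst = List.replicate ((b + 1) * bs.length) S.dflt := by
  induction bs with
  | nil => simp [grp]
  | cons x xs ih =>
    have : S.grp b (x :: xs) = ((S.dflt, some x) :: List.replicate b (S.dflt, none)) ++ S.grp b xs :=
      by simp [grp]
    rw [this, List.map_append, ih, List.length_cons, Nat.mul_succ, Nat.add_comm (_ * _),
      List.replicate_add, List.replicate_succ]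
    simp

theorem sweep_id {Q' E : Type} (f : Q' → E → Q' × E × Option Δ) (q : Q') (xs : List E)
    (h : ∀ d ∈ xs, f q d = (q, d, none)) : sweep f q xs = (q, xs, []) := by
  induction xs with
  | nil => rfl
  | cons d xs ih =>
    simp only [List.mem_cons, forall_eq_or_imp] at h
    simp [sweep, h.1, ih h.2]

/-- Only the first cell of a group carries a counter digit; the filler cells hand the carry on
unchanged. So one sweep is one binary increment. -/
theorem sweep_cnt (a : InSym Γ) (c : Bool) (bs : List Bool) :
    sweep (fun q => (S.toSM b).cell q a) (.cnt c) (S.grp b bs) =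
      (.cnt (addCarry c bs).2, S.grp b (addCarry c bs).1, []) := by
  induction bs generalizing c with
  | nil => rfl
  | cons x xs ih =>
    have hg : ∀ y ys, S.grp b (y :: ys) =
        [(S.dflt, some y)] ++ (List.replicate b (S.dflt, none) ++ S.grp b ys) := by
      intros; simp [grp]
    rw [hg, sweep_append, sweep_append]
    have h1 : sweep (fun q => (S.toSM b).cell q a) (.cnt c) [(S.dflt, some x)] =
      (.cnt (c && x), [(S.dflt, some (c ^^ x))], []) := rfl
    have h2 : sweep (fun q => (S.toSM b).cell q a) (.cnt (c && x))
        (List.replicate b (S.dflt, (none : Option Bool))) =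
        (.cnt (c && x), List.replicate b (S.dflt, none), []) := by
      refine sweep_id _ _ _ fun d hd => ?_
      rw [List.eq_of_mem_replicate hd]; rfl
    simp only [h1, h2, ih, addCarry, hg, List.append_nil]

/-- The counter digits remain on the second track and are never looked at again, so the resulting
string is described on its first track only. -/
theorem sweep_run (a : InSym Γ) (q : Q) (zs : List (D × Option Bool)) :
    ∃ zs', sweep (fun q => (S.toSM b).cell q a) (.run q) zs =
      (.run (sweep (fun q => S.cell q a) q (zs.map Prod.fst)).1, zs',
        (sweep (fun q => S.cell q a) q (zs.map Prod.fst)).2.2) ∧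
      zs'.map Prod.fst = (sweep (fun q => S.cell q a) q (zs.map Prod.fst)).2.1 := by
  induction zs generalizing q with
  | nil => exact ⟨[], rfl, rfl⟩
  | cons z zs ih =>
    obtain ⟨zs', h, h'⟩ := ih (S.cell q a z.1).1
    have hc : (S.toSM b).cell (.run q) a z =
      (.run (S.cell q a z.1).1, ((S.cell q a z.1).2.1, z.2), (S.cell q a z.1).2.2) := rfl
    refine ⟨((S.cell q a z.1).2.1, z.2) :: zs', ?_, ?_⟩
    · rw [sweep, hc, h]; rfl
    · simp [sweep, h']

/-- Configurations of the building stage and of the running stage. -/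
inductive Inv : SM.Cfg Δ (D × Option Bool) (ICtl b Q) → Prop
  | cnt (h : ℕ) (hh : h ≤ w.length + 1) : Inv ⟨.cnt true, h, S.grp b (Nat.bits h), []⟩
  | fill (h : ℕ) (hh : h ≤ w.length + 1) (j : Fin (b + 1)) (xs : List (D × Option Bool))
      (hx : xs ++ List.replicate j (S.dflt, none) = S.grp b (Nat.bits (h + 1))) :
      Inv ⟨.fill j, h, xs, []⟩
  | back (h : ℕ) (hh : h ≤ w.length + 1) :
      Inv ⟨.back, h, S.grp b (Nat.bits (w.length + 2)), []⟩
  | run (c : SM.Cfg Δ D Q) (hc : S.Reachable (strLen b w.length) w c)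
      (zs : List (D × Option Bool)) (hz : zs.map Prod.fst = c.str) :
      Inv ⟨.run c.state, c.head, zs, c.out⟩

theorem readInput_eq_rightEnd {w : List Γ} {h : ℕ} (hh : h ≤ w.length + 1) :
    readInput w h = .rightEnd ↔ h = w.length + 1 := by
  rcases h with _ | h
  · simp [readInput]
  · rcases Nat.lt_or_ge h w.length with h' | h'
    · simp [readInput, h', h'.ne]
    · obtain rfl : h = w.length := by omega
      simp [readInput]

theorem readInput_eq_leftEnd {w : List Γ} {h : ℕ} : readInput w h = .leftEnd ↔ h = 0 := by
  rcases h with _ | h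
  · simp [readInput]
  · simp only [readInput]; cases w[h]? <;> simp

theorem proceed_of_ne {b : ℕ} {a : InSym Γ} (h : a ≠ .rightEnd) :
    (proceed a : ICtl b Q × Move × Option Δ × Option (D × Option Bool)) =
      (.cnt true, .right, none, none) := by
  cases a <;> simp_all [proceed]

theorem iback_of_ne {b : ℕ} {a : InSym Γ} (h : a ≠ .leftEnd) :
    (iback S a : ICtl b Q × Move × Option Δ × Option (D × Option Bool)) =
      (.back, .left, none, none) := by
  cases a <;> simp_all [iback]

/-- The counter is incremented before the head is moved. At the right end marker, in cell `|w| + 1`,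
it therefore holds `|w| + 2`, which explains the argument of `Nat.size` in `strLen`. -/
theorem inv_proceed (h : ℕ) (hh : h ≤ w.length + 1) :
    S.Inv b w ⟨(proceed (readInput w h) : ICtl b Q × Move × Option Δ ×
      Option (D × Option Bool)).1, min ((proceed (readInput w h) : ICtl b Q × Move × Option Δ ×
      Option (D × Option Bool)).2.1.apply h) (w.length + 1), S.grp b (Nat.bits (h + 1)), []⟩ := by
  by_cases hr : readInput w h = .rightEnd
  · rw [hr]
    obtain rfl := (readInput_eq_rightEnd hh).mp hr
    simpa [proceed, Move.apply] using Inv.back (S := S) (b := b) (w := w) (w.length + 1) hh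
  · rw [proceed_of_ne hr]
    have : h ≠ w.length + 1 := fun h' => hr ((readInput_eq_rightEnd hh).mpr h')
    have := Inv.cnt (S := S) (b := b) (w := w) (h + 1) (by omega)
    simpa [Move.apply, show h ≤ w.length by omega] using this

theorem strLen_eq (n : ℕ) :
    (S.grp b (Nat.bits (n + 2))).map Prod.fst = List.replicate (strLen b n) S.dflt := by
  rw [map_fst_grp, Nat.size_eq_bits_len, strLen]

theorem step_iff_of_fin {c c' : SM.Cfg Δ (D × Option Bool) (ICtl b Q)} {q : ICtl b Q}
    {ys : List (D × Option Bool)} {o : List Δ}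
    {t : ICtl b Q × Move × Option Δ × Option (D × Option Bool)}
    (hc : ∀ q, c.state ≠ .run q) (hs : (S.toSM b).sw w c = (q, ys, o))
    (ht : (S.toSM b).fin q (readInput w c.head) = {t}) :
    (S.toSM b).Step w c c' ↔ c' = ⟨t.1, min (t.2.1.apply c.head) (w.length + 1),
      ys ++ t.2.2.2.toList, c.out ++ o ++ t.2.2.1.toList⟩ := by
  rw [SM.Step, hs]
  constructor
  · rintro ⟨-, t', h, rfl⟩
    rw [ht, Set.mem_singleton_iff] at h
    rw [h]
  · rintro rfl
    refine ⟨?_, t, by rw [ht]; rfl, rfl⟩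
    rintro ⟨q, -, h⟩
    exact hc q h

theorem proceed_out (a : InSym Γ) :
    (proceed a : ICtl b Q × Move × Option Δ × Option (D × Option Bool)).2.2 = (none, none) := by
  cases a <;> rfl

theorem step_cnt (h : ℕ) {c' : SM.Cfg Δ (D × Option Bool) (ICtl b Q)} :
    (S.toSM b).Step w ⟨.cnt true, h, S.grp b (Nat.bits h), []⟩ c' ↔
      c' = if (addCarry true (Nat.bits h)).2
        then ⟨.fill (Fin.last b), min h (w.length + 1),
          S.grp b (addCarry true (Nat.bits h)).1 ++ [(S.dflt, some true)], []⟩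
        else ⟨(proceed (readInput w h) : ICtl b Q × Move × Option Δ ×
          Option (D × Option Bool)).1, min ((proceed (readInput w h) : ICtl b Q × Move × Option Δ ×
          Option (D × Option Bool)).2.1.apply h) (w.length + 1), S.grp b (Nat.bits (h + 1)), []⟩ := by
  have hs : (S.toSM b).sw w ⟨.cnt true, h, S.grp b (Nat.bits h), []⟩ = _ := S.sweep_cnt b _ _ _
  rw [bits_succ h]
  cases hc : (addCarry true (Nat.bits h)).2
  · rw [hc] at hs
    rw [S.step_iff_of_fin b w (by simp) hs rfl, proceed_out]
    simp
  · rw [hc] at hs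
    rw [S.step_iff_of_fin b w (by simp) hs rfl]
    simp [Move.apply]

theorem inv_step_cnt (h : ℕ) (hh : h ≤ w.length + 1) :
    S.Inv b w (if (addCarry true (Nat.bits h)).2
        then ⟨.fill (Fin.last b), min h (w.length + 1),
          S.grp b (addCarry true (Nat.bits h)).1 ++ [(S.dflt, some true)], []⟩
        else ⟨(proceed (readInput w h) : ICtl b Q × Move × Option Δ ×
          Option (D × Option Bool)).1, min ((proceed (readInput w h) : ICtl b Q × Move × Option Δ ×
          Option (D × Option Bool)).2.1.apply h) (w.length + 1), S.grp b (Nat.bits (h + 1)), []⟩) := by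
  split_ifs with hc
  · rw [min_eq_left hh]
    refine .fill _ hh _ _ ?_
    rw [bits_succ, hc]
    simp [grp]
  · exact S.inv_proceed b w h hh

theorem step_fill_zero (h : ℕ) (xs : List (D × Option Bool))
    {c' : SM.Cfg Δ (D × Option Bool) (ICtl b Q)} :
    (S.toSM b).Step w ⟨.fill 0, h, xs, []⟩ c' ↔
      c' = ⟨(proceed (readInput w h) : ICtl b Q × Move × Option Δ ×
          Option (D × Option Bool)).1, min ((proceed (readInput w h) : ICtl b Q × Move × Option Δ ×
          Option (D × Option Bool)).2.1.apply h) (w.length + 1), xs, []⟩ := by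
  have hs : (S.toSM b).sw w ⟨.fill 0, h, xs, []⟩ = (.fill 0, xs, []) :=
    sweep_id _ _ _ fun d _ => rfl
  rw [S.step_iff_of_fin b w (by simp) hs rfl, proceed_out]
  simp

theorem step_fill_succ (h : ℕ) (j : Fin b) (xs : List (D × Option Bool))
    {c' : SM.Cfg Δ (D × Option Bool) (ICtl b Q)} :
    (S.toSM b).Step w ⟨.fill j.succ, h, xs, []⟩ c' ↔
      c' = ⟨.fill j.castSucc, min h (w.length + 1), xs ++ [(S.dflt, none)], []⟩ := by
  have hs : (S.toSM b).sw w ⟨.fill j.succ, h, xs, []⟩ = (.fill j.succ, xs, []) :=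
    sweep_id _ _ _ fun d _ => rfl
  rw [S.step_iff_of_fin b w (by simp) hs rfl]
  simp [Move.apply]

theorem step_back (h : ℕ) (xs : List (D × Option Bool))
    {c' : SM.Cfg Δ (D × Option Bool) (ICtl b Q)} :
    (S.toSM b).Step w ⟨.back, h, xs, []⟩ c' ↔
      c' = if h = 0 then ⟨.run S.start, 0, xs, []⟩ else ⟨.back, min (h - 1) (w.length + 1), xs, []⟩ := by
  have hs : (S.toSM b).sw w ⟨.back, h, xs, []⟩ = (.back, xs, []) :=
    sweep_id _ _ _ fun d _ => rfl
  rw [S.step_iff_of_fin b w (by simp) hs rfl]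
  split_ifs with h0
  · subst h0
    simp [readInput, iback, Move.apply]
  · have : readInput w h ≠ .leftEnd := fun h' => h0 (readInput_eq_leftEnd.mp h')
    rw [iback_of_ne S this]
    simp [Move.apply]

theorem step_run (c : SM.Cfg Δ D Q) (zs : List (D × Option Bool))
    (hz : zs.map Prod.fst = c.str) {c' : SM.Cfg Δ (D × Option Bool) (ICtl b Q)} :
    (S.toSM b).Step w ⟨.run c.state, c.head, zs, c.out⟩ c' ↔
      ∃ c1, S.Step w c c1 ∧ c'.state = .run c1.state ∧ c'.head = c1.head ∧ c'.out = c1.out ∧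
        c'.str = ((S.toSM b).sw w ⟨.run c.state, c.head, zs, c.out⟩).2.1 := by
  obtain ⟨zs', h1, h2⟩ := S.sweep_run b (readInput w c.head) c.state zs
  have hs : (S.toSM b).sw w ⟨.run c.state, c.head, zs, c.out⟩ =
    (.run (S.sw w c).1, zs', (S.sw w c).2.2) := by
    rw [SM.sw, h1, FM.sw, hz]
  have hacc : (ICtl.run c.state ∈ (S.toSM b).accept) ↔ c.state ∈ S.accept := by
    simp [toSM]
  constructor
  · rintro ⟨hn, t, ht, rfl⟩
    rw [hs] at ht
    obtain ⟨t', ht', rfl⟩ := ht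
    refine ⟨_, ⟨fun h => hn (hacc.mpr h), t', ht', rfl⟩, ?_⟩
    simp [hs]
  · rintro ⟨c1, ⟨hn, t, ht, rfl⟩, e1, e2, e3, e4⟩
    obtain ⟨st, hd, str, out⟩ := c'
    simp only at e1 e2 e3 e4
    subst e1 e2 e3 e4
    refine ⟨fun h => hn (hacc.mp h), (.run t.1, t.2.1, t.2.2, none), ?_, ?_⟩
    · rw [hs]; exact ⟨t, ht, rfl⟩
    · simp [hs]

theorem map_fst_sw (c : SM.Cfg Δ D Q) (zs : List (D × Option Bool))
    (hz : zs.map Prod.fst = c.str) :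
    ((S.toSM b).sw w ⟨.run c.state, c.head, zs, c.out⟩).2.1.map Prod.fst = (S.sw w c).2.1 := by
  obtain ⟨zs', h1, h2⟩ := S.sweep_run b (readInput w c.head) c.state zs
  rw [SM.sw, h1, FM.sw, ← hz]
  exact h2

theorem inv_step {c c' : SM.Cfg Δ (D × Option Bool) (ICtl b Q)} (h : S.Inv b w c)
    (hs : (S.toSM b).Step w c c') : S.Inv b w c' := by
  cases h with
  | cnt h hh => rw [step_cnt] at hs; subst hs; exact S.inv_step_cnt b w h hh
  | fill h hh j xs hx =>
    cases j using Fin.cases with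
    | zero =>
      rw [step_fill_zero] at hs; subst hs
      have : xs = S.grp b (Nat.bits (h + 1)) := by simpa using hx
      rw [this]; exact S.inv_proceed b w h hh
    | succ j =>
      rw [step_fill_succ] at hs; subst hs
      rw [min_eq_left hh]
      refine .fill _ hh _ _ ?_
      rw [← hx, Fin.val_castSucc, Fin.val_succ, List.replicate_succ]; simp
  | back h hh =>
    rw [step_back] at hs; subst hs
    split_ifs with h0
    · exact .run (S.initCfg (strLen b w.length)) .refl _ (S.strLen_eq b _)
    · rw [min_eq_left (by omega)]; exact .back _ (by omega)
  | run c hc zs hz =>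
    rw [S.step_run b w c zs hz] at hs
    obtain ⟨c1, h1, e1, e2, e3, e4⟩ := hs
    obtain ⟨st, hd, str, out⟩ := c'
    simp only at e1 e2 e3 e4
    subst e1 e2 e3
    refine .run c1 (hc.tail h1) _ ?_
    rw [e4, map_fst_sw _ _ _ _ _ hz]
    obtain ⟨_, t, _, rfl⟩ := h1; rfl

theorem inv_reachable {c : SM.Cfg Δ (D × Option Bool) (ICtl b Q)}
    (h : (S.toSM b).Reachable w c) : S.Inv b w c := by
  induction h with
  | refl => exact .cnt 0 (by omega)
  | tail _ hs ih => exact S.inv_step b w ih hs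

theorem run_proceed (h : ℕ) (j : Fin (b + 1)) (hh : h ≤ w.length + 1)
    (xs : List (D × Option Bool))
    (hx : xs ++ List.replicate j (S.dflt, none) = S.grp b (Nat.bits (h + 1))) :
    Relation.ReflTransGen ((S.toSM b).Step w) ⟨.fill j, h, xs, []⟩
      ⟨(proceed (readInput w h) : ICtl b Q × Move × Option Δ ×
          Option (D × Option Bool)).1, min ((proceed (readInput w h) : ICtl b Q × Move × Option Δ ×
          Option (D × Option Bool)).2.1.apply h) (w.length + 1), S.grp b (Nat.bits (h + 1)), []⟩ := by
  induction j using Fin.induction generalizing xs with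
  | zero =>
    have : xs = S.grp b (Nat.bits (h + 1)) := by simpa using hx
    rw [this]
    exact .single ((S.step_fill_zero ..).mpr rfl)
  | succ j ih =>
    refine .head ((S.step_fill_succ ..).mpr rfl) ?_
    rw [min_eq_left hh]
    refine ih _ ?_
    rw [← hx, Fin.val_castSucc, Fin.val_succ, List.replicate_succ]; simp

theorem run_cnt (h : ℕ) (hh : h ≤ w.length + 1) :
    Relation.ReflTransGen ((S.toSM b).Step w) ⟨.cnt true, h, S.grp b (Nat.bits h), []⟩
      ⟨(proceed (readInput w h) : ICtl b Q × Move × Option Δ ×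
          Option (D × Option Bool)).1, min ((proceed (readInput w h) : ICtl b Q × Move × Option Δ ×
          Option (D × Option Bool)).2.1.apply h) (w.length + 1), S.grp b (Nat.bits (h + 1)), []⟩ := by
  refine .head ((S.step_cnt ..).mpr rfl) ?_
  split_ifs with hc
  · rw [min_eq_left hh]
    refine S.run_proceed b w h _ hh _ ?_
    rw [bits_succ, hc]
    simp [grp]
  · exact .refl

theorem run_init :
    Relation.ReflTransGen ((S.toSM b).Step w) (S.toSM b).initCfg
      ⟨.run S.start, 0, S.grp b (Nat.bits (w.length + 2)), []⟩ := by
  have h1 : ∀ h ≤ w.length + 1, Relation.ReflTransGen ((S.toSM b).Step w) (S.toSM b).initCfg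
      ⟨.cnt true, h, S.grp b (Nat.bits h), []⟩ := by
    intro h hh
    induction h with
    | zero => exact .refl
    | succ h ih =>
      refine (ih (by omega)).trans ?_
      have := S.run_cnt b w h (by omega)
      rw [proceed_of_ne (by rw [Ne, readInput_eq_rightEnd (by omega)]; omega)] at this
      simpa [Move.apply, show h ≤ w.length by omega] using this
  have h2 : ∀ h ≤ w.length + 1, Relation.ReflTransGen ((S.toSM b).Step w)
      ⟨.back, h, S.grp b (Nat.bits (w.length + 2)), []⟩
      ⟨.run S.start, 0, S.grp b (Nat.bits (w.length + 2)), []⟩ := by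
    intro h hh
    induction h with
    | zero => exact .single ((S.step_back ..).mpr (by simp))
    | succ h ih =>
      refine .head ((S.step_back ..).mpr rfl) ?_
      simpa [show h ≤ w.length + 1 by omega] using ih (by omega)
  refine (h1 _ le_rfl).trans (.trans ?_ (h2 (w.length + 1) le_rfl))
  have := S.run_cnt b w _ le_rfl
  rw [(readInput_eq_rightEnd le_rfl).mpr rfl] at this
  simpa [proceed, Move.apply] using this

theorem run_reachable {c : SM.Cfg Δ D Q} (h : S.Reachable (strLen b w.length) w c) :
    ∃ zs : List (D × Option Bool), zs.map Prod.fst = c.str ∧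
      (S.toSM b).Reachable w ⟨.run c.state, c.head, zs, c.out⟩ := by
  induction h with
  | refl => exact ⟨_, S.strLen_eq b _, S.run_init b w⟩
  | @tail c c' _ hs ih =>
    obtain ⟨zs, hz, hr⟩ := ih
    refine ⟨_, ?_, hr.tail ((S.step_run b w c zs hz).mpr ⟨c', hs, rfl, rfl, rfl, rfl⟩)⟩
    rw [map_fst_sw _ _ _ _ _ hz]
    obtain ⟨_, t, _, rfl⟩ := hs; rfl

theorem toSM_outputs : (S.toSM b).outputs w = S.outputs (strLen b w.length) w := by
  ext y
  constructor
  · rintro ⟨c, hc, ⟨q, hq, hcq⟩, rfl⟩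
    cases S.inv_reachable b w hc with
    | run c hr zs hz => cases hcq; exact ⟨c, hr, hq, rfl⟩
    | _ => cases hcq
  · rintro ⟨c, hc, ha, rfl⟩
    obtain ⟨zs, -, hr⟩ := S.run_reachable b w hc
    exact ⟨_, hr, ⟨_, ha, rfl⟩, rfl⟩

theorem length_grp (bs : List Bool) : (S.grp b bs).length = (b + 1) * bs.length := by
  rw [← List.length_map (f := Prod.fst), map_fst_grp, List.length_replicate]

theorem inv_length {c : SM.Cfg Δ (D × Option Bool) (ICtl b Q)} (h : S.Inv b w c) :
    c.str.length ≤ strLen b w.length := by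
  have hm : ∀ h ≤ w.length + 2, (b + 1) * (Nat.bits h).length ≤ strLen b w.length := by
    intro h hh
    rw [Nat.size_eq_bits_len, strLen]
    exact Nat.mul_le_mul_left _ (Nat.size_le_size hh)
  cases h with
  | cnt h hh => rw [length_grp]; exact hm _ (by omega)
  | fill h hh j xs hx =>
    refine le_trans ?_ (hm (h + 1) (by omega))
    rw [← S.length_grp, ← hx]; simp
  | back h hh => rw [length_grp]; exact hm _ le_rfl
  | run c hc zs hz =>
    rw [← length_str hc, ← hz]; simp

variable [Finite D] [Finite Q]

/-- Every sweeping machine with strings of logarithmic length is simulated by a log-space Turing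
machine. -/
theorem exists_TM : ∃ M : TM Γ Δ, M.LogSpace ∧
    ((∀ q a, (S.fin q a).Subsingleton) → M.Deterministic) ∧
    ∀ w, M.outputs w = S.outputs (strLen b w.length) w := by
  refine ⟨(S.toSM b).toTM, (S.toSM b).toTM_logSpace (3 * (b + 1) + 1) fun w c hc => ?_,
    fun h => (S.toSM b).toTM_deterministic (S.toSM_fin_subsingleton b h), fun w => ?_⟩
  · have h1 := S.inv_length b w (S.inv_reachable b w hc)
    have h2 := strLen_le b w.length
    nlinarith
  · rw [SM.toTM_outputs, toSM_outputs]

end FM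

end Machine


/-! ### Log-space execution, level 3: pebbles stored as binary positions. -/

namespace Machine

/-! ## Pebble automata -/

/-- A two-way automaton with output and with pebbles indexed by `ι`. An instruction moves the head,
puts some of the pebbles on the current position and emits at most one symbol. It depends on the
scanned symbol and on the set of pebbles at the current position. -/
structure PA (Γ Δ ι Q : Type) where
  start : Q
  accept : Set Q
  trans : Q → Option Γ → (ι → Bool) → Set (Q × Move × (ι → Bool) × Option Δ)

namespace PA

variable {Γ Δ ι Q : Type}

/-- Configurations; positions are counted from `0`. -/
structure Cfg (Δ ι Q : Type) where
  state : Q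
  head : ℕ
  peb : ι → ℕ
  out : List Δ

def initCfg (S : PA Γ Δ ι Q) : Cfg Δ ι Q := ⟨S.start, 0, fun _ => 0, []⟩

/-- The pebbles at a position. -/
def here (r : ι → ℕ) (h : ℕ) : ι → Bool := fun i => decide (r i = h)

/-- Put some pebbles on a position. -/
def place (asg : ι → Bool) (r : ι → ℕ) (h : ℕ) : ι → ℕ := fun i => if asg i then h else r i

def Step (S : PA Γ Δ ι Q) (w : List Γ) (c c' : Cfg Δ ι Q) : Prop :=
  c.state ∉ S.accept ∧ ∃ t ∈ S.trans c.state w[c.head]? (here c.peb c.head),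
    c' = ⟨t.1, min (t.2.1.apply c.head) w.length, place t.2.2.1 c.peb c.head,
      c.out ++ t.2.2.2.toList⟩

def Reachable (S : PA Γ Δ ι Q) (w : List Γ) (c : Cfg Δ ι Q) : Prop :=
  Relation.ReflTransGen (S.Step w) S.initCfg c

def outputs (S : PA Γ Δ ι Q) (w : List Γ) : Set (List Δ) :=
  {y | ∃ c, S.Reachable w c ∧ c.state ∈ S.accept ∧ c.out = y}

theorem bounds {S : PA Γ Δ ι Q} {w : List Γ} {c : Cfg Δ ι Q} (h : S.Reachable w c) :
    c.head ≤ w.length ∧ ∀ i, c.peb i ≤ w.length := by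
  induction h with
  | refl => simp [initCfg]
  | tail _ h ih =>
    obtain ⟨_, t, _, rfl⟩ := h
    refine ⟨by simp, fun i => ?_⟩
    simp only [place]; split_ifs
    · exact ih.1
    · exact ih.2 i

/-- Control states of the simulating sweeping machine. -/
inductive Ctl (ι Q : Type) where
  | boot
  | test (q : Q) (z : Bool) (e : ι → Bool)
  | upd (q : Q) (mv : Move) (asg : ι → Bool) (c : Bool)

instance : Finite Move :=
  Finite.of_injective
    (fun s : Move => (match s with
      | .left => 0
      | .stay => 1
      | .right => 2 : Fin 3))
    (by rintro (_ | _ | _) (_ | _ | _) h <;> simp_all)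

instance [Finite ι] [Finite Q] : Finite (Ctl ι Q) :=
  Finite.of_injective
    (fun s : Ctl ι Q => (match s with
      | .boot => .inl none
      | .test q z e => .inl (some (q, z, e))
      | .upd q mv asg c => .inr (q, mv, asg, c) :
        Option (Q × Bool × (ι → Bool)) ⊕ (Q × Move × (ι → Bool) × Bool)))
    (by rintro (_ | _ | _) (_ | _ | _) h <;> simp_all)

/-- The letter in an input cell. -/
def letter : InSym Γ → Option Γ
  | .sym a => some a
  | _ => none

/-- The move that is really made: `z` says that the head is at position `0`. -/
def clip (z : Bool) : InSym Γ → Move → Move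
  | _, .left => if z then .stay else .left
  | .rightEnd, .right => .stay
  | _, m => m

/-- New digit of the head position and new carry. -/
def updBit : Move → Bool → Bool → Bool × Bool
  | .left, c, x => (c ^^ x, c && !x)
  | .stay, c, x => (x, c)
  | .right, c, x => (c ^^ x, c && x)

/-- The sweeping machine that stores the positions of head and pebbles in binary. -/
def toFM (S : PA Γ Δ ι Q) : FM Γ Δ (Bool × (ι → Bool)) (Ctl ι Q) where
  start := .boot
  accept := {s | ∃ q ∈ S.accept, ∃ z e, s = .test q z e}
  dflt := (false, fun _ => false)
  cell := fun s _ d =>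
    match s with
    | .boot => (.boot, d, none)
    | .test q z e => (.test q (z && !d.1) (fun i => e i && (d.2 i == d.1)), d, none)
    | .upd q mv asg c => (.upd q mv asg (updBit mv c d.1).2,
        ((updBit mv c d.1).1, fun i => if asg i then d.1 else d.2 i), none)
  fin := fun s a =>
    match s with
    | .boot => {(.test S.start true (fun _ => true), .right, none)}
    | .test q z e => {t | ∃ t' ∈ S.trans q (letter a) e,
        t = (.upd t'.1 (clip z a t'.2.1) t'.2.2.1 true, clip z a t'.2.1, t'.2.2.2)}
    | .upd q _ _ _ => {(.test q true (fun _ => true), .stay, none)}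

/-- The string that stores the positions of head and pebbles. -/
def enc : ℕ → ℕ → (ι → ℕ) → List (Bool × (ι → Bool))
  | 0, _, _ => []
  | L + 1, h, r => (decide (h % 2 = 1), fun i => decide (r i % 2 = 1)) ::
      enc L (h / 2) (fun i => r i / 2)

theorem enc_zero (L : ℕ) : enc L 0 (fun _ : ι => 0) = List.replicate L (false, fun _ => false) := by
  induction L with
  | zero => rfl
  | succ L ih => simp [enc, ih, List.replicate_succ]

variable (S : PA Γ Δ ι Q) (w : List Γ)

/-- Numbers below `2 ^ L` are equal if and only if their `L` low digits are. One pass thus finds the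
pebbles at the head (`e`), and whether the head is at position `0` (`z`), which is needed to clip
left moves. -/
theorem sweep_test (a : InSym Γ) (q : Q) (z : Bool) (e : ι → Bool) (L h : ℕ) (r : ι → ℕ)
    (hh : h < 2 ^ L) (hr : ∀ i, r i < 2 ^ L) :
    sweep (fun s => (S.toFM).cell s a) (.test q z e) (enc L h r) =
      (.test q (z && decide (h = 0)) (fun i => e i && here r h i), enc L h r, []) := by
  induction L generalizing z e h r with
  | zero =>
    have h0 : h = 0 := by simpa using hh
    have hr0 : ∀ i, r i = 0 := by simpa using hr
    simp [enc, sweep, h0, hr0, here]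
  | succ L ih =>
    have := ih (z && !decide (h % 2 = 1))
      (fun i => e i && (decide (r i % 2 = 1) == decide (h % 2 = 1))) (h / 2) (fun i => r i / 2)
      (by omega) (fun i => by have := hr i; omega)
    have hc : (S.toFM).cell (.test q z e) a
        (decide (h % 2 = 1), fun i => decide (r i % 2 = 1)) = (.test q (z && !decide (h % 2 = 1))
        (fun i => e i && (decide (r i % 2 = 1) == decide (h % 2 = 1))),
        (decide (h % 2 = 1), fun i => decide (r i % 2 = 1)), none) := rfl
    simp only [enc, sweep, hc, this, Option.toList_none, List.append_nil, Prod.mk.injEq, and_true]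
    congr 1
    · rw [Bool.and_assoc]
      congr 1
      rw [Bool.eq_iff_iff]; simp; omega
    · funext i
      rw [Bool.and_assoc]
      congr 1
      rw [Bool.eq_iff_iff]
      simp only [here, Bool.and_eq_true, beq_iff_eq, decide_eq_decide, decide_eq_true_eq]
      omega

/-- The hypothesis on `h'` contains the incoming carry or borrow so that the induction goes through.
Since `enc` truncates to `L` digits, the outgoing carry is irrelevant and no bound on the numbers is
needed. Placed pebbles copy the digits of the head before the move. -/
theorem sweep_upd (a : InSym Γ) (q : Q) (mv : Move) (asg : ι → Bool) (c : Bool) (L h h' : ℕ)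
    (r : ι → ℕ) (hh : match mv with
      | .left => h = h' + c.toNat
      | .stay => h' = h
      | .right => h' = h + c.toNat) :
    ∃ c', sweep (fun s => (S.toFM).cell s a) (.upd q mv asg c) (enc L h r) =
      (.upd q mv asg c', enc L h' (place asg r h), []) := by
  induction L generalizing c h h' r with
  | zero => exact ⟨c, rfl⟩
  | succ L ih =>
    have hc : (S.toFM).cell (.upd q mv asg c) a
        (decide (h % 2 = 1), fun i => decide (r i % 2 = 1)) =
        (.upd q mv asg (updBit mv c (decide (h % 2 = 1))).2,
        ((updBit mv c (decide (h % 2 = 1))).1, fun i => if asg i then decide (h % 2 = 1) else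
          decide (r i % 2 = 1)), none) := rfl
    obtain ⟨c', hc'⟩ := ih (updBit mv c (decide (h % 2 = 1))).2 (h / 2) (h' / 2)
      (fun i => r i / 2) (by
        cases mv <;> cases c <;> simp only [updBit, Bool.toNat_true, Bool.toNat_false] at hh ⊢
        · simp; omega
        · by_cases hp : h % 2 = 1 <;> simp [hp] <;> omega
        · omega
        · omega
        · simp; omega
        · by_cases hp : h % 2 = 1 <;> simp [hp] <;> omega)
    refine ⟨c', ?_⟩
    simp only [enc, sweep, hc, hc', Option.toList_none, List.append_nil, Prod.mk.injEq, true_and,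
      and_true, List.cons.injEq]
    refine ⟨⟨?_, ?_⟩, ?_⟩
    · rw [Bool.eq_iff_iff]
      cases mv <;> cases c <;> simp only [updBit, Bool.toNat_true, Bool.toNat_false] at hh ⊢ <;>
        simp <;> omega
    · funext i; simp only [place]; split_ifs <;> rfl
    · congr 1; funext i; simp only [place]; split_ifs <;> rfl

theorem toFM_initCfg (L : ℕ) :
    (S.toFM).initCfg L = ⟨.boot, 0, enc L 0 (fun _ => 0), []⟩ := by
  rw [enc_zero]; rfl

/-- The simulation relation. -/
inductive Sim (L : ℕ) : SM.Cfg Δ (Bool × (ι → Bool)) (Ctl ι Q) → Cfg Δ ι Q → Prop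
  | boot : Sim L ⟨.boot, 0, enc L 0 (fun _ => 0), []⟩ S.initCfg
  | test (p : Cfg Δ ι Q) :
      Sim L ⟨.test p.state true (fun _ => true), p.head + 1, enc L p.head p.peb, p.out⟩ p
  | upd (p : Cfg Δ ι Q) (mv : Move) (asg : ι → Bool) (h : ℕ) (r : ι → ℕ)
      (hh : match mv with
        | .left => h = p.head + 1
        | .stay => p.head = h
        | .right => p.head = h + 1) (hr : p.peb = place asg r h) :
      Sim L ⟨.upd p.state mv asg true, p.head + 1, enc L h r, p.out⟩ p

theorem letter_readInput (h : ℕ) : letter (readInput w (h + 1)) = w[h]? := by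
  simp only [readInput]; cases w[h]? <;> rfl

/-- Clipping implements the bounds of the tape. -/
theorem clip_spec {h : ℕ} (hh : h ≤ w.length) (mv : Move) :
    (match clip (decide (h = 0)) (readInput w (h + 1)) mv with
      | .left => h = min (mv.apply h) w.length + 1
      | .stay => min (mv.apply h) w.length = h
      | .right => min (mv.apply h) w.length = h + 1) ∧
    min ((clip (decide (h = 0)) (readInput w (h + 1)) mv).apply (h + 1)) (w.length + 1) =
      min (mv.apply h) w.length + 1 := by
  have hr := FM.readInput_eq_rightEnd (w := w) (show h + 1 ≤ w.length + 1 by omega)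
  cases mv with
  | left =>
    by_cases h0 : h = 0
    · subst h0
      cases hx : readInput w (0 + 1) <;> simp [clip, Move.apply]
    · cases hx : readInput w (h + 1) <;> simp [clip, Move.apply, h0] <;> omega
  | stay => cases hx : readInput w (h + 1) <;> simp [clip, Move.apply] <;> omega
  | right =>
    cases hx : readInput w (h + 1) <;> simp [hx] at hr <;> simp [clip, Move.apply] <;> omega

theorem test_step {L : ℕ} (hL : w.length < 2 ^ L) (p : Cfg Δ ι Q) (hp : p.head ≤ w.length)
    (hp' : ∀ i, p.peb i ≤ w.length) {c' : SM.Cfg Δ (Bool × (ι → Bool)) (Ctl ι Q)} :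
    (S.toFM).Step w ⟨.test p.state true (fun _ => true), p.head + 1, enc L p.head p.peb, p.out⟩ c' ↔
    p.state ∉ S.accept ∧ ∃ t ∈ S.trans p.state w[p.head]? (here p.peb p.head),
      c' = ⟨.upd t.1 (clip (decide (p.head = 0)) (readInput w (p.head + 1)) t.2.1) t.2.2.1 true,
        min (t.2.1.apply p.head) w.length + 1, enc L p.head p.peb, p.out ++ t.2.2.2.toList⟩ := by
  have hs : (S.toFM).sw w
      ⟨.test p.state true (fun _ => true), p.head + 1, enc L p.head p.peb, p.out⟩ =
      (.test p.state (decide (p.head = 0)) (here p.peb p.head), enc L p.head p.peb, []) := by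
    have := S.sweep_test (readInput w (p.head + 1)) p.state true (fun _ => true) L p.head p.peb
      (by omega) (fun i => (hp' i).trans_lt hL)
    simpa [FM.sw] using this
  rw [FM.Step, hs]
  constructor
  · rintro ⟨hn, t, ⟨t', ht', rfl⟩, rfl⟩
    rw [letter_readInput] at ht'
    refine ⟨fun h => hn ⟨_, h, _, _, rfl⟩, t', ht', ?_⟩
    simp [(clip_spec w hp t'.2.1).2]
  · rintro ⟨hn, t, ht, rfl⟩
    refine ⟨?_, _, ⟨t, by rwa [letter_readInput], rfl⟩, ?_⟩
    · rintro ⟨q, hq, z, e, h⟩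
      cases h; exact hn hq
    · simp [(clip_spec w hp t.2.1).2]

theorem upd_step {L : ℕ} (p : Cfg Δ ι Q) (hp : p.head ≤ w.length) (mv : Move) (asg : ι → Bool)
    (h : ℕ) (r : ι → ℕ)
    (hh : match mv with
      | .left => h = p.head + 1
      | .stay => p.head = h
      | .right => p.head = h + 1) (hr : p.peb = place asg r h)
    {c' : SM.Cfg Δ (Bool × (ι → Bool)) (Ctl ι Q)} :
    (S.toFM).Step w ⟨.upd p.state mv asg true, p.head + 1, enc L h r, p.out⟩ c' ↔
    c' = ⟨.test p.state true (fun _ => true), p.head + 1, enc L p.head p.peb, p.out⟩ := by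
  obtain ⟨c1, hc1⟩ := S.sweep_upd (readInput w (p.head + 1)) p.state mv asg true L h p.head r
    (by cases mv <;> simpa using hh)
  have hs : (S.toFM).sw w ⟨.upd p.state mv asg true, p.head + 1, enc L h r, p.out⟩ =
    (.upd p.state mv asg c1, enc L p.head p.peb, []) := by rw [hr]; exact hc1
  have he : (min (Move.stay.apply (p.head + 1)) (w.length + 1)) = p.head + 1 := by
    simp [Move.apply, hp]
  rw [FM.Step, hs]
  constructor
  · rintro ⟨-, t, ht, rfl⟩
    obtain rfl : t = _ := ht
    simp [he]
  · rintro rfl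
    refine ⟨?_, _, rfl, ?_⟩
    · rintro ⟨q, hq, z, e, h⟩
      cases h
    · simp [he]

theorem boot_step {L : ℕ} {c' : SM.Cfg Δ (Bool × (ι → Bool)) (Ctl ι Q)} :
    (S.toFM).Step w ⟨.boot, 0, enc L 0 (fun _ => 0), []⟩ c' ↔
    c' = ⟨.test S.start true (fun _ => true), 1, enc L 0 (fun _ => 0), []⟩ := by
  have hs : (S.toFM).sw w ⟨.boot, 0, enc L 0 (fun _ => 0), []⟩ =
    (.boot, enc L 0 (fun _ => 0), []) := FM.sweep_id _ _ _ fun d _ => rfl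
  rw [FM.Step, hs]
  constructor
  · rintro ⟨-, t, ht, rfl⟩
    obtain rfl : t = _ := ht
    simp [Move.apply]
  · rintro rfl
    refine ⟨?_, _, rfl, ?_⟩
    · rintro ⟨q, hq, z, e, h⟩
      cases h
    · simp [Move.apply]

/-- The abstract step is charged to the testing sweep. From then on the related abstract
configuration is already the new one, while the string still stores the old positions; the updating
sweep catches up without an abstract step. -/
theorem sim_step {L : ℕ} (hL : w.length < 2 ^ L) {c c' : SM.Cfg Δ (Bool × (ι → Bool)) (Ctl ι Q)}
    {p : Cfg Δ ι Q} (hp : S.Reachable w p) (h : S.Sim L c p) (hs : (S.toFM).Step w c c') :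
    ∃ p', S.Reachable w p' ∧ S.Sim L c' p' := by
  cases h with
  | boot =>
    rw [boot_step] at hs
    exact ⟨_, hp, hs ▸ Sim.test S.initCfg⟩
  | test =>
    rw [S.test_step w hL p (bounds hp).1 (bounds hp).2] at hs
    obtain ⟨hn, t, ht, rfl⟩ := hs
    refine ⟨_, hp.tail ⟨hn, t, ht, rfl⟩, ?_⟩
    exact Sim.upd ⟨t.1, _, _, _⟩ _ _ _ _ (clip_spec w (bounds hp).1 t.2.1).1 rfl
  | upd _ mv asg h r hh hr =>
    rw [S.upd_step w p (bounds hp).1 mv asg h r hh hr] at hs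
    exact ⟨p, hp, hs ▸ Sim.test p⟩

theorem toFM_outputs {L : ℕ} (hL : w.length < 2 ^ L) : (S.toFM).outputs L w = S.outputs w := by
  ext y
  constructor
  · rintro ⟨c, hc, ⟨q, hq, z, e, hcq⟩, rfl⟩
    have : ∃ p, S.Reachable w p ∧ S.Sim L c p := by
      clear hcq
      induction hc with
      | refl => exact ⟨_, .refl, by rw [toFM_initCfg]; exact .boot⟩
      | tail _ hs ih =>
        obtain ⟨p, hp, hsim⟩ := ih
        exact S.sim_step w hL hp hsim hs
    obtain ⟨p, hp, hsim⟩ := this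
    cases hsim with
    | test => cases hcq; exact ⟨p, hp, hq, rfl⟩
    | _ => cases hcq
  · rintro ⟨p, hp, ha, rfl⟩
    have : (S.toFM).Reachable L w
        ⟨.test p.state true (fun _ => true), p.head + 1, enc L p.head p.peb, p.out⟩ := by
      clear ha
      induction hp with
      | refl =>
        rw [FM.Reachable, toFM_initCfg]
        exact .single ((S.boot_step w).mpr rfl)
      | @tail p p' hp hs ih =>
        have hb := bounds hp
        have hb' := bounds (hp.tail hs)
        obtain ⟨hn, t, ht, rfl⟩ := hs
        refine (ih.tail ((S.test_step w hL p hb.1 hb.2).mpr ⟨hn, t, ht, rfl⟩)).tail ?_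
        exact (S.upd_step w ⟨t.1, _, _, _⟩ hb'.1 _ _ _ _ (clip_spec w hb.1 t.2.1).1 rfl).mpr rfl
    exact ⟨_, this, ⟨_, ha, _, _, rfl⟩, rfl⟩

/-- Every pebble automaton is simulated by a log-space Turing machine. -/
theorem exists_TM [Finite ι] [Finite Q] : ∃ M : TM Γ Δ, M.LogSpace ∧
    ∀ w, M.outputs w = S.outputs w := by
  obtain ⟨M, h1, -, h2⟩ := FM.exists_TM S.toFM 0
  refine ⟨M, h1, fun w => ?_⟩
  rw [h2, toFM_outputs]
  have := lt_two_pow_strLen 0 w.length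
  omega

end PA

end Machine


/-! ### Log-space execution, level 4: regular programs and their refinement calculus. -/

namespace Machine

/-! ## Nondeterministic programs for pebble automata -/

section Relations

variable {X Δ : Type}

/-- Sequential composition of relations with output. -/
def RSeq (R S : X → List Δ → X → Prop) (x : X) (y : List Δ) (z : X) : Prop :=
  ∃ m y₁ y₂, R x y₁ m ∧ S m y₂ z ∧ y = y₁ ++ y₂

/-- Union of relations with output. -/
def RAlt (R S : X → List Δ → X → Prop) (x : X) (y : List Δ) (z : X) : Prop :=
  R x y z ∨ S x y z

/-- Iteration of a relation with output. -/
inductive RStar (R : X → List Δ → X → Prop) : X → List Δ → X → Prop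
  | nil (x : X) : RStar R x [] x
  | cons {x m z : X} {y₁ y₂ : List Δ} : R x y₁ m → RStar R m y₂ z → RStar R x (y₁ ++ y₂) z

/-- A relation that emits nothing, given by a relation without output. -/
def RSil (R : X → X → Prop) (x : X) (y : List Δ) (z : X) : Prop := y = [] ∧ R x z

theorem rSeq_rSil (R : X → X → Prop) (S : X → List Δ → X → Prop) (x : X) (y : List Δ) (z : X) :
    RSeq (RSil R) S x y z ↔ ∃ m, R x m ∧ S m y z := by
  simp only [RSeq, RSil]
  constructor
  · rintro ⟨m, _, y₂, ⟨rfl, h⟩, h', rfl⟩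
    exact ⟨m, h, h'⟩
  · rintro ⟨m, h, h'⟩
    exact ⟨m, [], y, ⟨rfl, h⟩, h', rfl⟩

theorem rStar_rSil (R : X → X → Prop) :
    RStar (RSil R : X → List Δ → X → Prop) = RSil (Relation.ReflTransGen R) := by
  funext x y z
  refine propext ⟨fun h => ?_, ?_⟩
  · induction h with
    | nil => exact ⟨rfl, .refl⟩
    | cons h _ ih =>
      obtain ⟨rfl, h⟩ := h
      obtain ⟨rfl, ih⟩ := ih
      exact ⟨rfl, .head h ih⟩
  · rintro ⟨rfl, h⟩
    induction h using Relation.ReflTransGen.head_induction_on with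
    | refl => exact .nil _
    | head h _ ih => exact .cons (y₁ := []) ⟨rfl, h⟩ ih

theorem rSeq_rSil_rSil (R S : X → X → Prop) :
    RSeq (RSil R : X → List Δ → X → Prop) (RSil S) = RSil (fun x z => ∃ m, R x m ∧ S m z) := by
  funext x y z
  refine propext ?_
  rw [rSeq_rSil]
  simp only [RSil]
  constructor
  · rintro ⟨m, h, h', h''⟩; exact ⟨h', m, h, h''⟩
  · rintro ⟨h', m, h, h''⟩; exact ⟨m, h, h', h''⟩

end Relations

/-- Programs: guarded instructions, composition, choice and iteration. -/
inductive Prog (Γ Δ ι : Type) where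
  | atom (g : Option Γ → (ι → Bool) → Bool) (mv : Move) (asg : ι → Bool) (o : Option Δ)
  | seq (a b : Prog Γ Δ ι)
  | alt (a b : Prog Γ Δ ι)
  | star (a : Prog Γ Δ ι)

namespace Prog

variable {Γ Δ ι : Type}

/-- Positions of head and pebbles. -/
structure Pos (ι : Type) where
  head : ℕ
  peb : ι → ℕ

def Pos.Ok (w : List Γ) (p : Pos ι) : Prop := p.head ≤ w.length ∧ ∀ i, p.peb i ≤ w.length

/-- The relation computed by a program. -/
def rel (w : List Γ) : Prog Γ Δ ι → Pos ι → List Δ → Pos ι → Prop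
  | atom g mv asg o => fun p y p' => g w[p.head]? (PA.here p.peb p.head) = true ∧
      p' = ⟨min (mv.apply p.head) w.length, PA.place asg p.peb p.head⟩ ∧ y = o.toList
  | seq a b => RSeq (rel w a) (rel w b)
  | alt a b => RAlt (rel w a) (rel w b)
  | star a => RStar (rel w a)

theorem rel_ok {w : List Γ} {P : Prog Γ Δ ι} {p p' : Pos ι} {y : List Δ} (h : P.rel w p y p')
    (hp : p.Ok w) : p'.Ok w := by
  induction P generalizing p p' y with
  | atom g mv asg o =>
    obtain ⟨-, rfl, -⟩ := h
    refine ⟨by simp, fun i => ?_⟩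
    simp only [PA.place]; split_ifs
    · exact hp.1
    · exact hp.2 i
  | seq a b iha ihb => obtain ⟨m, _, _, h1, h2, -⟩ := h; exact ihb h2 (iha h1 hp)
  | alt a b iha ihb => exact h.elim (iha · hp) (ihb · hp)
  | star a iha =>
    change RStar _ _ _ _ at h
    induction h with
    | nil => exact hp
    | cons h _ ih => exact ih (iha h hp)

/-- The relation computed by a list of programs. -/
def relL (w : List Γ) : List (Prog Γ Δ ι) → Pos ι → List Δ → Pos ι → Prop
  | [] => fun p y p' => p' = p ∧ y = []
  | P :: κ => RSeq (rel w P) (relL w κ)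

/-- Instructions of the automaton whose states are lists of programs. -/
def trans : List (Prog Γ Δ ι) → Option Γ → (ι → Bool) →
    Set (List (Prog Γ Δ ι) × Move × (ι → Bool) × Option Δ)
  | [], _, _ => ∅
  | atom g mv asg o :: κ, s, e => {t | g s e = true ∧ t = (κ, mv, asg, o)}
  | seq a b :: κ, _, _ => {(a :: b :: κ, .stay, fun _ => false, none)}
  | alt a b :: κ, _, _ => {(a :: κ, .stay, fun _ => false, none),
      (b :: κ, .stay, fun _ => false, none)}
  | star a :: κ, _, _ => {(κ, .stay, fun _ => false, none),
      (a :: star a :: κ, .stay, fun _ => false, none)}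

/-- The states that occur in the execution of a program followed by a list of programs. -/
def conts : Prog Γ Δ ι → List (Prog Γ Δ ι) → Set (List (Prog Γ Δ ι))
  | atom g mv asg o, κ => {atom g mv asg o :: κ}
  | seq a b, κ => insert (seq a b :: κ) (conts a (b :: κ) ∪ conts b κ)
  | alt a b, κ => insert (alt a b :: κ) (conts a κ ∪ conts b κ)
  | star a, κ => insert (star a :: κ) (conts a (star a :: κ))

theorem finite_conts (P : Prog Γ Δ ι) (κ : List (Prog Γ Δ ι)) : (conts P κ).Finite := by
  induction P generalizing κ with
  | atom => exact Set.finite_singleton _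
  | seq a b iha ihb => exact ((iha _).union (ihb _)).insert _
  | alt a b iha ihb => exact ((iha _).union (ihb _)).insert _
  | star a iha => exact (iha _).insert _

theorem mem_conts (P : Prog Γ Δ ι) (κ : List (Prog Γ Δ ι)) : P :: κ ∈ conts P κ := by
  cases P <;> simp [conts]

/-- Executing `P` never touches the list `κ` below it, and an iteration puts back the same `star a`.
So only finitely many lists of programs occur, as with partial derivatives of regular expressions,
and they can serve as control states. -/
theorem conts_closed (P : Prog Γ Δ ι) (κ κ₁ : List (Prog Γ Δ ι)) (h : κ₁ ∈ conts P κ)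
    {s : Option Γ} {e : ι → Bool} {t : List (Prog Γ Δ ι) × Move × (ι → Bool) × Option Δ}
    (ht : t ∈ trans κ₁ s e) : t.1 ∈ conts P κ ∨ t.1 = κ := by
  induction P generalizing κ with
  | atom =>
    obtain rfl := h
    exact .inr (by rw [ht.2])
  | seq a b iha ihb =>
    rcases h with rfl | h | h
    · obtain rfl : t = _ := ht
      exact .inl (.inr (.inl (mem_conts ..)))
    · rcases iha _ h with h | h
      · exact .inl (.inr (.inl h))
      · exact .inl (.inr (.inr (h ▸ mem_conts ..)))
    · rcases ihb _ h with h | h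
      · exact .inl (.inr (.inr h))
      · exact .inr h
  | alt a b iha ihb =>
    rcases h with rfl | h | h
    · rcases ht with rfl | rfl
      · exact .inl (.inr (.inl (mem_conts ..)))
      · exact .inl (.inr (.inr (mem_conts ..)))
    · exact (iha _ h).imp (fun h => .inr (.inl h)) id
    · exact (ihb _ h).imp (fun h => .inr (.inr h)) id
  | star a iha =>
    rcases h with rfl | h
    · rcases ht with rfl | rfl
      · exact .inr rfl
      · exact .inl (.inr (mem_conts ..))
    · rcases iha _ h with h | h
      · exact .inl (.inr h)
      · exact .inl (.inl h)

/-- The states of the automaton for a program. -/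
abbrev St (P : Prog Γ Δ ι) : Type := {κ : List (Prog Γ Δ ι) // κ ∈ insert [] (conts P [])}

instance (P : Prog Γ Δ ι) : Finite (St P) := ((finite_conts P []).insert []).to_subtype

/-- The pebble automaton for a program. -/
def toPA (P : Prog Γ Δ ι) : PA Γ Δ ι (St P) where
  start := ⟨[P], .inr (mem_conts ..)⟩
  accept := {q | q.1 = []}
  trans := fun q s e => {t | (t.1.1, t.2) ∈ trans q.1 s e}

theorem place_none (r : ι → ℕ) (h : ℕ) : PA.place (fun _ => false) r h = r := by
  funext i; simp [PA.place]

variable (w : List Γ)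

theorem trans_sound {κ : List (Prog Γ Δ ι)} {p p' : Pos ι} {y : List Δ}
    {t : List (Prog Γ Δ ι) × Move × (ι → Bool) × Option Δ} (hp : p.head ≤ w.length)
    (ht : t ∈ trans κ w[p.head]? (PA.here p.peb p.head))
    (h : relL w t.1 ⟨min (t.2.1.apply p.head) w.length, PA.place t.2.2.1 p.peb p.head⟩ y p') :
    relL w κ p (t.2.2.2.toList ++ y) p' := by
  have hstay : (⟨min (Move.stay.apply p.head) w.length, PA.place (fun _ => false) p.peb p.head⟩ :
      Pos ι) = p := by
    rw [place_none, Move.apply, min_eq_left hp]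
  match κ, ht with
  | atom g mv asg o :: κ, ⟨hg, ht⟩ =>
    subst ht
    exact ⟨_, _, _, ⟨hg, rfl, rfl⟩, h, rfl⟩
  | seq a b :: κ, ht =>
    obtain rfl : t = _ := ht
    simp only [hstay] at h
    obtain ⟨m, y₁, y₂, h1, ⟨m', y₃, y₄, h2, h3, rfl⟩, rfl⟩ := h
    exact ⟨_, _, _, ⟨_, _, _, h1, h2, rfl⟩, h3, by simp⟩
  | alt a b :: κ, ht =>
    rcases ht with rfl | rfl <;> simp only [hstay] at h <;> obtain ⟨m, y₁, y₂, h1, h2, rfl⟩ := h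
    · exact ⟨_, _, _, .inl h1, h2, by simp⟩
    · exact ⟨_, _, _, .inr h1, h2, by simp⟩
  | star a :: κ, ht =>
    rcases ht with rfl | rfl <;> simp only [hstay] at h
    · exact ⟨_, _, _, .nil _, h, by simp⟩
    · obtain ⟨m, y₁, y₂, h1, ⟨m', y₃, y₄, h2, h3, rfl⟩, rfl⟩ := h
      exact ⟨_, _, _, .cons h1 h2, h3, by simp⟩

theorem sound (P : Prog Γ Δ ι) {c c' : PA.Cfg Δ ι (St P)}
    (h : Relation.ReflTransGen (P.toPA.Step w) c c') (hc : c.head ≤ w.length)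
    (hc' : c'.state.1 = []) :
    ∃ y, relL w c.state.1 ⟨c.head, c.peb⟩ y ⟨c'.head, c'.peb⟩ ∧ c'.out = c.out ++ y := by
  induction h using Relation.ReflTransGen.head_induction_on with
  | refl => exact ⟨[], by rw [hc']; exact ⟨rfl, rfl⟩, by simp⟩
  | head hs _ ih =>
    obtain ⟨-, t, ht, rfl⟩ := hs
    obtain ⟨y, hy, ho⟩ := ih (by simp)
    exact ⟨t.2.2.2.toList ++ y, trans_sound w (t := (t.1.1, t.2)) hc ht hy, by simp [ho]⟩

/-- The continuation `κ` is arbitrary because subprograms run on top of what is still to be done;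
membership in `conts` travels along the run, since states are elements of a subtype. -/
theorem complete_aux (P₀ P : Prog Γ Δ ι) {p p' : Pos ι} {y : List Δ} (h : P.rel w p y p')
    (hp : p.Ok w) (κ : List (Prog Γ Δ ι)) (hκ : P :: κ ∈ insert [] (conts P₀ [])) (o : List Δ) :
    ∃ hκ' : κ ∈ insert [] (conts P₀ []), Relation.ReflTransGen (P₀.toPA.Step w)
      ⟨⟨P :: κ, hκ⟩, p.head, p.peb, o⟩ ⟨⟨κ, hκ'⟩, p'.head, p'.peb, o ++ y⟩ := by
  have clos : ∀ {κ₁ : List (Prog Γ Δ ι)} {s e}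
      {t : List (Prog Γ Δ ι) × Move × (ι → Bool) × Option Δ}, κ₁ ∈ insert [] (conts P₀ []) →
      t ∈ trans κ₁ s e → t.1 ∈ insert [] (conts P₀ []) := by
    rintro κ₁ s e t (rfl | h) ht
    · cases ht
    · exact (conts_closed P₀ [] κ₁ h ht).symm
  have one : ∀ (P : Prog Γ Δ ι) (κ : List (Prog Γ Δ ι)) (hκ : P :: κ ∈ insert [] (conts P₀ []))
      (p : Pos ι) (o : List Δ) (t : List (Prog Γ Δ ι) × Move × (ι → Bool) × Option Δ),
      t ∈ trans (P :: κ) w[p.head]? (PA.here p.peb p.head) →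
      ∃ h : t.1 ∈ insert [] (conts P₀ []), P₀.toPA.Step w ⟨⟨P :: κ, hκ⟩, p.head, p.peb, o⟩
        ⟨⟨t.1, h⟩, min (t.2.1.apply p.head) w.length, PA.place t.2.2.1 p.peb p.head,
          o ++ t.2.2.2.toList⟩ :=
    fun P κ hκ p o t ht => ⟨clos hκ ht, by simp [toPA], (⟨t.1, clos hκ ht⟩, t.2), ht, rfl⟩
  have stay : ∀ (P : Prog Γ Δ ι) (κ : List (Prog Γ Δ ι)) (hκ : P :: κ ∈ insert [] (conts P₀ []))
      (p : Pos ι) (_ : p.Ok w) (o : List Δ) (κ' : List (Prog Γ Δ ι)),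
      (κ', Move.stay, fun _ => false, none) ∈ trans (P :: κ) w[p.head]? (PA.here p.peb p.head) →
      ∃ h : κ' ∈ insert [] (conts P₀ []), P₀.toPA.Step w ⟨⟨P :: κ, hκ⟩, p.head, p.peb, o⟩
        ⟨⟨κ', h⟩, p.head, p.peb, o⟩ := by
    intro P κ hκ p hp o κ' h
    obtain ⟨h', hs⟩ := one P κ hκ p o _ h
    refine ⟨h', ?_⟩
    simpa [place_none, Move.apply, hp.1] using hs
  induction P generalizing p p' y κ o with
  | atom g mv asg b =>
    obtain ⟨hg, rfl, rfl⟩ := h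
    obtain ⟨h', hs⟩ := one _ κ hκ p o (κ, mv, asg, b) ⟨hg, rfl⟩
    exact ⟨h', .single hs⟩
  | seq a b iha ihb =>
    obtain ⟨m, y₁, y₂, h1, h2, rfl⟩ := h
    obtain ⟨k1, s1⟩ := stay _ κ hκ p hp o (a :: b :: κ) rfl
    obtain ⟨k2, s2⟩ := iha h1 hp _ k1 o
    obtain ⟨k3, s3⟩ := ihb h2 (rel_ok h1 hp) _ k2 (o ++ y₁)
    rw [List.append_assoc] at s3
    exact ⟨k3, .head s1 (s2.trans s3)⟩
  | alt a b iha ihb =>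
    rcases h with h | h
    · obtain ⟨k1, s1⟩ := stay _ κ hκ p hp o (a :: κ) (.inl rfl)
      obtain ⟨k2, s2⟩ := iha h hp _ k1 o
      exact ⟨k2, .head s1 s2⟩
    · obtain ⟨k1, s1⟩ := stay _ κ hκ p hp o (b :: κ) (.inr rfl)
      obtain ⟨k2, s2⟩ := ihb h hp _ k1 o
      exact ⟨k2, .head s1 s2⟩
  | star a iha =>
    -- Each round runs `a` on top of a new copy of `star a`, so an inner induction follows the
    -- rounds while the outer hypothesis executes `a`.
    change RStar _ _ _ _ at h
    induction h generalizing o with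
    | nil p =>
      obtain ⟨k1, s1⟩ := stay _ κ hκ p hp o κ (.inl rfl)
      exact ⟨k1, .single (by simpa using s1)⟩
    | @cons p m z y₁ y₂ h1 _ ih =>
      obtain ⟨k1, s1⟩ := stay _ κ hκ p hp o (a :: star a :: κ) (.inr rfl)
      obtain ⟨k2, s2⟩ := iha h1 hp _ k1 o
      obtain ⟨k3, s3⟩ := ih (rel_ok h1 hp) (o ++ y₁)
      rw [List.append_assoc] at s3
      exact ⟨k3, .head s1 (s2.trans s3)⟩

theorem toPA_outputs (P : Prog Γ Δ ι) :
    P.toPA.outputs w = {y | ∃ p', P.rel w ⟨0, fun _ => 0⟩ y p'} := by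
  ext y
  constructor
  · rintro ⟨c, hc, ha, rfl⟩
    obtain ⟨y, ⟨m, y₁, y₂, h, ⟨rfl, rfl⟩, rfl⟩, ho⟩ :=
      sound w P hc (by simp [PA.initCfg]) ha
    refine ⟨⟨c.head, c.peb⟩, ?_⟩
    rw [ho]
    simpa [PA.initCfg] using h
  · rintro ⟨p', h⟩
    obtain ⟨h', hs⟩ := complete_aux w P P h ⟨by simp, by simp⟩ [] (.inr (mem_conts ..)) []
    exact ⟨_, hs, rfl, by simp⟩

/-- Every program is executed by a log-space Turing machine. -/
theorem exists_TM [Finite ι] (P : Prog Γ Δ ι) : ∃ M : TM Γ Δ, M.LogSpace ∧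
    ∀ w, M.outputs w = {y | ∃ p', P.rel w ⟨0, fun _ => 0⟩ y p'} := by
  obtain ⟨M, h1, h2⟩ := P.toPA.exists_TM
  exact ⟨M, h1, fun w => by rw [h2, toPA_outputs]⟩

/-! ### Refinement -/

/-- The program computes the relation `R` on the views `V` of positions. -/
def Impl {X : Type} (V : Pos ι → X) (P : Prog Γ Δ ι) (R : X → List Δ → X → Prop) : Prop :=
  ∀ p, p.Ok w → ∀ y x', (∃ p', P.rel w p y p' ∧ V p' = x') ↔ R (V p) y x'

variable {w}
variable {X : Type} {V : Pos ι → X} {P P' : Prog Γ Δ ι} {R R' : X → List Δ → X → Prop}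

theorem Impl.congr (h : Impl w V P R) (hR : R = R') : Impl w V P R' := hR ▸ h

/-- `Impl` speaks about all admissible positions with a given view. This is why the actual
intermediate position, of which only the view is known, can be handed to the second program. -/
theorem Impl.seq (h : Impl w V P R) (h' : Impl w V P' R') : Impl w V (P.seq P') (RSeq R R') := by
  intro p hp y x'
  constructor
  · rintro ⟨p', ⟨m, y₁, y₂, h1, h2, rfl⟩, rfl⟩
    exact ⟨V m, y₁, y₂, (h p hp ..).mp ⟨m, h1, rfl⟩, (h' m (rel_ok h1 hp) ..).mp ⟨p', h2, rfl⟩, rfl⟩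
  · rintro ⟨x, y₁, y₂, h1, h2, rfl⟩
    obtain ⟨m, k1, rfl⟩ := (h p hp ..).mpr h1
    obtain ⟨p', k2, rfl⟩ := (h' m (rel_ok k1 hp) ..).mpr h2
    exact ⟨p', ⟨m, y₁, y₂, k1, k2, rfl⟩, rfl⟩

theorem Impl.alt (h : Impl w V P R) (h' : Impl w V P' R') : Impl w V (P.alt P') (RAlt R R') := by
  intro p hp y x'
  rw [RAlt, ← h p hp, ← h' p hp]
  constructor
  · rintro ⟨p', h | h, rfl⟩
    exacts [.inl ⟨p', h, rfl⟩, .inr ⟨p', h, rfl⟩]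
  · rintro (⟨p', h, rfl⟩ | ⟨p', h, rfl⟩)
    exacts [⟨p', .inl h, rfl⟩, ⟨p', .inr h, rfl⟩]

theorem Impl.star (h : Impl w V P R) : Impl w V P.star (RStar R) := by
  intro p hp y x'
  constructor
  · rintro ⟨p', h', rfl⟩
    change RStar _ _ _ _ at h'
    induction h' with
    | nil => exact .nil _
    | cons h1 _ ih => exact .cons ((h _ hp ..).mp ⟨_, h1, rfl⟩) (ih (rel_ok h1 hp))
  · intro h'
    generalize hx : V p = x at h'
    induction h' generalizing p with
    | nil => exact ⟨p, .nil _, hx⟩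
    | cons h1 _ ih =>
      subst hx
      obtain ⟨m, k1, rfl⟩ := (h p hp ..).mpr h1
      obtain ⟨p', k2, rfl⟩ := ih m (rel_ok k1 hp) rfl
      exact ⟨p', .cons k1 k2, rfl⟩

/-- Data may be forgotten as soon as the forgotten result depends only on the forgotten start. This
is used to hide the scratch pebbles. -/
theorem Impl.coarsen {Y : Type} (h : Impl w V P R) (H : X → Y) {S : Y → List Δ → Y → Prop}
    (hS : ∀ x y z, (∃ x', R x y x' ∧ H x' = z) ↔ S (H x) y z) : Impl w (H ∘ V) P S := by
  intro p hp y z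
  rw [Function.comp, ← hS]
  simp only [← h p hp, Function.comp]
  constructor
  · rintro ⟨p', h, rfl⟩; exact ⟨_, ⟨p', h, rfl⟩, rfl⟩
  · rintro ⟨_, ⟨p', h, rfl⟩, rfl⟩; exact ⟨p', h, rfl⟩

/-- Choice among the elements of a list of programs. -/
def alts : List (Prog Γ Δ ι) → Prog Γ Δ ι
  | [] => atom (fun _ _ => false) .stay (fun _ => false) none
  | P :: l => alt P (alts l)

theorem impl_alts {α : Type} (f : α → Prog Γ Δ ι) (R : α → X → List Δ → X → Prop) (l : List α)
    (h : ∀ a ∈ l, Impl w V (f a) (R a)) :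
    Impl w V (alts (l.map f)) (fun x y z => ∃ a ∈ l, R a x y z) := by
  induction l with
  | nil => intro p hp y x'; simp [alts, rel]
  | cons a l ih =>
    simp only [List.mem_cons, forall_eq_or_imp] at h
    refine ((h.1.alt (ih h.2)).congr ?_)
    funext x y z
    simp [RAlt]

/-! ### Basic programs -/

/-- Suffixes of the input at the positions of head and pebbles. -/
def view (w : List Γ) (p : Pos ι) : List Γ × (ι → List Γ) :=
  (w.drop p.head, fun i => w.drop (p.peb i))

/-- Move the head to a pebble. -/
def goto (i : ι) : Prog Γ Δ ι :=
  .seq (.star (.alt (.atom (fun _ _ => true) .left (fun _ => false) none)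
      (.atom (fun _ _ => true) .right (fun _ => false) none)))
    (.atom (fun _ e => e i) .stay (fun _ => false) none)

/-- Put a pebble on the current position. -/
def put [DecidableEq ι] (i : ι) : Prog Γ Δ ι :=
  .atom (fun _ _ => true) .stay (fun j => decide (j = i)) none

/-- Test the scanned letter and move to the right. -/
def step (f : Γ → Bool) : Prog Γ Δ ι :=
  .atom (fun s _ => s.elim false f) .right (fun _ => false) none

/-- Test the scanned letter. -/
def check (f : Option Γ → Bool) : Prog Γ Δ ι :=
  .atom (fun s _ => f s) .stay (fun _ => false) none

/-- Emit a symbol. -/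
def emit (o : Δ) : Prog Γ Δ ι :=
  .atom (fun _ _ => true) .stay (fun _ => false) (some o)

/-- The head walks nondeterministically; the final test discards every walk that does not end at the
pebble, so the surviving walks all have the same effect. -/
theorem impl_goto (i : ι) : Impl w (view w) (goto i : Prog Γ Δ ι)
    (RSil fun x z => z = (x.2 i, x.2)) := by
  -- Every admissible position can be reached silently, by moving always to the right or always to
  -- the left.
  have wander : ∀ (p : Pos ι), p.Ok w → ∀ h ≤ w.length,
      RStar (Prog.rel (Δ := Δ) w (.alt (.atom (fun _ _ => true) .left (fun _ => false) none)
      (.atom (fun _ _ => true) .right (fun _ => false) none))) p [] ⟨h, p.peb⟩ := by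
    rintro ⟨h, r⟩ hp h' hh'
    replace hp := hp.1
    simp only at hp ⊢
    rcases le_total h h' with hle | hle <;> obtain ⟨k, rfl⟩ := Nat.exists_eq_add_of_le hle
    · induction k generalizing h with
      | zero => exact .nil _
      | succ k ih =>
        refine .cons (y₁ := []) (m := ⟨h + 1, r⟩) (.inr ⟨rfl, ?_, rfl⟩) ?_
        · simp only [place_none, Move.apply, Pos.mk.injEq, and_true]; omega
        · have := ih (h + 1) (by omega) (by omega) (by omega)
          rwa [show h + 1 + k = h + (k + 1) by omega] at this
    · induction k with
      | zero => exact .nil _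
      | succ k ih =>
        refine .cons (y₁ := []) (m := ⟨h' + k, r⟩) (.inl ⟨rfl, ?_, rfl⟩) (ih (by omega) (by omega))
        simp only [place_none, Move.apply, Pos.mk.injEq, and_true]; omega
  have sil : ∀ (p p' : Pos ι) (y : List Δ),
      RStar (Prog.rel (Δ := Δ) w (.alt (.atom (fun _ _ => true) .left (fun _ => false) none)
      (.atom (fun _ _ => true) .right (fun _ => false) none))) p y p' → y = [] ∧ p'.peb = p.peb := by
    intro p p' y h
    induction h with
    | nil => exact ⟨rfl, rfl⟩
    | cons h1 _ ih =>
      rcases h1 with ⟨-, rfl, rfl⟩ | ⟨-, rfl, rfl⟩ <;> simp_all [place_none]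
  intro p hp y x'
  constructor
  · rintro ⟨p', ⟨m, y₁, y₂, h1, ⟨h2, rfl, rfl⟩, rfl⟩, rfl⟩
    have hm : m.Ok w := rel_ok (P := .star _) h1 hp
    obtain ⟨rfl, hr⟩ := sil _ _ _ h1
    have h2 : m.peb i = m.head := by simpa [PA.here] using h2
    refine ⟨rfl, ?_⟩
    rw [place_none]
    simp [view, Move.apply, ← h2, hr, hp.2 i]
  · rintro ⟨rfl, rfl⟩
    refine ⟨⟨p.peb i, p.peb⟩, ⟨_, [], [], wander p hp _ (hp.2 i), ⟨?_, ?_, rfl⟩, rfl⟩, rfl⟩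
    · simp [PA.here]
    · simp [place_none, Move.apply, hp.2 i]

theorem impl_put [DecidableEq ι] (i : ι) : Impl w (view w) (put i : Prog Γ Δ ι)
    (RSil fun x z => z = (x.1, Function.update x.2 i x.1)) := by
  intro p hp y x'
  have : view w ⟨min (Move.stay.apply p.head) w.length,
      PA.place (fun j => decide (j = i)) p.peb p.head⟩ =
      ((view w p).1, Function.update (view w p).2 i (view w p).1) := by
    simp only [view, Move.apply, min_eq_left hp.1, Prod.mk.injEq, true_and]
    funext j
    by_cases h : j = i
    · subst h; simp [PA.place]
    · simp [PA.place, h]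
  constructor
  · rintro ⟨p', ⟨-, rfl, rfl⟩, rfl⟩
    exact ⟨rfl, this⟩
  · rintro ⟨rfl, rfl⟩
    exact ⟨_, ⟨rfl, rfl, rfl⟩, this⟩

theorem impl_step (f : Γ → Bool) : Impl w (view w) (step f : Prog Γ Δ ι)
    (RSil fun x z => ∃ a s, x.1 = a :: s ∧ f a = true ∧ z = (s, x.2)) := by
  intro p hp y x'
  have hmin : p.head < w.length → view w ⟨min (Move.right.apply p.head) w.length,
      PA.place (fun _ => false) p.peb p.head⟩ = (w.drop (p.head + 1), (view w p).2) := by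
    intro h
    simp [view, Move.apply, place_none, Nat.succ_le_of_lt h]
  constructor
  · rintro ⟨p', ⟨hg, rfl, rfl⟩, rfl⟩
    rcases Nat.lt_or_ge p.head w.length with h | h
    · refine ⟨rfl, w[p.head], w.drop (p.head + 1), List.drop_eq_getElem_cons h, ?_, hmin h⟩
      simpa [h] using hg
    · simp [h] at hg
  · rintro ⟨rfl, a, s, h1, h2, rfl⟩
    have h : p.head < w.length := by
      by_contra h
      simp [view, List.drop_eq_nil_of_le (not_lt.mp h)] at h1
    have h3 : w[p.head] :: w.drop (p.head + 1) = a :: s := by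
      rw [← h1]; exact (List.drop_eq_getElem_cons h).symm
    simp only [List.cons.injEq] at h3
    refine ⟨_, ⟨?_, rfl, rfl⟩, ?_⟩
    · simp [h, h3.1, h2]
    · rw [hmin h, h3.2]

theorem impl_check (f : Option Γ → Bool) : Impl w (view w) (check f : Prog Γ Δ ι)
    (RSil fun x z => f x.1.head? = true ∧ z = x) := by
  intro p hp y x'
  have h1 : (view w p).1.head? = w[p.head]? := by simp [view]
  have h2 : view w ⟨min (Move.stay.apply p.head) w.length,
      PA.place (fun _ => false) p.peb p.head⟩ = view w p := by
    simp [view, Move.apply, hp.1, place_none]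
  rw [RSil, h1]
  constructor
  · rintro ⟨p', ⟨hg, rfl, rfl⟩, rfl⟩
    exact ⟨rfl, hg, h2⟩
  · rintro ⟨rfl, hg, rfl⟩
    exact ⟨_, ⟨hg, rfl, rfl⟩, h2⟩

theorem impl_emit (o : Δ) : Impl w (view w) (emit o : Prog Γ Δ ι)
    (fun x y z => y = [o] ∧ z = x) := by
  intro p hp y x'
  have h2 : view w ⟨min (Move.stay.apply p.head) w.length,
      PA.place (fun _ => false) p.peb p.head⟩ = view w p := by
    simp [view, Move.apply, hp.1, place_none]
  constructor
  · rintro ⟨p', ⟨-, rfl, rfl⟩, rfl⟩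
    exact ⟨rfl, h2⟩
  · rintro ⟨rfl, rfl⟩
    exact ⟨_, ⟨rfl, rfl, rfl⟩, h2⟩

end Prog

end Machine


/-! ### Programs that read words and compare names. -/

namespace Machine

namespace Prog

variable {Γ Δ ι : Type} {w : List Γ}

/-! ### Programs that read a prefix of the remaining input -/

/-- The relation "read a word of `L`". -/
def RReads {A : Type} (L : Set (List Γ)) : List Γ × A → List Δ → List Γ × A → Prop :=
  RSil fun x z => ∃ u ∈ L, x.1 = u ++ z.1 ∧ z.2 = x.2

theorem rReads_seq {A : Type} (L L' : Set (List Γ)) :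
    RSeq (RReads L : List Γ × A → List Δ → List Γ × A → Prop) (RReads L') =
      RReads {u | ∃ v ∈ L, ∃ v' ∈ L', u = v ++ v'} := by
  rw [RReads, RReads, rSeq_rSil_rSil]
  refine congrArg RSil ?_
  funext x z
  refine propext ⟨?_, ?_⟩
  · rintro ⟨m, ⟨u, hu, h1, h2⟩, u', hu', h3, h4⟩
    exact ⟨_, ⟨u, hu, u', hu', rfl⟩, by rw [h1, h3, List.append_assoc], h4.trans h2⟩
  · rintro ⟨_, ⟨u, hu, u', hu', rfl⟩, h1, h2⟩
    exact ⟨(u' ++ z.1, x.2), ⟨u, hu, by rw [h1, List.append_assoc], rfl⟩, u', hu', rfl, h2⟩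

theorem rReads_alt {A : Type} (L L' : Set (List Γ)) :
    RAlt (RReads L : List Γ × A → List Δ → List Γ × A → Prop) (RReads L') = RReads (L ∪ L') := by
  funext x y z
  refine propext ⟨?_, ?_⟩
  · rintro (⟨h, u, hu, h'⟩ | ⟨h, u, hu, h'⟩)
    exacts [⟨h, u, .inl hu, h'⟩, ⟨h, u, .inr hu, h'⟩]
  · rintro ⟨h, u, hu | hu, h'⟩
    exacts [.inl ⟨h, u, hu, h'⟩, .inr ⟨h, u, hu, h'⟩]

theorem rReads_star {A : Type} (L : Set (List Γ)) :
    RStar (RReads L : List Γ × A → List Δ → List Γ × A → Prop) =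
      RReads {u | ∃ l : List (List Γ), (∀ v ∈ l, v ∈ L) ∧ u = l.flatten} := by
  rw [RReads, rStar_rSil, RReads]
  refine congrArg RSil ?_
  funext x z
  refine propext ⟨fun h => ?_, ?_⟩
  · induction h using Relation.ReflTransGen.head_induction_on with
    | refl => exact ⟨_, ⟨[], by simp, rfl⟩, rfl, rfl⟩
    | head h _ ih =>
      obtain ⟨u, hu, h1, h2⟩ := h
      obtain ⟨_, ⟨l, hl, rfl⟩, h3, h4⟩ := ih
      exact ⟨_, ⟨u :: l, by simpa [hu] using hl, rfl⟩, by simp [h1, h3], h4.trans h2⟩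
  · rintro ⟨_, ⟨l, hl, rfl⟩, h1, h2⟩
    induction l generalizing x with
    | nil =>
      have : x = z := Prod.ext (by simpa using h1) h2.symm
      exact this ▸ .refl
    | cons u l ih =>
      simp only [List.mem_cons, forall_eq_or_imp] at hl
      exact .head (b := (l.flatten ++ z.1, x.2)) ⟨u, hl.1, by simp [h1], rfl⟩
        (ih (x := (l.flatten ++ z.1, x.2)) hl.2 rfl h2)

/-- Repeatedly read letters with a property. -/
theorem rReads_star_step {A : Type} (f : Γ → Bool) :
    RStar (RReads {u | ∃ a, f a = true ∧ u = [a]} : List Γ × A → List Δ → List Γ × A → Prop) =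
      RReads {u | ∀ a ∈ u, f a = true} := by
  rw [rReads_star]
  congr 1
  ext u
  constructor
  · rintro ⟨l, hl, rfl⟩ a ha
    obtain ⟨v, hv, ha⟩ := List.mem_flatten.mp ha
    obtain ⟨b, hb, rfl⟩ := hl v hv
    rw [List.mem_singleton.mp ha, hb]
  · intro h
    refine ⟨u.map fun a => [a], ?_, ?_⟩
    · intro v hv
      obtain ⟨a, ha, rfl⟩ := List.mem_map.mp hv
      exact ⟨a, h a ha, rfl⟩
    · induction u with
      | nil => rfl
      | cons a u ih => simp at h; simpa using ih h.2

/-! ### Views that hide two scratch pebbles -/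

variable {κ : Type}

/-- Forget the scratch pebbles. -/
def hide (x : List Γ × (κ ⊕ Bool → List Γ)) : List Γ × (κ → List Γ) := (x.1, fun i => x.2 (.inl i))

theorem step_eq (f : Γ → Bool) : Impl w (view w) (step f : Prog Γ Δ ι)
    (RReads {u | ∃ a, f a = true ∧ u = [a]}) := by
  refine (impl_step f).congr (congrArg RSil ?_)
  funext x z
  refine propext ⟨?_, ?_⟩
  · rintro ⟨a, s, h1, h2, rfl⟩; exact ⟨_, ⟨a, h2, rfl⟩, h1, rfl⟩
  · rintro ⟨_, ⟨a, h2, rfl⟩, h1, h3⟩; exact ⟨a, z.1, h1, h2, Prod.ext rfl h3⟩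

theorem Impl.hide_reads {P : Prog Γ Δ (κ ⊕ Bool)} {L : Set (List Γ)}
    (h : Impl w (view w) P (RReads L)) : Impl w (hide ∘ view w) P (RReads L) := by
  refine h.coarsen hide fun x y z => ⟨?_, ?_⟩
  · rintro ⟨x', ⟨rfl, u, hu, h1, h2⟩, rfl⟩
    exact ⟨rfl, u, hu, h1, by simp [hide, h2]⟩
  · rintro ⟨rfl, u, hu, h1, h2⟩
    exact ⟨(z.1, x.2), ⟨rfl, u, hu, h1, rfl⟩, Prod.ext rfl h2.symm⟩

theorem hide_goto (i : κ) : Impl w (hide ∘ view w) (goto (.inl i) : Prog Γ Δ (κ ⊕ Bool))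
    (RSil fun x z => z = (x.2 i, x.2)) := by
  refine (impl_goto _).coarsen hide fun x y z => ⟨?_, ?_⟩
  · rintro ⟨_, ⟨rfl, rfl⟩, rfl⟩; exact ⟨rfl, rfl⟩
  · rintro ⟨rfl, rfl⟩; exact ⟨_, ⟨rfl, rfl⟩, rfl⟩

theorem hide_put [DecidableEq κ] (i : κ) :
    Impl w (hide ∘ view w) (put (.inl i) : Prog Γ Δ (κ ⊕ Bool))
    (RSil fun x z => z = (x.1, Function.update x.2 i x.1)) := by
  have key : ∀ x : List Γ × (κ ⊕ Bool → List Γ),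
      hide (x.1, Function.update x.2 (.inl i) x.1) =
      ((hide x).1, Function.update (hide x).2 i (hide x).1) := by
    intro x
    refine Prod.ext rfl ?_
    funext j
    by_cases h : j = i
    · subst h; simp [hide]
    · simp [hide, h]
  refine (impl_put _).coarsen hide fun x y z => ⟨?_, ?_⟩
  · rintro ⟨_, ⟨rfl, rfl⟩, rfl⟩; exact ⟨rfl, key x⟩
  · rintro ⟨rfl, rfl⟩; exact ⟨_, ⟨rfl, rfl⟩, key x⟩

theorem hide_check (f : Option Γ → Bool) :
    Impl w (hide ∘ view w) (check f : Prog Γ Δ (κ ⊕ Bool))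
    (RSil fun x z => f x.1.head? = true ∧ z = x) := by
  refine (impl_check _).coarsen hide fun x y z => ⟨?_, ?_⟩
  · rintro ⟨_, ⟨rfl, h, rfl⟩, rfl⟩; exact ⟨rfl, h, rfl⟩
  · rintro ⟨rfl, h, rfl⟩; exact ⟨_, ⟨rfl, h, rfl⟩, rfl⟩

theorem hide_emit (o : Δ) : Impl w (hide ∘ view w) (emit o : Prog Γ Δ (κ ⊕ Bool))
    (fun x y z => y = [o] ∧ z = x) := by
  refine (impl_emit _).coarsen hide fun x y z => ⟨?_, ?_⟩
  · rintro ⟨_, ⟨rfl, rfl⟩, rfl⟩; exact ⟨rfl, rfl⟩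
  · rintro ⟨rfl, rfl⟩; exact ⟨_, ⟨rfl, rfl⟩, rfl⟩

/-! ### Comparison of words that end with a separator -/

variable [DecidableEq Γ] [DecidableEq κ] (sep : Γ)

/-- Read a word that ends with a separator. -/
def word : Prog Γ Δ ι :=
  .seq (.star (step fun a => decide (a ≠ sep))) (step fun a => decide (a = sep))

/-- Words that end with a separator and have no other one. -/
def words : Set (List Γ) := {u | ∃ v, sep ∉ v ∧ u = v ++ [sep]}

theorem impl_word : Impl w (view w) (word sep : Prog Γ Δ ι) (RReads (words sep)) := by
  refine ((step_eq _).star.seq (step_eq _)).congr ?_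
  rw [rReads_star_step, rReads_seq]
  congr 1
  ext u
  simp only [Set.mem_ofPred_eq, words, decide_eq_true_eq]
  constructor
  · rintro ⟨v, hv, _, ⟨a, rfl, rfl⟩, rfl⟩; exact ⟨v, fun h => hv _ h rfl, rfl⟩
  · rintro ⟨v, hv, rfl⟩; exact ⟨v, fun a ha h => hv (h ▸ ha), _, ⟨_, rfl, rfl⟩, rfl⟩

/-- Advance both scratch pebbles over the letter `c`. -/
def both (c : Γ) : Prog Γ Δ (κ ⊕ Bool) :=
  .seq (goto (.inr true)) (.seq (step fun a => decide (a = c)) (.seq (put (.inr true))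
    (.seq (goto (.inr false)) (.seq (step fun a => decide (a = c)) (put (.inr false))))))

/-- Put the scratch pebbles on given positions. -/
def setScratch (r : κ ⊕ Bool → List Γ) (s t : List Γ) : κ ⊕ Bool → List Γ
  | .inl i => r (.inl i)
  | .inr true => s
  | .inr false => t

theorem impl_both (c : Γ) : Impl w (view w) (both c : Prog Γ Δ (κ ⊕ Bool))
    (RSil fun x z => ∃ s t, x.2 (.inr true) = c :: s ∧ x.2 (.inr false) = c :: t ∧
      z = (t, setScratch x.2 s t)) := by
  refine ((impl_goto _).seq ((impl_step _).seq ((impl_put _).seq ((impl_goto _).seq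
    ((impl_step _).seq (impl_put _)))))).congr ?_
  simp only [rSeq_rSil_rSil]
  refine congrArg RSil ?_
  funext x z
  have key : ∀ s t, Function.update (Function.update x.2 (.inr true) s) (.inr false) t =
      setScratch x.2 s t := by
    intro s t
    funext i
    rcases i with i | _ | _ <;> simp [setScratch]
  refine propext ⟨?_, ?_⟩
  · rintro ⟨_, rfl, _, ⟨a, s, h1, h2, rfl⟩, _, rfl, _, rfl, _, ⟨a', t, h3, h4, rfl⟩, rfl⟩
    simp only [decide_eq_true_eq] at h2 h4
    subst h2 h4
    exact ⟨s, t, h1, by simpa using h3, by rw [← key]⟩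
  · rintro ⟨s, t, h1, h2, rfl⟩
    exact ⟨_, rfl, _, ⟨c, s, h1, by simp, rfl⟩, _, rfl, _, rfl, _, ⟨c, t, by simpa using h2, by simp,
      rfl⟩, by simp [key]⟩

variable [Finite Γ]

/-- The list of all letters. -/
noncomputable def letters (Γ : Type) [Finite Γ] : List Γ :=
  (Fintype.ofFinite Γ).elems.toList

theorem mem_letters (c : Γ) : c ∈ letters Γ :=
  Finset.mem_toList.mpr ((Fintype.ofFinite Γ).complete c)

/-- Advance both scratch pebbles over a common prefix without separators. -/
noncomputable def common : Prog Γ Δ (κ ⊕ Bool) :=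
  .star (alts (((letters Γ).filter fun c => decide (c ≠ sep)).map both))

theorem impl_common : Impl w (view w) (common sep : Prog Γ Δ (κ ⊕ Bool))
    (RSil (Relation.ReflTransGen fun x z => ∃ c, c ≠ sep ∧ ∃ s t, x.2 (.inr true) = c :: s ∧
      x.2 (.inr false) = c :: t ∧ z = (t, setScratch x.2 s t))) := by
  refine (impl_alts _ _ _ fun c _ => impl_both c).star.congr ?_
  rw [← rStar_rSil]
  congr 1
  funext x y z
  simp only [RSil, List.mem_filter, decide_eq_true_eq, mem_letters, true_and]
  refine propext ⟨?_, ?_⟩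
  · rintro ⟨c, h, h', h''⟩; exact ⟨h', c, h, h''⟩
  · rintro ⟨h', c, h, h''⟩; exact ⟨c, h, h', h''⟩

/-- The invariant is that both scratch pebbles have advanced over the same word `u`. The position of
the head is left open, since whatever follows the loop begins with a jump to a scratch pebble. -/
theorem common_iff (x z : List Γ × (κ ⊕ Bool → List Γ)) :
    (∃ h, Relation.ReflTransGen (fun x z : List Γ × (κ ⊕ Bool → List Γ) => ∃ c, c ≠ sep ∧ ∃ s t,
      x.2 (.inr true) = c :: s ∧ x.2 (.inr false) = c :: t ∧ z = (t, setScratch x.2 s t)) x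
      (h, z.2)) ↔ ∃ u, sep ∉ u ∧ x.2 (.inr true) = u ++ z.2 (.inr true) ∧
        x.2 (.inr false) = u ++ z.2 (.inr false) ∧ ∀ i, z.2 (.inl i) = x.2 (.inl i) := by
  constructor
  · rintro ⟨h, hr⟩
    generalize hz : (h, z.2) = z' at hr
    have hz : z.2 = z'.2 := by rw [← hz]
    rw [hz]
    clear hz
    induction hr using Relation.ReflTransGen.head_induction_on with
    | refl => exact ⟨[], by simp⟩
    | head h _ ih =>
      obtain ⟨c, hc, s, t, h1, h2, rfl⟩ := h
      obtain ⟨u, hu, h3, h4, h5⟩ := ih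
      exact ⟨c :: u, by simp [hc.symm, hu], by simp [h1, ← h3, setScratch],
        by simp [h2, ← h4, setScratch], h5⟩
  · rintro ⟨u, hu, h1, h2, h3⟩
    induction u generalizing x with
    | nil =>
      have : z.2 = x.2 := by
        funext i
        rcases i with i | _ | _
        · exact h3 i
        · exact h2.symm
        · exact h1.symm
      exact ⟨x.1, by rw [this]⟩
    | cons c u ih =>
      simp only [List.mem_cons, not_or] at hu
      obtain ⟨h, hr⟩ := ih (u ++ z.2 (.inr false), setScratch x.2 (u ++ z.2 (.inr true))
        (u ++ z.2 (.inr false))) hu.2 rfl rfl h3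
      exact ⟨h, .head ⟨c, Ne.symm hu.1, _, _, h1, h2, rfl⟩ hr⟩

/-- Put the scratch pebbles on the current position and on the pebble `i`, and advance them over a
common prefix. -/
noncomputable def compare (i : κ) : Prog Γ Δ (κ ⊕ Bool) :=
  .seq (put (.inr false)) (.seq (goto (.inl i)) (.seq (put (.inr true)) (common sep)))

theorem impl_compare (i : κ) : Impl w (view w) (compare sep i : Prog Γ Δ (κ ⊕ Bool))
    (RSil fun x z => Relation.ReflTransGen (fun x z : List Γ × (κ ⊕ Bool → List Γ) =>
      ∃ c, c ≠ sep ∧ ∃ s t, x.2 (.inr true) = c :: s ∧ x.2 (.inr false) = c :: t ∧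
      z = (t, setScratch x.2 s t)) (x.2 (.inl i), setScratch x.2 (x.2 (.inl i)) x.1) z) := by
  refine ((impl_put _).seq ((impl_goto _).seq ((impl_put _).seq (impl_common sep)))).congr ?_
  simp only [rSeq_rSil_rSil]
  refine congrArg RSil ?_
  funext x z
  have key : ∀ s t, Function.update (Function.update x.2 (.inr false) t) (.inr true) s =
      setScratch x.2 s t := by
    intro s t
    funext i
    rcases i with i | _ | _ <;> simp [setScratch]
  simp [key]

/-- Compare the word at the pebble `i` with the word at the current position, which is read. -/
noncomputable def eqWord (i : κ) : Prog Γ Δ (κ ⊕ Bool) :=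
  .seq (compare sep i) (.seq (goto (.inr true)) (.seq (check fun a => decide (a = some sep))
    (.seq (goto (.inr false)) (step fun a => decide (a = sep)))))

/-- The number of common letters is guessed. If both scratch pebbles then stand on separators, the
common prefix is the whole of either word; the last step leaves the head behind the second word. -/
theorem impl_eqWord (i : κ) : Impl w (hide ∘ view w) (eqWord sep i : Prog Γ Δ (κ ⊕ Bool))
    (RSil fun x z => ∃ u s, sep ∉ u ∧ x.2 i = u ++ sep :: s ∧ x.1 = u ++ sep :: z.1 ∧
      z.2 = x.2) := by
  refine ((impl_compare sep i).seq ((impl_goto _).seq ((impl_check _).seq ((impl_goto _).seq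
    (impl_step _))))).coarsen hide ?_
  intro x y z
  simp only [rSeq_rSil_rSil]
  constructor
  · rintro ⟨_, ⟨rfl, m, hm, _, rfl, _, ⟨h1, rfl⟩, _, rfl, a, s, h2, h3, rfl⟩, rfl⟩
    obtain ⟨u, hu, h4, h5, h6⟩ := (common_iff sep _ m).mp ⟨_, hm⟩
    simp only [decide_eq_true_eq] at h1 h2 h3
    subst h3
    obtain ⟨t, ht⟩ := List.head?_eq_some_iff.mp h1
    rw [ht] at h4
    rw [h2] at h5
    refine ⟨rfl, u, t, hu, h4, h5, ?_⟩
    funext j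
    exact h6 j
  · rintro ⟨rfl, u, s, hu, h1, h2, h3⟩
    obtain ⟨h, hr⟩ := (common_iff sep (x.2 (.inl i), setScratch x.2 (x.2 (.inl i)) x.1)
      ([], setScratch x.2 (sep :: s) (sep :: z.1))).mpr ⟨u, hu, h1, h2, fun _ => rfl⟩
    refine ⟨_, ⟨rfl, _, hr, _, rfl, _, ⟨by simp [setScratch], rfl⟩, _, rfl, sep, z.1, rfl, by simp,
      rfl⟩, Prod.ext rfl h3.symm⟩

/-- Check that the scanned symbols at the scratch pebbles differ. -/
noncomputable def differ : Prog Γ Δ (κ ⊕ Bool) :=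
  alts ((letters Γ).map fun c => .seq (goto (.inr true)) (.seq (check fun a => decide (a = some c))
    (.seq (goto (.inr false)) (check fun a => a.elim false fun b => decide (b ≠ c)))))

theorem impl_differ : Impl w (view w) (differ : Prog Γ Δ (κ ⊕ Bool))
    (RSil fun x z => ∃ c d, c ≠ d ∧ (x.2 (.inr true)).head? = some c ∧
      (x.2 (.inr false)).head? = some d ∧ z = (x.2 (.inr false), x.2)) := by
  refine (impl_alts _ _ _ fun c _ => (impl_goto _).seq ((impl_check _).seq ((impl_goto _).seq
    (impl_check _)))).congr ?_
  simp only [rSeq_rSil_rSil]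
  funext x y z
  refine propext ⟨?_, ?_⟩
  · rintro ⟨c, -, rfl, _, rfl, _, ⟨h1, rfl⟩, _, rfl, h2, rfl⟩
    simp only [decide_eq_true_eq] at h1 h2
    cases hd : (x.2 (.inr false)).head? with
    | none => simp [hd] at h2
    | some d => exact ⟨rfl, c, d, (show d ≠ c by rw [hd] at h2; simpa using h2).symm, h1, hd, rfl⟩
  · rintro ⟨rfl, c, d, hcd, h1, h2, rfl⟩
    refine ⟨c, mem_letters c, rfl, _, rfl, _, ⟨by simp [h1], rfl⟩, _, rfl, ?_, rfl⟩
    simp only [h2]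
    simpa using Ne.symm hcd

/-- Check that the word at the pebble `i` differs from the word at the current position, which is
read. -/
noncomputable def neWord (i : κ) : Prog Γ Δ (κ ⊕ Bool) :=
  .seq (compare sep i) (.seq differ (.seq (goto (.inr true)) (.seq (word sep)
    (.seq (goto (.inr false)) (word sep)))))

/-- With their terminating separators, neither of two different words is a prefix of the other. So
behind the longest common prefix there are two different letters, one of which may be the separator
itself. -/
theorem differ_of_ne (u v s t : List Γ) (hu : sep ∉ u) (hv : sep ∉ v) (h : u ≠ v) :
    ∃ p c d u' v', c ≠ d ∧ sep ∉ p ∧ u ++ sep :: s = p ++ c :: u' ∧ v ++ sep :: t = p ++ d :: v' ∧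
      (∃ u₁, sep ∉ u₁ ∧ c :: u' = u₁ ++ sep :: s) ∧ (∃ v₁, sep ∉ v₁ ∧ d :: v' = v₁ ++ sep :: t) := by
  induction u generalizing v with
  | nil =>
    cases v with
    | nil => exact absurd rfl h
    | cons b v =>
      simp only [List.mem_cons, not_or] at hv
      exact ⟨[], sep, b, s, v ++ sep :: t, hv.1, by simp, rfl, rfl, ⟨[], by simp, rfl⟩,
        ⟨b :: v, by simp [hv], rfl⟩⟩
  | cons a u ih =>
    cases v with
    | nil =>
      exact ⟨[], a, sep, u ++ sep :: s, t, by rintro rfl; simp at hu, by simp, rfl, rfl,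
        ⟨a :: u, hu, rfl⟩, ⟨[], by simp, rfl⟩⟩
    | cons b v =>
      by_cases hab : a = b
      · subst hab
        simp only [List.mem_cons, not_or] at hu hv
        obtain ⟨p, c, d, u', v', h1, h2, h3, h4, h5, h6⟩ := ih v hu.2 hv.2 (by simpa using h)
        exact ⟨a :: p, c, d, u', v', h1, by simp [hu, h2], by simp [h3], by simp [h4], h5, h6⟩
      · exact ⟨[], a, b, u ++ sep :: s, v ++ sep :: t, hab, by simp, rfl, rfl, ⟨a :: u, hu, rfl⟩,
          ⟨b :: v, hv, rfl⟩⟩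

theorem impl_neWord (i : κ) : Impl w (hide ∘ view w) (neWord sep i : Prog Γ Δ (κ ⊕ Bool))
    (RSil fun x z => ∃ u v s, sep ∉ u ∧ sep ∉ v ∧ u ≠ v ∧ x.2 i = u ++ sep :: s ∧
      x.1 = v ++ sep :: z.1 ∧ z.2 = x.2) := by
  refine ((impl_compare sep i).seq (impl_differ.seq ((impl_goto _).seq ((impl_word sep).seq
    ((impl_goto _).seq (impl_word sep)))))).coarsen hide ?_
  intro x y z
  simp only [RReads, rSeq_rSil_rSil]
  constructor
  · rintro ⟨x', ⟨rfl, m, hm, _, ⟨c, d, hcd, h1, h2, rfl⟩, _, rfl, m', ⟨_, ⟨u', hu', rfl⟩, h3, h4⟩,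
      _, rfl, _, ⟨v', hv', rfl⟩, h5, h6⟩, rfl⟩
    obtain ⟨p, hp, h7, h8, h9⟩ := (common_iff sep _ m).mp ⟨_, hm⟩
    simp only at h3 h4 h5 h6
    rw [h4] at h5 h6
    rw [h3] at h7 h1
    rw [h5] at h8 h2
    have e1 : x.2 (.inl i) = (p ++ u') ++ sep :: m'.1 := by simpa [setScratch] using h7
    have e2 : x.1 = (p ++ v') ++ sep :: x'.1 := by simpa [setScratch] using h8
    refine ⟨rfl, p ++ u', p ++ v', m'.1, by simp [hp, hu'], by simp [hp, hv'], ?_, e1, e2, ?_⟩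
    -- If the two rests were equal, the first letters behind the common prefix (letters of the
    -- rests, or separators when the rests are empty) would coincide, contrary to `hcd`.
    · intro h
      have h := List.append_cancel_left h
      subst h
      rcases u' with _ | ⟨a, u'⟩ <;> simp_all
    · funext j
      simp only [hide, h6]
      exact h9 j
  · rintro ⟨rfl, u, v, s, hu, hv, huv, h1, h2, h3⟩
    obtain ⟨p, c, d, u', v', hcd, hp, e1, e2, ⟨u₁, hu₁, e3⟩, v₁, hv₁, e4⟩ :=
      differ_of_ne sep u v s z.1 hu hv huv
    obtain ⟨h, hr⟩ := (common_iff sep (x.2 (.inl i), setScratch x.2 (x.2 (.inl i)) x.1)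
      ([], setScratch x.2 (c :: u') (d :: v'))).mpr
        ⟨p, hp, h1.trans e1, h2.trans e2, fun _ => rfl⟩
    refine ⟨(z.1, setScratch x.2 (c :: u') (d :: v')), ⟨rfl, _, hr, _,
      ⟨c, d, hcd, rfl, rfl, rfl⟩, _, rfl, (s, setScratch x.2 (c :: u') (d :: v')),
      ⟨_, ⟨u₁, hu₁, rfl⟩, ?_, rfl⟩, _, rfl, _, ⟨v₁, hv₁, rfl⟩, ?_, rfl⟩,
      Prod.ext rfl h3.symm⟩
    · simp [setScratch, e3]
    · simp [setScratch, e4]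

end Prog

end Machine


/-! ### Membership: unique parsing and reading of instances. -/

namespace Spanner

open Machine Machine.Prog

variable {σ : Type}

/-- Transitions of automata whose states and variables are binary words. -/
abbrev Tr (σ : Type) : Type := List Bool × Op σ (List Bool) × List Bool

/-! ### The code of an instance can be parsed in only one way -/

/-- The first separator marks the end of a word that contains none. -/
theorem append_sep_inj {Γ : Type} {sep : Γ} {u v s t : List Γ} (hu : sep ∉ u) (hv : sep ∉ v)
    (h : u ++ sep :: s = v ++ sep :: t) : u = v ∧ s = t := by
  induction u generalizing v with
  | nil =>
    cases v with
    | nil => exact ⟨rfl, by simpa using h⟩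
    | cons b v => simp at h hv; exact absurd h.1 hv.1
  | cons a u ih =>
    cases v with
    | nil => simp at h hu; exact absurd h.1.symm hu.1
    | cons b v =>
      simp only [List.cons_append, List.cons.injEq, List.mem_cons, not_or] at h hu hv
      obtain ⟨rfl, h'⟩ := h
      obtain ⟨rfl, h''⟩ := ih hu.2 hv.2 h'
      exact ⟨rfl, h''⟩

theorem sep_notMem_bits (q : List Bool) : (Sym.sep : Sym σ) ∉ q.map Sym.bit := by simp

theorem bits_inj {p q : List Bool} (h : (p.map Sym.bit : List (Sym σ)) = q.map Sym.bit) : p = q :=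
  List.map_injective_iff.mpr (fun a b h => by simpa using h) h

theorem encName_eq (q : List Bool) (s : List (Sym σ)) :
    encName q ++ s = q.map Sym.bit ++ Sym.sep :: s := by simp [encName]

theorem encName_inj {p q : List Bool} {s t : List (Sym σ)} (h : encName p ++ s = encName q ++ t) :
    p = q ∧ s = t := by
  rw [encName_eq, encName_eq] at h
  obtain ⟨h1, h2⟩ := append_sep_inj (sep_notMem_bits _) (sep_notMem_bits _) h
  exact ⟨bits_inj h1, h2⟩

theorem encOp_inj {o o' : Op σ (List Bool)} {s t : List (Sym σ)}
    (h : encOp o ++ s = encOp o' ++ t) : o = o' ∧ s = t := by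
  cases o <;> cases o' <;> simp only [encOp, List.cons_append, List.cons.injEq, List.nil_append,
    Sym.letter.injEq, reduceCtorEq, false_and, true_and] at h
  · exact ⟨by rw [h.1], h.2⟩
  all_goals obtain ⟨rfl, rfl⟩ := encName_inj h; exact ⟨rfl, rfl⟩

theorem encTrans_eq (t : Tr σ) (s : List (Sym σ)) :
    encTrans t ++ s = encName t.1 ++ (encOp t.2.1 ++ (encName t.2.2 ++ s)) := by
  simp [encTrans]

theorem encTrans_inj {t t' : Tr σ} {s s' : List (Sym σ)}
    (h : encTrans t ++ s = encTrans t' ++ s') : t = t' ∧ s = s' := by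
  rw [encTrans_eq, encTrans_eq] at h
  obtain ⟨h1, h⟩ := encName_inj h
  obtain ⟨h2, h⟩ := encOp_inj h
  obtain ⟨h3, h⟩ := encName_inj h
  exact ⟨Prod.ext h1 (Prod.ext h2 h3), h⟩

/-- A prefix code is uniquely decodable, and `R`, which begins with no code word, marks the end of
the full list. The other list is only a prefix since `s` is arbitrary: it is what a program has read
when it decides to stop. -/
theorem flatMap_inj {α Γ : Type} {enc : α → List Γ}
    (henc : ∀ a b s t, enc a ++ s = enc b ++ t → a = b ∧ s = t) {R : List Γ}
    (hR : ∀ a s, enc a ++ s ≠ R) {l l' : List α} {s : List Γ}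
    (h : l.flatMap enc ++ R = l'.flatMap enc ++ s) :
    ∃ l₂, l = l' ++ l₂ ∧ s = l₂.flatMap enc ++ R := by
  induction l' generalizing l with
  | nil => exact ⟨l, rfl, by simpa using h.symm⟩
  | cons a l' ih =>
    cases l with
    | nil => exact absurd (by simpa using h.symm) (hR a (l'.flatMap enc ++ s))
    | cons b l =>
      simp only [List.flatMap_cons, List.append_assoc] at h
      obtain ⟨rfl, h'⟩ := henc _ _ _ _ h
      obtain ⟨l₂, rfl, h''⟩ := ih h'
      exact ⟨l₂, rfl, h''⟩

theorem flatMap_inj' {α Γ : Type} {enc : α → List Γ}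
    (henc : ∀ a b s t, enc a ++ s = enc b ++ t → a = b ∧ s = t) {R R' : List Γ}
    (hR : ∀ a s, enc a ++ s ≠ R) (hR' : ∀ a s, enc a ++ s ≠ R') {l l' : List α}
    (h : l.flatMap enc ++ R = l'.flatMap enc ++ R') : l = l' ∧ R = R' := by
  obtain ⟨l₂, rfl, h'⟩ := flatMap_inj henc hR h
  cases l₂ with
  | nil => exact ⟨by simp, by simpa using h'.symm⟩
  | cons a l₂ => exact absurd (by simpa using h'.symm) (hR' a (l₂.flatMap enc ++ R))

theorem encName_ne_bar (q : List Bool) (s R : List (Sym σ)) : encName q ++ s ≠ Sym.bar :: R := by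
  cases q <;> simp [encName]

theorem encTrans_ne_bar (t : Tr σ) (s R : List (Sym σ)) : encTrans t ++ s ≠ Sym.bar :: R := by
  rw [encTrans_eq]; exact encName_ne_bar _ _ _

/-- The part of a code from some transition on. -/
def tl (ts : List (Tr σ)) (d : List σ) : List (Sym σ) :=
  ts.flatMap encTrans ++ Sym.bar :: d.map Sym.letter

theorem encInput_eq (qs : List (List Bool)) (q₀ : List Bool) (fs : List (List Bool))
    (ts : List (Tr σ)) (d : List σ) : encInput qs q₀ fs ts d =
      qs.flatMap encName ++ Sym.bar :: (encName q₀ ++ Sym.bar ::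
        (fs.flatMap encName ++ Sym.bar :: tl ts d)) := by
  simp [encInput, tl]

theorem tl_inj {ts ts' : List (Tr σ)} {d d' : List σ} (h : tl ts d = tl ts' d') :
    ts = ts' ∧ d = d' := by
  obtain ⟨h1, h2⟩ := flatMap_inj' (fun _ _ _ _ => encTrans_inj) (fun _ _ => encTrans_ne_bar _ _ _)
    (fun _ _ => encTrans_ne_bar _ _ _) h
  refine ⟨h1, List.map_injective_iff.mpr (fun a b h => ?_) (List.cons.inj h2).2⟩
  simpa using h

theorem names_inj {l l' : List (List Bool)} {R R' : List (Sym σ)}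
    (h : l.flatMap encName ++ Sym.bar :: R = l'.flatMap encName ++ Sym.bar :: R') :
    l = l' ∧ R = R' := by
  obtain ⟨h1, h2⟩ := flatMap_inj' (fun _ _ _ _ => encName_inj) (fun _ _ => encName_ne_bar _ _ _)
    (fun _ _ => encName_ne_bar _ _ _) h
  exact ⟨h1, (List.cons.inj h2).2⟩

/-! ### Reading programs -/

def Sym.isBit : Sym σ → Bool
  | .bit _ => true
  | _ => false

def Sym.isLetter : Sym σ → Bool
  | .letter _ => true
  | _ => false

def Sym.isMark : Sym σ → Bool
  | .opn => true
  | .cls => true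
  | _ => false

def Sym.isSep : Sym σ → Bool
  | .sep => true
  | _ => false

def Sym.isBar : Sym σ → Bool
  | .bar => true
  | _ => false

/-- Views of positions: the suffixes at the head and at the pebbles. -/
abbrev View (σ : Type) : Type := List (Sym σ) × (Fin 6 → List (Sym σ))

abbrev MProg (σ : Type) : Type := Prog (Sym σ) Bool (Fin 6 ⊕ Bool)

/-- The program computes a relation between views. -/
def Computes (P : MProg σ) (R : View σ → List Bool → View σ → Prop) : Prop :=
  ∀ w : List (Sym σ), Impl w (hide ∘ view w) P R

theorem Computes.seq {P P' : MProg σ} {R R' : View σ → List Bool → View σ → Prop}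
    (h : Computes P R) (h' : Computes P' R') : Computes (P.seq P') (RSeq R R') :=
  fun w => (h w).seq (h' w)

theorem Computes.alt {P P' : MProg σ} {R R' : View σ → List Bool → View σ → Prop}
    (h : Computes P R) (h' : Computes P' R') : Computes (P.alt P') (RAlt R R') :=
  fun w => (h w).alt (h' w)

theorem Computes.star {P : MProg σ} {R : View σ → List Bool → View σ → Prop}
    (h : Computes P R) : Computes P.star (RStar R) :=
  fun w => (h w).star

/-- The program reads a word of the given set. -/
def Rd (P : MProg σ) (L : Set (List (Sym σ))) : Prop := Computes P (RReads L)

theorem Rd.seq {P P' : MProg σ} {L L' L'' : Set (List (Sym σ))} (h : Rd P L) (h' : Rd P' L')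
    (hL : ∀ u, u ∈ L'' ↔ ∃ v ∈ L, ∃ v' ∈ L', u = v ++ v') : Rd (P.seq P') L'' := by
  intro w
  have := Computes.seq h h' w
  rw [rReads_seq] at this
  obtain rfl : L'' = {u | ∃ v ∈ L, ∃ v' ∈ L', u = v ++ v'} := Set.ext hL
  exact this

theorem Rd.alt {P P' : MProg σ} {L L' L'' : Set (List (Sym σ))} (h : Rd P L) (h' : Rd P' L')
    (hL : ∀ u, u ∈ L'' ↔ u ∈ L ∨ u ∈ L') : Rd (P.alt P') L'' := by
  intro w
  have := Computes.alt h h' w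
  rw [rReads_alt] at this
  obtain rfl : L'' = L ∪ L' := Set.ext hL
  exact this

theorem Rd.star_range {α : Type} {P : MProg σ} {enc : α → List (Sym σ)}
    (h : Rd P (Set.range enc)) : Rd P.star (Set.range fun l : List α => l.flatMap enc) := by
  intro w
  have := Computes.star h w
  rw [rReads_star] at this
  refine this.congr ?_
  congr 1
  ext u
  constructor
  · rintro ⟨l, hl, rfl⟩
    induction l with
    | nil => exact ⟨[], rfl⟩
    | cons v l ih =>
      simp only [List.mem_cons, forall_eq_or_imp] at hl
      obtain ⟨a, rfl⟩ := hl.1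
      obtain ⟨l', h⟩ := ih hl.2
      exact ⟨a :: l', by simpa using h⟩
  · rintro ⟨l, rfl⟩
    exact ⟨l.map enc, by simp, by simp [List.flatMap]⟩

theorem rd_step (f : Sym σ → Bool) : Rd (step f) {u | ∃ a, f a = true ∧ u = [a]} :=
  fun _ => (step_eq f).hide_reads

theorem rd_star_step (f : Sym σ → Bool) : Rd (.star (step f)) {u | ∀ a ∈ u, f a = true} := by
  intro w
  have := Computes.star (rd_step f) w
  rwa [rReads_star_step] at this

def rdName : MProg σ := .seq (.star (step Sym.isBit)) (step Sym.isSep)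

theorem rd_rdName : Rd (rdName : MProg σ) (Set.range encName) := by
  refine (rd_star_step _).seq (rd_step _) fun u => ?_
  constructor
  · rintro ⟨q, rfl⟩
    exact ⟨q.map Sym.bit, fun a ha => by
      obtain ⟨b, _, rfl⟩ := List.mem_map.mp ha; rfl, _, ⟨Sym.sep, rfl, rfl⟩, rfl⟩
  · rintro ⟨v, hv, _, ⟨a, ha, rfl⟩, rfl⟩
    obtain rfl : a = Sym.sep := by cases a <;> simp_all [Sym.isSep]
    suffices ∃ q : List Bool, v = q.map Sym.bit by
      obtain ⟨q, rfl⟩ := this; exact ⟨q, rfl⟩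
    induction v with
    | nil => exact ⟨[], rfl⟩
    | cons a v ih =>
      have h1 := hv a (by simp)
      obtain ⟨q, rfl⟩ := ih fun b hb => hv b (by simp [hb])
      cases a <;> simp [Sym.isBit] at h1
      rename_i b
      exact ⟨b :: q, rfl⟩

/-- Read a list of names up to the end of the block. -/
def rdBlock : MProg σ := .seq (.star rdName) (step Sym.isBar)

theorem isBar_iff {a : Sym σ} : a.isBar = true ↔ a = Sym.bar := by cases a <;> simp [Sym.isBar]

theorem rd_rdBlock :
    Rd (rdBlock : MProg σ) (Set.range fun l : List (List Bool) => l.flatMap encName ++ [Sym.bar]) := by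
  refine rd_rdName.star_range.seq (rd_step _) fun u => ?_
  constructor
  · rintro ⟨l, rfl⟩
    exact ⟨_, ⟨l, rfl⟩, _, ⟨_, isBar_iff.mpr rfl, rfl⟩, rfl⟩
  · rintro ⟨_, ⟨l, rfl⟩, _, ⟨a, ha, rfl⟩, rfl⟩
    obtain rfl := isBar_iff.mp ha
    exact ⟨l, rfl⟩

/-- Read one name and the end of the block. -/
def rdName1 : MProg σ := .seq rdName (step Sym.isBar)

theorem rd_rdName1 :
    Rd (rdName1 : MProg σ) (Set.range fun q : List Bool => encName q ++ [Sym.bar]) := by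
  refine rd_rdName.seq (rd_step _) fun u => ?_
  constructor
  · rintro ⟨l, rfl⟩
    exact ⟨_, ⟨l, rfl⟩, _, ⟨_, isBar_iff.mpr rfl, rfl⟩, rfl⟩
  · rintro ⟨_, ⟨l, rfl⟩, _, ⟨a, ha, rfl⟩, rfl⟩
    obtain rfl := isBar_iff.mp ha
    exact ⟨l, rfl⟩

def rdOp : MProg σ := .alt (step Sym.isLetter) (.seq (step Sym.isMark) rdName)

theorem rd_rdOp : Rd (rdOp : MProg σ) (Set.range encOp) := by
  refine (rd_step _).alt ((rd_step _).seq rd_rdName (fun u => Iff.rfl)) fun u => ?_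
  constructor
  · rintro ⟨o, rfl⟩
    cases o with
    | letter a => exact .inl ⟨_, rfl, rfl⟩
    | opn x => exact .inr ⟨_, ⟨Sym.opn, rfl, rfl⟩, _, ⟨x, rfl⟩, rfl⟩
    | cls x => exact .inr ⟨_, ⟨Sym.cls, rfl, rfl⟩, _, ⟨x, rfl⟩, rfl⟩
  · rintro (⟨a, ha, rfl⟩ | ⟨_, ⟨a, ha, rfl⟩, _, ⟨x, rfl⟩, rfl⟩)
    · cases a <;> simp [Sym.isLetter] at ha
      exact ⟨.letter _, rfl⟩
    · cases a <;> simp [Sym.isMark] at ha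
      exacts [⟨.opn x, rfl⟩, ⟨.cls x, rfl⟩]

def rdTrans : MProg σ := .seq rdName (.seq rdOp rdName)

theorem rd_rdTrans : Rd (rdTrans : MProg σ) (Set.range encTrans) := by
  refine rd_rdName.seq (rd_rdOp.seq rd_rdName (fun u => Iff.rfl)) fun u => ?_
  constructor
  · rintro ⟨t, rfl⟩
    exact ⟨_, ⟨t.1, rfl⟩, _, ⟨_, ⟨t.2.1, rfl⟩, _, ⟨t.2.2, rfl⟩, rfl⟩, by simp [encTrans]⟩
  · rintro ⟨_, ⟨p, rfl⟩, _, ⟨_, ⟨o, rfl⟩, _, ⟨q, rfl⟩, rfl⟩, rfl⟩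
    exact ⟨(p, o, q), by simp [encTrans]⟩

/-- Read the blocks in front of the transitions. -/
def rdHeader : MProg σ := .seq rdBlock (.seq rdName1 rdBlock)

/-- The codes of the blocks in front of the transitions. -/
def header (t : List (List Bool) × List Bool × List (List Bool)) : List (Sym σ) :=
  t.1.flatMap encName ++ Sym.bar :: (encName t.2.1 ++ Sym.bar ::
    (t.2.2.flatMap encName ++ [Sym.bar]))

theorem rd_rdHeader : Rd (rdHeader : MProg σ) (Set.range header) := by
  refine rd_rdBlock.seq (rd_rdName1.seq rd_rdBlock (fun u => Iff.rfl)) fun u => ?_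
  constructor
  · rintro ⟨t, rfl⟩
    exact ⟨_, ⟨t.1, rfl⟩, _, ⟨_, ⟨t.2.1, rfl⟩, _, ⟨t.2.2, rfl⟩, rfl⟩, by simp [header]⟩
  · rintro ⟨_, ⟨p, rfl⟩, _, ⟨_, ⟨o, rfl⟩, _, ⟨q, rfl⟩, rfl⟩, rfl⟩
    exact ⟨(p, o, q), by simp [header]⟩

theorem header_append (qs : List (List Bool)) (q₀ : List Bool) (fs : List (List Bool))
    (ts : List (Tr σ)) (d : List σ) :
    header (qs, q₀, fs) ++ tl ts d = encInput qs q₀ fs ts d := by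
  simp [header, encInput_eq]

theorem header_inj {t t' : List (List Bool) × List Bool × List (List Bool)} {s s' : List (Sym σ)}
    (h : header t ++ s = header t' ++ s') : t = t' ∧ s = s' := by
  simp only [header, List.append_assoc, List.cons_append] at h
  obtain ⟨h1, h⟩ := names_inj h
  obtain ⟨h2, h⟩ := encName_inj h
  obtain ⟨h3, h⟩ := names_inj (List.cons.inj h).2
  exact ⟨Prod.ext h1 (Prod.ext h2 h3), by simpa using h⟩

end Spanner


/-! ### Membership: building blocks of the evaluation program and their abstract meaning. -/

namespace Spanner

open Machine Machine.Prog

variable {σ : Type}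

/-! ### Simulation of abstract relations by relations between views -/

section Bis

variable {X α : Type}

/-- Related states can mimic each other's steps. -/
def Bis (I : X → α → Prop) (R : X → List Bool → X → Prop) (S : α → List Bool → α → Prop) : Prop :=
  ∀ x a, I x a → (∀ y z, R x y z → ∃ b, S a y b ∧ I z b) ∧ ∀ y b, S a y b → ∃ z, R x y z ∧ I z b

variable {I : X → α → Prop} {R R' : X → List Bool → X → Prop} {S S' : α → List Bool → α → Prop}

theorem Bis.seq (h : Bis I R S) (h' : Bis I R' S') : Bis I (RSeq R R') (RSeq S S') := by
  refine fun x a hx => ⟨?_, ?_⟩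
  · rintro _ z ⟨m, y₁, y₂, h1, h2, rfl⟩
    obtain ⟨b, k1, k2⟩ := (h x a hx).1 _ _ h1
    obtain ⟨c, k3, k4⟩ := (h' m b k2).1 _ _ h2
    exact ⟨c, ⟨b, _, _, k1, k3, rfl⟩, k4⟩
  · rintro _ z ⟨m, y₁, y₂, h1, h2, rfl⟩
    obtain ⟨b, k1, k2⟩ := (h x a hx).2 _ _ h1
    obtain ⟨c, k3, k4⟩ := (h' b m k2).2 _ _ h2
    exact ⟨c, ⟨b, _, _, k1, k3, rfl⟩, k4⟩

theorem Bis.alt (h : Bis I R S) (h' : Bis I R' S') : Bis I (RAlt R R') (RAlt S S') := by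
  refine fun x a hx => ⟨?_, ?_⟩
  · rintro y z (h1 | h1)
    · obtain ⟨b, k1, k2⟩ := (h x a hx).1 _ _ h1; exact ⟨b, .inl k1, k2⟩
    · obtain ⟨b, k1, k2⟩ := (h' x a hx).1 _ _ h1; exact ⟨b, .inr k1, k2⟩
  · rintro y z (h1 | h1)
    · obtain ⟨b, k1, k2⟩ := (h x a hx).2 _ _ h1; exact ⟨b, .inl k1, k2⟩
    · obtain ⟨b, k1, k2⟩ := (h' x a hx).2 _ _ h1; exact ⟨b, .inr k1, k2⟩

theorem Bis.star (h : Bis I R S) : Bis I (RStar R) (RStar S) := by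
  refine fun x a hx => ⟨?_, ?_⟩
  · intro y z h1
    induction h1 generalizing a with
    | nil => exact ⟨a, .nil _, hx⟩
    | cons h1 _ ih =>
      obtain ⟨b, k1, k2⟩ := (h _ a hx).1 _ _ h1
      obtain ⟨c, k3, k4⟩ := ih b k2
      exact ⟨c, .cons k1 k3, k4⟩
  · intro y z h1
    induction h1 generalizing x with
    | nil => exact ⟨x, .nil _, hx⟩
    | cons h1 _ ih =>
      obtain ⟨b, k1, k2⟩ := (h x _ hx).2 _ _ h1
      obtain ⟨c, k3, k4⟩ := ih b k2
      exact ⟨c, .cons k1 k3, k4⟩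

theorem Bis.silent {r : X → X → Prop} {s : α → α → Prop}
    (h : ∀ x a, I x a → (∀ z, r x z → ∃ b, s a b ∧ I z b) ∧ ∀ b, s a b → ∃ z, r x z ∧ I z b) :
    Bis I (RSil r) (RSil s) := by
  refine fun x a hx => ⟨?_, ?_⟩
  · rintro y z ⟨rfl, h1⟩
    obtain ⟨b, k1, k2⟩ := (h x a hx).1 _ h1
    exact ⟨b, ⟨rfl, k1⟩, k2⟩
  · rintro y z ⟨rfl, h1⟩
    obtain ⟨b, k1, k2⟩ := (h x a hx).2 _ h1
    exact ⟨b, ⟨rfl, k1⟩, k2⟩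

end Bis

/-! ### Silent programs -/

/-- The program computes a relation between views without output. -/
def Silent (P : MProg σ) (r : View σ → View σ → Prop) : Prop := Computes P (RSil r)

theorem Silent.seq {P P' : MProg σ} {r r' : View σ → View σ → Prop}
    (h : Silent P r) (h' : Silent P' r') :
    Silent (P.seq P') (fun x z => ∃ m, r x m ∧ r' m z) := by
  intro w
  have := Computes.seq h h' w
  rwa [rSeq_rSil_rSil] at this

theorem Silent.congr {P : MProg σ} {r r' : View σ → View σ → Prop} (h : Silent P r)
    (hr : ∀ x z, r x z ↔ r' x z) : Silent P r' := by
  obtain rfl : r = r' := by funext x z; exact propext (hr x z)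
  exact h

theorem Rd.silent {P : MProg σ} {L : Set (List (Sym σ))} (h : Rd P L) :
    Silent P (fun x z => ∃ u ∈ L, x.1 = u ++ z.1 ∧ z.2 = x.2) := h

theorem Silent.goto (i : Fin 6) : Silent (goto (.inl i) : MProg σ) (fun x z => z = (x.2 i, x.2)) :=
  fun _ => hide_goto i

theorem Silent.put (i : Fin 6) : Silent (put (.inl i) : MProg σ)
    (fun x z => z = (x.1, Function.update x.2 i x.1)) :=
  fun _ => hide_put i

theorem Silent.check (f : Option (Sym σ) → Bool) : Silent (check f : MProg σ)
    (fun x z => f x.1.head? = true ∧ z = x) :=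
  fun _ => hide_check f

/-! ### The pieces of the evaluation program -/

/-- Go to the transitions. -/
def toTs : MProg σ := .seq (goto (.inl 0)) rdHeader

/-- Go to some transition. -/
def findTrans : MProg σ := .seq toTs (.star rdTrans)

theorem silent_toTs :
    Silent (toTs : MProg σ) (fun x z => ∃ h, x.2 0 = header h ++ z.1 ∧ z.2 = x.2) := by
  refine ((Silent.goto 0).seq rd_rdHeader.silent).congr fun x z => ⟨?_, ?_⟩
  · rintro ⟨_, rfl, _, ⟨h, rfl⟩, h1, h2⟩; exact ⟨h, h1, h2⟩
  · rintro ⟨h, h1, h2⟩; exact ⟨_, rfl, _, ⟨h, rfl⟩, h1, h2⟩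

theorem silent_findTrans : Silent (findTrans : MProg σ) (fun x z => ∃ h, ∃ l : List (Tr σ),
    x.2 0 = header h ++ (l.flatMap encTrans ++ z.1) ∧ z.2 = x.2) := by
  refine (silent_toTs.seq rd_rdTrans.star_range.silent).congr fun x z => ⟨?_, ?_⟩
  · rintro ⟨m, ⟨h, h1, h2⟩, _, ⟨l, rfl⟩, h3, h4⟩; exact ⟨h, l, by rw [h1, h3], h4.trans h2⟩
  · rintro ⟨h, l, h1, h2⟩; exact ⟨(_, x.2), ⟨h, h1, rfl⟩, _, ⟨l, rfl⟩, rfl, h2⟩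

section Compare

variable [Finite σ]

open Classical in
noncomputable def eqAt (i : Fin 6) : MProg σ := eqWord Sym.sep i

open Classical in
noncomputable def neAt (i : Fin 6) : MProg σ := neWord Sym.sep i

open Classical in
noncomputable def wordAny : MProg σ := word Sym.sep

theorem silent_eqAt (i : Fin 6) : Silent (eqAt i : MProg σ) (fun x z => ∃ v, Sym.sep ∉ v ∧
    (∃ s, x.2 i = v ++ Sym.sep :: s) ∧ x.1 = v ++ Sym.sep :: z.1 ∧ z.2 = x.2) := by
  classical
  have : Silent (eqAt i : MProg σ) _ := fun _ => impl_eqWord Sym.sep i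
  refine this.congr fun x z => ⟨?_, ?_⟩
  · rintro ⟨u, s, h1, h2, h3⟩; exact ⟨u, h1, ⟨s, h2⟩, h3⟩
  · rintro ⟨u, h1, ⟨s, h2⟩, h3⟩; exact ⟨u, s, h1, h2, h3⟩

theorem silent_neAt (i : Fin 6) : Silent (neAt i : MProg σ) (fun x z => ∃ v, Sym.sep ∉ v ∧
    (∃ u s, Sym.sep ∉ u ∧ u ≠ v ∧ x.2 i = u ++ Sym.sep :: s) ∧
    x.1 = v ++ Sym.sep :: z.1 ∧ z.2 = x.2) := by
  classical
  have : Silent (neAt i : MProg σ) _ := fun _ => impl_neWord Sym.sep i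
  refine this.congr fun x z => ⟨?_, ?_⟩
  · rintro ⟨u, v, s, h1, h2, h3, h4, h5⟩; exact ⟨v, h2, ⟨u, s, h1, h3, h4⟩, h5⟩
  · rintro ⟨v, h2, ⟨u, s, h1, h3, h4⟩, h5⟩; exact ⟨u, v, s, h1, h2, h3, h4, h5⟩

theorem silent_wordAny : Silent (wordAny : MProg σ) (fun x z => ∃ v, Sym.sep ∉ v ∧
    True ∧ x.1 = v ++ Sym.sep :: z.1 ∧ z.2 = x.2) := by
  classical
  have : Silent (wordAny : MProg σ) _ := fun _ => (impl_word Sym.sep).hide_reads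
  refine this.congr fun x z => ⟨?_, ?_⟩
  · rintro ⟨_, ⟨v, h1, rfl⟩, h2, h3⟩; exact ⟨v, h1, trivial, by simpa using h2, h3⟩
  · rintro ⟨v, h1, -, h2, h3⟩; exact ⟨_, ⟨v, h1, rfl⟩, by simpa using h2, h3⟩

end Compare

/-- Variable operations. -/
def IsVar : Op σ (List Bool) → Prop
  | .letter _ => False
  | _ => True

theorem isMark_head {o : Op σ (List Bool)} {s : List (Sym σ)} :
    (encOp o ++ s).head?.elim false Sym.isMark = true ↔ IsVar o := by
  cases o <;> simp [encOp, Sym.isMark, IsVar]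

theorem encOp_isVar {o : Op σ (List Bool)} (h : IsVar o) :
    ∃ v, Sym.sep ∉ v ∧ encOp o = v ++ [Sym.sep] := by
  cases o with
  | letter a => exact h.elim
  | opn x => exact ⟨Sym.opn :: x.map Sym.bit, by simp, by simp [encOp, encName]⟩
  | cls x => exact ⟨Sym.cls :: x.map Sym.bit, by simp, by simp [encOp, encName]⟩

/-- Abstract states: current state, target state, position on a path, rest of the input at the
pebbles on the transitions and on the document. -/
structure AState (σ : Type) where
  p : List Bool
  q : List Bool
  n : List Bool
  L : List (Sym σ)
  D : List (Sym σ)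

/-- The view represents the abstract state, on the input with the given parts. -/
structure Inv (h : List (List Bool) × List Bool × List (List Bool)) (ts : List (Tr σ)) (d : List σ)
    (x : View σ) (a : AState σ) : Prop where
  all : x.2 0 = header h ++ tl ts d
  p : ∃ s, x.2 1 = encName a.p ++ s
  q : ∃ s, x.2 2 = encName a.q ++ s
  n : ∃ s, x.2 3 = encName a.n ++ s
  L : x.2 4 = a.L
  D : x.2 5 = a.D

variable {h : List (List Bool) × List Bool × List (List Bool)} {ts : List (Tr σ)} {d : List σ}

theorem tl_cons (t : Tr σ) (ts : List (Tr σ)) (d : List σ) :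
    tl (t :: ts) d = encName t.1 ++ (encOp t.2.1 ++ (encName t.2.2 ++ tl ts d)) := by
  simp [tl, encTrans]

/-- Whatever header and transitions a program claims to have read, unique parsing forces them to be
the actual ones; the only freedom is the place in the list where it stopped. -/
theorem tl_split {h' : List (List Bool) × List Bool × List (List Bool)} {l : List (Tr σ)}
    {z : List (Sym σ)} (H : header h ++ tl ts d = header h' ++ (l.flatMap encTrans ++ z)) :
    ∃ l₂, ts = l ++ l₂ ∧ z = tl l₂ d := by
  obtain ⟨-, h1⟩ := header_inj H
  exact flatMap_inj (fun _ _ _ _ => encTrans_inj) (fun _ _ => encTrans_ne_bar _ _ _) h1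

theorem tl_name {l : List (Tr σ)} {p : List Bool} {z : List (Sym σ)} (H : tl l d = encName p ++ z) :
    ∃ t l', l = t :: l' ∧ t.1 = p ∧ z = encOp t.2.1 ++ (encName t.2.2 ++ tl l' d) := by
  cases l with
  | nil => exact absurd H.symm (encName_ne_bar _ _ _)
  | cons t l' =>
    rw [tl_cons] at H
    obtain ⟨h1, h2⟩ := encName_inj H
    exact ⟨t, l', rfl, h1, h2.symm⟩

theorem name_word {p : List Bool} {v s z : List (Sym σ)} (hv : Sym.sep ∉ v)
    (H : encName p ++ s = v ++ Sym.sep :: z) : v = p.map Sym.bit ∧ s = z := by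
  rw [encName_eq] at H
  obtain ⟨h1, h2⟩ := append_sep_inj (sep_notMem_bits _) hv H
  exact ⟨h1.symm, h2⟩

section Program

variable [Finite σ]

/-- Follow some transition with a variable operation that passes the test. -/
noncomputable def vstep (cmp : MProg σ) : MProg σ :=
  .seq findTrans (.seq (eqAt 3) (.seq (check fun s => s.elim false Sym.isMark)
    (.seq cmp (put (.inl 3)))))

/-- Abstract effect of `vstep`. -/
def VStep (ts : List (Tr σ)) (K : List (Sym σ) → List (Sym σ) → Prop) (a b : AState σ) : Prop :=
  ∃ t ∈ ts, t.1 = a.n ∧ (∃ v, Sym.sep ∉ v ∧ encOp t.2.1 = v ++ [Sym.sep] ∧ K v a.L) ∧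
    b = { a with n := t.2.2 }

/-- A marker and the name after it form one word in front of a separator, so `cmp` can test a whole
operation at once, against pebble 4. Pebble 3 then moves to the target name inside the chosen
transition. Which occurrence of a name a pebble marks does not matter, since `Inv` only fixes the
name. -/
theorem bis_vstep {cmp : MProg σ} {K : List (Sym σ) → List (Sym σ) → Prop}
    (hcmp : Silent cmp (fun x z => ∃ v, Sym.sep ∉ v ∧ K v (x.2 4) ∧
      x.1 = v ++ Sym.sep :: z.1 ∧ z.2 = x.2)) :
    ∃ R, Computes (vstep cmp) R ∧ Bis (Inv h ts d) R (RSil (VStep ts K)) := by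
  refine ⟨_, silent_findTrans.seq ((silent_eqAt 3).seq ((Silent.check _).seq
    (hcmp.seq (Silent.put 3)))), Bis.silent ?_⟩
  rintro x a ⟨hA, hp, hq, ⟨s, hn⟩, hL, hD⟩
  constructor
  · rintro z ⟨m₁, ⟨h', l, h1, h2⟩, m₂, ⟨u, hu, ⟨s', h3⟩, h4, h5⟩, _, ⟨h6, rfl⟩, m₃,
      ⟨v, hv, h7, h8, h9⟩, rfl⟩
    rw [hA] at h1
    obtain ⟨l₂, rfl, h1'⟩ := tl_split h1
    rw [h2, hn] at h3
    obtain ⟨rfl, -⟩ := name_word hu h3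
    rw [h4, ← encName_eq] at h1'
    obtain ⟨t, l', rfl, ht, h10⟩ := tl_name h1'.symm
    rw [h10, isMark_head] at h6
    obtain ⟨v', hv', ho⟩ := encOp_isVar h6
    rw [h10, ho, List.append_assoc] at h8
    obtain ⟨rfl, h8'⟩ := append_sep_inj hv' hv h8
    rw [h9, h5, h2]
    refine ⟨_, ⟨t, by simp, ht, ⟨v', hv', ho, ?_⟩, rfl⟩, ?_⟩
    · rw [h5, h2, hL] at h7; exact h7
    · exact ⟨by simp [hA], by simpa using hp, by simpa using hq,
        by simpa using ⟨_, h8'.symm⟩, by simpa using hL, by simpa using hD⟩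
  · rintro b ⟨t, ht, h1, ⟨v, hv, ho, hK⟩, rfl⟩
    obtain ⟨l, l', rfl⟩ := List.append_of_mem ht
    -- The code of a letter does not end with a separator.
    have hvar : IsVar t.2.1 := by
      rcases t with ⟨_, _ | _ | _, _⟩
      · simp only [encOp] at ho
        have := congrArg List.getLast? ho
        simp at this
      · trivial
      · trivial
    refine ⟨_, ⟨(tl (t :: l') d, x.2), ⟨h, l, by simp [hA, tl], rfl⟩,
      (encOp t.2.1 ++ (encName t.2.2 ++ tl l' d), x.2), ⟨t.1.map Sym.bit, sep_notMem_bits _, ⟨s, by rw [h1, hn, encName_eq]⟩,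
        by rw [tl_cons, encName_eq], rfl⟩, _, ⟨isMark_head.mpr hvar, rfl⟩,
      (encName t.2.2 ++ tl l' d, x.2), ⟨v, hv, by rw [hL]; exact hK, by simp [ho], rfl⟩, rfl⟩, ?_⟩
    exact ⟨by simp [hA], by simpa using hp, by simpa using hq, by simp, by simpa using hL,
      by simpa using hD⟩

/-- Start with the next transition, which has a variable operation. -/
def varPre : MProg σ :=
  .seq (goto (.inl 4)) (.seq rdName (.seq (check fun s => s.elim false Sym.isMark)
    (.seq (put (.inl 4)) (.seq (goto (.inl 1)) (put (.inl 3))))))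

/-- The new `L` starts at the operation of the transition whose bit is to be emitted, where `eqAt 4`
and `neAt 4` find the word to compare with. The path that will justify the bit starts at the current
state. -/
def VarPre (a b : AState σ) : Prop :=
  ∃ p l, a.L = encName p ++ l ∧ l.head?.elim false Sym.isMark = true ∧
    b = { a with n := a.p, L := l }

theorem bis_varPre :
    ∃ R, Computes (varPre : MProg σ) R ∧ Bis (Inv h ts d) R (RSil VarPre) := by
  refine ⟨_, (Silent.goto 4).seq (rd_rdName.silent.seq ((Silent.check _).seq
    ((Silent.put 4).seq ((Silent.goto 1).seq (Silent.put 3))))), Bis.silent ?_⟩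
  rintro x a ⟨hA, hp, hq, hn, hL, hD⟩
  constructor
  · rintro z ⟨_, rfl, ⟨m, e⟩, ⟨_, ⟨p, rfl⟩, h1, rfl : e = _⟩, _, ⟨h2, rfl⟩, _, rfl, _, rfl, rfl⟩
    refine ⟨_, ⟨p, m, hL ▸ h1, h2, rfl⟩, by simp [hA], by simpa using hp, by simpa using hq,
      by simpa using hp, by simp, by simpa using hD⟩
  · rintro b ⟨p, l, h1, h2, rfl⟩
    refine ⟨_, ⟨_, rfl, (l, x.2), ⟨_, ⟨p, rfl⟩, by rw [hL, h1], rfl⟩, _, ⟨h2, rfl⟩, _, rfl, _, rfl,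
      rfl⟩, by simp [hA], by simpa using hp, by simpa using hq,
      by simpa using hp, by simp, by simpa using hD⟩

/-- Check that the target is reached and go to the next transition. -/
noncomputable def varPost : MProg σ :=
  .seq (goto (.inl 3)) (.seq (eqAt 2) (.seq (goto (.inl 4)) (.seq wordAny
    (.seq rdName (put (.inl 4))))))

/-- The path that justified the bit must end in the common target `a.q`. The word `v` is the
operation of the treated transition and `q` its target; behind them the next transition begins. -/
def VarPost (a b : AState σ) : Prop :=
  a.n = a.q ∧ ∃ v q l, Sym.sep ∉ v ∧ a.L = v ++ Sym.sep :: (encName q ++ l) ∧ b = { a with L := l }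

theorem bis_varPost :
    ∃ R, Computes (varPost : MProg σ) R ∧ Bis (Inv h ts d) R (RSil VarPost) := by
  refine ⟨_, (Silent.goto 3).seq ((silent_eqAt 2).seq ((Silent.goto 4).seq (silent_wordAny.seq
    (rd_rdName.silent.seq (Silent.put 4))))), Bis.silent ?_⟩
  rintro x a ⟨hA, hp, ⟨s, hq⟩, ⟨s', hn⟩, hL, hD⟩
  constructor
  · rintro z ⟨_, rfl, ⟨m, e⟩, ⟨u, hu, ⟨s₁, h1⟩, h2, rfl : e = _⟩, _, rfl, ⟨m', e⟩,
      ⟨v, hv, -, h3, rfl : e = _⟩, ⟨m'', e⟩, ⟨_, ⟨q, rfl⟩, h4, rfl : e = _⟩, rfl⟩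
    simp only at h1 h2 h3 h4
    rw [hq] at h1
    rw [hn] at h2
    obtain ⟨h5, -⟩ := name_word hu h1
    obtain ⟨h6, -⟩ := name_word hu h2
    refine ⟨_, ⟨bits_inj (h6.symm.trans h5), v, q, m'', hv, by rw [← hL, h3, h4], rfl⟩,
      by simp [hA], by simpa using hp, by simp [hq],
      by simp [hn], by simp, by simpa using hD⟩
  · rintro b ⟨h1, v, q, l, hv, h2, rfl⟩
    refine ⟨_, ⟨_, rfl, (s', x.2), ⟨a.n.map Sym.bit, sep_notMem_bits _,
      ⟨s, by rw [hq, h1, encName_eq]⟩, by rw [hn, encName_eq], rfl⟩, _, rfl, (encName q ++ l, x.2),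
      ⟨v, hv, trivial, hL.trans h2, rfl⟩, (l, x.2), ⟨_, ⟨q, rfl⟩, rfl, rfl⟩, rfl⟩,
      by simp [hA], by simpa using hp, by simp [hq], by simp [hn], by simp, by simpa using hD⟩

/-- Pass over a transition that reads a letter. -/
def perLetter : MProg σ :=
  .seq (goto (.inl 4)) (.seq rdName (.seq (step Sym.isLetter) (.seq rdName (put (.inl 4)))))

def PerLetter (a b : AState σ) : Prop :=
  ∃ p c q l, a.L = encName p ++ Sym.letter c :: (encName q ++ l) ∧ b = { a with L := l }

theorem bis_perLetter :
    ∃ R, Computes (perLetter : MProg σ) R ∧ Bis (Inv h ts d) R (RSil PerLetter) := by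
  refine ⟨_, (Silent.goto 4).seq (rd_rdName.silent.seq ((rd_step _).silent.seq
    (rd_rdName.silent.seq (Silent.put 4)))), Bis.silent ?_⟩
  rintro x a ⟨hA, hp, hq, hn, hL, hD⟩
  constructor
  · rintro z ⟨_, rfl, ⟨m, e⟩, ⟨_, ⟨p, rfl⟩, h1, rfl : e = _⟩, ⟨m', e⟩,
      ⟨_, ⟨c, hc, rfl⟩, h2, rfl : e = _⟩, ⟨m'', e⟩, ⟨_, ⟨q, rfl⟩, h3, rfl : e = _⟩, rfl⟩
    simp only at h1 h2 h3
    obtain ⟨c, rfl⟩ : ∃ c', c = Sym.letter c' := by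
      cases c <;> first | exact ⟨_, rfl⟩ | simp [Sym.isLetter] at hc
    exact ⟨_, ⟨p, c, q, m'', by rw [← hL, h1, h2, h3]; rfl, rfl⟩, by simp [hA], by simpa using hp,
      by simpa using hq, by simpa using hn, by simp, by simpa using hD⟩
  · rintro b ⟨p, c, q, l, h1, rfl⟩
    exact ⟨_, ⟨_, rfl, (_, x.2), ⟨_, ⟨p, rfl⟩, hL.trans h1, rfl⟩, (_, x.2),
      ⟨_, ⟨_, rfl, rfl⟩, rfl, rfl⟩, (l, x.2), ⟨_, ⟨q, rfl⟩, rfl, rfl⟩, rfl⟩,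
      by simp [hA], by simpa using hp,
      by simpa using hq, by simpa using hn, by simp, by simpa using hD⟩

/-- Start a path at the current state. -/
def pathStart : MProg σ := .seq (goto (.inl 1)) (put (.inl 3))

def PathStart (a b : AState σ) : Prop := b = { a with n := a.p }

theorem bis_pathStart :
    ∃ R, Computes (pathStart : MProg σ) R ∧ Bis (Inv h ts d) R (RSil PathStart) := by
  refine ⟨_, (Silent.goto 1).seq (Silent.put 3), Bis.silent ?_⟩
  rintro x a ⟨hA, hp, hq, hn, hL, hD⟩
  constructor
  · rintro z ⟨_, rfl, rfl⟩
    exact ⟨_, rfl, by simp [hA], by simpa using hp, by simpa using hq, by simpa using hp,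
      by simp [hL], by simpa using hD⟩
  · rintro b rfl
    exact ⟨_, ⟨_, rfl, rfl⟩, by simp [hA], by simpa using hp, by simpa using hq, by simpa using hp,
      by simp [hL], by simpa using hD⟩

/-- Make the end of the path the target and go to the first transition. -/
def setTarget : MProg σ :=
  .seq (goto (.inl 3)) (.seq (put (.inl 2)) (.seq toTs (put (.inl 4))))

/-- The path walked so far only guesses a reachable state. It is fixed here as the target that the
paths for all bits of this position have to share. -/
def SetTarget (ts : List (Tr σ)) (d : List σ) (a b : AState σ) : Prop :=
  b = { a with q := a.n, L := tl ts d }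

theorem bis_setTarget :
    ∃ R, Computes (setTarget : MProg σ) R ∧ Bis (Inv h ts d) R (RSil (SetTarget ts d)) := by
  refine ⟨_, (Silent.goto 3).seq ((Silent.put 2).seq (silent_toTs.seq (Silent.put 4))),
    Bis.silent ?_⟩
  rintro x a ⟨hA, hp, hq, hn, hL, hD⟩
  constructor
  · rintro z ⟨_, rfl, _, rfl, ⟨m, e⟩, ⟨h', h1, rfl : e = _⟩, rfl⟩
    have h2 : header h ++ tl ts d = header h' ++ m := by simpa [hA] using h1
    obtain ⟨-, rfl⟩ := header_inj h2
    exact ⟨_, rfl, by simp [hA], by simpa using hp, by simpa using hn, by simpa using hn,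
      by simp, by simpa using hD⟩
  · rintro b rfl
    exact ⟨_, ⟨_, rfl, _, rfl, (tl ts d, _), ⟨h, by simp [hA], rfl⟩, rfl⟩,
      by simp [hA], by simpa using hp, by simpa using hn, by simpa using hn,
      by simp, by simpa using hD⟩

/-- Check that all transitions have been treated. -/
def transEnd : MProg σ := .seq (goto (.inl 4)) (check fun s => s.elim false Sym.isBar)

def TransEnd (a b : AState σ) : Prop := a.L.head?.elim false Sym.isBar = true ∧ b = a

theorem bis_transEnd :
    ∃ R, Computes (transEnd : MProg σ) R ∧ Bis (Inv h ts d) R (RSil TransEnd) := by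
  refine ⟨_, (Silent.goto 4).seq (Silent.check _), Bis.silent ?_⟩
  rintro x a hx
  have hL := hx.L
  constructor
  · rintro z ⟨_, rfl, h1, rfl⟩
    exact ⟨_, ⟨hL ▸ h1, rfl⟩, hx.all, hx.p, hx.q, hx.n, hx.L, hx.D⟩
  · rintro b ⟨h1, rfl⟩
    exact ⟨_, ⟨_, rfl, hL.symm ▸ h1, rfl⟩, hx.all, hx.p, hx.q, hx.n, hx.L, hx.D⟩

open Classical in
/-- Read a letter of the document by a transition from the target. -/
noncomputable def letterStep : MProg σ :=
  .seq findTrans (.seq (eqAt 2) (alts ((letters σ).map fun c =>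
    .seq (step fun s => decide (s = Sym.letter c)) (.seq (put (.inl 1)) (.seq (goto (.inl 5))
      (.seq (step fun s => decide (s = Sym.letter c)) (put (.inl 5))))))))

def LetterStep (ts : List (Tr σ)) (a b : AState σ) : Prop :=
  ∃ c q' l, (a.q, Op.letter c, q') ∈ ts ∧ a.D = Sym.letter c :: l ∧ b = { a with p := q', D := l }

theorem Silent.alts {α : Type} (f : α → MProg σ) (r : α → View σ → View σ → Prop) (l : List α)
    (H : ∀ a ∈ l, Silent (f a) (r a)) :
    Silent (Prog.alts (l.map f)) (fun x z => ∃ a ∈ l, r a x z) := by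
  intro w
  refine (impl_alts f _ l fun a ha => H a ha w).congr ?_
  funext x y z
  refine propext ⟨?_, ?_⟩
  · rintro ⟨a, ha, hy, hr⟩; exact ⟨hy, a, ha, hr⟩
  · rintro ⟨hy, a, ha, hr⟩; exact ⟨a, ha, hy, hr⟩

theorem bis_letterStep :
    ∃ R, Computes (letterStep : MProg σ) R ∧ Bis (Inv h ts d) R (RSil (LetterStep ts)) := by
  classical
  refine ⟨_, silent_findTrans.seq ((silent_eqAt 2).seq (Silent.alts _ _ _ fun c _ =>
    (rd_step _).silent.seq ((Silent.put 1).seq ((Silent.goto 5).seq ((rd_step _).silent.seq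
    (Silent.put 5)))))), Bis.silent ?_⟩
  rintro x a ⟨hA, hp, ⟨s, hq⟩, hn, hL, hD⟩
  constructor
  · rintro z ⟨⟨m₁, e⟩, ⟨h', l, h1, rfl : e = _⟩, ⟨m₂, e⟩, ⟨u, hu, ⟨s', h3⟩, h4, rfl : e = _⟩, c, -,
      ⟨m₃, e⟩, ⟨_, ⟨c₁, hc₁, rfl⟩, h5, rfl : e = _⟩, _, rfl, _, rfl,
      ⟨m₄, e⟩, ⟨_, ⟨c₂, hc₂, rfl⟩, h6, rfl : e = _⟩, rfl⟩
    simp only [decide_eq_true_eq] at hc₁ hc₂ h1 h3 h4 h5 h6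
    subst hc₁ hc₂
    rw [hA] at h1
    obtain ⟨l₂, rfl, h1'⟩ := tl_split h1
    rw [hq] at h3
    obtain ⟨rfl, -⟩ := name_word hu h3
    rw [h4, ← encName_eq] at h1'
    obtain ⟨t, l', rfl, ht, h10⟩ := tl_name h1'.symm
    rw [h10] at h5
    obtain ⟨ho, h7⟩ := encOp_inj (o' := Op.letter c) h5
    rw [Function.update_of_ne (by decide), hD] at h6
    refine ⟨_, ⟨c, t.2.2, m₄, ?_, h6, rfl⟩, by simp [hA], ?_, by simp [hq], by simpa using hn,
      by simpa using hL, by simp⟩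
    · rw [← ht, ← ho]; simp
    · simp [← h7]
  · rintro b ⟨c, q', l, h1, h2, rfl⟩
    obtain ⟨l₁, l₂, rfl⟩ := List.append_of_mem h1
    refine ⟨_, ⟨(tl (_ :: l₂) d, x.2), ⟨h, l₁, by simp [hA, tl]; rfl, rfl⟩,
      (Sym.letter c :: (encName q' ++ tl l₂ d), x.2), ⟨a.q.map Sym.bit, sep_notMem_bits _, ⟨s, by rw [hq, encName_eq]⟩,
        by rw [tl_cons, encName_eq]; rfl, rfl⟩, c, mem_letters c, (encName q' ++ tl l₂ d, x.2),
      ⟨_, ⟨_, decide_eq_true rfl, rfl⟩, rfl, rfl⟩, _, rfl, _, rfl, (l, _),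
      ⟨_, ⟨_, decide_eq_true rfl, rfl⟩, by simpa [hD] using h2, rfl⟩, rfl⟩, ?_⟩
    exact ⟨by simp [hA], by simp, by simp [hq], by simpa using hn, by simpa using hL, by simp⟩

/-- Check that the document has been read and that the target is a final state. -/
noncomputable def atEnd : MProg σ :=
  .seq (goto (.inl 5)) (.seq (check fun s => s.elim true fun _ => false)
    (.seq (goto (.inl 0)) (.seq rdBlock (.seq rdName1 (.seq (.star rdName) (eqAt 2))))))

def AtEnd (fs : List (List Bool)) (a b : AState σ) : Prop := a.D = [] ∧ a.q ∈ fs ∧ b = a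

theorem bis_atEnd :
    ∃ R, Computes (atEnd : MProg σ) R ∧ Bis (Inv h ts d) R (RSil (AtEnd h.2.2)) := by
  refine ⟨_, (Silent.goto 5).seq ((Silent.check _).seq ((Silent.goto 0).seq (rd_rdBlock.silent.seq
    (rd_rdName1.silent.seq (rd_rdName.star_range.silent.seq (silent_eqAt 2)))))), Bis.silent ?_⟩
  intro x a hx
  obtain ⟨hA, hp, ⟨s, hq⟩, hn, hL, hD⟩ := hx
  obtain ⟨qs, q₀, fs⟩ := h
  constructor
  · rintro z ⟨_, rfl, _, ⟨h1, rfl⟩, _, rfl, ⟨m₁, e⟩, ⟨_, ⟨qs', rfl⟩, h2, rfl : e = _⟩,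
      ⟨m₂, e⟩, ⟨_, ⟨q', rfl⟩, h3, rfl : e = _⟩, ⟨m₃, e⟩, ⟨_, ⟨l, rfl⟩, h4, rfl : e = _⟩,
      u, hu, ⟨s', h5⟩, h6, h7⟩
    simp only at h1 h2 h3 h4 h5 h6 h7
    rw [hq] at h5
    obtain ⟨rfl, -⟩ := name_word hu h5
    rw [← encName_eq] at h6
    rw [hA, h3, h4, h6, header_append, encInput_eq, List.append_assoc] at h2
    obtain ⟨-, h8⟩ := names_inj h2
    rw [List.append_assoc] at h8
    obtain ⟨-, h9⟩ := encName_inj h8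
    have h10 := (List.cons.inj h9).2
    have h11 : fs.flatMap encName ++ Sym.bar :: tl ts d = (l ++ [a.q]).flatMap encName ++ z.1 := by
      simpa using h10
    obtain ⟨l₂, h12, -⟩ := flatMap_inj (fun _ _ _ _ => encName_inj)
      (fun _ _ => encName_ne_bar _ _ _) h11
    refine ⟨a, ⟨?_, by simp [h12], rfl⟩, ?_⟩
    · rw [← hD]
      cases h : x.2 5 with
      | nil => rfl
      | cons c l => rw [h] at h1; simp at h1
    · exact ⟨by rw [h7, hA], by rw [h7]; exact hp, by rw [h7]; exact ⟨s, hq⟩, by rw [h7]; exact hn,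
        by rw [h7]; exact hL, by rw [h7]; exact hD⟩
  · rintro b ⟨h1, h2, rfl⟩
    obtain ⟨l₁, l₂, h3⟩ := List.append_of_mem h2
    simp only at h3
    subst h3
    let z := l₂.flatMap encName ++ Sym.bar :: tl ts d
    let z₃ := encName b.q ++ z
    let z₂ := l₁.flatMap encName ++ z₃
    refine ⟨(z, x.2), ⟨_, rfl, _, ⟨by simp [hD, h1], rfl⟩, _, rfl,
      (encName q₀ ++ Sym.bar :: z₂, x.2), ⟨_, ⟨qs, rfl⟩, ?_, rfl⟩, (z₂, x.2), ⟨_, ⟨q₀, rfl⟩, ?_, rfl⟩,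
      (z₃, x.2), ⟨_, ⟨l₁, rfl⟩, rfl, rfl⟩,
      b.q.map Sym.bit, sep_notMem_bits _, ⟨s, by rw [hq, encName_eq]⟩, encName_eq _ _, rfl⟩,
      hA, hp, ⟨s, hq⟩, hn, hL, hD⟩
    · simp [hA, header, z₂, z₃, z]
    · simp

end Program

end Spanner


/-! ### Membership: the words that the evaluation program emits. -/

namespace Spanner

open Machine Machine.Prog

variable {σ : Type}

/-! ### Abstract runs of the evaluation program -/

/-- Paths of variable transitions. -/
inductive VPath (ts : List (Tr σ)) : List Bool → List (Op σ (List Bool)) → List Bool → Prop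
  | nil (p : List Bool) : VPath ts p [] p
  | cons {p p' q : List Bool} {o : Op σ (List Bool)} {os : List (Op σ (List Bool))} :
      (p, o, p') ∈ ts → IsVar o → VPath ts p' os q → VPath ts p (o :: os) q

theorem VPath.append {ts : List (Tr σ)} {p q r : List Bool} {os os' : List (Op σ (List Bool))}
    (h : VPath ts p os q) (h' : VPath ts q os' r) : VPath ts p (os ++ os') r := by
  induction h with
  | nil => exact h'
  | cons h1 h2 _ ih => exact .cons h1 h2 (ih h')

theorem VPath.split {ts : List (Tr σ)} {p r : List Bool} {os os' : List (Op σ (List Bool))}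
    (h : VPath ts p (os ++ os') r) : ∃ q, VPath ts p os q ∧ VPath ts q os' r := by
  induction os generalizing p with
  | nil => exact ⟨p, .nil p, h⟩
  | cons o os ih =>
    cases h with
    | cons h1 h2 h3 =>
      obtain ⟨q, h4, h5⟩ := ih h3
      exact ⟨q, .cons h1 h2 h4, h5⟩

theorem VPath.isVar {ts : List (Tr σ)} {p r : List Bool} {os : List (Op σ (List Bool))}
    (h : VPath ts p os r) : ∀ o ∈ os, IsVar o := by
  induction h with
  | nil => simp
  | cons h1 h2 _ ih => simpa using ⟨h2, ih⟩

/-- For every variable transition in the list, one bit that tells whether its operation occurs on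
some path between the given states. -/
inductive Bits (ts : List (Tr σ)) (p q : List Bool) : List (Tr σ) → List Bool → Prop
  | nil : Bits ts p q [] []
  | letter {t : Tr σ} {l : List (Tr σ)} {y : List Bool} :
      ¬ IsVar t.2.1 → Bits ts p q l y → Bits ts p q (t :: l) y
  | var {t : Tr σ} {l : List (Tr σ)} {y : List Bool} {os : List (Op σ (List Bool))} {b : Bool} :
      IsVar t.2.1 → VPath ts p os q → (t.2.1 ∈ os ↔ b = true) → Bits ts p q l y →
      Bits ts p q (t :: l) (b :: y)

theorem Bits.length_le {ts : List (Tr σ)} {p q : List Bool} {l : List (Tr σ)} {y : List Bool}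
    (h : Bits ts p q l y) : y.length ≤ l.length := by
  induction h with
  | nil => rfl
  | letter _ _ ih => simp; omega
  | var _ _ _ _ ih => simp; omega

/-- `Acc ts fs i p d y ρ`: the run `ρ` from the state `p` at the position `i` over the rest `d` of
the document is accepting, and `y` is a possible output for it. -/
inductive Acc (ts : List (Tr σ)) (fs : List (List Bool)) :
    ℕ → List Bool → List σ → List Bool → List (Op σ (List Bool) × ℕ) → Prop
  | last {i : ℕ} {p q : List Bool} {os : List (Op σ (List Bool))} {y : List Bool} :
      VPath ts p os q → Bits ts p q ts y → q ∈ fs → Acc ts fs i p [] y (os.map fun o => (o, i))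
  | step {i : ℕ} {p q p' : List Bool} {os : List (Op σ (List Bool))} {y y' : List Bool} {c : σ}
      {d : List σ} {ρ : List (Op σ (List Bool) × ℕ)} :
      VPath ts p os q → Bits ts p q ts y → (q, Op.letter c, p') ∈ ts →
      Acc ts fs (i + 1) p' d y' ρ →
      Acc ts fs i p (c :: d) (y ++ y') ((os.map fun o => (o, i)) ++ (Op.letter c, i) :: ρ)

/-- There is at most one bit per transition and position. This holds for every automaton, functional
or not, and makes the set of outputs finite on every input word. -/
theorem Acc.length_le {ts : List (Tr σ)} {fs : List (List Bool)} {i : ℕ} {p : List Bool}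
    {d : List σ} {y : List Bool} {ρ : List (Op σ (List Bool) × ℕ)} (h : Acc ts fs i p d y ρ) :
    y.length ≤ (d.length + 1) * ts.length := by
  induction h with
  | last _ h _ => simpa using h.length_le
  | step _ h _ _ ih =>
    have := h.length_le
    simp only [List.length_append, List.length_cons]
    linarith

/-- The operation passes the test, in the context of the rest of the input at the pebble. -/
def Passes (K : List (Sym σ) → List (Sym σ) → Prop) (L : List (Sym σ)) (o : Op σ (List Bool)) :
    Prop :=
  ∃ v, Sym.sep ∉ v ∧ encOp o = v ++ [Sym.sep] ∧ K v L

theorem Passes.isVar {K : List (Sym σ) → List (Sym σ) → Prop} {L : List (Sym σ)}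
    {o : Op σ (List Bool)} (h : Passes K L o) : IsVar o := by
  obtain ⟨v, -, h, -⟩ := h
  cases o with
  | letter a =>
    have := congrArg List.getLast? h
    simp [encOp] at this
  | _ => trivial

theorem passes_any {L : List (Sym σ)} {o : Op σ (List Bool)} :
    Passes (fun _ _ => True) L o ↔ IsVar o := by
  refine ⟨Passes.isVar, fun h => ?_⟩
  obtain ⟨v, h1, h2⟩ := encOp_isVar h
  exact ⟨v, h1, h2, trivial⟩

/-- Operations have a prefix code, so equal words in front of the separator mean equal operations;
`passes_ne` is the complementary test. -/
theorem passes_eq {l : List (Sym σ)} {o o' : Op σ (List Bool)} (ho' : IsVar o') :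
    Passes (fun v L => ∃ s, L = v ++ Sym.sep :: s) (encOp o' ++ l) o ↔ o = o' := by
  constructor
  · rintro ⟨v, h1, h2, s, h3⟩
    have : encOp o' ++ l = encOp o ++ s := by rw [h3, h2]; simp
    exact (encOp_inj this).1.symm
  · rintro rfl
    obtain ⟨v, h1, h2⟩ := encOp_isVar ho'
    exact ⟨v, h1, h2, l, by simp [h2]⟩

theorem passes_ne {l : List (Sym σ)} {o o' : Op σ (List Bool)} (ho' : IsVar o') :
    Passes (fun v L => ∃ u s, Sym.sep ∉ u ∧ u ≠ v ∧ L = u ++ Sym.sep :: s) (encOp o' ++ l) o ↔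
      IsVar o ∧ o ≠ o' := by
  obtain ⟨v', k1, k2⟩ := encOp_isVar ho'
  constructor
  · intro h
    refine ⟨h.isVar, ?_⟩
    rintro rfl
    obtain ⟨v, h1, h2, u, s, h3, h4, h5⟩ := h
    rw [h2, List.append_assoc] at h5
    exact h4 (append_sep_inj h1 h3 h5).1.symm
  · rintro ⟨h1, h2⟩
    obtain ⟨v, h3, h4⟩ := encOp_isVar h1
    refine ⟨v, h3, h4, v', l, k1, ?_, by simp [k2]⟩
    rintro rfl
    exact h2 (encOp_inj (s := []) (t := []) (by rw [h4, k2])).1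

section

variable {ts : List (Tr σ)} {d : List σ}

/-- A step changes only the component `n`, so the test is made against the same `a.L` all along the
path. -/
theorem star_vStep {K : List (Sym σ) → List (Sym σ) → Prop} {a b : AState σ} {y : List Bool} :
    RStar (RSil (VStep ts K)) a y b ↔ y = [] ∧ ∃ os n, VPath ts a.n os n ∧
      (∀ o ∈ os, Passes K a.L o) ∧ b = { a with n := n } := by
  rw [rStar_rSil]
  refine and_congr_right fun _ => ⟨fun h => ?_, ?_⟩
  · induction h using Relation.ReflTransGen.head_induction_on with
    | refl => exact ⟨[], b.n, .nil _, by simp, rfl⟩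
    | head h _ ih =>
      obtain ⟨t, ht, h1, h2, rfl⟩ := h
      obtain ⟨os, n, h3, h4, rfl⟩ := ih
      refine ⟨t.2.1 :: os, n, .cons (by rw [← h1]; exact ht) (Passes.isVar h2) h3, ?_, rfl⟩
      simpa using ⟨h2, h4⟩
  · rintro ⟨os, n, h1, h2, rfl⟩
    generalize hm : a.n = m at h1
    induction h1 generalizing a with
    | nil => subst hm; exact .refl
    | @cons p p' q o os h1 h3 h4 ih =>
      simp only [List.mem_cons, forall_eq_or_imp] at h2
      exact .head (b := { a with n := p' }) ⟨_, h1, hm.symm, h2.1, rfl⟩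
        (ih (a := { a with n := p' }) h2.2 rfl)

/-- Abstract effect of the emission of a bit. -/
def Emit (b : Bool) (a : AState σ) (y : List Bool) (a' : AState σ) : Prop := y = [b] ∧ a' = a

/-- Abstract effect of the treatment of a variable transition. -/
def PerVar (ts : List (Tr σ)) : AState σ → List Bool → AState σ → Prop :=
  RSeq (RSil VarPre) (RSeq (RAlt
    (RSeq (RStar (RSil (VStep ts fun v L => ∃ u s, Sym.sep ∉ u ∧ u ≠ v ∧ L = u ++ Sym.sep :: s)))
      (Emit false))
    (RSeq (RStar (RSil (VStep ts fun _ _ => True)))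
      (RSeq (RSil (VStep ts fun v L => ∃ s, L = v ++ Sym.sep :: s))
        (RSeq (RStar (RSil (VStep ts fun _ _ => True))) (Emit true)))))
    (RSil VarPost))

/-- The first branch walks only along operations different from that of `t`, which justifies the bit
0. The second one walks freely, takes a transition with this operation, possibly not `t` itself, and
walks on, which justifies the bit 1. -/
theorem perVar_sound {a b : AState σ} {y : List Bool} {t : Tr σ} {l : List (Sym σ)}
    (h : PerVar ts a y b) (hL : a.L = encTrans t ++ l) :
    IsVar t.2.1 ∧ (∃ β os, y = [β] ∧ VPath ts a.p os a.q ∧ (t.2.1 ∈ os ↔ β = true)) ∧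
      b.p = a.p ∧ b.q = a.q ∧ b.D = a.D ∧ b.L = l := by
  obtain ⟨_, _, _, ⟨rfl, p, l₁, h1, h2, rfl⟩, ⟨m, y₁, _, h3, ⟨rfl, h4, v, q, l₂, h5, h6, rfl⟩,
    rfl⟩, rfl⟩ := h
  rw [hL, encTrans_eq] at h1
  obtain ⟨rfl, rfl⟩ := encName_inj h1
  rw [isMark_head] at h2
  suffices H : (∃ β os, y₁ = [β] ∧ VPath ts a.p os m.n ∧ (t.2.1 ∈ os ↔ β = true)) ∧
      m.p = a.p ∧ m.q = a.q ∧ m.D = a.D ∧ m.L = encOp t.2.1 ++ (encName t.2.2 ++ l) by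
    obtain ⟨⟨β, os, rfl, H1, H2⟩, H3, H4, H5, H6⟩ := H
    refine ⟨h2, ⟨β, os, by simp, by rwa [h4, H4] at H1, H2⟩, H3, H4, H5, ?_⟩
    obtain ⟨v', k1, k2⟩ := encOp_isVar h2
    rw [H6, k2, List.append_assoc] at h6
    exact (encName_inj (append_sep_inj k1 h5 h6).2).2.symm
  rcases h3 with ⟨_, _, _, h3, ⟨rfl, rfl⟩, rfl⟩ | ⟨_, _, _, h3, ⟨_, _, _, ⟨rfl, k3⟩,
    ⟨_, _, _, h7, ⟨rfl, rfl⟩, rfl⟩, rfl⟩, rfl⟩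
  · obtain ⟨rfl, os, n, k1, k2, rfl⟩ := star_vStep.mp h3
    refine ⟨⟨false, os, rfl, k1, ?_⟩, rfl, rfl, rfl, rfl⟩
    simp only [Bool.false_eq_true, iff_false]
    exact fun h => ((passes_ne h2).mp (k2 _ h)).2 rfl
  · obtain ⟨rfl, os, n, k1, k2, rfl⟩ := star_vStep.mp h3
    obtain ⟨t', ht', k4, k5, rfl⟩ := k3
    have : t'.2.1 = t.2.1 := (passes_eq h2).mp k5
    obtain ⟨rfl, os', n', k6, k7, rfl⟩ := star_vStep.mp h7
    refine ⟨⟨true, os ++ t.2.1 :: os', rfl, k1.append (.cons ?_ h2 k6), by simp⟩,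
      rfl, rfl, rfl, rfl⟩
    rw [← this, show n = t'.1 from k4.symm]
    exact ht'

theorem perVar_complete {a : AState σ} {t : Tr σ} {l : List (Sym σ)} {β : Bool}
    {os : List (Op σ (List Bool))} (hL : a.L = encTrans t ++ l) (ht : IsVar t.2.1)
    (hp : VPath ts a.p os a.q) (hβ : t.2.1 ∈ os ↔ β = true) :
    PerVar ts a [β] { a with n := a.q, L := l } := by
  let m : AState σ := { a with n := a.p, L := encOp t.2.1 ++ (encName t.2.2 ++ l) }
  obtain ⟨v, hv1, hv2⟩ := encOp_isVar ht
  refine ⟨m, [], [β], ⟨rfl, t.1, _, by rw [hL, encTrans_eq], isMark_head.mpr ht, rfl⟩,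
    ⟨{ m with n := a.q }, [β], [], ?_, ⟨rfl, rfl, v, t.2.2, l, hv1, ?_, rfl⟩, rfl⟩, rfl⟩
  · cases β with
    | false =>
      refine .inl ⟨_, [], [false], star_vStep.mpr ⟨rfl, os, a.q, hp, fun o ho => ?_, rfl⟩,
        ⟨rfl, rfl⟩, rfl⟩
      refine (passes_ne ht).mpr ⟨hp.isVar o ho, ?_⟩
      rintro rfl
      simpa using hβ.mp ho
    | true =>
      -- The path is cut at an occurrence of the operation; the three parts are executed by the
      -- three loops and steps of the second branch.
      obtain ⟨os₁, os₂, rfl⟩ := List.append_of_mem (hβ.mpr rfl)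
      obtain ⟨n, h1, h2⟩ := hp.split
      cases h2 with
      | @cons _ n' _ _ _ h2 _ h3 =>
        refine .inr ⟨{ m with n := n }, [], [true], star_vStep.mpr ⟨rfl, os₁, n, h1, fun o ho =>
          passes_any.mpr (h1.isVar o ho), rfl⟩, ⟨{ m with n := n' }, [], [true], ⟨rfl, _, h2, rfl,
          (passes_eq ht).mpr rfl, rfl⟩, ⟨{ m with n := a.q }, [], [true], star_vStep.mpr ⟨rfl, os₂, a.q,
          h3, fun o ho => passes_any.mpr (h3.isVar o ho), rfl⟩, ⟨rfl, rfl⟩, rfl⟩, rfl⟩, rfl⟩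
  · simp [m, hv2]

/-- Abstract effect of the treatment of all transitions. -/
def AllTrans (ts : List (Tr σ)) : AState σ → List Bool → AState σ → Prop :=
  RSeq (RStar (RAlt (RSil PerLetter) (PerVar ts))) (RSil TransEnd)

theorem perLetter_iff {a b : AState σ} {t : Tr σ} {l : List (Sym σ)} (hL : a.L = encTrans t ++ l) :
    PerLetter a b ↔ ¬ IsVar t.2.1 ∧ b = { a with L := l } := by
  constructor
  · rintro ⟨p, c, q, l', h1, rfl⟩
    have : encTrans t ++ l = encTrans (p, Op.letter c, q) ++ l' := by
      rw [← hL, h1]; simp [encTrans, encOp]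
    obtain ⟨rfl, rfl⟩ := encTrans_inj this
    exact ⟨id, rfl⟩
  · rintro ⟨h, rfl⟩
    rcases t with ⟨p, _ | _ | _, q⟩
    · exact ⟨p, _, q, l, by rw [hL]; simp [encTrans, encOp]; rfl, rfl⟩
    · exact absurd trivial h
    · exact absurd trivial h

/-- Unique parsing forces every round to treat the first remaining transition, by the branch that
fits its operation, and the bar at the end forces all transitions to be treated. -/
theorem allTrans_sound {a b : AState σ} {y : List Bool} {l : List (Tr σ)}
    (h : AllTrans ts a y b) (hL : a.L = tl l d) :
    Bits ts a.p a.q l y ∧ b.p = a.p ∧ b.q = a.q ∧ b.D = a.D := by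
  obtain ⟨m, y₁, _, h1, ⟨rfl, h2, rfl⟩, rfl⟩ := h
  rw [List.append_nil]
  induction h1 generalizing l with
  | nil =>
    cases l with
    | nil => exact ⟨.nil, rfl, rfl, rfl⟩
    | cons t l =>
      rw [hL, tl_cons] at h2
      rcases t with ⟨_ | _, _⟩ <;> simp [encName, Sym.isBar] at h2
  | @cons x m z y₁ y₂ h1 _ ih =>
    cases l with
    | nil =>
      exfalso
      rcases h1 with ⟨-, p, c, q, l', h1, -⟩ | ⟨_, _, _, ⟨-, p, l₁, h1, -⟩, -⟩
      · exact encName_ne_bar _ _ _ (h1.symm.trans hL)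
      · exact encName_ne_bar _ _ _ (h1.symm.trans hL)
    | cons t l =>
      have hL' : x.L = encTrans t ++ tl l d := by rw [hL]; simp [tl]
      rcases h1 with ⟨rfl, h1⟩ | h1
      · obtain ⟨h3, rfl⟩ := (perLetter_iff hL').mp h1
        obtain ⟨k1, k2⟩ := ih rfl h2
        exact ⟨.letter h3 k1, k2⟩
      · obtain ⟨k1, ⟨β, os, rfl, k2, k3⟩, k4, k5, k6, k7⟩ := perVar_sound h1 hL'
        obtain ⟨k8, k9, k10, k11⟩ := ih k7 h2
        rw [k4, k5] at k8
        exact ⟨.var k1 k2 k3 k8, k9.trans k4, k10.trans k5, k11.trans k6⟩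

theorem allTrans_complete {a : AState σ} {y : List Bool} {l : List (Tr σ)}
    (h : Bits ts a.p a.q l y) (hL : a.L = tl l d) :
    ∃ b, AllTrans ts a y b ∧ b.p = a.p ∧ b.q = a.q ∧ b.D = a.D := by
  suffices ∃ b, RStar (RAlt (RSil PerLetter) (PerVar ts)) a y b ∧ b.p = a.p ∧ b.q = a.q ∧
      b.D = a.D ∧ b.L = tl [] d by
    obtain ⟨b, h1, h2, h3, h4, h5⟩ := this
    exact ⟨b, ⟨b, y, [], h1, ⟨rfl, by rw [h5]; rfl, rfl⟩, by simp⟩, h2, h3, h4⟩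
  generalize hp : a.p = p at h
  generalize hq : a.q = q at h
  induction h generalizing a with
  | nil => exact ⟨a, .nil _, hp, hq, rfl, hL⟩
  | @letter t l y ht _ ih =>
    have hL' : a.L = encTrans t ++ tl l d := by rw [hL]; simp [tl]
    obtain ⟨b, h1, h2, h3, h4⟩ := ih (a := { a with L := tl l d }) rfl hp hq
    exact ⟨b, .cons (.inl ⟨rfl, (perLetter_iff hL').mpr ⟨ht, rfl⟩⟩) h1, h2, h3, h4⟩
  | @var t l y os β ht ho hβ _ ih =>
    have hL' : a.L = encTrans t ++ tl l d := by rw [hL]; simp [tl]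
    obtain ⟨b, h1, h2, h3, h4⟩ := ih (a := { a with n := a.q, L := tl l d }) rfl hp hq
    subst hp hq
    exact ⟨b, .cons (.inr (perVar_complete hL' ht ho hβ)) h1, h2, h3, h4⟩

/-- Abstract effect of the program for one position of the document. -/
def Segment (ts : List (Tr σ)) (d : List σ) : AState σ → List Bool → AState σ → Prop :=
  RSeq (RSil PathStart) (RSeq (RStar (RSil (VStep ts fun _ _ => True)))
    (RSeq (RSil (SetTarget ts d)) (AllTrans ts)))

/-- The list `os` comes from the path that guessed the target. It becomes a piece of the run in
`Acc`, while the bits have witnesses of their own. -/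
theorem segment_sound {a b : AState σ} {y : List Bool} (h : Segment ts d a y b) :
    ∃ os, VPath ts a.p os b.q ∧ Bits ts a.p b.q ts y ∧ b.D = a.D := by
  obtain ⟨_, _, _, ⟨rfl, rfl⟩, ⟨_, _, _, h1, ⟨_, _, _, ⟨rfl, rfl⟩, h2, rfl⟩, rfl⟩, rfl⟩ := h
  obtain ⟨rfl, os, n, h3, -, rfl⟩ := star_vStep.mp h1
  obtain ⟨k1, k2, k3, k4⟩ := allTrans_sound h2 rfl
  refine ⟨os, k3 ▸ h3, k3 ▸ k1, k4⟩

theorem segment_complete {a : AState σ} {q : List Bool} {os : List (Op σ (List Bool))}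
    {y : List Bool} (h : VPath ts a.p os q) (h' : Bits ts a.p q ts y) :
    ∃ b, Segment ts d a y b ∧ b.q = q ∧ b.D = a.D := by
  obtain ⟨b, h1, h2, h3, h4⟩ := allTrans_complete (d := d)
    (a := { a with n := q, q := q, L := tl ts d }) h' rfl
  exact ⟨b, ⟨{ a with n := a.p }, [], y, ⟨rfl, rfl⟩, ⟨{ a with n := q }, [], y,
    star_vStep.mpr ⟨rfl, os, q, h, fun o ho => passes_any.mpr (h.isVar o ho), rfl⟩,
    ⟨_, [], y, ⟨rfl, rfl⟩, h1, rfl⟩, rfl⟩, rfl⟩, h3, h4⟩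

/-- Abstract effect of the evaluation program. -/
def Eval (ts : List (Tr σ)) (fs : List (List Bool)) (d : List σ) :
    AState σ → List Bool → AState σ → Prop :=
  RSeq (RStar (RSeq (Segment ts d) (RSil (LetterStep ts)))) (RSeq (Segment ts d) (RSil (AtEnd fs)))

/-- The index `i` is known only to the run `ρ`, not to the program. The rest of the document at
pebble 5 decides between reading a letter and the final check. -/
theorem eval_iff {fs : List (List Bool)} {a : AState σ} {y : List Bool} {d' : List σ} {i : ℕ}
    (hD : a.D = d'.map Sym.letter) :
    (∃ b, Eval ts fs d a y b) ↔ ∃ ρ, Acc ts fs i a.p d' y ρ := by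
  constructor
  · rintro ⟨b, m, y₁, y₂, h1, ⟨_, y₃, _, h2, ⟨rfl, h3, h4, rfl⟩, rfl⟩, rfl⟩
    obtain ⟨os, k1, k2, k3⟩ := segment_sound h2
    rw [List.append_nil]
    induction h1 generalizing d' i with
    | nil =>
      obtain rfl : d' = [] := by simpa [← k3, h3] using hD
      exact ⟨_, .last k1 k2 h4⟩
    | cons h5 _ ih =>
      obtain ⟨_, _, _, h5, ⟨rfl, c, q', l, h6, h7, rfl⟩, rfl⟩ := h5
      obtain ⟨os', k4, k5, k6⟩ := segment_sound h5
      rw [h7] at k6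
      rw [← k6] at hD
      cases d' with
      | nil => simp at hD
      | cons c' d'' =>
        simp only [List.map_cons, List.cons.injEq, Sym.letter.injEq] at hD
        obtain ⟨rfl, rfl⟩ := hD
        obtain ⟨ρ, h8⟩ := ih (i := i + 1) rfl h2 k1 k2 k3
        rw [List.append_nil, List.append_assoc]
        exact ⟨_, .step k4 k5 h6 h8⟩
  · rintro ⟨ρ, h⟩
    generalize hp : a.p = p at h
    induction h generalizing a with
    | last h1 h2 h3 =>
      subst hp
      obtain ⟨b, h4, rfl, h6⟩ := segment_complete (d := d) h1 h2
      exact ⟨b, a, [], _, .nil _, ⟨b, _, [], h4, ⟨rfl, by simp [h6, hD], h3, rfl⟩,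
        (List.append_nil _).symm⟩, rfl⟩
    | @step i p q p' os y y' c d₁ ρ h1 h2 h3 _ ih =>
      subst hp
      obtain ⟨b, h4, rfl, h6⟩ := segment_complete (d := d) h1 h2
      obtain ⟨z, m, y₁, y₂, h7, h8, rfl⟩ :=
        ih (a := { b with p := p', D := d₁.map Sym.letter }) rfl rfl
      refine ⟨z, m, y ++ y₁, y₂, .cons ⟨b, y, [], h4, ⟨rfl, c, p', _, h3, ?_, rfl⟩, by simp⟩ h7, h8,
        by simp⟩
      rw [h6, hD, List.map_cons]

end

/-! ### The evaluation program -/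

variable [Finite σ]

noncomputable def stepAny : MProg σ := vstep wordAny

noncomputable def stepEq : MProg σ := vstep (eqAt 4)

noncomputable def stepNe : MProg σ := vstep (neAt 4)

noncomputable def perVar : MProg σ :=
  .seq varPre (.seq (.alt (.seq (.star stepNe) (emit false))
    (.seq (.star stepAny) (.seq stepEq (.seq (.star stepAny) (emit true))))) varPost)

noncomputable def segment : MProg σ :=
  .seq pathStart (.seq (.star stepAny) (.seq setTarget
    (.seq (.star (.alt perLetter perVar)) transEnd)))

noncomputable def evalProg : MProg σ :=
  .seq (.star (.seq segment letterStep)) (.seq segment atEnd)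

/-- The program simulates an abstract relation on an input with the given parts. -/
def Simulates (h : List (List Bool) × List Bool × List (List Bool)) (ts : List (Tr σ)) (d : List σ)
    (P : MProg σ) (S : AState σ → List Bool → AState σ → Prop) : Prop :=
  ∃ R, Computes P R ∧ Bis (Inv h ts d) R S

section

variable {h : List (List Bool) × List Bool × List (List Bool)} {ts : List (Tr σ)} {d : List σ}
  {P P' : MProg σ} {S S' : AState σ → List Bool → AState σ → Prop}

theorem Simulates.seq (H : Simulates h ts d P S) (H' : Simulates h ts d P' S') :
    Simulates h ts d (P.seq P') (RSeq S S') := by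
  obtain ⟨R, h1, h2⟩ := H
  obtain ⟨R', h1', h2'⟩ := H'
  exact ⟨_, h1.seq h1', h2.seq h2'⟩

theorem Simulates.alt (H : Simulates h ts d P S) (H' : Simulates h ts d P' S') :
    Simulates h ts d (P.alt P') (RAlt S S') := by
  obtain ⟨R, h1, h2⟩ := H
  obtain ⟨R', h1', h2'⟩ := H'
  exact ⟨_, h1.alt h1', h2.alt h2'⟩

theorem Simulates.star (H : Simulates h ts d P S) : Simulates h ts d P.star (RStar S) := by
  obtain ⟨R, h1, h2⟩ := H
  exact ⟨_, h1.star, h2.star⟩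

theorem simulates_emit (b : Bool) : Simulates h ts d (emit b) (Emit b) := by
  refine ⟨_, fun _ => hide_emit b, fun x a hx => ⟨?_, ?_⟩⟩
  · rintro y z ⟨rfl, rfl⟩; exact ⟨a, ⟨rfl, rfl⟩, hx⟩
  · rintro y z ⟨rfl, rfl⟩; exact ⟨x, ⟨rfl, rfl⟩, hx⟩

theorem simulates_perVar : Simulates h ts d perVar (PerVar ts) :=
  Simulates.seq bis_varPre (.seq (.alt (.seq (.star (bis_vstep (silent_neAt 4))) (simulates_emit _))
    (.seq (.star (bis_vstep silent_wordAny)) (.seq (bis_vstep (silent_eqAt 4))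
      (.seq (.star (bis_vstep silent_wordAny)) (simulates_emit _))))) bis_varPost)

theorem simulates_segment : Simulates h ts d segment (Segment ts d) :=
  Simulates.seq bis_pathStart (.seq (.star (bis_vstep silent_wordAny)) (.seq bis_setTarget
    (.seq (.star (.alt bis_perLetter simulates_perVar)) bis_transEnd)))

theorem simulates_eval : Simulates h ts d evalProg (Eval ts h.2.2 d) :=
  Simulates.seq (.star (.seq simulates_segment bis_letterStep))
    (.seq simulates_segment bis_atEnd)

end

/-- Check that the input is the code of an instance, and setUp the pebbles. -/
def setUp : MProg σ :=
  .seq rdBlock (.seq (put (.inl 1)) (.seq (put (.inl 2)) (.seq (put (.inl 3)) (.seq rdName1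
    (.seq rdBlock (.seq (.star rdTrans) (.seq (step Sym.isBar) (.seq (put (.inl 5))
      (.seq (.star (step Sym.isLetter)) (check fun s => s.elim true fun _ => false))))))))))

theorem letters_eq {u : List (Sym σ)} (hu : ∀ a ∈ u, Sym.isLetter a = true) :
    ∃ d : List σ, u = d.map Sym.letter := by
  induction u with
  | nil => exact ⟨[], rfl⟩
  | cons a u ih =>
    have h1 := hu a (by simp)
    obtain ⟨d, rfl⟩ := ih fun b hb => hu b (by simp [hb])
    cases a <;> simp [Sym.isLetter] at h1
    exact ⟨_ :: d, rfl⟩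

/-- Abstract state after the initialization. -/
def AState.start (w : List (Sym σ)) (q₀ : List Bool) (d : List σ) : AState σ :=
  ⟨q₀, q₀, q₀, w, d.map Sym.letter⟩

theorem exists_setUp : ∃ r, Silent (setUp : MProg σ) r ∧ ∀ w,
    (∀ z, r (w, fun _ => w) z → ∃ h ts d, w = header h ++ tl ts d ∧
      Inv h ts d z (AState.start w h.2.1 d)) ∧
    ∀ h ts d, w = header h ++ tl ts d →
      ∃ z, r (w, fun _ => w) z ∧ Inv h ts d z (AState.start w h.2.1 d) := by
  refine ⟨_, rd_rdBlock.silent.seq ((Silent.put 1).seq ((Silent.put 2).seq ((Silent.put 3).seq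
    (rd_rdName1.silent.seq (rd_rdBlock.silent.seq (rd_rdTrans.star_range.silent.seq
    ((rd_step _).silent.seq ((Silent.put 5).seq ((rd_star_step _).silent.seq
    (Silent.check _)))))))))), fun w => ⟨?_, ?_⟩⟩
  · rintro z ⟨⟨m₁, e⟩, ⟨_, ⟨qs, rfl⟩, h1, rfl : e = _⟩, _, rfl, _, rfl, _, rfl,
      ⟨m₂, e⟩, ⟨_, ⟨q₀, rfl⟩, h2, rfl : e = _⟩, ⟨m₃, e⟩, ⟨_, ⟨fs, rfl⟩, h3, rfl : e = _⟩,
      ⟨m₄, e⟩, ⟨_, ⟨ts, rfl⟩, h4, rfl : e = _⟩, ⟨m₅, e⟩, ⟨_, ⟨c, hc, rfl⟩, h5, rfl : e = _⟩,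
      _, rfl, ⟨m₆, e⟩, ⟨u, hu, h6, rfl : e = _⟩, h7, rfl⟩
    simp only at h1 h2 h3 h4 h5 h6 h7
    obtain rfl := isBar_iff.mp hc
    obtain ⟨d, rfl⟩ := letters_eq hu
    obtain rfl : m₆ = [] := by
      cases m₆ with
      | nil => rfl
      | cons => simp at h7
    rw [List.append_nil] at h6
    have hw : w = header (qs, q₀, fs) ++ tl ts d := by
      rw [h1, h2, h3, h4, h5, h6]; simp [header, tl]
    refine ⟨(qs, q₀, fs), ts, d, hw, by simpa using hw, ⟨?_, ?_⟩, ⟨?_, ?_⟩, ⟨?_, ?_⟩, by simp [AState.start],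
      by simp [AState.start, h6]⟩
    rotate_left
    · simp only [ne_eq, Fin.reduceEq, not_false_eq_true, Function.update_of_ne,
        Function.update_self, AState.start]
      rw [h2, List.append_assoc]
    rotate_left
    · simp only [ne_eq, Fin.reduceEq, not_false_eq_true, Function.update_of_ne,
        Function.update_self, AState.start]
      rw [h2, List.append_assoc]
    rotate_left
    · simp only [ne_eq, Fin.reduceEq, not_false_eq_true, Function.update_of_ne,
        Function.update_self, AState.start]
      rw [h2, List.append_assoc]
  · rintro ⟨qs, q₀, fs⟩ ts d hw
    let z₄ : List (Sym σ) := Sym.bar :: d.map Sym.letter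
    let z₃ := tl ts d
    let z₂ := fs.flatMap encName ++ Sym.bar :: z₃
    let z₁ := encName q₀ ++ Sym.bar :: z₂
    refine ⟨_, ⟨(z₁, _), ⟨_, ⟨qs, rfl⟩, ?_, rfl⟩, _, rfl, _, rfl, _, rfl, (z₂, _),
      ⟨_, ⟨q₀, rfl⟩, ?_, rfl⟩, (z₃, _), ⟨_, ⟨fs, rfl⟩, ?_, rfl⟩, (z₄, _), ⟨_, ⟨ts, rfl⟩, rfl, rfl⟩,
      (d.map Sym.letter, _), ⟨_, ⟨_, rfl, rfl⟩, rfl, rfl⟩, _, rfl, ([], _),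
      ⟨d.map Sym.letter, ?_, by simp, rfl⟩, rfl, rfl⟩, by simpa using hw, ⟨Sym.bar :: z₂, ?_⟩,
        ⟨Sym.bar :: z₂, ?_⟩, ⟨Sym.bar :: z₂, ?_⟩, by simp [AState.start], by simp [AState.start]⟩
    · simp [hw, header, z₁, z₂, z₃]
    · simp [z₁]
    · simp [z₂]
    · intro a ha
      obtain ⟨b, -, rfl⟩ := List.mem_map.mp ha
      rfl
    all_goals simp [AState.start, z₁]

/-- A log-space machine that evaluates the automata. -/
theorem exists_eval_TM (σ : Type) [Finite σ] : ∃ M : TM (Sym σ) Bool, M.LogSpace ∧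
    ∀ w, M.outputs w = {y | ∃ qs q₀ fs ts d ρ, w = encInput qs q₀ fs ts d ∧
      Acc ts fs 1 q₀ d y ρ} := by
  obtain ⟨M, h1, h2⟩ := (Prog.seq (setUp : MProg σ) evalProg).exists_TM
  refine ⟨M, h1, fun w => ?_⟩
  obtain ⟨r, hr, hw⟩ := exists_setUp (σ := σ)
  obtain ⟨hw₁, hw₂⟩ := hw w
  have hview : (hide ∘ view w) ⟨0, fun _ => 0⟩ = (w, fun _ : Fin 6 => w) := by
    simp [hide, view]
  have hOk : Pos.Ok w (⟨0, fun _ => 0⟩ : Pos (Fin 6 ⊕ Bool)) := ⟨by simp, by simp⟩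
  rw [h2]
  ext y
  simp only [Set.mem_ofPred_eq]
  constructor
  · rintro ⟨p', m, y₁, y₂, k1, k2, rfl⟩
    obtain ⟨rfl, k3⟩ := (hr w _ hOk ..).mp ⟨m, k1, rfl⟩
    rw [hview] at k3
    obtain ⟨h, ts, d, rfl, hI⟩ := hw₁ _ k3
    obtain ⟨R, hR, hB⟩ := simulates_eval (h := h) (ts := ts) (d := d)
    obtain ⟨b, k4, -⟩ := (hB _ _ hI).1 _ _ ((hR _ m (rel_ok k1 hOk) ..).mp ⟨p', k2, rfl⟩)
    obtain ⟨ρ, k5⟩ := (eval_iff (i := 1) (d' := d) rfl).mp ⟨b, k4⟩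
    exact ⟨h.1, h.2.1, h.2.2, ts, d, ρ, header_append _ _ _ _ _, k5⟩
  · rintro ⟨qs, q₀, fs, ts, d, ρ, rfl, hA⟩
    obtain ⟨z, k1, hI⟩ := hw₂ (qs, q₀, fs) ts d (header_append _ _ _ _ _).symm
    obtain ⟨R, hR, hB⟩ := simulates_eval (h := (qs, q₀, fs)) (ts := ts) (d := d)
    obtain ⟨m, k2, rfl⟩ := (hr _ _ hOk [] z).mpr (by rw [hview]; exact ⟨rfl, k1⟩)
    obtain ⟨b, k4⟩ := (eval_iff (i := 1) (d := d)
      (a := AState.start (encInput qs q₀ fs ts d) q₀ d) rfl).mpr ⟨ρ, hA⟩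
    obtain ⟨z', k5, -⟩ := (hB _ _ hI).2 _ _ k4
    obtain ⟨p', k6, -⟩ := (hR _ m (rel_ok k2 hOk) ..).mpr k5
    exact ⟨p', m, [], y, k2, k6, rfl⟩

end Spanner


/-! ### Membership: in functional automata, outputs and mappings correspond one to one. -/

namespace Spanner

open Machine Machine.Prog

/-- Sets that are related by a bi-unique relation have the same size. -/
theorem encard_eq_of_rel {α β : Type} {s : Set α} {t : Set β} (T : α → β → Prop)
    (h₁ : ∀ a ∈ s, ∃ b ∈ t, T a b) (h₂ : ∀ b ∈ t, ∃ a ∈ s, T a b)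
    (h₃ : ∀ a a' b b', T a b → T a' b' → (a = a' ↔ b = b')) : s.encard = t.encard := by
  have h₁' : ∀ a : s, ∃ b : t, T a b := fun a => by
    obtain ⟨b, hb, h⟩ := h₁ a a.2; exact ⟨⟨b, hb⟩, h⟩
  have h₂' : ∀ b : t, ∃ a : s, T a b := fun b => by
    obtain ⟨a, ha, h⟩ := h₂ b b.2; exact ⟨⟨a, ha⟩, h⟩
  choose f hf using h₁'
  choose g hg using h₂'
  refine le_antisymm (Function.Embedding.encard_le ⟨f, fun a a' h => ?_⟩)
    (Function.Embedding.encard_le ⟨g, fun b b' h => ?_⟩)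
  · exact Subtype.ext ((h₃ _ _ _ _ (hf a) (hf a')).mpr (congrArg _ h))
  · exact Subtype.ext ((h₃ _ _ _ _ (hg b) (hg b')).mp (congrArg _ h))

/-! ### Runs -/

section Runs

variable {σ V S : Type} {A : VA σ V S} {d : List σ}

theorem VA.Run.append {p q r : S} {i j k : ℕ} {ρ ρ' : List (Op σ V × ℕ)}
    (h : A.Run d p i ρ q j) (h' : A.Run d q j ρ' r k) : A.Run d p i (ρ ++ ρ') r k := by
  induction h with
  | nil => exact h'
  | letter h1 h2 _ ih => exact .letter h1 h2 (ih h')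
  | opn h1 _ ih => exact .opn h1 (ih h')
  | cls h1 _ ih => exact .cls h1 (ih h')

/-- The mapping defined by a run exists. -/
theorem Valid.exists_defines {ρ : List (Op σ V × ℕ)} (h : Valid ρ) :
    ∃ μ, Defines ρ μ := by
  classical
  -- Two different positions of one marker would be two entries of the run with the same label,
  -- which validity allows for letters only.
  have uniq : ∀ {o : Op σ V} {i j}, (∀ a, o ≠ .letter a) → (o, i) ∈ ρ → (o, j) ∈ ρ → i = j := by
    intro o i j ho hi hj
    by_contra hij
    rcases List.pairwise_iff_getElem.mp h.1 with H
    obtain ⟨m, hm, hm'⟩ := List.mem_iff_getElem.mp hi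
    obtain ⟨n, hn, hn'⟩ := List.mem_iff_getElem.mp hj
    rcases lt_trichotomy m n with hmn | rfl | hmn
    · obtain ⟨a, ha⟩ := H m n hm hn hmn (by rw [hm', hn'])
      rw [hm'] at ha; exact ho a ha
    · exact hij (Prod.ext_iff.mp (hm'.symm.trans hn')).2
    · obtain ⟨a, ha⟩ := H n m hn hm hmn (by rw [hm', hn'])
      rw [hn'] at ha; exact ho a ha
  have fin : {x : V | ∃ s : Span, (Op.opn x, s.lo) ∈ ρ ∧ (Op.cls x, s.hi) ∈ ρ}.Finite := by
    refine Set.Finite.subset (s := {x : V | Op.opn x ∈ ρ.map Prod.fst}) ?_ ?_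
    · exact Set.Finite.preimage (fun x _ y _ h => by simpa using h)
        (List.finite_toSet (ρ.map Prod.fst))
    · rintro x ⟨s, hs, -⟩
      exact List.mem_map.mpr ⟨_, hs, rfl⟩
  refine ⟨⟨fun x => if h : ∃ s : Span, (Op.opn x, s.lo) ∈ ρ ∧ (Op.cls x, s.hi) ∈ ρ then
    some h.choose else none, fin.subset fun x hx => ?_⟩, fun x s => ?_⟩
  · by_contra hn
    refine hx ?_
    exact dif_neg hn
  · dsimp only
    constructor
    · intro hs
      split_ifs at hs with hx
      obtain rfl := Option.some.inj hs
      exact hx.choose_spec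
    · intro hs
      rw [dif_pos ⟨s, hs⟩]
      have := (⟨s, hs⟩ : ∃ s : Span, (Op.opn x, s.lo) ∈ ρ ∧ (Op.cls x, s.hi) ∈ ρ).choose_spec
      exact congrArg some (Span.ext (uniq (by simp) this.1 hs.1) (uniq (by simp) this.2 hs.2))

/-- Valid runs define the same mapping if and only if they execute the same variable operations
at the same positions. -/
theorem Defines.eq_iff {ρ ρ' : List (Op σ V × ℕ)} {μ μ' : Mapping V} (h : Defines ρ μ)
    (h' : Defines ρ' μ') (hv : Valid ρ) (hv' : Valid ρ') (h1 : ∀ s ∈ ρ, 1 ≤ s.2)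
    (h1' : ∀ s ∈ ρ', 1 ≤ s.2) :
    μ = μ' ↔ ∀ x i, ((Op.opn x, i) ∈ ρ ↔ (Op.opn x, i) ∈ ρ') ∧
      ((Op.cls x, i) ∈ ρ ↔ (Op.cls x, i) ∈ ρ') := by
  constructor
  · rintro rfl
    have key : ∀ {ρ ρ' : List (Op σ V × ℕ)}, Defines ρ μ → Defines ρ' μ → Valid ρ →
        (∀ s ∈ ρ, 1 ≤ s.2) → ∀ x i, ((Op.opn x, i) ∈ ρ → (Op.opn x, i) ∈ ρ') ∧
          ((Op.cls x, i) ∈ ρ → (Op.cls x, i) ∈ ρ') := by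
      intro ρ ρ' h h' hv h1 x i
      constructor
      · intro ho
        obtain ⟨j, hij, hc⟩ := hv.2.1 x i ho
        exact ((h' x _).mp ((h x ⟨i, j, h1 _ ho, hij⟩).mpr ⟨ho, hc⟩)).1
      · intro hc
        obtain ⟨j, hij, ho⟩ := hv.2.2 x i hc
        exact ((h' x _).mp ((h x ⟨j, i, h1 _ ho, hij⟩).mpr ⟨ho, hc⟩)).2
    intro x i
    exact ⟨⟨(key h h' hv h1 x i).1, (key h' h hv' h1' x i).1⟩,
      ⟨(key h h' hv h1 x i).2, (key h' h hv' h1' x i).2⟩⟩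
  · intro H
    refine Mapping.ext (funext fun x => Option.ext fun s => ?_)
    rw [h x s, h' x s, (H x s.lo).1, (H x s.hi).2]

end Runs

/-! ### Functional automata -/

section Functional

variable {σ : Type} {A : VA σ (List Bool) (List Bool)} {ts : List (Tr σ)} {fs : List (List Bool)}
  {d : List σ}

theorem VPath.run (hts : ∀ t, t ∈ ts ↔ t ∈ A.trans) {p q : List Bool}
    {os : List (Op σ (List Bool))} (h : VPath ts p os q) (i : ℕ) :
    A.Run d p i (os.map fun o => (o, i)) q i := by
  induction h with
  | nil => exact .nil _ _
  | @cons p p' q o os h1 h2 _ ih =>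
    rw [hts] at h1
    cases o with
    | letter a => exact h2.elim
    | opn x => exact .opn h1 ih
    | cls x => exact .cls h1 ih

theorem Acc.run (hts : ∀ t, t ∈ ts ↔ t ∈ A.trans) (hfs : ∀ q, q ∈ fs ↔ q ∈ A.final) {i : ℕ}
    {p : List Bool} {d₁ d₂ : List σ} {y : List Bool} {ρ : List (Op σ (List Bool) × ℕ)}
    (h : Acc ts fs i p d₂ y ρ) (hd : d = d₁ ++ d₂) (hi : i = d₁.length + 1) :
    ∃ q ∈ A.final, A.Run d p i ρ q (d.length + 1) := by
  induction h generalizing d₁ with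
  | last h1 _ h3 =>
    refine ⟨_, (hfs _).mp h3, ?_⟩
    convert h1.run hts _ using 1
    rw [hd, hi, List.append_nil]
  | @step i p q p' os y y' c d₂ ρ h1 _ h3 _ ih =>
    obtain ⟨f, hf, h4⟩ := ih (d₁ := d₁ ++ [c]) (by simp [hd]) (by simp [hi])
    refine ⟨f, hf, (h1.run hts i).append (.letter ((hts _).mp h3) ?_ h4)⟩
    simp [hd, hi]

theorem Acc.le_of_mem {i : ℕ} {p : List Bool} {y : List Bool} {ρ : List (Op σ (List Bool) × ℕ)}
    (h : Acc ts fs i p d y ρ) : ∀ s ∈ ρ, i ≤ s.2 := by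
  induction h with
  | last => simp
  | step _ _ _ _ ih =>
    intro s hs
    simp only [List.mem_append, List.mem_map, List.mem_cons] at hs
    rcases hs with ⟨o, _, rfl⟩ | rfl | hs
    · exact le_rfl
    · exact le_rfl
    · exact (Nat.le_succ _).trans (ih s hs)

/-- A single path can justify all bits consistently, so every segment of a run has an output. -/
theorem Bits.exists {p q : List Bool} {os : List (Op σ (List Bool))} (h : VPath ts p os q)
    (l : List (Tr σ)) : ∃ y, Bits ts p q l y := by
  classical
  induction l with
  | nil => exact ⟨[], .nil⟩
  | cons t l ih =>
    obtain ⟨y, hy⟩ := ih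
    by_cases ht : IsVar t.2.1
    · exact ⟨_, .var ht h (b := decide (t.2.1 ∈ os)) (by simp) hy⟩
    · exact ⟨y, .letter ht hy⟩

/-- The run is cut at its letters, by induction from its front. The prefix `d₁` has been read, hence
`i = |d₁| + 1`. -/
theorem exists_acc (hts : ∀ t, t ∈ ts ↔ t ∈ A.trans) (hfs : ∀ q, q ∈ fs ↔ q ∈ A.final) {i k : ℕ}
    {p q : List Bool} {ρ : List (Op σ (List Bool) × ℕ)} (h : A.Run d p i ρ q k)
    (hk : k = d.length + 1) (hq : q ∈ A.final) {d₁ d₂ : List σ} (hd : d = d₁ ++ d₂)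
    (hi : i = d₁.length + 1) : ∃ y, Acc ts fs i p d₂ y ρ := by
  -- A variable transition in front extends the first segment. Its bits refer to the start of the
  -- segment and are therefore chosen anew.
  have prepend : ∀ {i p p' d₂} {o : Op σ (List Bool)} {ρ : List (Op σ (List Bool) × ℕ)},
      (p, o, p') ∈ ts → IsVar o → (∃ y, Acc ts fs i p' d₂ y ρ) →
        ∃ y, Acc ts fs i p d₂ y ((o, i) :: ρ) := by
    rintro i p p' d₂ o ρ h1 ho ⟨y, h2⟩
    cases h2 with
    | last h3 _ h5 =>
      have h6 : VPath ts p _ _ := .cons h1 ho h3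
      obtain ⟨y, hy⟩ := Bits.exists h6 ts
      exact ⟨y, .last h6 hy h5⟩
    | step h3 _ h5 h7 =>
      have h6 : VPath ts p _ _ := .cons h1 ho h3
      obtain ⟨y, hy⟩ := Bits.exists h6 ts
      exact ⟨_, .step h6 hy h5 h7⟩
  induction h generalizing d₁ d₂ with
  | nil p i =>
    obtain rfl : d₂ = [] := by
      rw [hk, hd] at hi
      simpa using hi
    obtain ⟨y, hy⟩ := Bits.exists (.nil p : VPath ts p [] p) ts
    exact ⟨y, .last (.nil p) hy ((hfs _).mpr hq)⟩
  | @letter p p' q a i k ρ h1 h2 _ ih =>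
    cases d₂ with
    | nil =>
      exfalso
      rw [hd, hi] at h2
      simp at h2
    | cons c d₂ =>
      obtain rfl : c = a := by
        rw [hd, hi] at h2
        simpa using h2
      obtain ⟨y, hy⟩ := ih hk hq (d₁ := d₁ ++ [c]) (d₂ := d₂) (by simp [hd]) (by simp [hi])
      obtain ⟨y', hy'⟩ := Bits.exists (.nil p : VPath ts p [] p) ts
      exact ⟨_, .step (.nil p) hy' ((hts _).mpr h1) hy⟩
  | opn h1 _ ih => exact prepend ((hts _).mpr h1) trivial (ih hk hq hd hi)
  | cls h1 _ ih => exact prepend ((hts _).mpr h1) trivial (ih hk hq hd hi)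

/-- In a functional automaton, variable paths between the same states that occur in accepting runs
have the same operations. -/
theorem mem_of_vPath (hA : A.Functional) (hts : ∀ t, t ∈ ts ↔ t ∈ A.trans) {p q f : List Bool}
    {os os' : List (Op σ (List Bool))} {i : ℕ} {ρ₁ ρ₂ : List (Op σ (List Bool) × ℕ)}
    (h : VPath ts p os q) (h' : VPath ts p os' q) (h₁ : A.Run d A.init 1 ρ₁ p i)
    (h₂ : A.Run d q i ρ₂ f (d.length + 1)) (hf : f ∈ A.final) {o : Op σ (List Bool)}
    (ho : o ∈ os) : o ∈ os' := by
  obtain ⟨V, M⟩ := hA d _ ⟨f, hf, h₁.append ((h.run hts i).append h₂)⟩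
  obtain ⟨V', M'⟩ := hA d _ ⟨f, hf, h₁.append ((h'.run hts i).append h₂)⟩
  have hvar := h.isVar o ho
  -- The variable of `o` occurs in the automaton, so the run through `os'` mentions it; by validity
  -- it both opens and closes it, and thus executes `o` somewhere.
  have hx : ∃ j, (o, j) ∈ ρ₁ ++ (os'.map (fun o => (o, i)) ++ ρ₂) := by
    have trans : ∃ p q, (p, o, q) ∈ A.trans := by
      clear h' h₁ h₂ V M V' M'
      induction h with
      | nil => simp at ho
      | cons h1 h2 _ ih =>
        rcases List.mem_cons.mp ho with rfl | ho
        · exact ⟨_, _, (hts _).mp h1⟩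
        · exact ih ho
    obtain ⟨p', q', ht⟩ := trans
    cases o with
    | letter => exact hvar.elim
    | opn x =>
      obtain ⟨j, hj | hj⟩ := M' x ⟨p', q', .inl ht⟩
      · exact ⟨j, hj⟩
      · obtain ⟨j', _, hj'⟩ := V'.2.2 x j hj; exact ⟨j', hj'⟩
    | cls x =>
      obtain ⟨j, hj | hj⟩ := M' x ⟨p', q', .inr ht⟩
      · obtain ⟨j', _, hj'⟩ := V'.2.1 x j hj; exact ⟨j', hj'⟩
      · exact ⟨j, hj⟩
  obtain ⟨j, hj⟩ := hx
  have hne : ∀ a, o ≠ .letter a := by rintro a rfl; exact hvar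
  -- The run through `os` already executes `o` at `i`, so `o` occurs neither in `ρ₁` nor in `ρ₂`. In
  -- the other run only `os'` is left as its place.
  have P := V.1
  rw [List.pairwise_append, List.pairwise_append] at P
  simp only [List.mem_append, List.mem_map, Prod.mk.injEq] at hj
  have hmem : (o, i) ∈ os.map fun o => (o, i) := List.mem_map.mpr ⟨o, ho, rfl⟩
  rcases hj with hj | ⟨o', ho', rfl, -⟩ | hj
  · obtain ⟨a, ha⟩ := P.2.2 _ hj _ (List.mem_append_left _ hmem) rfl
    exact (hne a ha).elim
  · exact ho'
  · obtain ⟨a, ha⟩ := P.2.1.2.2 _ hmem _ hj rfl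
    exact (hne a ha).elim

open Classical in
/-- The bits that tell at which positions the run executes the variable operations. -/
noncomputable def bitsOf (ts : List (Tr σ)) (ρ : List (Op σ (List Bool) × ℕ)) (i n : ℕ) : List Bool :=
  ((List.range' i n) ×ˢ (ts.filter fun t => IsVar t.2.1)).map fun s => decide ((s.2.2.1, s.1) ∈ ρ)

theorem bitsOf_succ (ts : List (Tr σ)) (ρ : List (Op σ (List Bool) × ℕ)) (i n : ℕ) [DecidablePred
    fun t : Tr σ => IsVar t.2.1] [DecidablePred fun t : Tr σ => (t.2.1, i) ∈ ρ] :
    bitsOf ts ρ i (n + 1) = ((ts.filter fun t => IsVar t.2.1).map fun t => decide ((t.2.1, i) ∈ ρ)) ++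
      bitsOf ts ρ (i + 1) n := by
  classical
  simp only [bitsOf, List.range'_succ, List.product_cons, List.map_append, List.map_map,
    Function.comp_def]
  congr!

/-- By `mem_of_vPath`, the path that witnesses a bit has the same operations as the piece of the run
between the same states. So the guesses made for single bits cannot disagree with the run. The run
`ρ₁` before position `i` is carried along because functionality speaks about complete runs. -/
theorem Acc.eq_bitsOf (hA : A.Functional) (hts : ∀ t, t ∈ ts ↔ t ∈ A.trans)
    (hfs : ∀ q, q ∈ fs ↔ q ∈ A.final) {i : ℕ}
    {p : List Bool} {d₁ d₂ : List σ} {y : List Bool} {ρ₁ ρ₂ : List (Op σ (List Bool) × ℕ)}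
    (h : Acc ts fs i p d₂ y ρ₂) (hd : d = d₁ ++ d₂) (hi : i = d₁.length + 1)
    (h₁ : A.Run d A.init 1 ρ₁ p i) (hρ₁ : ∀ s ∈ ρ₁, s.2 < i) :
    y = bitsOf ts (ρ₁ ++ ρ₂) i (d₂.length + 1) := by
  classical
  -- One segment: variable operations of `ρ₁` happen before `i` and those of `ρ₂` after `i`, so
  -- membership of `(t.2.1, i)` is decided in `os`.
  have key : ∀ {i p q f os y} {ρ₁ ρ₂ : List (Op σ (List Bool) × ℕ)}, VPath ts p os q → f ∈ A.final →
      A.Run d A.init 1 ρ₁ p i → (∀ s ∈ ρ₁, s.2 < i) → A.Run d q i ρ₂ f (d.length + 1) →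
      (∀ s ∈ ρ₂, IsVar s.1 → i < s.2) → Bits ts p q ts y → y = ((ts.filter fun t => IsVar t.2.1).map
        fun t => decide ((t.2.1, i) ∈ ρ₁ ++ (os.map (fun o => (o, i)) ++ ρ₂))) := by
    intro i p q f os y ρ₁ ρ₂ h hf h₁ hρ₁ h₂ hρ₂ hb
    suffices H : ∀ l, Bits ts p q l y → y = ((l.filter fun t => IsVar t.2.1).map
        fun t => decide ((t.2.1, i) ∈ ρ₁ ++ (os.map (fun o => (o, i)) ++ ρ₂))) from H _ hb
    clear hb
    intro l hl
    induction hl with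
    | nil => rfl
    | letter ht _ ih => rw [List.filter_cons_of_neg (by simpa using ht)]; exact ih
    | @var t l y os' b ht ho hβ _ ih =>
      rw [List.filter_cons_of_pos (by simpa using ht), List.map_cons, ← ih]
      congr 1
      have h3 : t.2.1 ∈ os' ↔ t.2.1 ∈ os :=
        ⟨mem_of_vPath hA hts ho h h₁ h₂ hf, mem_of_vPath hA hts h ho h₁ h₂ hf⟩
      have h4 : (t.2.1, i) ∈ ρ₁ ++ (os.map (fun o => (o, i)) ++ ρ₂) ↔ t.2.1 ∈ os := by
        simp only [List.mem_append, List.mem_map, Prod.mk.injEq, and_true, exists_eq_right]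
        refine ⟨?_, fun h => .inr (.inl h)⟩
        rintro (h | h | h)
        · exact absurd (hρ₁ _ h) (lt_irrefl _)
        · exact h
        · exact absurd (hρ₂ _ h ht) (lt_irrefl _)
      rw [Bool.eq_iff_iff, decide_eq_true_eq, h4, ← h3, hβ]
  induction h generalizing d₁ ρ₁ with
  | @last i p q os y h2 h3 h4 =>
    have h5 := key (ρ₂ := []) h2 ((hfs _).mp h4) h₁ hρ₁ (by rw [hd, hi, List.append_nil]; exact .nil _ _)
      (by simp) h3
    rw [List.append_nil] at h5
    rw [List.length_nil, bitsOf_succ, ← h5]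
    simp [bitsOf]
  | @step i p q p' os y y' c d₂ ρ h2 h3 h4 h5 ih =>
    have hd' : d = (d₁ ++ [c]) ++ d₂ := by simp [hd]
    have hi' : i + 1 = (d₁ ++ [c]).length + 1 := by simp [hi]
    obtain ⟨f, hf, h6⟩ := h5.run hts hfs hd' hi'
    have h7 : A.Run d q i ((Op.letter c, i) :: ρ) f (d.length + 1) :=
      .letter ((hts _).mp h4) (by simp [hd, hi]) h6
    have h8 := key h2 hf h₁ hρ₁ h7 (fun s hs hv => by
      rcases List.mem_cons.mp hs with rfl | hs
      · exact hv.elim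
      · exact h5.le_of_mem s hs) h3
    have h9 := ih (ρ₁ := ρ₁ ++ ((os.map fun o => (o, i)) ++ [(Op.letter c, i)])) hd' hi'
      (h₁.append ((h2.run hts i).append (.letter ((hts _).mp h4) (by simp [hd, hi]) (.nil _ _))))
      (fun s hs => by
        simp only [List.mem_append, List.mem_map, List.mem_singleton] at hs
        rcases hs with hs | ⟨o, _, rfl⟩ | rfl
        · exact (hρ₁ s hs).trans (Nat.lt_succ_self _)
        · exact Nat.lt_succ_self _
        · exact Nat.lt_succ_self _)
    rw [List.length_cons, bitsOf_succ, ← h8, h9]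
    simp

theorem bitsOf_inj {ρ ρ' : List (Op σ (List Bool) × ℕ)} {i n : ℕ} :
    bitsOf ts ρ i n = bitsOf ts ρ' i n ↔ ∀ t ∈ ts, IsVar t.2.1 → ∀ j, i ≤ j → j < i + n →
      ((t.2.1, j) ∈ ρ ↔ (t.2.1, j) ∈ ρ') := by
  classical
  simp only [bitsOf, List.map_inj_left, decide_eq_decide]
  have mem : ∀ j t, (j, t) ∈ List.range' i n ×ˢ (ts.filter fun t => decide (IsVar t.2.1)) ↔
      (i ≤ j ∧ j < i + n) ∧ t ∈ ts ∧ IsVar t.2.1 := by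
    intro j t
    refine List.pair_mem_product.trans ?_
    rw [List.mem_range'_1, List.mem_filter, decide_eq_true_eq]
  constructor
  · intro H t ht hv j h1 h2
    exact H (j, t) ((mem j t).mpr ⟨⟨h1, h2⟩, ht, hv⟩)
  · rintro H ⟨j, t⟩ h
    obtain ⟨⟨h1, h2⟩, ht, hv⟩ := (mem j t).mp h
    exact H t ht hv j h1 h2

theorem VA.Run.le {V S : Type} {A : VA σ V S} {p q : S} {i j : ℕ} {ρ : List (Op σ V × ℕ)}
    (h : A.Run d p i ρ q j) : i ≤ j ∧ ∀ s ∈ ρ, i ≤ s.2 ∧ s.2 ≤ j ∧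
      ∃ p q, (p, s.1, q) ∈ A.trans := by
  induction h with
  | nil => simp
  | letter h1 _ _ ih =>
    refine ⟨by omega, fun s hs => ?_⟩
    rcases List.mem_cons.mp hs with rfl | hs
    · exact ⟨le_rfl, by simp only; omega, _, _, h1⟩
    · obtain ⟨h3, h4⟩ := ih.2 s hs; exact ⟨by omega, h4⟩
  | opn h1 _ ih =>
    refine ⟨by omega, fun s hs => ?_⟩
    rcases List.mem_cons.mp hs with rfl | hs
    · exact ⟨le_rfl, by simp only; omega, _, _, h1⟩
    · exact ih.2 s hs
  | cls h1 _ ih =>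
    refine ⟨by omega, fun s hs => ?_⟩
    rcases List.mem_cons.mp hs with rfl | hs
    · exact ⟨le_rfl, by simp only; omega, _, _, h1⟩
    · exact ih.2 s hs

/-- An output and a mapping are related if they come from a common run. The relation is bi-unique
since either one carries the same information, namely which variable operations are executed at
which positions. -/
theorem encard_acc (hA : A.Functional) (hts : ∀ t, t ∈ ts ↔ t ∈ A.trans)
    (hfs : ∀ q, q ∈ fs ↔ q ∈ A.final) :
    {y | ∃ ρ, Acc ts fs 1 A.init d y ρ}.encard = (A.sem d).encard := by
  have hrun : ∀ {y ρ}, Acc ts fs 1 A.init d y ρ → A.Accepting d ρ := fun h =>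
    h.run hts hfs (d₁ := []) rfl rfl
  have hle : ∀ {ρ}, A.Accepting d ρ → ∀ s ∈ ρ, 1 ≤ s.2 := by
    rintro ρ ⟨q, _, h⟩ s hs; exact (h.le.2 s hs).1
  refine encard_eq_of_rel (fun y μ => ∃ ρ, Acc ts fs 1 A.init d y ρ ∧ Defines ρ μ) ?_ ?_ ?_
  · rintro y ⟨ρ, h⟩
    have hv := (hA d ρ (hrun h)).1
    obtain ⟨μ, hμ⟩ := hv.exists_defines
    exact ⟨μ, ⟨ρ, hrun h, hv, hμ⟩, ρ, h, hμ⟩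
  · rintro μ ⟨ρ, ⟨q, hq, h⟩, hv, hμ⟩
    obtain ⟨y, hy⟩ := exists_acc hts hfs h rfl hq (d₁ := []) rfl rfl
    exact ⟨y, ⟨ρ, hy⟩, ρ, hy, hμ⟩
  · rintro y y' μ μ' ⟨ρ, h, hμ⟩ ⟨ρ', h', hμ'⟩
    have e := h.eq_bitsOf hA hts hfs (ρ₁ := []) (d₁ := []) rfl rfl (.nil _ _) (by simp)
    have e' := h'.eq_bitsOf hA hts hfs (ρ₁ := []) (d₁ := []) rfl rfl (.nil _ _) (by simp)
    rw [hμ.eq_iff hμ' (hA d ρ (hrun h)).1 (hA d ρ' (hrun h')).1 (hle (hrun h)) (hle (hrun h')),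
      e, e', bitsOf_inj, List.nil_append, List.nil_append]
    obtain ⟨q, -, hr⟩ := hrun h
    obtain ⟨q', -, hr'⟩ := hrun h'
    constructor
    · intro H
      have H' : ∀ o, IsVar o → ∀ i, (o, i) ∈ ρ ↔ (o, i) ∈ ρ' := by
        intro o ho i
        constructor
        · intro hi
          obtain ⟨h1, h2, p, r, h3⟩ := hr.le.2 _ hi
          exact (H _ ((hts _).mpr h3) ho i h1 (by simp only at h2; omega)).mp hi
        · intro hi
          obtain ⟨h1, h2, p, r, h3⟩ := hr'.le.2 _ hi
          exact (H _ ((hts _).mpr h3) ho i h1 (by simp only at h2; omega)).mpr hi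
      exact fun x i => ⟨H' (.opn x) trivial i, H' (.cls x) trivial i⟩
    · rintro H ⟨p, o, r⟩ - hv j - -
      cases o with
      | letter => exact hv.elim
      | opn x => exact (H x j).1
      | cls x => exact (H x j).2

end Functional

/-- Counting the outputs of functional automata is in SpanL. -/
theorem countFVA_memSpanL (σ : Type) [Finite σ] : (CountFVA σ).MemSpanL := by
  obtain ⟨M, h1, h2⟩ := exists_eval_TM σ
  have parse : ∀ {qs q₀ fs} {ts : List (Tr σ)} {d qs' q₀' fs'} {ts' : List (Tr σ)} {d'},
      encInput qs q₀ fs ts d = encInput qs' q₀' fs' ts' d' →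
      q₀ = q₀' ∧ fs = fs' ∧ ts = ts' ∧ d = d' := by
    intro qs q₀ fs ts d qs' q₀' fs' ts' d' h
    rw [← header_append, ← header_append] at h
    obtain ⟨k1, k2⟩ := header_inj h
    obtain ⟨k3, k4⟩ := tl_inj k2
    simp only [Prod.mk.injEq] at k1
    exact ⟨k1.2.1, k1.2.2, k3, k4⟩
  have key : ∀ qs q₀ fs ts (d : List σ), M.outputs (encInput qs q₀ fs ts d) =
      {y | ∃ ρ, Acc ts fs 1 q₀ d y ρ} := by
    intro qs q₀ fs ts d
    rw [h2]
    ext y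
    constructor
    · rintro ⟨qs', q₀', fs', ts', d', ρ, h, hA⟩
      obtain ⟨rfl, rfl, rfl, rfl⟩ := parse h
      exact ⟨ρ, hA⟩
    · rintro ⟨ρ, hA⟩
      exact ⟨qs, q₀, fs, ts, d, ρ, rfl, hA⟩
  -- SpanL requires a finite number on every word, including codes of automata that are not
  -- functional and words that are no codes.
  have hfin : ∀ w, (M.outputs w).Finite := by
    intro w
    by_cases hw : ∃ qs q₀ fs ts d, w = encInput qs q₀ fs ts d
    · obtain ⟨qs, q₀, fs, ts, d, rfl⟩ := hw
      rw [key]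
      refine (List.finite_length_le Bool ((d.length + 1) * ts.length)).subset ?_
      rintro y ⟨ρ, h⟩
      exact h.length_le
    · rw [h2]
      convert Set.finite_empty
      ext y
      simp only [Set.mem_ofPred_eq, Set.mem_empty_iff_false, iff_false]
      rintro ⟨qs, q₀, fs, ts, d, ρ, h, -⟩
      exact hw ⟨qs, q₀, fs, ts, d, h⟩
  refine ⟨fun w => (M.outputs w).ncard, ⟨Bool, inferInstance, M, h1, fun w => ?_⟩, ?_⟩
  · exact ((hfin w).cast_ncard_eq).symm
  · rintro w ⟨⟨A, hA⟩, d⟩ ⟨qs, fs, ts, -, hfs, hts, rfl⟩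
    rw [(hfin _).cast_ncard_eq, key]
    exact encard_acc hA hts hfs

end Spanner


/-! ### Hardness: counting through all strings of logarithmic length. -/

namespace Machine

/-! ## Digit strings -/

section Digits

variable {B : ℕ} [NeZero B]

/-- The `L` least significant digits of `m` in base `B`, least significant digit first. -/
def digs (B : ℕ) [NeZero B] : ℕ → ℕ → List (Fin B)
  | 0, _ => []
  | L + 1, m => Fin.ofNat B m :: digs B L (m / B)

@[simp] theorem digs_length (L m : ℕ) : (digs B L m).length = L := by
  induction L generalizing m with
  | zero => rfl
  | succ L ih => simp [digs, ih]

/-- Addition of a carry to a digit: new carry and new digit. -/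
def incDigit (c : Bool) (d : Fin B) : Bool × Fin B :=
  if c then (decide (d.val + 1 = B), Fin.ofNat B (d.val + 1)) else (false, d)

/-- Addition of a carry to a digit string. -/
def incDigits : Bool → List (Fin B) → Bool × List (Fin B)
  | c, [] => (c, [])
  | c, d :: ds => ((incDigits (incDigit c d).1 ds).1, (incDigit c d).2 :: (incDigits (incDigit c d).1 ds).2)

theorem incDigits_false (ds : List (Fin B)) : incDigits false ds = (false, ds) := by
  induction ds with
  | nil => rfl
  | cons d ds ih => simp [incDigits, incDigit, ih]

/-- The carry leaves the lowest digit exactly if this digit is `B - 1`. It survives all `L` digits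
exactly for `m = B ^ L - 1`, and this overflow is the signal that all strings have been visited. -/
theorem incDigits_digs (L m : ℕ) (hm : m < B ^ L) :
    incDigits true (digs B L m) = (decide (m + 1 = B ^ L), digs B L (m + 1)) := by
  have hB : 0 < B := Nat.pos_of_ne_zero (NeZero.ne B)
  induction L generalizing m with
  | zero =>
    obtain rfl : m = 0 := by simpa using hm
    simp [digs, incDigits]
  | succ L ih =>
    have hm' : m / B < B ^ L := by
      rw [Nat.div_lt_iff_lt_mul hB]; rwa [pow_succ] at hm
    have hdm := Nat.div_add_mod m B
    have hlt := Nat.mod_lt m hB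
    have hdig : Fin.ofNat B (m % B + 1) = Fin.ofNat B (m + 1) := by
      apply Fin.ext; simp [Fin.ofNat]
    by_cases h : m % B + 1 = B
    · have h1 : (m + 1) / B = m / B + 1 := by
        rw [Nat.div_eq_of_lt_le] <;> nlinarith
      have h2 : (m / B + 1 = B ^ L) ↔ (m + 1 = B ^ (L + 1)) := by
        rw [pow_succ]
        constructor
        · intro h3; rw [← h3]; nlinarith
        · intro h3
          have : (m / B + 1) * B = B ^ L * B := by rw [← h3]; nlinarith
          exact Nat.eq_of_mul_eq_mul_right hB this
      simp only [digs, incDigits, incDigit, Fin.val_ofNat, if_true, h, decide_true, ih _ hm', h1, ← hdig]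
      simp [h2]
    · have h1 : (m + 1) / B = m / B := by
        have : m % B + 1 < B := by omega
        refine Nat.div_eq_of_lt_le ?_ ?_
        · rw [Nat.mul_comm]; omega
        · rw [Nat.add_mul, Nat.mul_comm]; omega
      have h2 : m + 1 ≠ B ^ (L + 1) := by
        intro h3
        have : B ∣ m + 1 := h3 ▸ dvd_pow_self B (by omega)
        have h4 := Nat.mul_div_cancel' this
        rw [h1] at h4
        omega
      simp only [digs, incDigits, incDigit, Fin.val_ofNat, if_true, h, decide_false, incDigits_false,
        h1, ← hdig, h2]

theorem digs_pow (L : ℕ) : digs B L (B ^ L) = digs B L 0 := by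
  have hB : 0 < B := Nat.pos_of_ne_zero (NeZero.ne B)
  induction L with
  | zero => rfl
  | succ L ih =>
    simp only [digs, Nat.zero_div]
    rw [pow_succ, Nat.mul_div_cancel _ hB, ih]
    congr 1
    apply Fin.ext; simp [Fin.ofNat]

theorem exists_digs (ds : List (Fin B)) : ∃ m < B ^ ds.length, digs B ds.length m = ds := by
  have hB : 0 < B := Nat.pos_of_ne_zero (NeZero.ne B)
  induction ds with
  | nil => exact ⟨0, by simp, rfl⟩
  | cons d ds ih =>
    obtain ⟨m, hm, h⟩ := ih
    refine ⟨d.val + B * m, ?_, ?_⟩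
    · rw [List.length_cons, pow_succ]
      have := d.isLt
      nlinarith
    · have h1 : (d.val + B * m) / B = m := by
        rw [Nat.add_mul_div_left _ _ hB, Nat.div_eq_of_lt d.isLt, zero_add]
      simp only [List.length_cons, digs, h1, h]
      congr 1
      apply Fin.ext
      simp [Fin.ofNat, Nat.mod_eq_of_lt d.isLt]

theorem digs_inj {L m m' : ℕ} (hm : m < B ^ L) (hm' : m' < B ^ L) (h : digs B L m = digs B L m') :
    m = m' := by
  have hB : 0 < B := Nat.pos_of_ne_zero (NeZero.ne B)
  induction L generalizing m m' with
  | zero => simp at hm hm'; omega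
  | succ L ih =>
    simp only [digs, List.cons.injEq] at h
    rw [pow_succ] at hm hm'
    have h1 := ih ((Nat.div_lt_iff_lt_mul hB).mpr hm) ((Nat.div_lt_iff_lt_mul hB).mpr hm') h.2
    have h2 : m % B = m' % B := congrArg Fin.val h.1
    rw [← Nat.div_add_mod m B, ← Nat.div_add_mod m' B, h1, h2]

theorem digs_zero (L : ℕ) : digs B L 0 = List.replicate L 0 := by
  induction L with
  | zero => rfl
  | succ L ih => simp only [digs, Nat.zero_div, ih, List.replicate_succ]; rfl

theorem digs_getElem (L m x : ℕ) (h : x < (digs B L m).length) :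
    ((digs B L m)[x]).val = m / B ^ x % B := by
  induction L generalizing m x with
  | zero => simp [digs] at h
  | succ L ih =>
    cases x with
    | zero => simp [digs, Fin.ofNat]
    | succ x =>
      simp only [digs, List.getElem_cons_succ]
      rw [ih, Nat.div_div_eq_div_mul, pow_succ']

end Digits

/-! ## Enumeration of strings -/

/-- A symbol printed for every cell of a string, and one at the end. -/
structure Item (D Δ : Type) where
  cell : D → Option Δ
  last : Option Δ

/-- Print an item for a string. -/
def Item.print {D Δ : Type} (it : Item D Δ) (xs : List D) : List Δ :=
  xs.filterMap it.cell ++ it.last.toList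

def printAll {D Δ : Type} (its : List (Item D Δ)) (xs : List D) : List Δ :=
  its.flatMap fun it => it.print xs

/-- One pass over all pairs of an input position and a string: the items printed at the beginning,
the items printed for every accepted string, and the finite automaton that accepts the strings. -/
structure Phase (Γ Δ D S : Type) where
  pre : List (Item D Δ)
  items : List (Item D Δ)
  start : S
  step : InSym Γ → S → D → S
  good : InSym Γ → S → Bool

namespace Phase

variable {Γ Δ S : Type} {B : ℕ} [NeZero B]

def accepts {D : Type} (ph : Phase Γ Δ D S) (a : InSym Γ) (xs : List D) : Bool :=
  ph.good a (xs.foldl (ph.step a) ph.start)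

/-- The string in which the position `p` and the number `m` are written. -/
def str (B : ℕ) [NeZero B] (L p m : ℕ) : List (Fin 2 × Fin B) := (digs 2 L p).zip (digs B L m)

/-- The accepted strings, in the order of the enumeration. -/
def hits (ph : Phase Γ Δ (Fin 2 × Fin B) S) (L : ℕ) (w : List Γ) : List (List (Fin 2 × Fin B)) :=
  (List.range (w.length + 2)).flatMap fun p =>
    ((List.range (B ^ L)).map (str B L p)).filter (ph.accepts (readInput w p))

/-- The word printed in one phase. -/
def word (ph : Phase Γ Δ (Fin 2 × Fin B) S) (L : ℕ) (w : List Γ) : List Δ :=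
  printAll ph.pre (str B L 0 0) ++ (ph.hits L w).flatMap (printAll ph.items)

/-- Control states of the enumerating machine. -/
inductive Ctl (J K : ℕ) (S : Type) where
  | item (i : Fin (K + 1)) (main : Bool) (j : Fin (J + 1))
  | check (i : Fin (K + 1)) (s : S)
  | inc (i : Fin (K + 1)) (c : Bool)
  | incP (i : Fin (K + 1)) (c : Bool)
  | rewind (i : Fin (K + 1))
  | done

instance {J K : ℕ} [Finite S] : Finite (Ctl J K S) :=
  Finite.of_injective
    (fun s : Ctl J K S => (match s with
      | .item i m j => .inl (i, m, j)
      | .check i s => .inr (.inl (i, s))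
      | .inc i c => .inr (.inr (.inl (i, c)))
      | .incP i c => .inr (.inr (.inr (.inl (i, c))))
      | .rewind i => .inr (.inr (.inr (.inr (some i))))
      | .done => .inr (.inr (.inr (.inr none))) :
        (Fin (K + 1) × Bool × Fin (J + 1)) ⊕ (Fin (K + 1) × S) ⊕ (Fin (K + 1) × Bool) ⊕
          (Fin (K + 1) × Bool) ⊕ Option (Fin (K + 1))))
    (by rintro (_ | _ | _ | _ | _ | _) (_ | _ | _ | _ | _ | _) h <;> simp_all)

def _root_.Machine.InSym.isRight {Γ : Type} : InSym Γ → Bool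
  | .rightEnd => true
  | _ => false

def _root_.Machine.InSym.isLeft {Γ : Type} : InSym Γ → Bool
  | .leftEnd => true
  | _ => false

variable (J : ℕ) (phs : List (Phase Γ Δ (Fin 2 × Fin B) S))

/-- The item that is printed in a state. -/
def itemAt (i : ℕ) (main : Bool) (j : ℕ) : Option (Item (Fin 2 × Fin B) Δ) :=
  phs[i]?.bind fun ph => (if main then ph.items else ph.pre)[j]?

/-- Behaviour of the enumerating machine on one cell. -/
def cellF : Ctl J phs.length S → InSym Γ → Fin 2 × Fin B →
    Ctl J phs.length S × (Fin 2 × Fin B) × Option Δ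
  | .item i main j, _, d => (.item i main j, d, (itemAt phs i main j).bind fun it => it.cell d)
  | .check i s, a, d => (match phs[i.val]? with
    | some ph => .check i (ph.step a s d)
    | none => .check i s, d, none)
  | .inc i c, _, d => (.inc i (incDigit c d.2).1, (d.1, (incDigit c d.2).2), none)
  | .incP i c, a, d => if a.isRight then (.incP i c, (0, d.2), none) else
    (.incP i (incDigit c d.1).1, ((incDigit c d.1).2, d.2), none)
  | .rewind i, _, d => (.rewind i, d, none)
  | .done, _, d => (.done, d, none)

/-- Start to check the current string. -/
def toCheck (i : Fin (phs.length + 1)) : Ctl J phs.length S :=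
  match phs[i.val]? with
  | some ph => .check i ph.start
  | none => .done

/-- Behaviour of the enumerating machine at the end of a sweep. -/
def finF : Ctl J phs.length S → InSym Γ → Ctl J phs.length S × Move × Option Δ
  | .item i main j, _ => match itemAt phs i main j with
    | some it => (.item i main (Fin.ofNat _ (j + 1)), .stay, it.last)
    | none => (if main then .inc i true else toCheck J phs i, .stay, none)
  | .check i s, a => (match phs[i.val]? with
    | some ph => if ph.good a s then .item i true 0 else .inc i true
    | none => .done, .stay, none)
  | .inc i c, _ => (if c then .incP i true else toCheck J phs i, .stay, none)
  | .incP i _, a => if a.isRight then (.rewind i, .stay, none) else (toCheck J phs i, .right, none)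
  | .rewind i, a => if a.isLeft then (.item (Fin.ofNat _ (i + 1)) false 0, .stay, none) else
    (.rewind i, .left, none)
  | .done, _ => (.done, .stay, none)

/-- The machine that executes the phases. -/
def toFM : FM Γ Δ (Fin 2 × Fin B) (Ctl J phs.length S) where
  start := .item 0 false 0
  accept := {.done}
  dflt := (0, 0)
  cell := cellF J phs
  fin := fun q a => {finF J phs q a}

variable (w : List Γ)

/-- The configuration after the next step. -/
def next (c : SM.Cfg Δ (Fin 2 × Fin B) (Ctl J phs.length S)) :
    SM.Cfg Δ (Fin 2 × Fin B) (Ctl J phs.length S) :=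
  let s := (toFM J phs).sw w c
  let t := finF J phs s.1 (readInput w c.head)
  ⟨t.1, min (t.2.1.apply c.head) (w.length + 1), s.2.1, c.out ++ s.2.2 ++ t.2.2.toList⟩

theorem step_iff {c c' : SM.Cfg Δ (Fin 2 × Fin B) (Ctl J phs.length S)} :
    (toFM J phs).Step w c c' ↔ c.state ≠ .done ∧ c' = next J phs w c := by
  simp [FM.Step, toFM, next]

/-- Reachability between configurations. -/
def Reach (c c' : SM.Cfg Δ (Fin 2 × Fin B) (Ctl J phs.length S)) : Prop :=
  Relation.ReflTransGen ((toFM J phs).Step w) c c'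

variable {J phs w}

theorem reach_head {c c' c'' : SM.Cfg Δ (Fin 2 × Fin B) (Ctl J phs.length S)}
    (hc : c.state ≠ .done) (h : next J phs w c = c') (h' : Reach J phs w c' c'') :
    Reach J phs w c c'' :=
  Relation.ReflTransGen.head ((step_iff J phs w).mpr ⟨hc, h.symm⟩) h'

variable {L p : ℕ} {xs : List (Fin 2 × Fin B)} {out : List Δ}

theorem sweep_item (a : InSym Γ) (i : Fin (phs.length + 1)) (main : Bool) (j : Fin (J + 1)) :
    sweep (fun q => cellF J phs q a) (.item i main j) xs =
      (.item i main j, xs, match itemAt phs i main j with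
        | some it => xs.filterMap it.cell
        | none => []) := by
  induction xs with
  | nil => cases itemAt phs i main j <;> rfl
  | cons d xs ih =>
    simp only [sweep, cellF, ih]
    cases itemAt phs i main j with
    | none => rfl
    | some it =>
      simp only [Option.bind_some, List.filterMap_cons]
      cases it.cell d <;> rfl

theorem sweep_check (a : InSym Γ) {i : Fin (phs.length + 1)} {ph : Phase Γ Δ (Fin 2 × Fin B) S}
    (hi : phs[i.val]? = some ph) (s : S) :
    sweep (fun q => cellF J phs q a) (.check i s) xs =
      (.check i (xs.foldl (ph.step a) s), xs, []) := by
  induction xs generalizing s with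
  | nil => rfl
  | cons d xs ih => simp only [sweep, cellF, hi, ih]; rfl

theorem sweep_inc (a : InSym Γ) (i : Fin (phs.length + 1)) (c : Bool) (u : List (Fin 2))
    (v : List (Fin B)) (h : u.length = v.length) :
    sweep (fun q => cellF J phs q a) (.inc i c) (u.zip v) =
      (.inc i (incDigits c v).1, u.zip (incDigits c v).2, []) := by
  induction v generalizing u c with
  | nil =>
    obtain rfl : u = [] := by simpa using h
    rfl
  | cons d v ih =>
    cases u with
    | nil => simp at h
    | cons e u =>
      simp only [List.zip_cons_cons, sweep, cellF, incDigits]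
      rw [ih _ u (by simpa using h)]
      rfl

theorem sweep_incP (a : InSym Γ) (ha : a.isRight = false) (i : Fin (phs.length + 1)) (c : Bool)
    (u : List (Fin 2)) (v : List (Fin B)) (h : u.length = v.length) :
    sweep (fun q => cellF J phs q a) (.incP i c) (u.zip v) =
      (.incP i (incDigits c u).1, (incDigits c u).2.zip v, []) := by
  induction v generalizing u c with
  | nil =>
    obtain rfl : u = [] := by simpa using h
    rfl
  | cons d v ih =>
    cases u with
    | nil => simp at h
    | cons e u =>
      simp only [List.zip_cons_cons, sweep, cellF, incDigits, ha]
      simp only [Bool.false_eq_true, if_false]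
      rw [ih _ u (by simpa using h)]
      rfl

theorem sweep_incP_right (a : InSym Γ) (ha : a.isRight = true) (i : Fin (phs.length + 1)) (c : Bool)
    (u : List (Fin 2)) (v : List (Fin B)) (h : u.length = v.length) :
    sweep (fun q => cellF J phs q a) (.incP i c) (u.zip v) =
      (.incP i c, (List.replicate v.length 0).zip v, []) := by
  induction v generalizing u with
  | nil =>
    obtain rfl : u = [] := by simpa using h
    rfl
  | cons d v ih =>
    cases u with
    | nil => simp at h
    | cons e u =>
      simp only [List.zip_cons_cons, sweep, cellF, ha, if_true]
      rw [ih u (by simpa using h)]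
      rfl

theorem sweep_rewind (a : InSym Γ) (i : Fin (phs.length + 1)) :
    sweep (fun q => cellF J phs q a) (.rewind i) xs = (.rewind i, xs, []) := by
  induction xs with
  | nil => rfl
  | cons d xs ih => simp only [sweep, cellF, ih]; rfl

variable {i : Fin (phs.length + 1)} {ph : Phase Γ Δ (Fin 2 × Fin B) S}

theorem reach_items (hp : p ≤ w.length + 1) (hi : phs[i.val]? = some ph) (main : Bool)
    (hJ : (if main then ph.items else ph.pre).length ≤ J) (k : ℕ) :
    ∀ j : Fin (J + 1), j.val + k = (if main then ph.items else ph.pre).length → ∀ out,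
    Reach J phs w ⟨.item i main j, p, xs, out⟩
      ⟨if main then .inc i true else .check i ph.start, p, xs,
        out ++ printAll ((if main then ph.items else ph.pre).drop j) xs⟩ := by
  induction k with
  | zero =>
    intro j hj out
    have h1 : itemAt phs i main j = none := by
      simp [itemAt, hi, ← hj]
    refine reach_head (by simp) ?_ .refl
    rw [List.drop_eq_nil_of_le (by omega)]
    have h2 : (toFM J phs).sw w ⟨.item i main j, p, xs, out⟩ = (.item i main j, xs, []) := by
      rw [FM.sw]; refine (sweep_item _ _ _ _).trans ?_; rw [h1]
    simp only [next, h2, finF, h1, toCheck, hi]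
    simp [Move.apply, hp, printAll]
  | succ k ih =>
    intro j hj out
    have hlt : j.val < (if main then ph.items else ph.pre).length := by omega
    have h1 : itemAt phs i main j = some ((if main then ph.items else ph.pre)[j.val]) := by
      simp [itemAt, hi]
    have hj' : (Fin.ofNat (J + 1) (j.val + 1)).val = j.val + 1 := by
      simp only [Fin.val_ofNat]; exact Nat.mod_eq_of_lt (by omega)
    have h2 : (toFM J phs).sw w ⟨.item i main j, p, xs, out⟩ = (.item i main j, xs,
        xs.filterMap ((if main then ph.items else ph.pre)[j.val]).cell) := by
      rw [FM.sw]; refine (sweep_item _ _ _ _).trans ?_; rw [h1]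
    refine reach_head (by simp) (c' := ⟨.item i main (Fin.ofNat (J + 1) (j.val + 1)), p, xs,
      out ++ ((if main then ph.items else ph.pre)[j.val]).print xs⟩) ?_ ?_
    · simp only [next, h2, finF, h1]
      simp [Move.apply, hp, Item.print]
    · have := ih (Fin.ofNat (J + 1) (j.val + 1)) (by omega) (out ++ ((if main then ph.items else ph.pre)[j.val]).print xs)
      rw [hj', List.append_assoc] at this
      rw [List.drop_eq_getElem_cons hlt]
      exact this

theorem reach_check (hp : p ≤ w.length + 1) (hi : phs[i.val]? = some ph) (hJ : ph.items.length ≤ J) :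
    Reach J phs w ⟨.check i ph.start, p, xs, out⟩ ⟨.inc i true, p, xs,
      out ++ if ph.accepts (readInput w p) xs then printAll ph.items xs else []⟩ := by
  have h2 : (toFM J phs).sw w ⟨.check i ph.start, p, xs, out⟩ =
      (.check i (xs.foldl (ph.step (readInput w p)) ph.start), xs, []) := sweep_check _ hi _
  by_cases h : ph.accepts (readInput w p) xs = true
  · refine reach_head (by simp) (c' := ⟨.item i true 0, p, xs, out⟩) ?_ ?_
    · simp only [next, h2, finF, hi]
      rw [accepts] at h
      simp [Move.apply, hp, h]
    · rw [if_pos h]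
      exact reach_items hp hi true hJ ph.items.length 0 (by simp) out
  · refine reach_head (by simp) ?_ .refl
    simp only [next, h2, finF, hi]
    rw [if_neg h]
    rw [accepts] at h
    simp [Move.apply, hp, h]

/-- The number `k` counts the strings that remain after the current one. The increment of the last
string overflows, which resets the string part to `0` and passes control to the position counter. -/
theorem reach_strings (hp : p ≤ w.length + 1) (hi : phs[i.val]? = some ph)
    (hJ : ph.items.length ≤ J) (k : ℕ) : ∀ m, m + k + 1 = B ^ L → ∀ out,
    Reach J phs w ⟨.check i ph.start, p, str B L p m, out⟩ ⟨.incP i true, p, str B L p 0,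
      out ++ (((List.range' m (k + 1)).map (str B L p)).filter
        (ph.accepts (readInput w p))).flatMap (printAll ph.items)⟩ := by
  have h2 : ∀ m < B ^ L, ∀ out, (toFM J phs).sw w ⟨.inc i true, p, str B L p m, out⟩ =
      (.inc i (decide (m + 1 = B ^ L)), str B L p (m + 1), []) := by
    intro m hm out
    refine (sweep_inc _ _ _ _ _ (by simp)).trans ?_
    rw [incDigits_digs _ _ hm]; rfl
  induction k with
  | zero =>
    intro m hm out
    refine (reach_check hp hi hJ).trans (reach_head (by simp) ?_ .refl)
    simp only [next, h2 m (by omega), finF]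
    rw [show m + 1 = B ^ L from hm]
    simp only [decide_true, if_true, str, digs_pow]
    rw [List.range'_succ]
    simp only [List.map_cons, List.range'_zero, List.map_nil]
    by_cases h : ph.accepts (readInput w p) ((digs 2 L p).zip (digs B L m)) = true <;>
      simp [str, h, Move.apply, hp]
  | succ k ih =>
    intro m hm out
    refine (reach_check hp hi hJ).trans (reach_head (by simp) (c' := ⟨.check i ph.start, p,
      str B L p (m + 1), out ++ if ph.accepts (readInput w p) (str B L p m) then
        printAll ph.items (str B L p m) else []⟩) ?_ ?_)
    · simp only [next, h2 m (by omega), finF]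
      have : m + 1 ≠ B ^ L := by omega
      simp [this, toCheck, hi, Move.apply, hp]
    · convert ih (m + 1) (by omega) (out ++ if ph.accepts (readInput w p) (str B L p m) then
        printAll ph.items (str B L p m) else []) using 2
      rw [List.range'_succ (n := k + 1), List.append_assoc]
      by_cases h : ph.accepts (readInput w p) (str B L p m) = true <;> simp [h]

/-- The position is kept both by the input head and as digits inside the string, where the finite
automaton can compare it with other data. By `hL` its counter does not overflow before the right end
marker; there its digits are overwritten with zeros. -/
theorem reach_positions (hL : w.length + 2 ≤ 2 ^ L) (hi : phs[i.val]? = some ph)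
    (hJ : ph.items.length ≤ J) (k : ℕ) :
    ∀ p, p + k = w.length + 1 → ∀ out,
    Reach J phs w ⟨.check i ph.start, p, str B L p 0, out⟩ ⟨.rewind i, w.length + 1, str B L 0 0,
      out ++ ((List.range' p (k + 1)).flatMap fun p => ((List.range (B ^ L)).map (str B L p)).filter
        (ph.accepts (readInput w p))).flatMap (printAll ph.items)⟩ := by
  have hB : 0 < B ^ L := Nat.pos_of_ne_zero (pow_ne_zero _ (NeZero.ne B))
  have h1 : ∀ p ≤ w.length + 1, ∀ out, Reach J phs w ⟨.check i ph.start, p, str B L p 0, out⟩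
      ⟨.incP i true, p, str B L p 0, out ++ (((List.range (B ^ L)).map (str B L p)).filter
        (ph.accepts (readInput w p))).flatMap (printAll ph.items)⟩ := by
    intro p hp out
    have := reach_strings (L := L) hp hi hJ (B ^ L - 1) 0 (by omega) out
    rwa [Nat.sub_add_cancel hB, ← List.range_eq_range'] at this
  induction k with
  | zero =>
    intro p hp out
    have ha : (readInput w p).isRight = true := by
      obtain rfl : p = w.length + 1 := by omega
      simp [readInput, InSym.isRight]
    refine (h1 p (by omega) out).trans (reach_head (by simp) ?_ .refl)
    have h2 : ∀ out, (toFM J phs).sw w ⟨.incP i true, p, str B L p 0, out⟩ =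
        (.incP i true, str B L 0 0, []) := by
      intro out
      refine (sweep_incP_right _ ha _ _ _ _ (by simp)).trans ?_
      rw [digs_length, str, digs_zero (B := 2)]
    simp only [next, h2, finF, ha]
    rw [List.range'_succ]
    simp [Move.apply, ← hp]
  | succ k ih =>
    intro p hp out
    have ha : (readInput w p).isRight = false := by
      cases p with
      | zero => rfl
      | succ p =>
        have : p < w.length := by omega
        simp [readInput, InSym.isRight, this]
    refine (h1 p (by omega) out).trans (reach_head (by simp) (c' := ⟨.check i ph.start, p + 1,
      str B L (p + 1) 0, out ++ (((List.range (B ^ L)).map (str B L p)).filter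
        (ph.accepts (readInput w p))).flatMap (printAll ph.items)⟩) ?_ ?_)
    · have h2 : ∀ out, ∃ c, (toFM J phs).sw w ⟨.incP i true, p, str B L p 0, out⟩ =
          (.incP i c, str B L (p + 1) 0, []) := by
        intro out
        have := sweep_incP (J := J) (readInput w p) ha i true (digs 2 L p) (digs B L 0) (by simp)
        rw [incDigits_digs _ _ (by omega)] at this
        exact ⟨_, this⟩
      obtain ⟨c, h2⟩ := h2 (out ++ (((List.range (B ^ L)).map (str B L p)).filter
        (ph.accepts (readInput w p))).flatMap (printAll ph.items))
      simp only [next, h2, finF, ha]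
      simp [toCheck, hi, Move.apply]
      omega
    · convert ih (p + 1) (by omega) (out ++ (((List.range (B ^ L)).map (str B L p)).filter
        (ph.accepts (readInput w p))).flatMap (printAll ph.items)) using 2
      rw [List.range'_succ (n := k + 1)]
      simp

theorem reach_rewind (hp : p ≤ w.length + 1) : Reach J phs w ⟨.rewind i, p, xs, out⟩
    ⟨.item (Fin.ofNat _ (i + 1)) false 0, 0, xs, out⟩ := by
  have h2 : ∀ p, (toFM J phs).sw w ⟨.rewind i, p, xs, out⟩ = (.rewind i, xs, []) := fun p =>
    sweep_rewind _ _
  induction p with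
  | zero =>
    refine reach_head (by simp) ?_ .refl
    simp [next, h2, finF, readInput, InSym.isLeft, Move.apply]
  | succ p ih =>
    refine reach_head (by simp) ?_ (ih (by omega))
    have ha : (readInput w (p + 1)).isLeft = false := by
      simp only [readInput]
      cases w[p]? <;> rfl
    simp only [next, h2, finF, ha]
    simp [Move.apply]
    omega

theorem reach_phases (hL : w.length + 2 ≤ 2 ^ L)
    (hJ : ∀ ph ∈ phs, ph.pre.length ≤ J ∧ ph.items.length ≤ J) (k : ℕ) :
    ∀ i : Fin (phs.length + 1), i.val + k = phs.length → ∀ out,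
    Reach J phs w ⟨.item i false 0, 0, str B L 0 0, out⟩ ⟨.done, 0, str B L 0 0,
      out ++ (phs.drop i).flatMap fun ph => ph.word L w⟩ := by
  induction k with
  | zero =>
    intro i hi out
    have h1 : phs[i.val]? = none := by simp [← hi]
    refine reach_head (by simp) ?_ .refl
    have h2 : (toFM J phs).sw w ⟨.item i false 0, 0, str B L 0 0, out⟩ =
        (.item i false 0, str B L 0 0, []) := by
      rw [FM.sw]; refine (sweep_item _ _ _ _).trans ?_; simp [itemAt, h1]
    rw [List.drop_eq_nil_of_le (by omega)]
    simp [next, h2, finF, itemAt, h1, toCheck, Move.apply]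
  | succ k ih =>
    intro i hi out
    have hlt : i.val < phs.length := by omega
    have h1 : phs[i.val]? = some phs[i.val] := by simp
    obtain ⟨hJ1, hJ2⟩ := hJ phs[i.val] (by simp)
    have hi' : (Fin.ofNat (phs.length + 1) (i.val + 1)).val = i.val + 1 := by
      simp only [Fin.val_ofNat]; exact Nat.mod_eq_of_lt (by omega)
    refine (reach_items (Nat.zero_le _) h1 false hJ1 (phs[i.val].pre.length) 0 (by simp) out).trans ?_
    refine (reach_positions hL h1 hJ2 (w.length + 1) 0 (by omega) _).trans ?_
    refine (reach_rewind le_rfl).trans ?_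
    have h3 := ih (Fin.ofNat _ (i.val + 1)) (by omega) (out ++ phs[i.val].word L w)
    rw [hi', List.append_assoc] at h3
    rw [List.drop_eq_getElem_cons hlt, List.flatMap_cons]
    refine (congrArg (fun o => Relation.ReflTransGen ((toFM J phs).Step w)
      ⟨.item (Fin.ofNat _ (i.val + 1)) false 0, 0, str B L 0 0, o⟩ _) ?_).mp h3
    rw [← List.range_eq_range']
    simp [word, hits]

theorem toFM_outputs (hL : w.length + 2 ≤ 2 ^ L)
    (hJ : ∀ ph ∈ phs, ph.pre.length ≤ J ∧ ph.items.length ≤ J) :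
    (toFM J phs).outputs L w = {phs.flatMap fun ph => ph.word L w} := by
  have h1 := reach_phases hL hJ phs.length 0 (by simp) []
  have h2 : (toFM J phs).initCfg L = ⟨.item 0 false 0, 0, str B L 0 0, []⟩ := by
    simp [FM.initCfg, toFM, str, digs_zero]
  -- The machine is deterministic and stops in `done`, so at most one final configuration can be
  -- reached.
  have key : ∀ c c' : SM.Cfg Δ (Fin 2 × Fin B) (Ctl J phs.length S), Reach J phs w c c' →
      c'.state = .done → ∀ c'', Reach J phs w c c'' → c''.state = .done → c' = c'' := by
    intro c c' h hd c'' h'' hd''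
    induction h using Relation.ReflTransGen.head_induction_on with
    | refl =>
      rcases Relation.ReflTransGen.cases_head h'' with rfl | ⟨m, hm, -⟩
      · rfl
      · exact absurd hd ((step_iff J phs w).mp hm).1
    | head h _ ih =>
      obtain ⟨hn, rfl⟩ := (step_iff J phs w).mp h
      rcases Relation.ReflTransGen.cases_head h'' with rfl | ⟨m, hm, h3⟩
      · exact absurd hd'' hn
      · obtain ⟨-, rfl⟩ := (step_iff J phs w).mp hm
        exact ih h3
  ext y
  simp only [FM.outputs, FM.Reachable, h2, Set.mem_singleton_iff]
  constructor
  · rintro ⟨c, hc, hd, rfl⟩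
    rw [← key _ _ h1 rfl c hc hd]
    simp
  · rintro rfl
    exact ⟨_, h1, rfl, by simp⟩

end Phase

/-- The concatenation of the words printed in the phases is computable in logarithmic space. -/
theorem exists_TM_of_phases {Γ Δ S : Type} [Finite S] {B : ℕ} [NeZero B] (b : ℕ)
    (phs : List (Phase Γ Δ (Fin 2 × Fin B) S)) :
    LogSpaceComputable fun w : List Γ => phs.flatMap fun ph => ph.word (strLen b w.length) w := by
  let J := (phs.map fun ph => ph.pre.length + ph.items.length).sum
  have hJ : ∀ ph ∈ phs, ph.pre.length ≤ J ∧ ph.items.length ≤ J := by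
    intro ph hph
    have : ph.pre.length + ph.items.length ≤ J :=
      List.single_le_sum (by simp) _ (List.mem_map.mpr ⟨ph, hph, rfl⟩)
    omega
  obtain ⟨M, h1, h2, h3⟩ := (Phase.toFM J phs).exists_TM b
  refine ⟨M, h2 fun q a => Set.subsingleton_singleton, h1, fun w => ?_⟩
  rw [h3, Phase.toFM_outputs (lt_two_pow_strLen b w.length).le hJ]

end Machine


/-! ### Hardness: normal forms of the output words of a finite graph. -/

namespace Machine

/-! ## Labelled graphs and their output words -/

namespace Graph

variable {X Δ : Type} (E : X → Option Δ → X → Prop) (acc : X → Prop)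

/-- Paths and their output words. -/
inductive Path : X → List Δ → X → Prop
  | nil (x : X) : Path x [] x
  | silent {x x' z : X} {y : List Δ} : E x none x' → Path x' y z → Path x y z
  | out {x x' z : X} {y : List Δ} {d : Δ} : E x (some d) x' → Path x' y z → Path x (d :: y) z

/-- The output words of the accepting paths. -/
def outs (x : X) : Set (List Δ) := {y | ∃ z, acc z ∧ Path E x y z}

/-- Silent paths with at most `k` steps. -/
def Sil : ℕ → X → X → Prop
  | 0, x, m => m = x
  | k + 1, x, m => ∃ x', (x' = x ∨ E x none x') ∧ Sil k x' m

/-- One block: an output symbol, or no output in an accepting state. -/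
def Blk (x : X) (l : Option Δ) (x' : X) : Prop :=
  (∃ d, l = some d ∧ E x l x') ∨ (l = none ∧ acc x ∧ x' = x)

/-- Words of blocks; between two blocks, there are at most `n` silent steps. -/
inductive Wd (n : ℕ) : X → List (Option Δ) → Prop
  | last {x : X} : acc x → Wd n x [none]
  | cons {x x' x'' : X} {l : Option Δ} {ls : List (Option Δ)} :
      Blk E acc x l x' → Sil E n x' x'' → Wd n x'' ls → Wd n x (l :: ls)

/-- The words with `n + 1` blocks. -/
def words (n : ℕ) (x : X) : Set (List (Option Δ)) :=
  {ls | ls.length = n + 1 ∧ ∃ m, Sil E n x m ∧ Wd E acc n m ls}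

variable {E acc}

theorem Path.append {x m z : X} {y y' : List Δ} (h : Path E x y m) (h' : Path E m y' z) :
    Path E x (y ++ y') z := by
  induction h with
  | nil => exact h'
  | silent h1 _ ih => exact .silent h1 (ih h')
  | out h1 _ ih => exact .out h1 (ih h')

theorem Path.split {x z : X} {y y' : List Δ} (h : Path E x (y ++ y') z) :
    ∃ m, Path E x y m ∧ Path E m y' z := by
  generalize hu : y ++ y' = u at h
  induction h generalizing y with
  | nil x =>
    obtain ⟨rfl, rfl⟩ := List.append_eq_nil_iff.mp hu
    exact ⟨x, .nil x, .nil x⟩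
  | silent h1 _ ih =>
    obtain ⟨m, h2, h3⟩ := ih hu
    exact ⟨m, .silent h1 h2, h3⟩
  | @out x x' z u d h1 h4 ih =>
    cases y with
    | nil =>
      obtain rfl : y' = _ := hu
      exact ⟨x, .nil x, .out h1 h4⟩
    | cons c y =>
      simp only [List.cons_append, List.cons.injEq] at hu
      obtain ⟨rfl, hu'⟩ := hu
      obtain ⟨m, h2, h3⟩ := ih hu'
      exact ⟨m, .out h1 h2, h3⟩

theorem Sil.path {k : ℕ} {x m : X} (h : Sil E k x m) : Path E x [] m := by
  induction k generalizing x with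
  | zero => obtain rfl : m = x := h; exact .nil _
  | succ k ih =>
    obtain ⟨x', rfl | h1, h2⟩ := h
    · exact ih h2
    · exact .silent h1 (ih h2)

theorem Sil.snoc {k : ℕ} {x m m' : X} (h : Sil E k x m) (h' : m' = m ∨ E m none m') :
    Sil E (k + 1) x m' := by
  induction k generalizing x with
  | zero => obtain rfl : m = x := h; exact ⟨m', h', rfl⟩
  | succ k ih =>
    obtain ⟨x', h1, h2⟩ := h
    exact ⟨x', h1, ih h2⟩

theorem path_nil_iff {x z : X} :
    Path E x [] z ↔ Relation.ReflTransGen (fun a b => E a none b) x z := by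
  constructor
  · intro h
    generalize hu : [] = u at h
    induction h with
    | nil => exact .refl
    | silent h1 _ ih => exact .head h1 (ih hu)
    | out => simp at hu
  · intro h
    induction h using Relation.ReflTransGen.head_induction_on with
    | refl => exact .nil _
    | head h1 _ ih => exact .silent h1 ih

/-- Silent paths can be shortened. -/
theorem sil_of_path [Finite X] {k : ℕ} (hk : Nat.card X ≤ k + 1) {x m : X} (h : Path E x [] m) :
    Sil E k x m := by
  rw [path_nil_iff] at h
  -- As long as a further step reaches a new vertex, the set of vertices reached grows by at least
  -- one; once it stops growing it is closed under silent edges.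
  have key : ∀ k, (∀ m, Relation.ReflTransGen (fun a b => E a none b) x m → Sil E k x m) ∨
      k + 1 ≤ {m | Sil E k x m}.ncard := by
    intro k
    induction k with
    | zero =>
      right
      have : {m | Sil E 0 x m} = {x} := rfl
      rw [this, Set.ncard_singleton]
    | succ k ih =>
      rcases ih with ih | ih
      · exact .inl fun m hm => (ih m hm).snoc (.inl rfl)
      · by_cases hs : ∀ m, Sil E (k + 1) x m → Sil E k x m
        · left
          intro m hm
          induction hm with
          | refl =>
            clear ih hs
            induction k with
            | zero => exact ⟨x, .inl rfl, rfl⟩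
            | succ k ih => exact ⟨x, .inl rfl, ih⟩
          | tail _ h2 ih' => exact (hs _ ih').snoc (.inr h2)
        · right
          push Not at hs
          obtain ⟨m, h1, h2⟩ := hs
          refine Nat.succ_le_of_lt (ih.trans_lt (Set.ncard_lt_ncard ⟨fun m hm => hm.snoc (.inl rfl),
            fun h => h2 (h h1)⟩ (Set.toFinite _)))
  rcases key k with hs | hs
  · exact hs m h
  · have : {m | Sil E k x m} = Set.univ :=
      Set.eq_of_subset_of_ncard_le (Set.subset_univ _) (by rw [Set.ncard_univ]; omega)
    have hm : m ∈ {m | Sil E k x m} := this ▸ Set.mem_univ m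
    exact hm

/-- The vertices of a path before the single symbols of the output word. -/
theorem Path.exists_stops {x z : X} {y : List Δ} (h : Path E x y z) :
    ∃ c : ℕ → X, c 0 = x ∧ Path E (c y.length) [] z ∧
      ∀ i j, i ≤ j → j ≤ y.length → Path E (c i) ((y.drop i).take (j - i)) (c j) := by
  induction y generalizing x with
  | nil =>
    refine ⟨fun _ => x, rfl, h, fun i j hij hj => ?_⟩
    simpa using Path.nil x
  | cons d y ih =>
    obtain ⟨m, h1, h2⟩ := Path.split (y := [d]) (y' := y) h
    obtain ⟨c, rfl, h3, h4⟩ := ih h2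
    refine ⟨fun | 0 => x | k + 1 => c k, rfl, h3, ?_⟩
    rintro (_ | i) (_ | j) hij hj
    · simpa using Path.nil x
    · simpa using h1.append (h4 0 j (Nat.zero_le _) (by simpa using hj))
    · omega
    · simpa using h4 i j (by omega) (by simpa using hj)

/-- If the set of output words is finite, then the output words are short. -/
theorem length_lt_of_finite [Finite X] {n : ℕ} (hn : Nat.card X ≤ n + 1) {x : X}
    (hfin : (outs E acc x).Finite) {y : List Δ} (hy : y ∈ outs E acc x) : y.length < n + 1 := by
  by_contra hlen
  push Not at hlen
  obtain ⟨z, hz, hp⟩ := hy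
  obtain ⟨c, rfl, hc1, hc2⟩ := hp.exists_stops
  have := Fintype.ofFinite X
  -- There are more stops, namely `y.length + 1`, than vertices.
  obtain ⟨i, j, hij, h⟩ : ∃ i j : Fin (y.length + 1), i < j ∧ c i = c j := by
    obtain ⟨i, j, hne, h⟩ := Fintype.exists_ne_map_eq_of_card_lt
      (fun i : Fin (y.length + 1) => c i) (by
        rw [Fintype.card_fin, ← Nat.card_eq_fintype_card]; omega)
    rcases lt_or_gt_of_ne hne with h' | h'
    · exact ⟨i, j, h', h⟩
    · exact ⟨j, i, h', h.symm⟩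
  have hlt : i.val < j.val := hij
  have hj := j.isLt
  let mid := (y.drop i).take (j - i)
  have hmid : mid.length = j - i := by
    simp [mid]; omega
  have hloop : Path E (c i) mid (c i) := by
    have := hc2 i j hlt.le (by omega)
    rwa [← h] at this
  have hstart : Path E (c 0) (y.take i) (c i) := by
    simpa using hc2 0 i (Nat.zero_le _) (by omega)
  have hend : Path E (c i) (y.drop i) z := by
    have := (hc2 i y.length (by omega) le_rfl).append hc1
    rwa [List.append_nil, List.take_of_length_le (by simp)] at this
  -- The loop between the equal stops emits the nonempty word `mid`. Repeating it gives outputs of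
  -- pairwise different lengths, contrary to finiteness.
  have hpump : ∀ k : ℕ, Path E (c i) (List.replicate k mid).flatten (c i) := by
    intro k
    induction k with
    | zero => exact .nil _
    | succ k ih => rw [List.replicate_succ, List.flatten_cons]; exact hloop.append ih
  refine Set.infinite_of_injective_forall_mem
    (f := fun k : ℕ => y.take i ++ ((List.replicate k mid).flatten ++ y.drop i)) ?_ ?_ hfin
  · intro k k' hkk
    have := congrArg List.length hkk
    simp only [List.length_append, List.length_flatten, List.map_replicate, hmid,
      List.sum_replicate, smul_eq_mul] at this
    have h3 : 0 < j.val - i.val := by omega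
    have h4 : k * (j.val - i.val) = k' * (j.val - i.val) := by omega
    exact Nat.eq_of_mul_eq_mul_right h3 h4
  · intro k
    exact ⟨z, hz, hstart.append ((hpump k).append hend)⟩

theorem Path.of_acc (hacc : ∀ x l x', acc x → ¬ E x l x') {x z : X} {y : List Δ} (hx : acc x)
    (h : Path E x y z) : y = [] ∧ z = x := by
  cases h with
  | nil => exact ⟨rfl, rfl⟩
  | silent h1 _ => exact absurd h1 (hacc _ _ _ hx)
  | out h1 _ => exact absurd h1 (hacc _ _ _ hx)

/-- A block `none` is possible in an accepting vertex only, and such a vertex has no outgoing edges.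
So all later blocks are `none` as well, and the word is an output followed by padding. -/
theorem Wd.exists_path (hacc : ∀ x l x', acc x → ¬ E x l x') {n : ℕ} {x : X} {ls : List (Option Δ)}
    (h : Wd E acc n x ls) :
    ∃ y j, ls = y.map some ++ List.replicate (j + 1) none ∧ y ∈ outs E acc x := by
  induction h with
  | last hx => exact ⟨[], 0, rfl, _, hx, .nil _⟩
  | @cons x x' x'' l ls h1 h2 _ ih =>
    obtain ⟨y, j, rfl, z, hz, hp⟩ := ih
    rcases h1 with ⟨d, rfl, h1⟩ | ⟨rfl, h1, rfl⟩
    · exact ⟨d :: y, j, rfl, z, hz, .out h1 (h2.path.append hp)⟩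
    · obtain ⟨rfl, rfl⟩ := Path.of_acc hacc h1 (h2.path.append hp)
      refine ⟨[], j + 1, rfl, _, hz, .nil _⟩

/-- Silent stretches of any length are cut down by `sil_of_path`. Behind the last symbol the path
waits in the accepting vertex `z` for the padding blocks. -/
theorem Path.exists_wd [Finite X] {n : ℕ} (hn : Nat.card X ≤ n + 1) {x z : X} {y : List Δ}
    (h : Path E x y z) (hz : acc z) (j : ℕ) :
    ∃ m, Sil E n x m ∧ Wd E acc n m (y.map some ++ List.replicate (j + 1) none) := by
  induction y generalizing x with
  | nil =>
    refine ⟨z, sil_of_path hn h, ?_⟩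
    clear h
    induction j with
    | zero => exact .last hz
    | succ j ih => exact .cons (.inr ⟨rfl, hz, rfl⟩) (sil_of_path hn (.nil z)) ih
  | cons d y ih =>
    generalize hu : d :: y = u at h
    induction h with
    | nil => simp at hu
    | silent h1 _ ih' =>
      obtain ⟨m, h2, h3⟩ := ih' hz ih hu
      exact ⟨m, sil_of_path hn (.silent h1 h2.path), h3⟩
    | out h1 h2 _ =>
      simp only [List.cons.injEq] at hu
      obtain ⟨rfl, rfl⟩ := hu
      obtain ⟨m, h3, h4⟩ := ih h2
      exact ⟨_, sil_of_path hn (.nil _), .cons (.inl ⟨d, rfl, h1⟩) h3 h4⟩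

/-- There are as many words of blocks as output words. -/
theorem encard_words [Finite X] (hacc : ∀ x l x', acc x → ¬ E x l x') {n : ℕ}
    (hn : Nat.card X ≤ n + 1) {x : X} (hfin : (outs E acc x).Finite) :
    (words E acc n x).encard = (outs E acc x).encard := by
  -- An output corresponds to its padding to `n + 1` blocks. As it has at most `n` symbols, the last
  -- block is always `none`.
  refine (Spanner.encard_eq_of_rel (fun y ls => y.length < n + 1 ∧
    ls = y.map some ++ List.replicate (n + 1 - y.length) none) ?_ ?_ ?_).symm
  · intro y hy
    have hlt := length_lt_of_finite hn hfin hy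
    obtain ⟨z, hz, hp⟩ := hy
    obtain ⟨m, h1, h2⟩ := hp.exists_wd hn hz (n - y.length)
    rw [show n - y.length + 1 = n + 1 - y.length by omega] at h2
    exact ⟨_, ⟨by simp; omega, m, h1, h2⟩, hlt, rfl⟩
  · rintro ls ⟨hl, m, h1, h2⟩
    obtain ⟨y, j, rfl, z, hz, hp⟩ := h2.exists_path hacc
    simp only [List.length_append, List.length_map, List.length_replicate] at hl
    refine ⟨y, ⟨z, hz, h1.path.append hp⟩, by omega, ?_⟩
    rw [← hl, Nat.add_sub_cancel_left]
  · rintro y y' ls ls' ⟨h1, rfl⟩ ⟨h2, rfl⟩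
    constructor
    · rintro rfl; rfl
    · intro h
      -- Deleting the padding recovers the output.
      have := congrArg List.reduceOption h
      simpa [List.reduceOption_append, List.reduceOption, List.filterMap_map] using this

end Graph

end Machine


/-! ### Hardness: a functional automaton whose spans spell words of blocks. -/

namespace Spanner

open Machine Machine.Graph

/-! ### Automata that spell words of blocks -/

/-- Phases of a block: silent steps, choice of a symbol, and end of the word. -/
inductive Ph (r : ℕ) where
  | start
  | run (j : Fin (r + 1))
  | fin

section Block

variable {σ X Δ : Type} {n r : ℕ}

/-- A vertex of the graph, the number of the block, the number of the silent step, and the phase. -/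
abbrev BState (X : Type) (n r : ℕ) : Type := X × Fin (n + 1) × Fin (n + 1) × Ph r

/-- The transitions of the automaton: a symbol is encoded by the length of a span. -/
inductive Trans (a : σ) (E : X → Option Δ → X → Prop) (acc : X → Prop) (e : Fin (r + 1) ≃ Option Δ) :
    BState X n r → Op σ (Fin (n + 1)) → BState X n r → Prop
  | sil {x x' : X} {i t t' : Fin (n + 1)} : t'.val = t.val + 1 → (x' = x ∨ E x none x') →
      Trans a E acc e (x, i, t, .start) (.letter a) (x', i, t', .start)
  | opn {x : X} {i t : Fin (n + 1)} : t.val = n →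
      Trans a E acc e (x, i, t, .start) (.opn i) (x, i, t, .run 0)
  | run {x : X} {i t : Fin (n + 1)} {j j' : Fin (r + 1)} : j'.val = j.val + 1 →
      Trans a E acc e (x, i, t, .run j) (.letter a) (x, i, t, .run j')
  | cls {x x' : X} {i i' t : Fin (n + 1)} {j : Fin (r + 1)} : i'.val = i.val + 1 →
      Blk E acc x (e j) x' → Trans a E acc e (x, i, t, .run j) (.cls i) (x', i', 0, .start)
  | fin {x : X} {i t : Fin (n + 1)} {j : Fin (r + 1)} : i.val = n → acc x → e j = none →
      Trans a E acc e (x, i, t, .run j) (.cls i) (x, 0, 0, .fin)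
  | loop {x : X} {i t : Fin (n + 1)} :
      Trans a E acc e (x, i, t, .fin) (.letter a) (x, i, t, .fin)

/-- Rename the variable of a label. -/
def Op.map {V W : Type} (f : V → W) : Op σ V → Op σ W
  | .letter a => .letter a
  | .opn x => .opn (f x)
  | .cls x => .cls (f x)

/-- The variable operations of a run. -/
def marks {V : Type} (ρ : List (Op σ V × ℕ)) : List (Op σ V × ℕ) :=
  ρ.filter fun s => match s.1 with
    | .letter _ => false
    | _ => true

/-- The variable operations of the run that spells a given word from the block `i` on. -/
def canon {V : Type} (vn : Fin (n + 1) → V) : ℕ → ℕ → List (Fin (r + 1)) → List (Op σ V × ℕ)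
  | _, _, [] => []
  | i, k, j :: js => (.opn (vn (Fin.ofNat _ i)), k) :: (.cls (vn (Fin.ofNat _ i)), k + j) ::
      canon vn (i + 1) (k + j + n) js

theorem mem_marks_opn {V : Type} {ρ : List (Op σ V × ℕ)} {x : V} {i : ℕ} :
    (Op.opn x, i) ∈ marks ρ ↔ (Op.opn x, i) ∈ ρ := by
  simp [marks]

theorem mem_marks_cls {V : Type} {ρ : List (Op σ V × ℕ)} {x : V} {i : ℕ} :
    (Op.cls x, i) ∈ marks ρ ↔ (Op.cls x, i) ∈ ρ := by
  simp [marks]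

section Canon

variable {V : Type} {vn : Fin (n + 1) → V}

theorem canon_mem {i k : ℕ} {js : List (Fin (r + 1))} {s : Op σ V × ℕ} (h : s ∈ canon vn i k js) :
    ∃ l, i ≤ l ∧ l < i + js.length ∧
      (s.1 = .opn (vn (Fin.ofNat _ l)) ∨ s.1 = .cls (vn (Fin.ofNat _ l))) := by
  induction js generalizing i k with
  | nil => simp [canon] at h
  | cons j js ih =>
    simp only [canon, List.mem_cons] at h
    simp only [List.length_cons]
    rcases h with rfl | rfl | h
    · exact ⟨i, le_rfl, by omega, .inl rfl⟩
    · exact ⟨i, le_rfl, by omega, .inr rfl⟩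
    · obtain ⟨l, h1, h2, h3⟩ := ih h
      exact ⟨l, by omega, by omega, h3⟩

theorem ofNat_inj {l l' : ℕ} (hl : l < n + 1) (hl' : l' < n + 1)
    (h : Fin.ofNat (n + 1) l = Fin.ofNat (n + 1) l') : l = l' := by
  have := congrArg Fin.val h
  simpa [Fin.ofNat, Nat.mod_eq_of_lt hl, Nat.mod_eq_of_lt hl'] using this

theorem canon_fresh (hv : vn.Injective) {i k : ℕ} {js : List (Fin (r + 1))} {s : Op σ V × ℕ}
    (hi : i + 1 + js.length ≤ n + 1) (h : s ∈ canon vn (i + 1) k js) :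
    s.1 ≠ .opn (vn (Fin.ofNat _ i)) ∧ s.1 ≠ .cls (vn (Fin.ofNat _ i)) := by
  obtain ⟨l, h1, h2, h3⟩ := canon_mem h
  have hne : vn (Fin.ofNat _ l) ≠ vn (Fin.ofNat _ i) := fun h => by
    have := ofNat_inj (by omega) (by omega) (hv h)
    omega
  rcases h3 with h3 | h3 <;> rw [h3]
  · exact ⟨fun h => hne (Op.opn.inj h), nofun⟩
  · exact ⟨nofun, fun h => hne (Op.cls.inj h)⟩

theorem canon_pairwise (hv : vn.Injective) {i k : ℕ} {js : List (Fin (r + 1))}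
    (hi : i + js.length ≤ n + 1) :
    (canon vn i k js : List (Op σ V × ℕ)).Pairwise fun s t => s.1 ≠ t.1 := by
  induction js generalizing i k with
  | nil => exact .nil
  | cons j js ih =>
    simp only [List.length_cons] at hi
    simp only [canon, List.pairwise_cons, List.mem_cons, forall_eq_or_imp]
    exact ⟨⟨by simp, fun s hs => (canon_fresh hv (by omega) hs).1.symm⟩,
      fun s hs => (canon_fresh hv (by omega) hs).2.symm, ih (by omega)⟩

theorem canon_opn {i k p : ℕ} {js : List (Fin (r + 1))} {x : V}
    (h : (Op.opn x, p) ∈ (canon vn i k js : List (Op σ V × ℕ))) :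
    ∃ q, p ≤ q ∧ (Op.cls x, q) ∈ (canon vn i k js : List (Op σ V × ℕ)) := by
  induction js generalizing i k with
  | nil => simp [canon] at h
  | cons j js ih =>
    simp only [canon, List.mem_cons, Prod.mk.injEq, Op.opn.injEq, reduceCtorEq, false_and,
      false_or] at h ⊢
    rcases h with ⟨rfl, rfl⟩ | h
    · exact ⟨_, Nat.le_add_right _ _, .inl ⟨rfl, rfl⟩⟩
    · obtain ⟨q, h1, h2⟩ := ih h; exact ⟨q, h1, .inr h2⟩

theorem canon_cls {i k p : ℕ} {js : List (Fin (r + 1))} {x : V}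
    (h : (Op.cls x, p) ∈ (canon vn i k js : List (Op σ V × ℕ))) :
    ∃ q, q ≤ p ∧ (Op.opn x, q) ∈ (canon vn i k js : List (Op σ V × ℕ)) := by
  induction js generalizing i k with
  | nil => simp [canon] at h
  | cons j js ih =>
    simp only [canon, List.mem_cons, Prod.mk.injEq, Op.cls.injEq, reduceCtorEq, false_and,
      false_or] at h ⊢
    rcases h with ⟨rfl, rfl⟩ | h
    · exact ⟨_, Nat.le_add_right _ _, .inl ⟨rfl, rfl⟩⟩
    · obtain ⟨q, h1, h2⟩ := ih h; exact ⟨q, h1, .inr h2⟩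

theorem canon_all {i k l : ℕ} {js : List (Fin (r + 1))} (h1 : i ≤ l) (h2 : l < i + js.length) :
    ∃ p, (Op.opn (vn (Fin.ofNat _ l)), p) ∈ (canon vn i k js : List (Op σ V × ℕ)) := by
  induction js generalizing i k with
  | nil => simp at h2; omega
  | cons j js ih =>
    simp only [List.length_cons] at h2
    simp only [canon, List.mem_cons]
    rcases h1.eq_or_lt with rfl | h1
    · exact ⟨k, .inl rfl⟩
    · obtain ⟨p, hp⟩ := ih (i := i + 1) (k := k + j + n) h1 (by omega)
      exact ⟨p, .inr (.inr hp)⟩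

/-- The closing position of the first block determines its symbol, and hence the position `k + j +
n` at which the next block opens. So closing positions alone determine the word, block by block. -/
theorem canon_inj (hv : vn.Injective) {i k : ℕ} {js js' : List (Fin (r + 1))}
    (hi : i + js.length ≤ n + 1) (hl : js.length = js'.length)
    (h : ∀ x p, (Op.cls x, p) ∈ (canon vn i k js : List (Op σ V × ℕ)) →
      (Op.cls x, p) ∈ (canon vn i k js' : List (Op σ V × ℕ))) : js = js' := by
  induction js generalizing i k js' with
  | nil => exact (List.length_eq_zero_iff.mp hl.symm).symm
  | cons j js ih =>
    cases js' with
    | nil => simp at hl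
    | cons j' js' =>
      simp only [List.length_cons] at hi hl
      have h1 := h (vn (Fin.ofNat _ i)) (k + j) (by simp [canon])
      simp only [canon, List.mem_cons, Prod.mk.injEq, reduceCtorEq, false_and, true_and,
        false_or] at h1
      have hj : j = j' := by
        rcases h1 with h1 | h1
        · exact Fin.ext (by omega)
        · exact absurd rfl (canon_fresh hv (by omega) h1).2
      subst hj
      refine congrArg (j :: ·) (ih (i := i + 1) (k := k + j + n) (js' := js') (by omega) (by omega)
        fun x p hp => ?_)
      have h2 := h x p (List.mem_cons_of_mem _ (List.mem_cons_of_mem _ hp))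
      simp only [canon, List.mem_cons, Prod.mk.injEq, reduceCtorEq, false_and,
        false_or] at h2
      rcases h2 with ⟨h2, -⟩ | h2
      · exact absurd (by rw [h2]) (canon_fresh hv (by omega) hp).2
      · exact h2

/-- Validity is a property of the variable operations alone, and in the canonical sequence each of
the `n + 1` variables is opened once and closed once, not earlier. -/
theorem valid_of_marks (hv : vn.Injective) {k : ℕ} {js : List (Fin (r + 1))}
    {ρ : List (Op σ V × ℕ)} (hl : js.length = n + 1) (h : marks ρ = canon vn 0 k js) : Valid ρ := by
  refine ⟨?_, fun x i hi => ?_, fun x i hi => ?_⟩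
  · have := canon_pairwise (σ := σ) hv (i := 0) (k := k) (js := js) (by omega)
    rw [← h, marks, List.pairwise_filter] at this
    refine this.imp ?_
    rintro ⟨o, p⟩ ⟨o', p'⟩ h1 (rfl : o = o')
    cases o with
    | letter a => exact ⟨a, rfl⟩
    | opn x => exact absurd rfl (h1 rfl rfl)
    | cls x => exact absurd rfl (h1 rfl rfl)
  · rw [← mem_marks_opn, h] at hi
    obtain ⟨q, h1, h2⟩ := canon_opn hi
    exact ⟨q, h1, mem_marks_cls.mp (h ▸ h2)⟩
  · rw [← mem_marks_cls, h] at hi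
    obtain ⟨q, h1, h2⟩ := canon_cls hi
    exact ⟨q, h1, mem_marks_opn.mp (h ▸ h2)⟩

end Canon

/-- The automaton `A` spells the words of blocks of the graph, from the vertex `x₀` on. -/
structure Spells {V S : Type} (A : VA σ V S) (a : σ) (E : X → Option Δ → X → Prop) (acc : X → Prop)
    (e : Fin (r + 1) ≃ Option Δ) (x₀ : X) (nm : BState X n r → S) (vn : Fin (n + 1) → V) : Prop where
  nm_inj : nm.Injective
  vn_inj : vn.Injective
  init : A.init = nm (x₀, 0, 0, .start)
  trans : ∀ p o q, (p, o, q) ∈ A.trans ↔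
    ∃ s o' s', Trans a E acc e s o' s' ∧ p = nm s ∧ o = o'.map vn ∧ q = nm s'
  final : ∀ q ∈ A.final, ∃ x i t, q = nm (x, i, t, .fin)
  mem_final : ∀ (s : BState X n r) (o : Op σ (Fin (n + 1))) (x : X),
    Trans a E acc e s o (x, 0, 0, .fin) → nm (x, 0, 0, .fin) ∈ A.final

variable {V S : Type} {A : VA σ V S} {a : σ} {E : X → Option Δ → X → Prop} {acc : X → Prop}
  {e : Fin (r + 1) ≃ Option Δ} {x₀ : X} {nm : BState X n r → S} {vn : Fin (n + 1) → V} {d : List σ}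

/-- What the runs from a state to the end look like. -/
def Spec (E : X → Option Δ → X → Prop) (acc : X → Prop) (e : Fin (r + 1) ≃ Option Δ)
    (vn : Fin (n + 1) → V) (k : ℕ) (ρ : List (Op σ V × ℕ)) : BState X n r → Prop
  | (x, i, t, .start) => ∃ m, ∃ js : List (Fin (r + 1)), Sil E (n - t) x m ∧
      Wd E acc n m (js.map e) ∧ js.length = n + 1 - i ∧ marks ρ = canon vn i (k + (n - t)) js
  | (x, i, _, .run j) => ∃ j' : Fin (r + 1), ∃ js : List (Fin (r + 1)), j ≤ j' ∧
      Wd E acc n x ((j' :: js).map e) ∧ js.length + 1 = n + 1 - i ∧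
      marks ρ = (.cls (vn i), k + (j' - j)) :: canon vn (i + 1) (k + (j' - j) + n) js
  | (_, _, _, .fin) => marks ρ = []

/-- The counter `t` forces exactly `n - t` more letters before the variable is opened, whatever
silent steps are made meanwhile, and the symbol of the block is fixed only when the variable is
closed. Hence the positions of all markers depend on the word `js` alone. -/
theorem Spells.sound (h : Spells A a E acc e x₀ nm vn) {s : BState X n r} {p f : S} {k l : ℕ}
    {ρ : List (Op σ V × ℕ)} (hr : A.Run d p k ρ f l) (hp : p = nm s) (hf : f ∈ A.final) :
    Spec E acc e vn k ρ s := by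
  induction hr generalizing s with
  | nil p k =>
    obtain ⟨x, i, t, hq⟩ := h.final _ hf
    rw [hp] at hq
    rw [h.nm_inj hq]
    rfl
  | @letter p p' f b k l ρ h1 h2 _ ih =>
    obtain ⟨s₁, o, s', hT, h3, ho, h4⟩ := (h.trans _ _ _).mp h1
    obtain rfl := h.nm_inj (hp.symm.trans h3)
    have IH := ih h4 hf
    have hm : marks ((Op.letter b, k) :: ρ) = marks ρ := rfl
    cases hT with
    | @sil x x' i t t' ht hx =>
      obtain ⟨m, js, g1, g2, g3, g4⟩ := IH
      have ht' := t'.isLt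
      refine ⟨m, js, ?_, g2, g3, ?_⟩
      · rw [show n - t.val = (n - t'.val) + 1 by omega]
        exact ⟨x', hx, g1⟩
      · rw [hm, g4, show k + 1 + (n - t'.val) = k + (n - t.val) by omega]
    | opn => simp [Op.map] at ho
    | @run x i t j j' hj =>
      obtain ⟨j₁, js, g1, g2, g3, g4⟩ := IH
      have g1' : j'.val ≤ j₁.val := g1
      refine ⟨j₁, js, Fin.le_def.mpr (by omega), g2, g3, ?_⟩
      rw [hm, g4, show k + 1 + (j₁.val - j'.val) = k + (j₁.val - j.val) by omega]
    | cls => simp [Op.map] at ho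
    | fin => simp [Op.map] at ho
    | loop => exact IH
  | @opn p p' f y k l ρ h1 _ ih =>
    obtain ⟨s₁, o, s', hT, h3, ho, h4⟩ := (h.trans _ _ _).mp h1
    obtain rfl := h.nm_inj (hp.symm.trans h3)
    have IH := ih h4 hf
    have hm : marks ((Op.opn y, k) :: ρ) = (Op.opn y, k) :: marks ρ := rfl
    cases hT with
    | @opn x i t ht =>
      obtain ⟨j', js, g1, g2, g3, g4⟩ := IH
      simp only [Op.map, Op.opn.injEq] at ho
      subst ho
      refine ⟨x, j' :: js, ?_, g2, g3, ?_⟩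
      · rw [ht, Nat.sub_self]; rfl
      · have hi : Fin.ofNat (n + 1) i.val = i := Fin.ext (Nat.mod_eq_of_lt i.isLt)
        rw [hm, g4, canon, hi]
        simp [ht]
    | _ => simp [Op.map] at ho
  | @cls p p' f y k l ρ h1 _ ih =>
    obtain ⟨s₁, o, s', hT, h3, ho, h4⟩ := (h.trans _ _ _).mp h1
    obtain rfl := h.nm_inj (hp.symm.trans h3)
    have IH := ih h4 hf
    have hm : marks ((Op.cls y, k) :: ρ) = (Op.cls y, k) :: marks ρ := rfl
    cases hT with
    | @cls x x' i i' t j hi hx =>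
      obtain ⟨m, js, g1, g2, g3, g4⟩ := IH
      simp only [Op.map, Op.cls.injEq] at ho
      subst ho
      have := i'.isLt
      refine ⟨j, js, le_rfl, .cons hx (by simpa using g1) g2, by omega, ?_⟩
      rw [hm, g4, hi]
      simp
    | @fin x i t j hi hx hj =>
      simp only [Op.map, Op.cls.injEq] at ho
      subst ho
      refine ⟨j, [], le_rfl, ?_, by simp [hi], ?_⟩
      · simpa [hj] using Wd.last hx
      · have IH' : marks ρ = [] := IH
        simp [hm, IH', canon]
    | _ => simp [Op.map] at ho

theorem Spells.run_sil (h : Spells A a E acc e x₀ nm vn) {len : ℕ} {x m : X} {k q : ℕ}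
    (hs : Sil E k x m) (i t t' : Fin (n + 1)) (ht : t'.val = t.val + k) (hq : 1 ≤ q)
    (hk : q + k ≤ len + 1) :
    ∃ ρ, A.Run (List.replicate len a) (nm (x, i, t, .start)) q ρ (nm (m, i, t', .start)) (q + k) ∧
      marks ρ = [] := by
  induction k generalizing x t q with
  | zero =>
    obtain rfl : m = x := hs
    obtain rfl : t' = t := Fin.ext ht
    exact ⟨[], .nil _ _, rfl⟩
  | succ k ih =>
    obtain ⟨x', hx, hs⟩ := hs
    have ht' := t'.isLt
    obtain ⟨ρ, h1, h2⟩ := ih (q := q + 1) hs ⟨t.val + 1, by omega⟩ (by simp only; omega) (by omega)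
      (by omega)
    refine ⟨(Op.letter a, q) :: ρ, .letter ((h.trans _ _ _).mpr
      ⟨_, _, _, .sil (t' := ⟨t.val + 1, by omega⟩) rfl hx, rfl, rfl, rfl⟩) ?_ ?_, h2⟩
    · exact List.getElem?_replicate_of_lt (by omega)
    · rwa [show q + (k + 1) = q + 1 + k by omega]

theorem Spells.run_run (h : Spells A a E acc e x₀ nm vn) {len : ℕ} (x : X) {k q : ℕ}
    (i t : Fin (n + 1)) (j j' : Fin (r + 1)) (hj : j'.val = j.val + k) (hq : 1 ≤ q)
    (hk : q + k ≤ len + 1) :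
    ∃ ρ, A.Run (List.replicate len a) (nm (x, i, t, .run j)) q ρ (nm (x, i, t, .run j')) (q + k) ∧
      marks ρ = [] := by
  induction k generalizing j q with
  | zero =>
    obtain rfl : j' = j := Fin.ext hj
    exact ⟨[], .nil _ _, rfl⟩
  | succ k ih =>
    have hj' := j'.isLt
    obtain ⟨ρ, h1, h2⟩ := ih (q := q + 1) ⟨j.val + 1, by omega⟩ (by simp only; omega) (by omega)
      (by omega)
    refine ⟨(Op.letter a, q) :: ρ, .letter ((h.trans _ _ _).mpr
      ⟨_, _, _, .run (j' := ⟨j.val + 1, by omega⟩) rfl, rfl, rfl, rfl⟩) ?_ ?_, h2⟩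
    · exact List.getElem?_replicate_of_lt (by omega)
    · rwa [show q + (k + 1) = q + 1 + k by omega]

theorem Spells.run_loop (h : Spells A a E acc e x₀ nm vn) {len : ℕ} (x : X) {k q : ℕ}
    (i t : Fin (n + 1)) (hq : 1 ≤ q) (hk : q + k ≤ len + 1) :
    ∃ ρ, A.Run (List.replicate len a) (nm (x, i, t, .fin)) q ρ (nm (x, i, t, .fin)) (q + k) ∧
      marks ρ = [] := by
  induction k generalizing q with
  | zero => exact ⟨[], .nil _ _, rfl⟩
  | succ k ih =>
    obtain ⟨ρ, h1, h2⟩ := ih (q := q + 1) (by omega) (by omega)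
    refine ⟨(Op.letter a, q) :: ρ, .letter ((h.trans _ _ _).mpr
      ⟨_, _, _, .loop, rfl, rfl, rfl⟩) ?_ ?_, h2⟩
    · exact List.getElem?_replicate_of_lt (by omega)
    · rwa [show q + (k + 1) = q + 1 + k by omega]

theorem marks_append {ρ ρ' : List (Op σ V × ℕ)} : marks (ρ ++ ρ') = marks ρ ++ marks ρ' :=
  List.filter_append ..

/-- A block uses at most `r` letters for its span, and at most `n` letters are read before the next
one opens. This is the budget `r + n` per block in `hlen`. -/
theorem Spells.complete (h : Spells A a E acc e x₀ nm vn) {len : ℕ} {m : X} {q : ℕ}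
    {js : List (Fin (r + 1))} {i t : Fin (n + 1)} (hw : Wd E acc n m (js.map e)) (ht : t.val = n)
    (hi : js.length = n + 1 - i) (hq : 1 ≤ q) (hlen : q + js.length * (r + n) ≤ len + 1) :
    ∃ ρ, ∃ f ∈ A.final, A.Run (List.replicate len a) (nm (m, i, t, .start)) q ρ f (len + 1) ∧
      marks ρ = canon vn i q js := by
  have hofNat : Fin.ofNat (n + 1) i.val = i := Fin.ext (Nat.mod_eq_of_lt i.isLt)
  induction js generalizing m q i t with
  | nil => simp at hi; omega
  | cons j js ih =>
    have hj := j.isLt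
    simp only [List.length_cons] at hi hlen
    have hlen' : q + js.length * (r + n) + (r + n) ≤ len + 1 := by linarith
    obtain ⟨ρ₁, g1, g2⟩ := h.run_run (len := len) m (k := j.val) (q := q) i t 0 j (by simp) hq (by omega)
    have step₁ : A.Run (List.replicate len a) (nm (m, i, t, .start)) q ((Op.opn (vn i), q) :: ρ₁)
        (nm (m, i, t, .run j)) (q + j) :=
      .opn ((h.trans _ _ _).mpr ⟨_, _, _, .opn ht, rfl, rfl, rfl⟩) g1
    have m₁ : marks ((Op.opn (vn i), q) :: ρ₁) = [(Op.opn (vn i), q)] :=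
      congrArg ((Op.opn (vn i), q) :: ·) g2
    by_cases hn : i.val = n
    · obtain rfl : js = [] := List.length_eq_zero_iff.mp (by omega)
      have hjm : acc m ∧ e j = none := by
        simp only [List.map_cons, List.map_nil] at hw
        generalize hl : [e j] = l at hw
        cases hw with
        | last hm => exact ⟨hm, by simpa using hl⟩
        | cons _ _ h3 =>
          simp only [List.cons.injEq] at hl
          rw [← hl.2] at h3
          cases h3
      have hT : Trans a E acc e (m, i, t, .run j) (.cls i) (m, 0, 0, .fin) := .fin hn hjm.1 hjm.2
      -- Behind the last block the rest of the document is consumed by the loop of the final phase.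
      obtain ⟨ρ₂, g3, g4⟩ := h.run_loop (len := len) m (k := len + 1 - (q + j)) (q := q + j) 0 0
        (by omega) (by omega)
      rw [show q + j + (len + 1 - (q + j)) = len + 1 by omega] at g3
      refine ⟨_, _, h.mem_final _ _ _ hT, step₁.append
        (.cls ((h.trans _ _ _).mpr ⟨_, _, _, hT, rfl, rfl, rfl⟩) g3), ?_⟩
      have m₂ : marks ((Op.cls (vn i), q + j.val) :: ρ₂) = [(Op.cls (vn i), q + j.val)] :=
        congrArg ((Op.cls (vn i), q + j.val) :: ·) g4
      simp only [marks_append, m₁, m₂, canon, hofNat]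
      rfl
    · have hi' := i.isLt
      simp only [List.map_cons] at hw
      generalize ho : e j = o at hw
      generalize hl : js.map e = l at hw
      cases hw with
      | last hm => simp at hl; subst hl; simp at hi; omega
      | @cons _ x' x'' _ _ h1 h2 h3 =>
        subst hl
        obtain ⟨ρ₂, g3, g4⟩ := h.run_sil (len := len) (q := q + j) h2 ⟨i.val + 1, by omega⟩ 0 t
          (by simp [ht]) (by omega) (by omega)
        obtain ⟨ρ₃, f, hf, g5, g6⟩ := ih (i := ⟨i.val + 1, by omega⟩) (q := q + j + n) h3 ht
          (by simp only; omega) (by omega) (by omega)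
          (Fin.ext (Nat.mod_eq_of_lt (by simp only; omega)))
        refine ⟨_, f, hf, step₁.append (.cls ((h.trans _ _ _).mpr
          ⟨_, _, _, .cls (i' := ⟨i.val + 1, by omega⟩) rfl (ho ▸ h1), rfl, rfl, rfl⟩) (g3.append g5)), ?_⟩
        have m₂ : marks ((Op.cls (vn i), q + j.val) :: (ρ₂ ++ ρ₃)) =
            (Op.cls (vn i), q + j.val) :: marks ρ₃ := by
          refine congrArg ((Op.cls (vn i), q + j.val) :: ·) (?_ : marks (ρ₂ ++ ρ₃) = _)
          rw [marks_append, g4]; rfl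
        simp only [marks_append, m₁, m₂, g6, canon, hofNat]
        rfl

/-- The accepting runs of the automaton. -/
theorem Spells.accepting (h : Spells A a E acc e x₀ nm vn) {ρ : List (Op σ V × ℕ)}
    (hρ : A.Accepting d ρ) : ∃ js : List (Fin (r + 1)), js.length = n + 1 ∧
      js.map e ∈ words E acc n x₀ ∧ marks ρ = canon vn 0 (1 + n) js := by
  obtain ⟨f, hf, hr⟩ := hρ
  obtain ⟨m, js, h1, h2, h3, h4⟩ := h.sound hr h.init hf
  simp only [Fin.coe_ofNat_eq_mod, Nat.zero_mod, Nat.sub_zero] at h1 h3 h4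
  exact ⟨js, h3, ⟨by simp [h3], m, h1, h2⟩, h4⟩

/-- An accepting run over any document has the canonical markers of a word with `n + 1` blocks.
These are valid, and there are as many blocks as variables, so no variable is missed. -/
theorem Spells.functional (h : Spells A a E acc e x₀ nm vn) : A.Functional := by
  intro d ρ hρ
  obtain ⟨js, h1, -, h2⟩ := h.accepting hρ
  refine ⟨valid_of_marks h.vn_inj h1 h2, ?_⟩
  have key : ∀ x, (∃ i, x = vn i) → ∃ i, (Op.opn x, i) ∈ ρ ∨ (Op.cls x, i) ∈ ρ := by
    rintro _ ⟨i, rfl⟩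
    obtain ⟨p, hp⟩ := canon_all (σ := σ) (vn := vn) (i := 0) (k := 1 + n) (l := i.val) (js := js)
      (Nat.zero_le _) (by have := i.isLt; omega)
    rw [← h2, mem_marks_opn, show Fin.ofNat (n + 1) i.val = i from
      Fin.ext (Nat.mod_eq_of_lt i.isLt)] at hp
    exact ⟨p, .inl hp⟩
  rintro x ⟨p, q, hx | hx⟩
  · obtain ⟨s, o, s', -, -, ho, -⟩ := (h.trans _ _ _).mp hx
    cases o <;> simp [Op.map] at ho
    exact key x ⟨_, ho⟩
  · obtain ⟨s, o, s', -, -, ho, -⟩ := (h.trans _ _ _).mp hx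
    cases o <;> simp [Op.map] at ho
    exact key x ⟨_, ho⟩

/-- On long documents, the automaton has as many output mappings as there are words. -/
theorem Spells.encard_sem (h : Spells A a E acc e x₀ nm vn) {len : ℕ}
    (hlen : n + (n + 1) * (r + n) ≤ len) :
    (A.sem (List.replicate len a)).encard = (words E acc n x₀).encard := by
  refine (encard_eq_of_rel (fun ls μ => ∃ js ρ, ls = js.map e ∧ js.length = n + 1 ∧
    A.Accepting (List.replicate len a) ρ ∧ marks ρ = canon vn 0 (1 + n) js ∧ Defines ρ μ)
      ?_ ?_ ?_).symm
  · rintro ls ⟨hl, m, h1, h2⟩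
    have hls : ls = (ls.map e.symm).map e := by simp
    rw [hls] at h2
    obtain ⟨ρ₁, g1, g2⟩ := h.run_sil (len := len) (q := 1) h1 0 0 (Fin.last n) (by simp) le_rfl
      (by omega)
    obtain ⟨ρ₂, f, hf, g3, g4⟩ := h.complete (len := len) (q := 1 + n) (t := Fin.last n) (i := 0) h2
      rfl (by simp [hl]) (by omega) (by simp [hl]; omega)
    have hacc : A.Accepting (List.replicate len a) (ρ₁ ++ ρ₂) :=
      ⟨f, hf, by rw [h.init, List.length_replicate]; exact g1.append g3⟩
    have hv := (h.functional _ _ hacc).1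
    obtain ⟨μ, hμ⟩ := hv.exists_defines
    refine ⟨μ, ⟨_, hacc, hv, hμ⟩, ls.map e.symm, _, hls, by simp [hl], hacc, ?_, hμ⟩
    rw [marks_append, g2, g4]; rfl
  · rintro μ ⟨ρ, hacc, hv, hμ⟩
    obtain ⟨js, h1, h2, h3⟩ := h.accepting hacc
    exact ⟨_, h2, js, ρ, rfl, h1, hacc, h3, hμ⟩
  · rintro _ _ μ μ' ⟨js, ρ, rfl, h1, hacc, h2, hμ⟩ ⟨js', ρ', rfl, h1', hacc', h2', hμ'⟩
    have pos : ∀ {ρ}, A.Accepting (List.replicate len a) ρ → ∀ s ∈ ρ, 1 ≤ s.2 := by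
      rintro ρ ⟨q, _, h⟩ s hs; exact (h.le.2 s hs).1
    rw [hμ.eq_iff hμ' (h.functional _ _ hacc).1 (h.functional _ _ hacc').1 (pos hacc) (pos hacc'),
      (List.map_injective_iff.mpr e.injective).eq_iff]
    simp only [← mem_marks_opn (ρ := ρ), ← mem_marks_opn (ρ := ρ'), ← mem_marks_cls (ρ := ρ),
      ← mem_marks_cls (ρ := ρ'), h2, h2']
    constructor
    · rintro rfl; simp
    · intro H
      exact canon_inj (σ := σ) h.vn_inj (by omega) (by omega) fun x p => (H x p).2.mp

end Block

end Spanner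


/-! ### Hardness: a toolbox of finite automata for local conditions and addition. -/

namespace Machine

/-! ## Finite automata on strings, with the scanned input symbol as a parameter -/

/-- A deterministic finite automaton that knows one input symbol. -/
structure Aut (Γ A S : Type) where
  start : S
  step : InSym Γ → S → A → S
  good : InSym Γ → S → Bool

namespace Aut

variable {Γ A A' S S' : Type}

def accepts (M : Aut Γ A S) (a : InSym Γ) (xs : List A) : Bool :=
  M.good a (xs.foldl (M.step a) M.start)

/-- Apply a function to the letters. -/
def comap (f : A' → A) (M : Aut Γ A S) : Aut Γ A' S where
  start := M.start
  step a s d := M.step a s (f d)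
  good := M.good

theorem accepts_comap (f : A' → A) (M : Aut Γ A S) (a : InSym Γ) (xs : List A') :
    (M.comap f).accepts a xs = M.accepts a (xs.map f) := by
  simp [accepts, comap, List.foldl_map]

/-- Product automaton. -/
def and (M : Aut Γ A S) (M' : Aut Γ A S') : Aut Γ A (S × S') where
  start := (M.start, M'.start)
  step a s d := (M.step a s.1 d, M'.step a s.2 d)
  good a s := M.good a s.1 && M'.good a s.2

theorem accepts_and (M : Aut Γ A S) (M' : Aut Γ A S') (a : InSym Γ) (xs : List A) :
    (M.and M').accepts a xs = (M.accepts a xs && M'.accepts a xs) := by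
  have h : ∀ s s', xs.foldl ((M.and M').step a) (s, s') =
      (xs.foldl (M.step a) s, xs.foldl (M'.step a) s') := by
    induction xs with
    | nil => exact fun _ _ => rfl
    | cons d xs ih => exact fun s s' => ih _ _
  simp only [accepts]
  rw [show (M.and M').start = (M.start, M'.start) from rfl, h]
  rfl

/-- The automaton that accepts everything. -/
def triv (s : S) : Aut Γ A S where
  start := s
  step _ s _ := s
  good _ _ := true

theorem accepts_triv (s : S) (a : InSym Γ) (xs : List A) : (triv s).accepts a xs = true := rfl

/-- Add a condition on the input symbol. -/
def guard (g : InSym Γ → Bool) (M : Aut Γ A S) : Aut Γ A S where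
  start := M.start
  step := M.step
  good a s := g a && M.good a s

theorem accepts_guard (g : InSym Γ → Bool) (M : Aut Γ A S) (a : InSym Γ) (xs : List A) :
    (M.guard g).accepts a xs = (g a && M.accepts a xs) := rfl

/-- Check a condition on every letter. -/
def all (p : A → Bool) : Aut Γ A Bool where
  start := true
  step _ s d := s && p d
  good _ s := s

theorem accepts_all (p : A → Bool) (a : InSym Γ) (xs : List A) :
    (all p).accepts a xs = true ↔ ∀ x ∈ xs, p x = true := by
  have h : ∀ s, xs.foldl (fun s d => s && p d) s = (s && xs.all p) := by
    induction xs with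
    | nil => simp
    | cons d xs ih => intro s; simp [ih, Bool.and_assoc]
  simp [accepts, all, h]

/-- Check a condition on every letter and its predecessor, and a condition on the last letter. -/
def loc (p : Option A → A → Bool) (l : A → Bool) : Aut Γ A (Option A × Bool) where
  start := (none, true)
  step _ s d := (some d, s.2 && p s.1 d)
  good _ s := s.2 && s.1.all l

/-- The fold remembers the previous letter and the conjunction of the conditions so far; the two
components can be evaluated separately, and the first one ends as the last letter. -/
theorem accepts_loc (p : Option A → A → Bool) (l : A → Bool) (a : InSym Γ) (xs : List A) :
    (loc p l).accepts a xs = true ↔ (∀ i x, xs[i]? = some x →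
      p (match i with | 0 => none | i + 1 => xs[i]?) x = true) ∧ xs.getLast?.all l = true := by
  have h : ∀ o s, xs.foldl (fun (s : Option A × Bool) d => (some d, s.2 && p s.1 d)) (o, s) =
      (xs.getLast?.or o, s && (xs.foldl (fun (s : Option A × Bool) d => (some d, s.2 && p s.1 d))
        (o, true)).2) := by
    induction xs with
    | nil => simp
    | cons d xs ih =>
      intro o s
      simp only [List.foldl_cons, Bool.true_and]
      rw [ih (some d) (s && p o d), ih (some d) (p o d)]
      refine Prod.ext ?_ (by simp [Bool.and_assoc])
      cases xs with
      | nil => rfl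
      | cons e xs => rw [List.getLast?_cons_cons, List.getLast?_eq_some_getLast (by simp)]; rfl
  have h2 : ∀ o, (xs.foldl (fun (s : Option A × Bool) d => (some d, s.2 && p s.1 d))
      (o, true)).2 = true ↔ ∀ i x, xs[i]? = some x →
      p (match i with | 0 => o | i + 1 => xs[i]?) x = true := by
    clear h
    have h : ∀ (xs : List A) o s, (xs.foldl (fun (s : Option A × Bool) d => (some d, s.2 && p s.1 d))
        (o, s)).2 = (s && (xs.foldl (fun (s : Option A × Bool) d => (some d, s.2 && p s.1 d))
        (o, true)).2) := by
      intro xs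
      induction xs with
      | nil => simp
      | cons d xs ih =>
        intro o s
        simp only [List.foldl_cons, Bool.true_and]
        rw [ih (some d) (s && p o d), ih (some d) (p o d), Bool.and_assoc]
    induction xs with
    | nil => simp
    | cons d xs ih =>
      intro o
      simp only [List.foldl_cons, Bool.true_and]
      rw [h, Bool.and_eq_true, ih (some d)]
      constructor
      · rintro ⟨h1, h2⟩ (_ | i) x hx
        · simp only [List.getElem?_cons_zero, Option.some.injEq] at hx
          exact hx ▸ h1
        · have := h2 i x (by simpa using hx)
          cases i with
          | zero => simpa using this
          | succ i => simpa using this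
      · intro H
        refine ⟨H 0 d rfl, fun i x hx => ?_⟩
        have := H (i + 1) x (by simpa using hx)
        cases i with
        | zero => simpa using this
        | succ i => simpa using this
  simp only [accepts, loc]
  rw [h none true, Bool.true_and, Bool.and_eq_true, h2, Option.or_none]

/-- Check that one number is the sum of another one and of a carry. -/
def add {B : ℕ} [NeZero B] (c : InSym Γ → Bool) (f g : InSym Γ → A → Fin B) :
    Aut Γ A (Bool × Bool) where
  start := (true, true)
  step a s d := ((incDigit (s.1 && c a) (f a d)).1,
    s.2 && decide ((incDigit (s.1 && c a) (f a d)).2 = g a d))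
  good a s := s.2 && !(s.1 && c a)

theorem incDigit_false {B : ℕ} [NeZero B] (d : Fin B) : incDigit false d = (false, d) := by
  have := incDigits_false [d]
  simp only [incDigits, Prod.mk.injEq, List.cons.injEq, and_true] at this
  exact Prod.ext this.1 this.2

/-- The start state cannot depend on the input symbol, so the carry starts as `true` and counts only
in conjunction with `c a`. Acceptance also demands that no carry is left. -/
theorem accepts_add {B : ℕ} [NeZero B] (c : InSym Γ → Bool) (f g : InSym Γ → A → Fin B)
    (a : InSym Γ) (xs : List A) :
    (add c f g).accepts a xs = true ↔ incDigits (c a) (xs.map (f a)) = (false, xs.map (g a)) := by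
  have h : ∀ s t, ((xs.foldl ((add c f g).step a) (s, t)).2 = true ∧
      ((xs.foldl ((add c f g).step a) (s, t)).1 && c a) = false) ↔
      t = true ∧ incDigits (s && c a) (xs.map (f a)) = (false, xs.map (g a)) := by
    induction xs with
    | nil => intro s t; simp [incDigits]
    | cons d xs ih =>
      intro s t
      simp only [List.foldl_cons, List.map_cons, incDigits]
      rw [show (add c f g).step a (s, t) d = ((incDigit (s && c a) (f a d)).1,
        t && decide ((incDigit (s && c a) (f a d)).2 = g a d)) from rfl, ih]
      have hc : ((incDigit (s && c a) (f a d)).1 && c a) = (incDigit (s && c a) (f a d)).1 := by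
        cases h : c a
        · simp [incDigit_false]
        · simp
      rw [hc]
      simp only [Bool.and_eq_true, decide_eq_true_eq, Prod.ext_iff, List.cons.injEq]
      exact ⟨fun ⟨⟨h1, h2⟩, h3, h4⟩ => ⟨h1, h3, h2, h4⟩, fun ⟨h1, h3, h2, h4⟩ => ⟨⟨h1, h2⟩, h3, h4⟩⟩
  have := h true true
  simp only [true_and, Bool.true_and] at this
  rw [← this]
  rw [accepts, ← Bool.not_eq_true', ← Bool.and_eq_true]
  rfl

end Aut

end Machine


/-! ### Hardness: the configuration graph of a log-space machine, recognized by automata. -/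

namespace Machine

/-! ## Configurations as strings -/

theorem digs_eq_ofFn {B : ℕ} [NeZero B] (L m : ℕ) :
    digs B L m = List.ofFn fun x : Fin L => Fin.ofNat B (m / B ^ x.val) := by
  refine List.ext_getElem (by simp) fun x h _ => Fin.ext ?_
  rw [digs_getElem]
  simp [Fin.ofNat]

theorem zip_digs_ofFn {A : Type} {L : ℕ} (p : ℕ) (f : Fin L → A) :
    (digs 2 L p).zip (List.ofFn f) =
      List.ofFn fun x : Fin L => (Fin.ofNat 2 (p / 2 ^ x.val), f x) := by
  rw [digs_eq_ofFn]
  exact List.ext_getElem (by simp) fun x _ _ => by simp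

theorem incDigits_true_eq_iff {L m : ℕ} {v : List (Fin 2)} (hm : m + 1 < 2 ^ L) :
    incDigits true (digs 2 L m) = (false, v) ↔ v = digs 2 L (m + 1) := by
  rw [incDigits_digs _ _ (by omega), Prod.mk.injEq, decide_eq_false_iff_not]
  exact ⟨fun h => h.2.symm, fun h => ⟨by omega, h.symm⟩⟩

/-- A decrement is recognized by an increment in the opposite direction: among strings of this
length, the predecessor is the only one that is incremented to `m` without overflow. -/
theorem incDigits_true_eq_iff' {L m : ℕ} {v : List (Fin 2)} (hm : m < 2 ^ L) (h0 : m ≠ 0)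
    (hv : v.length = L) : incDigits true v = (false, digs 2 L m) ↔ v = digs 2 L (m - 1) := by
  subst hv
  obtain ⟨l, hl, hlv⟩ := exists_digs v
  constructor
  · intro h
    rw [← hlv, digs_length, incDigits_digs _ _ hl, Prod.mk.injEq, decide_eq_false_iff_not] at h
    have := digs_inj (by omega) hm h.2
    rw [← hlv, ← this]
    simp
  · intro h
    generalize v.length = L at *
    subst h
    rw [incDigits_digs _ _ (by omega), Nat.sub_add_cancel (by omega)]
    simp; omega

/-- The graph whose edges are recognized by finite automata: the input position is guessed. -/
def Graph.ofAuts {Γ Δ D S : Type} (κ : List (Option Δ × Aut Γ (Fin 2 × (D × D)) S)) (w : List Γ)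
    (L : ℕ) (u : Fin L → D) (l : Option Δ) (v : Fin L → D) : Prop :=
  ∃ p ≤ w.length + 1, ∃ A, (l, A) ∈ κ ∧
    A.accepts (readInput w p) ((digs 2 L p).zip (List.ofFn fun x => (u x, v x))) = true

theorem readInput_isLeft {Γ : Type} (w : List Γ) (p : ℕ) :
    (readInput w p).isLeft = decide (p = 0) := by
  cases p with
  | zero => rfl
  | succ p => simp only [readInput]; cases w[p]? <;> simp [InSym.isLeft]

theorem readInput_isRight {Γ : Type} (w : List Γ) (p : ℕ) :
    (readInput w p).isRight = decide (w.length < p) := by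
  cases p with
  | zero => simp [readInput, InSym.isRight]
  | succ p =>
    simp only [readInput]
    by_cases h : p < w.length
    · simp [h, InSym.isRight]
    · simp [List.getElem?_eq_none (not_lt.mp h), InSym.isRight]; omega

namespace TM

variable {Γ Δ : Type} (M : TM Γ Δ)

/-- One column of a configuration: the state, a bit of the position of the input head, the contents
of the work tapes, and whether the column is to the left of the work heads. -/
structure Cell where
  state : M.Q
  bit : Fin 2
  tape : Fin M.k → M.W
  th : Fin M.k → Bool

instance : Finite M.Cell :=
  have := M.finite_Q
  have := M.finite_W
  Finite.of_injective (fun d : M.Cell => (d.state, d.bit, d.tape, d.th))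
    (by rintro ⟨⟩ ⟨⟩ h; simp_all)

instance instFiniteAction {Q W : Type} [Finite Q] [Finite W] [Finite Δ] {k : ℕ} :
    Finite (Action Q W Δ k) :=
  have : Finite Move := Finite.of_injective
    (fun m : Move => (match m with | .left => 0 | .stay => 1 | .right => 2 : Fin 3))
    (by rintro (_ | _ | _) (_ | _ | _) h <;> simp_all)
  Finite.of_injective (fun d : Action Q W Δ k => (d.next, d.inMove, d.write, d.move, d.out))
    (by rintro ⟨⟩ ⟨⟩ h; simp_all)

/-- The columns of a configuration. -/
def cols (L : ℕ) (c : M.Cfg) (x : Fin L) : M.Cell where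
  state := c.state
  bit := Fin.ofNat 2 (c.inHead / 2 ^ x.val)
  tape i := c.tapes i x
  th i := decide (x.val < c.heads i)

variable {M}

/-- Local conditions for the execution of an instruction. -/
def LocOK (q : M.Q) (sc : Fin M.k → M.W) (act : Action M.Q M.W Δ M.k)
    (o : Option (Fin 2 × (M.Cell × M.Cell))) (d : Fin 2 × (M.Cell × M.Cell)) : Prop :=
  d.2.1.state = q ∧ d.2.1.bit = d.1 ∧ d.2.2.state = act.next ∧ ∀ i,
    ((d.2.1.th i = false ∧ ∀ b ∈ o, b.2.1.th i = true) →
      d.2.1.tape i = sc i ∧ d.2.2.tape i = act.write i) ∧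
    (¬ (d.2.1.th i = false ∧ ∀ b ∈ o, b.2.1.th i = true) → d.2.2.tape i = d.2.1.tape i) ∧
    (match act.move i with
      | .stay => d.2.2.th i = d.2.1.th i
      | .right => d.2.2.th i = o.elim true (·.2.1.th i)
      | .left => ∀ b ∈ o, b.2.2.th i = d.2.1.th i)

def moveUp (act : Action M.Q M.W Δ M.k) (a : InSym Γ) : Bool :=
  match act.inMove with
  | .right => !a.isRight
  | _ => false

def moveDown (act : Action M.Q M.W Δ M.k) (a : InSym Γ) : Bool :=
  match act.inMove with
  | .left => !a.isLeft
  | _ => false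

open scoped Classical in
/-- The automaton that recognizes the steps that execute a given instruction. -/
noncomputable def stepAut (t : M.Q × (Fin M.k → M.W) × Action M.Q M.W Δ M.k) :
    Aut Γ (Fin 2 × (M.Cell × M.Cell)) ((Option (Fin 2 × (M.Cell × M.Cell)) × Bool) × Bool × Bool) :=
  ((Aut.loc (fun o d => decide (LocOK t.1 t.2.1 t.2.2 o d))
      (fun d => decide (∀ i, t.2.2.move i = .left → d.2.2.th i = false))).and
    (Aut.add (fun a => moveUp t.2.2 a || moveDown t.2.2 a)
      (fun a d => if moveDown t.2.2 a then d.2.2.bit else d.2.1.bit)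
      (fun a d => if moveDown t.2.2 a then d.2.1.bit else d.2.2.bit))).guard
    fun a => decide (t.2.2 ∈ M.trans t.1 a t.2.1 ∧ t.1 ∉ M.accept)

theorem min_apply (act : Action M.Q M.W Δ M.k) {w : List Γ} {p : ℕ} (hp : p ≤ w.length + 1) :
    min (act.inMove.apply p) (w.length + 1) =
      if moveUp act (readInput w p) then p + 1 else
      if moveDown act (readInput w p) then p - 1 else p := by
  simp only [moveUp, moveDown, readInput_isLeft, readInput_isRight]
  cases act.inMove <;> simp [Move.apply] <;> (try split_ifs) <;> omega

variable {w : List Γ} {L p : ℕ} {c : M.Cfg} {v : Fin L → M.Cell} {q : M.Q} {sc : Fin M.k → M.W}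
  {act : Action M.Q M.W Δ M.k}

/-- The input head moves by at most one. For a move to the left the old position is the new one plus
one, so old and new digits exchange their roles; clipping at the ends is contained in `moveUp` and
`moveDown`. -/
theorem add_iff (hL : w.length + 2 < 2 ^ L) (hp : c.inHead ≤ w.length + 1) (hpw : p = c.inHead) :
    incDigits (moveUp act (readInput w p) || moveDown act (readInput w p))
        (List.ofFn fun x => if moveDown act (readInput w p) then (v x).bit
          else ((M.cols L c) x).bit) =
      (false, List.ofFn fun x => if moveDown act (readInput w p) then ((M.cols L c) x).bit
        else (v x).bit) ↔ ∀ x, (v x).bit = ((M.cols L (M.exec w c act)) x).bit := by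
  subst hpw
  have h1 : ∀ c : M.Cfg, List.ofFn (fun x => ((M.cols L c) x).bit) = digs 2 L c.inHead :=
    fun c => (digs_eq_ofFn _ _).symm
  have h2 : (∀ x, (v x).bit = ((M.cols L (M.exec w c act)) x).bit) ↔
      List.ofFn (fun x => (v x).bit) = digs 2 L (min (act.inMove.apply c.inHead) (w.length + 1)) := by
    rw [← funext_iff, ← List.ofFn_inj, h1]
    rfl
  rw [h2, min_apply _ hp]
  cases hd : moveDown act (readInput w c.inHead)
  · cases hu : moveUp act (readInput w c.inHead)
    · simp only [Bool.or_self, incDigits_false, Bool.false_eq_true, if_false, h1, Prod.mk.injEq,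
        true_and]
      exact eq_comm
    · simp only [Bool.or_false, Bool.false_eq_true, if_false, if_true, h1]
      exact incDigits_true_eq_iff (by omega)
  · have hu : moveUp act (readInput w c.inHead) = false := by
      unfold moveUp moveDown at *
      split <;> simp_all
    have h0 : c.inHead ≠ 0 := by
      intro h0
      unfold moveDown at hd
      rw [h0] at hd
      cases h : act.inMove <;> simp [h, readInput, InSym.isLeft] at hd
    simp only [hu, Bool.or_true, Bool.false_eq_true, if_false, if_true, h1]
    exact incDigits_true_eq_iff' (by omega) h0 (by simp)

/-- The predecessor of a letter in a string. -/
def prev {A : Type} (f : Fin L → A) (x : Fin L) : Option A :=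
  if h : x.val = 0 then none else some (f ⟨x.val - 1, by omega⟩)

theorem _root_.Machine.Aut.accepts_loc_ofFn {A : Type} (p : Option A → A → Bool) (l : A → Bool)
    (a : InSym Γ) (f : Fin L → A) :
    (Aut.loc p l).accepts a (List.ofFn f) = true ↔ (∀ x, p (prev f x) (f x) = true) ∧
      ∀ x : Fin L, x.val + 1 = L → l (f x) = true := by
  rw [Aut.accepts_loc]
  refine and_congr ?_ ?_
  · constructor
    · intro h x
      have := h x.val (f x) (by simp)
      obtain ⟨_ | x, hx⟩ := x
      · exact this
      · simpa [prev, Nat.lt_of_succ_lt hx] using this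
    · intro h i y hy
      simp only [List.getElem?_ofFn] at hy
      split at hy
      · rename_i hi
        obtain rfl : f ⟨i, hi⟩ = y := by simpa using hy
        have := h ⟨i, hi⟩
        cases i with
        | zero => exact this
        | succ i => simpa [prev, Nat.lt_of_succ_lt hi] using this
      · simp at hy
  · cases L with
    | zero => simp
    | succ L =>
      rw [List.getLast?_eq_some_getLast (by simp), List.getLast_ofFn]
      simp only [Option.all_some]
      constructor
      · intro h x hx
        convert h
        simp; omega
      · intro h
        exact h _ (by simp)

/-- The flag `th` marks the columns to the left of a work head. The head is therefore in the first
column without the flag, and writing and moving it become conditions on neighbouring columns. -/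
theorem loc_iff (hh : ∀ i, c.heads i < L) (hL : w.length + 2 < 2 ^ L) (hL0 : 0 < L)
    (hc : c.inHead ≤ w.length + 1) (hp : p ≤ w.length + 1) :
    ((∀ x, LocOK q sc act (prev (fun x : Fin L => (Fin.ofNat 2 (p / 2 ^ x.val),
        (M.cols L c x, v x))) x) (Fin.ofNat 2 (p / 2 ^ x.val), (M.cols L c x, v x))) ∧
      ∀ x : Fin L, x.val + 1 = L → ∀ i, act.move i = .left → (v x).th i = false) ↔
    (q = c.state ∧ p = c.inHead ∧ sc = fun i => c.tapes i (c.heads i)) ∧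
      (∀ x, (v x).state = (M.cols L (M.exec w c act) x).state) ∧
      (∀ x i, (v x).tape i = (M.cols L (M.exec w c act) x).tape i) ∧
      ∀ x i, (v x).th i = (M.cols L (M.exec w c act) x).th i := by
  -- Comparing digits forces the guessed position `p`, whose symbol the automaton knows, to be the
  -- position of the input head.
  have hbit : (∀ x : Fin L, (M.cols L c x).bit = Fin.ofNat 2 (p / 2 ^ x.val)) ↔ p = c.inHead := by
    rw [← funext_iff, ← List.ofFn_inj]
    refine (Iff.of_eq (congrArg₂ (· = ·) (digs_eq_ofFn L c.inHead).symm
      (digs_eq_ofFn L p).symm)).trans ⟨fun h => ?_, fun h => by rw [h]⟩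
    exact (digs_inj (by omega) (by omega) h).symm
  have hhere : ∀ (x : Fin L) i, ((M.cols L c x).th i = false ∧
      ∀ b ∈ prev (fun x : Fin L => (Fin.ofNat 2 (p / 2 ^ x.val), (M.cols L c x, v x))) x,
        b.2.1.th i = true) ↔ x.val = c.heads i := by
    intro x i
    unfold prev
    split
    · simp [cols]; omega
    · simp [cols]; omega
  have hth : ∀ i, ((∀ x : Fin L, match act.move i with
        | .stay => (v x).th i = (M.cols L c x).th i
        | .right => (v x).th i = (prev (fun x : Fin L => (Fin.ofNat 2 (p / 2 ^ x.val),
            (M.cols L c x, v x))) x).elim true (·.2.1.th i)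
        | .left => ∀ b ∈ prev (fun x : Fin L => (Fin.ofNat 2 (p / 2 ^ x.val),
            (M.cols L c x, v x))) x, b.2.2.th i = (M.cols L c x).th i) ∧
      ∀ x : Fin L, x.val + 1 = L → act.move i = .left → (v x).th i = false) ↔
      ∀ x, (v x).th i = (M.cols L (M.exec w c act) x).th i := by
    intro i
    have hi := hh i
    cases hm : act.move i with
    | stay => simp [cols, exec, hm, Move.apply]
    | right =>
      simp only [reduceCtorEq, false_implies, implies_true, and_true]
      refine forall_congr' fun x => Iff.of_eq (congrArg _ ?_)
      unfold prev
      split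
      · simp [cols, exec, hm, Move.apply]; omega
      · simp [cols, exec, hm, Move.apply]; omega
    | left =>
      -- For a left move, the new flag of a column is the old flag of the column to its right. The
      -- last column has no right neighbour; the global condition sets its flag to `false`, which is
      -- correct because the head was below `L`.
      have hcol : ∀ x, (M.cols L (M.exec w c act) x).th i = decide (x.val < c.heads i - 1) := by
        intro x; simp [cols, exec, hm, Move.apply]
      constructor
      · rintro ⟨h1, h2⟩ x
        rw [hcol]
        by_cases hx : x.val + 1 = L
        · rw [h2 x hx rfl]; symm; simp; omega
        · have := h1 ⟨x.val + 1, by omega⟩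
          simp only [prev, Nat.add_eq_zero_iff, one_ne_zero, and_false, dite_false,
            Option.mem_def, Option.some.injEq, forall_eq', Nat.add_sub_cancel] at this
          rw [this]
          simp [cols]; omega
      · intro h
        refine ⟨fun x => ?_, fun x hx _ => by rw [h, hcol]; simp; omega⟩
        intro b hb
        unfold prev at hb
        split at hb
        · simp at hb
        · simp only [Option.mem_def, Option.some.injEq] at hb
          rw [← hb]
          simp only [h, hcol]
          simp [cols]; omega
  have hexec : ∀ (x : Fin L) i, (M.cols L (M.exec w c act) x).tape i =
      if x.val = c.heads i then act.write i else c.tapes i x := by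
    intro x i; simp [cols, exec, Function.update_apply]
  constructor
  · rintro ⟨h1, h2⟩
    refine ⟨⟨?_, ?_, ?_⟩, ?_, ?_, ?_⟩
    · exact (h1 ⟨0, hL0⟩).1.symm
    · exact hbit.mp fun x => (h1 x).2.1
    · funext i
      exact (((h1 ⟨c.heads i, hh i⟩).2.2.2 i).1 ((hhere _ i).mpr rfl)).1.symm
    · exact fun x => (h1 x).2.2.1
    · intro x i
      rw [hexec]
      split
      · rename_i hx
        exact (((h1 x).2.2.2 i).1 ((hhere _ i).mpr hx)).2
      · rename_i hx
        exact ((h1 x).2.2.2 i).2.1 fun h => hx ((hhere _ i).mp h)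
    · exact fun x i => (hth i).mp ⟨fun x => ((h1 x).2.2.2 i).2.2, fun x hx => h2 x hx i⟩ x
  · rintro ⟨⟨rfl, h1, rfl⟩, h2, h3, h4⟩
    have h5 := fun i => (hth i).mpr fun x => h4 x i
    refine ⟨fun x => ⟨rfl, hbit.mpr h1 x, h2 x, fun i => ⟨fun h => ?_, fun h => ?_, (h5 i).1 x⟩⟩,
      fun x hx i => (h5 i).2 x hx⟩
    · have hx := (hhere x i).mp h
      refine ⟨by simp only [cols, hx], ?_⟩
      rw [h3, hexec, if_pos hx]
    · have hx := fun h' => h ((hhere x i).mpr h')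
      simp only
      rw [h3, hexec, if_neg hx]; rfl

-- Local conditions determine everything about the successor except the bits of the input head, and
-- the addition automaton determines these.
open scoped Classical in
theorem accepts_stepAut (hh : ∀ i, c.heads i < L) (hL : w.length + 2 < 2 ^ L) (hL0 : 0 < L)
    (hc : c.inHead ≤ w.length + 1) (hp : p ≤ w.length + 1) :
    (stepAut (q, sc, act)).accepts (readInput w p)
      ((digs 2 L p).zip (List.ofFn fun x => (M.cols L c x, v x))) = true ↔
    (q = c.state ∧ p = c.inHead ∧ sc = fun i => c.tapes i (c.heads i)) ∧
      (act ∈ M.trans q (readInput w p) sc ∧ q ∉ M.accept) ∧ v = M.cols L (M.exec w c act) := by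
  rw [stepAut, Aut.accepts_guard, Aut.accepts_and, Bool.and_eq_true, Bool.and_eq_true,
    decide_eq_true_eq, zip_digs_ofFn, Aut.accepts_loc_ofFn, Aut.accepts_add]
  simp only [decide_eq_true_eq, List.map_ofFn, Function.comp_def]
  rw [loc_iff hh hL hL0 hc hp]
  constructor
  · rintro ⟨h1, ⟨h2, h3, h4, h5⟩, h6⟩
    rw [add_iff hL hc h2.2.1] at h6
    refine ⟨h2, h1, funext fun x => ?_⟩
    have e1 := h3 x
    have e2 := h6 x
    have e3 := funext (h4 x)
    have e4 := funext (h5 x)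
    cases h : v x
    cases h' : M.cols L (M.exec w c act) x
    simp_all
  · rintro ⟨h1, h2, rfl⟩
    exact ⟨h2, ⟨h1, fun _ => rfl, fun _ _ => rfl, fun _ _ => rfl⟩,
      (add_iff hL hc h1.2.1).mpr fun _ => rfl⟩

theorem reachable_inHead (h : M.Reachable w c) : c.inHead ≤ w.length + 1 := by
  cases h with
  | refl => exact Nat.zero_le _
  | tail _ h =>
    obtain ⟨-, act, -, rfl⟩ := h
    exact min_le_right _ _

/-- The automata of all instructions. -/
noncomputable def stepAuts [Finite Δ] (M : TM Γ Δ) :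
    List (Option Δ × Aut Γ (Fin 2 × (M.Cell × M.Cell))
      ((Option (Fin 2 × (M.Cell × M.Cell)) × Bool) × Bool × Bool)) :=
  have := M.finite_Q
  have := M.finite_W
  have := Fintype.ofFinite (M.Q × (Fin M.k → M.W) × Action M.Q M.W Δ M.k)
  (Finset.univ.toList : List (M.Q × (Fin M.k → M.W) × Action M.Q M.W Δ M.k)).map
    fun t => (t.2.2.out, stepAut t)

theorem mem_stepAuts [Finite Δ] {s : Option Δ × Aut Γ (Fin 2 × (M.Cell × M.Cell))
      ((Option (Fin 2 × (M.Cell × M.Cell)) × Bool) × Bool × Bool)} :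
    s ∈ M.stepAuts ↔ ∃ q sc act, s = (act.out, stepAut (q, sc, act)) := by
  simp [stepAuts, eq_comm]

open Machine.Graph

/-- The target `v` is an arbitrary string, yet an edge from the columns of a configuration within
the bounds always leads to columns again. So strings that describe no configuration are never
reached from the initial one. -/
theorem ofAuts_cols [Finite Δ] (hh : ∀ i, c.heads i < L) (hL : w.length + 2 < 2 ^ L) (hL0 : 0 < L)
    (hc : c.inHead ≤ w.length + 1) {l : Option Δ} :
    ofAuts M.stepAuts w L (M.cols L c) l v ↔
      ∃ c', M.Step w c c' ∧ c'.out = c.out ++ l.toList ∧ v = M.cols L c' := by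
  constructor
  · rintro ⟨p, hp, A, hA, h⟩
    obtain ⟨q, sc, act, hs⟩ := mem_stepAuts.mp hA
    obtain ⟨rfl, rfl⟩ := Prod.mk.inj hs
    obtain ⟨⟨rfl, rfl, rfl⟩, ⟨h1, h2⟩, h3⟩ := (accepts_stepAut hh hL hL0 hc hp).mp h
    exact ⟨_, ⟨h2, act, h1, rfl⟩, rfl, h3⟩
  · rintro ⟨_, ⟨h1, act, h2, rfl⟩, h3, rfl⟩
    have h4 : act.out = l := by
      have := List.append_cancel_left h3
      revert this
      cases act.out <;> cases l <;> simp
    exact ⟨c.inHead, hc, _, mem_stepAuts.mpr ⟨_, _, act, by rw [h4]⟩,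
      (accepts_stepAut hh hL hL0 hc hc).mpr ⟨⟨rfl, rfl, rfl⟩, ⟨h2, h1⟩, rfl⟩⟩

/-- This holds for arbitrary strings `u`, not only for configurations. The padding argument for
words of blocks needs accepting vertices without outgoing edges in the whole graph. -/
theorem ofAuts_state [Finite Δ] {u : Fin L → M.Cell} {l : Option Δ}
    (h : ofAuts M.stepAuts w L u l v) (x : Fin L) : (u x).state ∉ M.accept := by
  obtain ⟨p, -, A, hA, h⟩ := h
  obtain ⟨q, sc, act, hs⟩ := mem_stepAuts.mp hA
  obtain ⟨rfl, rfl⟩ := Prod.mk.inj hs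
  classical
  rw [stepAut, Aut.accepts_guard, Aut.accepts_and, Bool.and_eq_true, Bool.and_eq_true,
    zip_digs_ofFn, Aut.accepts_loc_ofFn] at h
  have h1 := of_decide_eq_true h.1
  have h2 := of_decide_eq_true (h.2.1.1 x)
  rw [show (u x).state = q from h2.1]
  exact h1.2

open scoped Classical in
theorem outs_cols [Finite Δ] (hh : ∀ c, M.Reachable w c → ∀ i, c.heads i < L)
    (hL : w.length + 2 < 2 ^ L) (hL0 : 0 < L) :
    outs (ofAuts M.stepAuts w L) (fun u => ∀ x, (u x).state ∈ M.accept) (M.cols L M.initCfg) =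
      M.outputs w := by
  ext y
  constructor
  · rintro ⟨z, hz, h⟩
    revert h
    have key : ∀ u c, M.Reachable w c → u = M.cols L c → Path (ofAuts M.stepAuts w L) u y z →
        ∃ c', M.Reachable w c' ∧ z = M.cols L c' ∧ c'.out = c.out ++ y := by
      intro u c hc hu hp
      clear hz
      induction hp generalizing c with
      | nil u => exact ⟨c, hc, hu, by simp⟩
      | silent h1 _ ih =>
        subst hu
        obtain ⟨c', h2, h3, h4⟩ := (ofAuts_cols (hh c hc) hL hL0 (reachable_inHead hc)).mp h1
        obtain ⟨c'', h5, h6, h7⟩ := ih c' (hc.tail h2) h4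
        exact ⟨c'', h5, h6, by rw [h7, h3]; simp⟩
      | out h1 _ ih =>
        subst hu
        obtain ⟨c', h2, h3, h4⟩ := (ofAuts_cols (hh c hc) hL hL0 (reachable_inHead hc)).mp h1
        obtain ⟨c'', h5, h6, h7⟩ := ih c' (hc.tail h2) h4
        exact ⟨c'', h5, h6, by rw [h7, h3]; simp⟩
    intro h
    obtain ⟨c, h1, rfl, h3⟩ := key _ M.initCfg .refl rfl h
    exact ⟨c, h1, hz ⟨0, hL0⟩, h3⟩
  · rintro ⟨c, hc, ha, rfl⟩
    refine ⟨M.cols L c, fun _ => ha, ?_⟩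
    clear ha
    induction hc with
    | refl => exact .nil _
    | @tail c c' h1 h2 ih =>
      obtain ⟨h3, act, h4, rfl⟩ := h2
      have h5 := (ofAuts_cols (v := M.cols L (M.exec w c act)) (l := act.out) (hh c h1) hL hL0
        (reachable_inHead h1)).mpr ⟨_, ⟨h3, act, h4, rfl⟩, rfl, rfl⟩
      refine ih.append (?_ : Path _ _ act.out.toList _)
      generalize act.out = l at h5
      cases l with
      | none => exact .silent h5 (.nil _)
      | some d => exact .out h5 (.nil _)

/-- The outputs of a logarithmic-space machine are the output words of a graph on strings of
logarithmic length, the edges of which are recognized by finite automata. -/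
theorem LogSpace.exists_auts [Finite Δ] (hM : M.LogSpace) :
    ∃ (b : ℕ) (D S : Type) (_ : Finite D) (_ : Finite S) (_ : Nonempty S) (z : D) (accD : D → Bool)
      (κ : List (Option Δ × Aut Γ (Fin 2 × (D × D)) S)), ∀ w : List Γ,
      (∀ u l v, (∀ x, accD (u x) = true) → ¬ ofAuts κ w (strLen b w.length) u l v) ∧
      outs (ofAuts κ w (strLen b w.length)) (fun u => ∀ x, accD (u x) = true) (fun _ => z) =
        M.outputs w := by
  classical
  obtain ⟨C, hC⟩ := hM
  have := M.finite_Q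
  have := M.finite_W
  refine ⟨C, M.Cell, _, inferInstance, inferInstance,
    ⟨((none, true), true, true)⟩, ⟨M.start, 0, fun _ => M.blank, fun _ => false⟩,
    fun d => decide (d.state ∈ M.accept), M.stepAuts, fun w => ⟨fun u l v hu h => ?_, ?_⟩⟩
  · exact ofAuts_state h ⟨0, strLen_pos _ _⟩ (of_decide_eq_true (hu _))
  · rw [← outs_cols (fun c hc i => ?_) (lt_two_pow_strLen C w.length) (strLen_pos _ _)]
    · simp only [decide_eq_true_eq]
      congr 1
      funext x
      simp [cols, initCfg]
    -- The factor `C + 1` in `strLen C` leaves room for one more cell than the last one a work head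
    -- visits.
    · refine (hC w c hc i).trans_lt ?_
      refine lt_of_lt_of_le ?_ (le_strLen C w.length)
      rw [Nat.add_mul]; omega

end TM

end Machine


/-! ### Hardness: log-space enumeration over arbitrary finite alphabets. -/

namespace Machine

/-! ## Enumeration of strings over a finite alphabet -/

section Enumeration

variable {Γ Δ A S : Type}

/-- Symbols printed at the beginning, symbols printed for every accepted string, and the automaton
that accepts the strings. -/
structure Block (Γ Δ A S : Type) where
  pre : List (Item Unit Δ)
  items : List (Item A Δ)
  aut : Aut Γ (Fin 2 × A) S

def Item.comap {D D' : Type} (f : D' → D) (it : Item D Δ) : Item D' Δ := ⟨fun d => it.cell (f d), it.last⟩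

theorem printAll_comap {D D' : Type} (f : D' → D) (its : List (Item D Δ)) (xs : List D') :
    printAll (its.map (Item.comap f)) xs = printAll its (xs.map f) := by
  simp only [printAll, List.flatMap_map]
  congr 1
  funext it
  simp [Item.print, Item.comap, List.filterMap_map]

theorem printAll_append {D : Type} (its its' : List (Item D Δ)) (xs : List D) :
    printAll (its ++ its') xs = printAll its xs ++ printAll its' xs :=
  List.flatMap_append

variable [Finite A] [Nonempty A]

/-- The phase that executes a block. -/
noncomputable def Block.toPhase (bl : Block Γ Δ A S) : Phase Γ Δ (Fin 2 × Fin (Nat.card A)) S where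
  pre := bl.pre.map (Item.comap fun _ => ())
  items := bl.items.map (Item.comap fun d => (Finite.equivFin A).symm d.2)
  start := bl.aut.start
  step := (bl.aut.comap (Prod.map id (Finite.equivFin A).symm)).step
  good := bl.aut.good

/-- The enumeration of the strings of length `L` that are accepted for some input position. -/
noncomputable def Aut.hits (M : Aut Γ (Fin 2 × A) S) (L : ℕ) (w : List Γ) : List (List A) :=
  haveI : NeZero (Nat.card A) := ⟨Nat.card_pos.ne'⟩
  ((Block.toPhase (Δ := Empty) ⟨[], [], M⟩).hits L w).map (List.map fun d =>
    (Finite.equivFin A).symm d.2)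

theorem Phase.map_snd_str {B : ℕ} [NeZero B] (L p m : ℕ) (f : Fin B → A) :
    (Phase.str B L p m).map (fun d => f d.2) = (digs B L m).map f := by
  rw [Phase.str, show (fun d : Fin 2 × Fin B => f d.2) = f ∘ Prod.snd from rfl, ← List.map_map,
    List.map_snd_zip (by simp)]

theorem Phase.map_str {B : ℕ} [NeZero B] (L p m : ℕ) (f : Fin B → A) :
    (Phase.str B L p m).map (Prod.map id f) = (digs 2 L p).zip ((digs B L m).map f) := by
  rw [Phase.str, ← List.zip_map, List.map_id]

theorem Block.toPhase_accepts (bl : Block Γ Δ A S) (a : InSym Γ)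
    (xs : List (Fin 2 × Fin (Nat.card A))) :
    bl.toPhase.accepts a xs = bl.aut.accepts a (xs.map (Prod.map id (Finite.equivFin A).symm)) :=
  Aut.accepts_comap _ bl.aut a xs

/-- Every string of length `L` is the digit string of some number below `|A| ^ L`, so the
enumeration misses none. -/
theorem Aut.mem_hits {M : Aut Γ (Fin 2 × A) S} {L : ℕ} {w : List Γ} {s : List A} :
    s ∈ M.hits L w ↔ s.length = L ∧
      ∃ p ≤ w.length + 1, M.accepts (readInput w p) ((digs 2 L p).zip s) = true := by
  have : NeZero (Nat.card A) := ⟨Nat.card_pos.ne'⟩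
  simp only [Aut.hits, Phase.hits, List.mem_map, List.mem_flatMap, List.mem_range, List.mem_filter,
    Block.toPhase_accepts]
  constructor
  · rintro ⟨_, ⟨p, hp, ⟨m, -, rfl⟩, h⟩, rfl⟩
    rw [Phase.map_str] at h
    rw [Phase.map_snd_str]
    exact ⟨by simp, p, by omega, h⟩
  · rintro ⟨rfl, p, hp, h⟩
    obtain ⟨m, hm, he⟩ := exists_digs (s.map (Finite.equivFin A))
    rw [List.length_map] at hm he
    have hs : (digs (Nat.card A) s.length m).map (Finite.equivFin A).symm = s := by
      rw [he]; simp
    refine ⟨Phase.str (Nat.card A) s.length p m, ⟨p, by omega, ⟨m, hm, rfl⟩, ?_⟩, ?_⟩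
    · rw [Phase.map_str, hs]; exact h
    · rw [Phase.map_snd_str, hs]

/-- The trivial automaton accepts at every position and string. Printing one letter per hit produces
a document of this polynomial length. -/
theorem Aut.length_hits_triv (s : S) (L : ℕ) (w : List Γ) :
    ((Aut.triv s : Aut Γ (Fin 2 × A) S).hits L w).length =
      (w.length + 2) * Nat.card A ^ L := by
  have : NeZero (Nat.card A) := ⟨Nat.card_pos.ne'⟩
  simp only [Aut.hits, Phase.hits, List.length_map, List.length_flatMap]
  have h : ∀ p, ((List.range (Nat.card A ^ L)).map (Phase.str (Nat.card A) L p)).filter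
      ((Block.toPhase (Δ := Empty) ⟨[], [], (Aut.triv s : Aut Γ (Fin 2 × A) S)⟩).accepts
        (readInput w p)) = (List.range (Nat.card A ^ L)).map (Phase.str (Nat.card A) L p) :=
    fun p => List.filter_eq_self.mpr fun _ _ => rfl
  simp [h]

theorem Block.toPhase_word (bl : Block Γ Δ A S) (L : ℕ) (w : List Γ) [NeZero (Nat.card A)] :
    bl.toPhase.word L w = printAll bl.pre (List.replicate L ()) ++
      (bl.aut.hits L w).flatMap (printAll bl.items) := by
  rw [Phase.word]
  congr 1
  · rw [show bl.toPhase.pre = bl.pre.map (Item.comap fun _ => ()) from rfl, printAll_comap]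
    congr 1
    rw [List.map_const', Phase.str]
    simp
  · rw [Aut.hits, List.flatMap_map]
    exact congrArg₂ _ (funext fun xs => printAll_comap _ _ _) rfl

/-- Logarithmic-space machines can enumerate the strings of logarithmic length that are accepted by
finite automata. -/
theorem logSpaceComputable_enum [Finite S] (b : ℕ) (bls : List (Block Γ Δ A S)) :
    LogSpaceComputable fun w : List Γ => bls.flatMap fun bl =>
      printAll bl.pre (List.replicate (strLen b w.length) ()) ++
        (bl.aut.hits (strLen b w.length) w).flatMap (printAll bl.items) := by
  have : NeZero (Nat.card A) := ⟨Nat.card_pos.ne'⟩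
  have := exists_TM_of_phases b (bls.map Block.toPhase)
  simpa only [List.flatMap_map, Block.toPhase_word] using this

end Enumeration

end Machine

/-! ### Hardness: printable names of strings. -/

namespace Spanner

open Machine

/-! ### Names of strings -/

section Names

variable {T A σ : Type} [Finite T]

open scoped Classical in
/-- The unary code of a string. -/
noncomputable def oneHot (s : List T) : List Bool :=
  letI := Fintype.ofFinite T
  (Finset.univ.toList : List T).flatMap fun b => s.map fun d => decide (d = b)

theorem flatMap_inj_of_length {α β : Type} {l : List α} {f g : α → List β} {n : ℕ}
    (hf : ∀ a, (f a).length = n) (hg : ∀ a, (g a).length = n) (h : l.flatMap f = l.flatMap g) :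
    ∀ a ∈ l, f a = g a := by
  induction l with
  | nil => simp
  | cons a l ih =>
    simp only [List.flatMap_cons] at h
    obtain ⟨h1, h2⟩ := List.append_inj h (by rw [hf, hg])
    simp only [List.mem_cons, forall_eq_or_imp]
    exact ⟨h1, ih h2⟩

/-- The name has one block of bits per letter `b`, each as long as the string. Equal lengths align
the blocks, and the letter at a place is read off from its own block. Every block can be printed in
one pass with one bit per cell. -/
theorem oneHot_inj {s t : List T} (h : s.length = t.length) (h' : oneHot s = oneHot t) :
    s = t := by
  classical
  refine List.ext_getElem h fun y hy hy' => ?_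
  have := flatMap_inj_of_length (n := s.length) (by simp) (by simp [h]) h' s[y] (by simp)
  have h2 := congrArg (·[y]?) this
  simp [hy, hy'] at h2
  exact h2.symm

open scoped Classical in
/-- The items that print the name of a string. -/
noncomputable def nameItems (f : A → T) : List (Item A (Sym σ)) :=
  letI := Fintype.ofFinite T
  (Finset.univ.toList : List T).map (fun b => ⟨fun d => some (.bit (decide (f d = b))), none⟩) ++
    [⟨fun _ => none, some .sep⟩]

theorem printAll_nameItems (f : A → T) (s : List A) :
    printAll (nameItems f) s = encName (σ := σ) (oneHot (s.map f)) := by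
  rw [nameItems, printAll_append, encName, oneHot]
  congr 1
  · simp only [printAll, List.flatMap_map, List.map_flatMap, List.map_map]
    congr 1
    funext b
    simp [Item.print, Function.comp_def]
  · simp [printAll, Item.print]

/-- The item that prints one symbol. -/
def symItem (y : Sym σ) : Item A (Sym σ) := ⟨fun _ => none, some y⟩

theorem printAll_symItem (y : Sym σ) (s : List A) : printAll [symItem y] s = [y] := by
  simp [printAll, Item.print, symItem]

end Names

end Spanner


/-! ### Hardness: columnwise description of the transitions. -/

namespace Spanner

open Machine Machine.Graph

/-! ### Transitions recognized by finite automata -/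

section Kinds

variable {σ Γ Δ D S : Type} {B L n r : ℕ} [NeZero B]

instance : Finite (Ph r) :=
  Finite.of_injective (fun p : Ph r => (match p with
      | .start => .inr false
      | .run j => .inl j
      | .fin => .inr true : Fin (r + 1) ⊕ Bool))
    (by rintro (_ | _ | _) (_ | _ | _) h <;> simp_all)

instance : Nonempty (Ph r) := ⟨.start⟩

/-- One column of a vertex and two counters, with the phase. -/
abbrev Col (D : Type) (B r : ℕ) : Type := (D × Fin B × Fin B) × Ph r

/-- The digits of a number. -/
def dg (B : ℕ) [NeZero B] (L m : ℕ) (y : Fin L) : Fin B := Fin.ofNat B (m / B ^ y.val)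

/-- The columns of a state. -/
def cell (B : ℕ) [NeZero B] (s : BState (Fin L → D) n r) (y : Fin L) : Col D B r :=
  ((s.1 y, dg B L s.2.1 y, dg B L s.2.2.1 y), s.2.2.2)

theorem ofFn_dg (m : ℕ) : List.ofFn (dg B L m) = digs B L m := (digs_eq_ofFn L m).symm

theorem exists_dg (hn : n + 1 = B ^ L) (f : Fin L → Fin B) : ∃ m : Fin (n + 1), dg B L m = f := by
  obtain ⟨m, hm, h⟩ := exists_digs (List.ofFn f)
  rw [List.length_ofFn] at hm h
  exact ⟨⟨m, hn ▸ hm⟩, List.ofFn_injective ((ofFn_dg m).trans h)⟩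

theorem dg_inj (hn : n + 1 = B ^ L) {m m' : Fin (n + 1)} : dg B L m = dg B L m' ↔ m = m' := by
  refine ⟨fun h => Fin.ext ?_, fun h => h ▸ rfl⟩
  refine digs_inj (L := L) (m.isLt.trans_eq hn) (m'.isLt.trans_eq hn) ?_
  rw [← ofFn_dg, ← ofFn_dg, h]

theorem dg_ext (hn : n + 1 = B ^ L) {m m' : Fin (n + 1)} :
    (∀ y, dg B L m y = dg B L m' y) ↔ m = m' := by
  rw [← dg_inj hn, funext_iff]

/-- Both numbers are at most `n`, that is, below `B ^ L`, so the increment must not overflow; this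
is the condition that `Aut.add` tests. -/
theorem dg_succ (hn : n + 1 = B ^ L) {m m' : Fin (n + 1)} :
    incDigits true (List.ofFn (dg B L m)) = (false, List.ofFn (dg B L m')) ↔
      m'.val = m.val + 1 := by
  have h1 := m.isLt
  have h2 := m'.isLt
  rw [ofFn_dg, ofFn_dg, incDigits_digs _ _ (by omega), Prod.mk.injEq, decide_eq_false_iff_not]
  constructor
  · rintro ⟨h3, h4⟩
    exact (digs_inj (by omega) (by omega) h4).symm
  · intro h
    exact ⟨by omega, by rw [h]⟩

theorem dg_zero (hn : n + 1 = B ^ L) {m : Fin (n + 1)} : (∀ y, dg B L m y = 0) ↔ m = 0 := by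
  rw [← dg_inj hn, funext_iff]
  simp [dg]

theorem incDigits_last {ds : List (Fin B)} (h : ∀ d ∈ ds, d.val + 1 = B) :
    (incDigits true ds).1 = true := by
  induction ds with
  | nil => rfl
  | cons d ds ih =>
    simp only [List.mem_cons, forall_eq_or_imp] at h
    simpa [incDigits, incDigit, h.1] using ih h.2

theorem incDigits_true_fst {ds : List (Fin B)} (h : (incDigits true ds).1 = true) :
    ∀ d ∈ ds, d.val + 1 = B := by
  induction ds with
  | nil => simp
  | cons d ds ih =>
    simp only [incDigits, incDigit, if_true] at h
    by_cases hd : d.val + 1 = B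
    · simp only [hd, decide_true] at h
      simpa [hd] using ih h
    · simp [hd, incDigits_false] at h

/-- Since `n = B ^ L - 1`, a counter has reached its end exactly when all its digits are maximal,
which can be tested in each column separately. -/
theorem dg_last (hn : n + 1 = B ^ L) {m : Fin (n + 1)} :
    (∀ y, (dg B L m y).val + 1 = B) ↔ m.val = n := by
  have h1 := m.isLt
  have h2 : (incDigits true (List.ofFn (dg B L m))).1 = decide (m.val + 1 = B ^ L) := by
    rw [ofFn_dg, incDigits_digs _ _ (by omega)]
  constructor
  · intro h
    have := h2.symm.trans (incDigits_last (by simpa using h))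
    simp only [decide_eq_true_eq] at this
    omega
  · intro h
    have := incDigits_true_fst (h2.trans (by simp; omega))
    simpa using this

theorem cell_injective (hn : n + 1 = B ^ L) (hL : 0 < L) :
    (cell B : BState (Fin L → D) n r → Fin L → Col D B r).Injective := by
  rintro ⟨x, i, t, p⟩ ⟨x', i', t', p'⟩ h
  have h := fun y => congrFun h y
  simp only [cell, Prod.mk.injEq, forall_and] at h
  obtain ⟨⟨h1, h2, h3⟩, h4⟩ := h
  rw [funext h1, (dg_inj hn).mp (funext h2), (dg_inj hn).mp (funext h3), h4 ⟨0, hL⟩]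

/-- As `n + 1` is exactly `B ^ L`, every digit string is a counter value; only the constancy of the
phase has to be required. Hence pairs accepted by the automata are always pairs of states. -/
theorem exists_cell (hn : n + 1 = B ^ L) {u : Fin L → Col D B r} {p : Ph r}
    (h : ∀ y, (u y).2 = p) :
    ∃ s : BState (Fin L → D) n r, s.2.2.2 = p ∧ u = cell B s := by
  obtain ⟨i, hi⟩ := exists_dg hn fun y => (u y).1.2.1
  obtain ⟨t, ht⟩ := exists_dg hn fun y => (u y).1.2.2
  exact ⟨(fun y => (u y).1.1, i, t, p), rfl, funext fun y => by simp [cell, hi, ht, ← h y]⟩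

/-- The kinds of transitions; a number refers to the automaton of an edge. -/
inductive Kind (K r : ℕ) where
  | stay
  | sil (k : Fin K)
  | opn
  | run (j j' : Fin (r + 1))
  | cls (k : Fin K) (j : Fin (r + 1))
  | rep (j : Fin (r + 1))
  | fin (j : Fin (r + 1))
  | loop

instance {K : ℕ} : Finite (Kind K r) :=
  Finite.of_injective (fun p : Kind K r => (match p with
      | .stay => .inl 0
      | .opn => .inl 1
      | .loop => .inl 2
      | .sil k => .inr (.inl k)
      | .run j j' => .inr (.inr (.inl (j, j')))
      | .cls k j => .inr (.inr (.inr (.inl (k, j))))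
      | .rep j => .inr (.inr (.inr (.inr (j, false))))
      | .fin j => .inr (.inr (.inr (.inr (j, true)))) :
      Fin 3 ⊕ Fin K ⊕ (Fin (r + 1) × Fin (r + 1)) ⊕ (Fin K × Fin (r + 1)) ⊕ (Fin (r + 1) × Bool)))
    (by rintro (_ | _ | _ | _ | _ | _ | _ | _) (_ | _ | _ | _ | _ | _ | _ | _) h <;> simp_all)

/-- The label, the phases before and after a transition, a global condition and a condition on
every column, the counters that are incremented, and the automaton for the edge of the graph. -/
structure KindData (σ Γ D S : Type) (B r : ℕ) where
  lab : Op σ Unit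
  ph : Ph r
  ph' : Ph r
  g : Prop
  ok : D × Fin B × Fin B → D × Fin B × Fin B → Prop
  incI : Bool
  incT : Bool
  edge : Option (Aut Γ (Fin 2 × (D × D)) S)

open scoped Classical in
/-- The automaton that recognizes the transitions of one kind. -/
noncomputable def KindData.aut (s₀ : S) (K : KindData σ Γ D S B r) :
    Aut Γ (Fin 2 × (Col D B r × Col D B r)) (Bool × (Bool × Bool) × (Bool × Bool) × S) :=
  ((Aut.all fun d => decide (d.2.1.2 = K.ph ∧ d.2.2.2 = K.ph' ∧ K.ok d.2.1.1 d.2.2.1)).and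
    ((if K.incI then Aut.add (fun _ => true) (fun _ d => d.2.1.1.2.1) (fun _ d => d.2.2.1.2.1)
      else Aut.triv (true, true)).and
    ((if K.incT then Aut.add (fun _ => true) (fun _ d => d.2.1.1.2.2) (fun _ d => d.2.2.1.2.2)
      else Aut.triv (true, true)).and
    (match K.edge with
      | some M => M.comap (Prod.map id (Prod.map (fun d => d.1.1) (fun d => d.1.1)))
      | none => Aut.triv s₀)))).guard fun _ => decide K.g

theorem KindData.accepts_aut (s₀ : S) (K : KindData σ Γ D S B r) (a : InSym Γ) (p : ℕ)
    (u v : Fin L → Col D B r) :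
    (K.aut s₀).accepts a ((digs 2 L p).zip (List.ofFn fun y => (u y, v y))) = true ↔
      K.g ∧ (∀ y, (u y).2 = K.ph ∧ (v y).2 = K.ph' ∧ K.ok (u y).1 (v y).1) ∧
      (K.incI = true → incDigits true (List.ofFn fun y => (u y).1.2.1) =
        (false, List.ofFn fun y => (v y).1.2.1)) ∧
      (K.incT = true → incDigits true (List.ofFn fun y => (u y).1.2.2) =
        (false, List.ofFn fun y => (v y).1.2.2)) ∧
      ∀ M ∈ K.edge, M.accepts a
        ((digs 2 L p).zip (List.ofFn fun y => ((u y).1.1, (v y).1.1))) = true := by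
  classical
  rw [aut, Aut.accepts_guard, Aut.accepts_and, Aut.accepts_and, Aut.accepts_and]
  simp only [Bool.and_eq_true]
  refine and_congr (by simp) (and_congr ?_ (and_congr ?_ (and_congr ?_ ?_)))
  · rw [Aut.accepts_all, zip_digs_ofFn]
    simp
  · cases K.incI
    · simp [Aut.accepts_triv]
    · rw [if_pos rfl, Aut.accepts_add, zip_digs_ofFn]
      simp [List.map_ofFn, Function.comp_def]
  · cases K.incT
    · simp [Aut.accepts_triv]
    · rw [if_pos rfl, Aut.accepts_add, zip_digs_ofFn]
      simp [List.map_ofFn, Function.comp_def]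
  · cases K.edge with
    | none => simp [Aut.accepts_triv]
    | some M =>
      simp only [Aut.accepts_comap, Option.mem_def, Option.some.injEq, forall_eq']
      rw [zip_digs_ofFn, zip_digs_ofFn, List.map_ofFn]
      rfl

variable (a : σ) (accD : D → Bool) (κ : List (Option Δ × Aut Γ (Fin 2 × (D × D)) S))
  (e : Fin (r + 1) ≃ Option Δ)

/-- The data of a kind of transitions. -/
def Kind.data (B : ℕ) [NeZero B] : Kind κ.length r → KindData σ Γ D S B r
  | .stay => ⟨.letter a, .start, .start, True, fun c c' => c'.1 = c.1 ∧ c'.2.1 = c.2.1,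
      false, true, none⟩
  | .sil k => ⟨.letter a, .start, .start, κ[k].1 = none, fun c c' => c'.2.1 = c.2.1,
      false, true, some κ[k].2⟩
  | .opn => ⟨.opn (), .start, .run 0, True, fun c c' => c' = c ∧ c.2.2.val + 1 = B,
      false, false, none⟩
  | .run j j' => ⟨.letter a, .run j, .run j', j'.val = j.val + 1, fun c c' => c' = c,
      false, false, none⟩
  | .cls k j => ⟨.cls (), .run j, .start, κ[k].1 = e j ∧ e j ≠ none, fun _ c' => c'.2.2 = 0,
      true, false, some κ[k].2⟩
  | .rep j => ⟨.cls (), .run j, .start, e j = none,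
      fun c c' => c'.1 = c.1 ∧ accD c.1 = true ∧ c'.2.2 = 0, true, false, none⟩
  | .fin j => ⟨.cls (), .run j, .fin, e j = none, fun c c' => c'.1 = c.1 ∧ accD c.1 = true ∧
      c.2.1.val + 1 = B ∧ c'.2.1 = 0 ∧ c'.2.2 = 0, false, false, none⟩
  | .loop => ⟨.letter a, .fin, .fin, True, fun c c' => c' = c, false, false, none⟩

variable (w : List Γ)

/-- Pairs of strings that are accepted for some input position. -/
def Hit (s₀ : S) (K : KindData σ Γ D S B r) (u v : Fin L → Col D B r) : Prop :=
  ∃ p ≤ w.length + 1, (K.aut s₀).accepts (readInput w p)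
    ((digs 2 L p).zip (List.ofFn fun y => (u y, v y))) = true

variable {a accD κ e w} {s₀ : S}

theorem Hit.exists_cell (hn : n + 1 = B ^ L) {K : KindData σ Γ D S B r} {u v : Fin L → Col D B r}
    (h : Hit w s₀ K u v) : ∃ s s' : BState (Fin L → D) n r, u = cell B s ∧ v = cell B s' := by
  obtain ⟨p, -, h⟩ := h
  rw [KindData.accepts_aut] at h
  obtain ⟨s, -, hs⟩ := Spanner.exists_cell hn fun y => (h.2.1 y).1
  obtain ⟨s', -, hs'⟩ := Spanner.exists_cell hn fun y => (h.2.1 y).2.1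
  exact ⟨s, s', hs, hs'⟩

/-- A waiting step and a silent edge are different kinds but the same form of transition, and
likewise a block with a symbol and a padding block. The variable of a label is always the block
counter of the source state. -/
theorem Hit.sound (hn : n + 1 = B ^ L) (hL : 0 < L) {K : Kind κ.length r}
    {s s' : BState (Fin L → D) n r} (h : Hit w s₀ (K.data a accD κ e B) (cell B s) (cell B s')) :
    Trans a (ofAuts κ w L) (fun u => ∀ y, accD (u y) = true) e s
      (Op.map (fun _ => s.2.1) (K.data a accD κ e B).lab) s' := by
  obtain ⟨p, hp, h⟩ := h
  rw [KindData.accepts_aut] at h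
  obtain ⟨hg, h, hI, hT, hE⟩ := h
  have : Nonempty (Fin L) := ⟨⟨0, hL⟩⟩
  have mem : ∀ (k : Fin κ.length) {l}, κ[k].1 = l → (l, κ[k].2) ∈ κ := by
    rintro k l rfl; exact List.getElem_mem k.isLt
  obtain ⟨x, i, t, ph⟩ := s
  obtain ⟨x', i', t', ph'⟩ := s'
  simp only [cell, forall_and, forall_const] at h hI hT hE
  obtain ⟨h1, h2, h3⟩ := h
  cases K <;> simp only [Kind.data, forall_and, Prod.mk.injEq, forall_const, dg_ext hn, dg_last hn,
    dg_zero hn, Option.mem_def, Option.some.injEq, forall_eq'] at h1 h2 h3 hI hT hE hg <;>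
    subst h1 h2
  case stay =>
    obtain ⟨h3, rfl⟩ := h3
    obtain rfl := funext h3
    exact .sil ((dg_succ hn).mp hT) (.inl rfl)
  case sil k =>
    subst h3
    exact .sil ((dg_succ hn).mp hT) (.inr ⟨p, hp, κ[k].2, mem k hg, hE⟩)
  case opn =>
    obtain ⟨⟨h3, rfl, rfl⟩, h4⟩ := h3
    obtain rfl := funext h3
    exact .opn h4
  case run j j' =>
    obtain ⟨h3, rfl, rfl⟩ := h3
    obtain rfl := funext h3
    exact .run hg
  case cls k j =>
    subst h3
    obtain ⟨d, hd⟩ := Option.ne_none_iff_exists'.mp hg.2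
    exact .cls ((dg_succ hn).mp hI) (.inl ⟨d, hd, p, hp, κ[k].2, mem k hg.1, hE⟩)
  case rep j =>
    obtain ⟨h3, h4, rfl⟩ := h3
    obtain rfl := funext h3
    exact .cls ((dg_succ hn).mp hI) (.inr ⟨hg, h4, rfl⟩)
  case fin j =>
    obtain ⟨h3, h4, h5, rfl, rfl⟩ := h3
    obtain rfl := funext h3
    exact .fin h5 h4 hg
  case loop =>
    obtain ⟨h3, rfl, rfl⟩ := h3
    obtain rfl := funext h3
    exact .loop

/-- Only kinds that contain an edge of the graph depend on the input position; all others are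
accepted at every position, and position `0` is used as witness. -/
theorem Hit.complete (hn : n + 1 = B ^ L) {s s' : BState (Fin L → D) n r}
    {o : Op σ (Fin (n + 1))}
    (h : Trans a (ofAuts κ w L) (fun u => ∀ y, accD (u y) = true) e s o s') :
    ∃ K : Kind κ.length r, o = Op.map (fun _ => s.2.1) (K.data a accD κ e B).lab ∧
      Hit w s₀ (K.data a accD κ e B) (cell B s) (cell B s') := by
  simp only [Hit, KindData.accepts_aut]
  cases h with
  | @sil x x' i t t' ht hx =>
    rcases hx with rfl | ⟨p, hp, A, hA, hx⟩
    · exact ⟨.stay, rfl, 0, by omega, trivial, fun y => ⟨rfl, rfl, rfl, rfl⟩, nofun,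
        fun _ => (dg_succ hn).mpr ht, nofun⟩
    · obtain ⟨k, hk, hA⟩ := List.getElem_of_mem hA
      refine ⟨.sil ⟨k, hk⟩, rfl, p, hp, congrArg Prod.fst hA, fun y => ⟨rfl, rfl, rfl⟩, nofun,
        fun _ => (dg_succ hn).mpr ht, ?_⟩
      rintro M hM
      obtain rfl : κ[k].2 = M := Option.some.inj hM
      rw [hA]
      exact hx
  | @opn x i t ht =>
    exact ⟨.opn, rfl, 0, by omega, trivial, fun y => ⟨rfl, rfl, rfl, (dg_last hn).mpr ht y⟩, nofun,
        nofun, nofun⟩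
  | @run x i t j j' hj =>
    exact ⟨.run j j', rfl, 0, by omega, hj, fun y => ⟨rfl, rfl, rfl⟩, nofun, nofun, nofun⟩
  | @cls x x' i i' t j hi hx =>
    have h0 : ∀ y, dg B L (0 : Fin (n + 1)) y = 0 := (dg_zero hn).mpr rfl
    rcases hx with ⟨d, hd, p, hp, A, hA, hx⟩ | ⟨h1, h2, rfl⟩
    · obtain ⟨k, hk, hA⟩ := List.getElem_of_mem hA
      refine ⟨.cls ⟨k, hk⟩ j, rfl, p, hp, ⟨congrArg Prod.fst hA, by simp [hd]⟩,
        fun y => ⟨rfl, rfl, h0 y⟩, fun _ => (dg_succ hn).mpr hi, nofun, ?_⟩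
      rintro M hM
      obtain rfl : κ[k].2 = M := Option.some.inj hM
      rw [hA]
      exact hx
    · exact ⟨.rep j, rfl, 0, by omega, h1, fun y => ⟨rfl, rfl, rfl, h2 y, h0 y⟩,
        fun _ => (dg_succ hn).mpr hi, nofun, nofun⟩
  | @fin x i t j hi hx hj =>
    have h0 : ∀ y, dg B L (0 : Fin (n + 1)) y = 0 := (dg_zero hn).mpr rfl
    exact ⟨.fin j, rfl, 0, by omega, hj,
      fun y => ⟨rfl, rfl, rfl, hx y, (dg_last hn).mpr hi y, h0 y, h0 y⟩, nofun, nofun, nofun⟩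
  | loop =>
    exact ⟨.loop, rfl, 0, by omega, trivial, fun y => ⟨rfl, rfl, rfl⟩, nofun, nofun, nofun⟩

end Kinds

end Spanner


/-! ### Hardness: the reduction and the final count. -/

namespace Spanner

open Machine Machine.Graph

/-! ### The reduction -/

section Reduction

variable {σ Γ Δ D S : Type} {B L n r : ℕ} [NeZero B] [Finite D] [Nonempty D]

/-- All kinds of transitions. -/
noncomputable def kinds (K r : ℕ) : List (Kind K r) :=
  letI := Fintype.ofFinite (Kind K r)
  Finset.univ.toList

theorem mem_kinds {K r : ℕ} (k : Kind K r) : k ∈ kinds K r := by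
  simp [kinds]

/-- The items that print a label. -/
noncomputable def labItems : Op σ Unit → List (Item (Col D B r × Col D B r) (Sym σ))
  | .letter a => [symItem (.letter a)]
  | .opn _ => [symItem .opn] ++ nameItems fun d => d.1.1.2.1
  | .cls _ => [symItem .cls] ++ nameItems fun d => d.1.1.2.1

/-- The label of a transition. -/
noncomputable def labOp (o : Op σ Unit) (s : List (Col D B r × Col D B r)) : Op σ (List Bool) :=
  o.map fun _ => oneHot (s.map fun d => d.1.1.2.1)

theorem printAll_labItems (o : Op σ Unit) (s : List (Col D B r × Col D B r)) :
    printAll (labItems o) s = encOp (labOp o s) := by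
  cases o with
  | letter a => exact printAll_symItem _ _
  | _ =>
    rw [labItems, printAll_append, printAll_symItem, printAll_nameItems]
    rfl

variable (a : σ) (z : D) (accD : D → Bool) (κ : List (Option Δ × Aut Γ (Fin 2 × (D × D)) S))
  (e : Fin (r + 1) ≃ Option Δ) (s₀ : S)

/-- The enumerated transitions of one kind. -/
noncomputable def hitsOf (B : ℕ) [NeZero B] (K : Kind κ.length r) (L : ℕ) (w : List Γ) :
    List (List (Col D B r × Col D B r)) :=
  ((K.data a accD κ e B).aut s₀).hits L w

/-- The enumeration of the automaton and the document. -/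
noncomputable def blocks (B : ℕ) [NeZero B] :
    List (Block Γ (Sym σ) (Col D B r × Col D B r) (Bool × (Bool × Bool) × (Bool × Bool) × S)) :=
  let sing := fun (its : List (Item Unit (Sym σ))) =>
    [(⟨its, [], Aut.triv (true, (true, true), (true, true), s₀)⟩ : Block Γ (Sym σ)
      (Col D B r × Col D B r) (Bool × (Bool × Bool) × (Bool × Bool) × S))]
  let q₀ := nameItems fun _ : Unit => (((z, 0, 0), .start) : Col D B r)
  sing q₀ ++
  (kinds κ.length r).map (fun K => ⟨[], nameItems Prod.fst ++ nameItems Prod.snd,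
    (K.data a accD κ e B).aut s₀⟩) ++
  sing ([symItem .bar] ++ q₀ ++ [symItem .bar]) ++
  -- Every state of the final phase has a loop, so the loop transitions list all final states.
  [⟨[], nameItems Prod.snd, (Kind.loop.data a accD κ e B).aut s₀⟩] ++
  sing [symItem .bar] ++
  (kinds κ.length r).map (fun K => ⟨[], nameItems Prod.fst ++ labItems (K.data a accD κ e B).lab ++
    nameItems Prod.snd, (K.data a accD κ e B).aut s₀⟩) ++
  sing [symItem .bar] ++
  -- The document: one letter for each pair of a position and a string.
  [⟨[], [symItem (.letter a)], Aut.triv (true, (true, true), (true, true), s₀)⟩]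

/-- The name of the initial state. -/
noncomputable def initName (B : ℕ) [NeZero B] (r : ℕ) (z : D) (L : ℕ) : List Bool :=
  oneHot (List.replicate L (((z, 0, 0), .start) : Col D B r))

/-- The list of states. -/
noncomputable def stateNames (B : ℕ) [NeZero B] (L : ℕ) (w : List Γ) : List (List Bool) :=
  initName B r z L :: (kinds κ.length r).flatMap fun K =>
    (hitsOf a accD κ e s₀ B K L w).flatMap fun s =>
      [oneHot (s.map Prod.fst), oneHot (s.map Prod.snd)]

/-- The list of final states. -/
noncomputable def finalNames (B : ℕ) [NeZero B] (L : ℕ) (w : List Γ) : List (List Bool) :=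
  (hitsOf a accD κ e s₀ B .loop L w).map fun s => oneHot (s.map Prod.snd)

/-- The list of transitions. -/
noncomputable def transNames (B : ℕ) [NeZero B] (L : ℕ) (w : List Γ) :
    List (List Bool × Op σ (List Bool) × List Bool) :=
  (kinds κ.length r).flatMap fun K => (hitsOf a accD κ e s₀ B K L w).map fun s =>
    (oneHot (s.map Prod.fst), labOp (K.data a accD κ e B).lab s, oneHot (s.map Prod.snd))

theorem printAll_blocks (L : ℕ) (w : List Γ) :
    ((blocks a z accD κ e s₀ B).flatMap fun bl => printAll bl.pre (List.replicate L ()) ++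
      (bl.aut.hits L w).flatMap (printAll bl.items)) =
    encInput (stateNames a z accD κ e s₀ B L w) (initName B r z L)
      (finalNames a accD κ e s₀ B L w) (transNames a accD κ e s₀ B L w)
      (List.replicate ((w.length + 2) * Nat.card (Col D B r × Col D B r) ^ L) a) := by
  have h0 : ∀ (bl : List (List (Col D B r × Col D B r))),
      bl.flatMap (printAll ([] : List (Item _ (Sym σ)))) = [] := fun bl => by simp [printAll]
  have h1 : ∀ L : List (List (Col D B r × Col D B r)),
      L.flatMap (printAll [symItem (.letter a)]) = (List.replicate L.length a).map Sym.letter := by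
    intro L
    induction L with
    | nil => rfl
    | cons s L ih => simpa [List.replicate_succ, printAll_symItem] using ih
  have h2 : ∀ s : List Unit, printAll ([] : List (Item Unit (Sym σ))) s = [] := fun _ => rfl
  have h3 : printAll (nameItems Prod.fst ++ nameItems Prod.snd) =
      fun s : List (Col D B r × Col D B r) => encName (σ := σ) (oneHot (s.map Prod.fst)) ++
        encName (oneHot (s.map Prod.snd)) :=
    funext fun s => by simp only [printAll_append, printAll_nameItems]
  have h4 : printAll (nameItems Prod.snd) =
      fun s : List (Col D B r × Col D B r) => encName (σ := σ) (oneHot (s.map Prod.snd)) :=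
    funext fun s => printAll_nameItems _ s
  have h5 : ∀ o : Op σ Unit, printAll (nameItems Prod.fst ++ labItems o ++ nameItems Prod.snd) =
      fun s : List (Col D B r × Col D B r) =>
        encTrans (oneHot (s.map Prod.fst), labOp o s, oneHot (s.map Prod.snd)) :=
    fun o => funext fun s => by
      simp only [printAll_append, printAll_nameItems, printAll_labItems, encTrans]
  simp only [blocks, List.flatMap_append, List.flatMap_cons, List.flatMap_nil, List.append_nil,
    List.flatMap_map, h0, h1, h2, h3, h4, h5, List.nil_append, printAll_append, printAll_symItem,
    Aut.length_hits_triv, printAll_nameItems]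
  simp only [encInput, stateNames, finalNames, transNames, hitsOf, initName, List.flatMap_cons,
    List.flatMap_assoc, List.flatMap_map, List.append_assoc, List.flatMap_nil, List.append_nil, List.map_replicate]

variable {a z accD κ e s₀} {w : List Γ}

theorem mem_hitsOf {K : Kind κ.length r} {s : List (Col D B r × Col D B r)} :
    s ∈ hitsOf a accD κ e s₀ B K L w ↔ ∃ u v : Fin L → Col D B r,
      s = List.ofFn (fun y => (u y, v y)) ∧ Hit w s₀ (K.data a accD κ e B) u v := by
  rw [hitsOf, Aut.mem_hits]
  constructor
  · rintro ⟨rfl, h⟩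
    refine ⟨fun y => s[y].1, fun y => s[y].2, ?_, ?_⟩
    · exact (List.ofFn_getElem).symm
    · rw [Hit, show List.ofFn (fun y : Fin s.length => (s[y].1, s[y].2)) = s from
        List.ofFn_getElem]
      exact h
  · rintro ⟨u, v, rfl, h⟩
    exact ⟨by simp, h⟩

theorem mem_hitsOf_iff (hn : n + 1 = B ^ L) {K : Kind κ.length r}
    {s : List (Col D B r × Col D B r)} :
    s ∈ hitsOf a accD κ e s₀ B K L w ↔ ∃ t t' : BState (Fin L → D) n r,
      s = List.ofFn (fun y => (cell B t y, cell B t' y)) ∧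
      Hit w s₀ (K.data a accD κ e B) (cell B t) (cell B t') := by
  rw [mem_hitsOf]
  constructor
  · rintro ⟨u, v, rfl, h⟩
    obtain ⟨t, t', rfl, rfl⟩ := h.exists_cell hn
    exact ⟨t, t', rfl, h⟩
  · rintro ⟨t, t', rfl, h⟩
    exact ⟨_, _, rfl, h⟩

/-- The name of a state. -/
noncomputable def stName (B : ℕ) [NeZero B] (s : BState (Fin L → D) n r) : List Bool :=
  oneHot (List.ofFn (cell B s))

/-- The name of a variable. -/
noncomputable def varName (B L : ℕ) [NeZero B] (i : Fin (n + 1)) : List Bool :=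
  oneHot (List.ofFn (dg B L i))

theorem mem_transNames (hn : n + 1 = B ^ L) (hL : 0 < L) {p q : List Bool}
    {o : Op σ (List Bool)} : (p, o, q) ∈ transNames a accD κ e s₀ B L w ↔
      ∃ (s : BState (Fin L → D) n r) (o' : Op σ (Fin (n + 1))) (s' : BState (Fin L → D) n r),
        Trans a (ofAuts κ w L) (fun u => ∀ y, accD (u y) = true) e s o' s' ∧
        p = stName B s ∧ o = o'.map (varName B L) ∧ q = stName B s' := by
  have hlab : ∀ (l : Op σ Unit) (t t' : BState (Fin L → D) n r),
      labOp l (List.ofFn fun y => (cell B t y, cell B t' y)) =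
        (l.map fun _ => t.2.1).map (varName B L) := by
    intro l t t'
    have : oneHot ((List.ofFn fun y => (cell B t y, cell B t' y)).map fun d => d.1.1.2.1) =
        varName B L t.2.1 := by
      rw [List.map_ofFn]; rfl
    cases l <;> simp only [labOp, this] <;> rfl
  have hfst : ∀ t t' : BState (Fin L → D) n r,
      oneHot ((List.ofFn fun y => (cell B t y, cell B t' y)).map Prod.fst) = stName B t := by
    intro t t'; rw [List.map_ofFn]; rfl
  have hsnd : ∀ t t' : BState (Fin L → D) n r,
      oneHot ((List.ofFn fun y => (cell B t y, cell B t' y)).map Prod.snd) = stName B t' := by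
    intro t t'; rw [List.map_ofFn]; rfl
  simp only [transNames, List.mem_flatMap, List.mem_map, mem_hitsOf_iff hn, Prod.mk.injEq]
  constructor
  · rintro ⟨K, -, _, ⟨t, t', rfl, h⟩, rfl, rfl, rfl⟩
    exact ⟨t, _, t', h.sound hn hL, hfst _ _, hlab _ _ _, hsnd _ _⟩
  · rintro ⟨s, o', s', h, rfl, rfl, rfl⟩
    obtain ⟨K, rfl, hK⟩ := Hit.complete (s₀ := s₀) hn h
    exact ⟨K, mem_kinds K, _, ⟨s, s', rfl, hK⟩, hfst _ _, hlab _ _ _, hsnd _ _⟩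

/-- All states of the final phase are final, also unreachable ones. This is harmless, as only loops
leave them. -/
theorem mem_finalNames (hn : n + 1 = B ^ L) {q : List Bool} :
    q ∈ finalNames a accD κ e s₀ B L w ↔
      ∃ x i t, q = stName B ((x, i, t, .fin) : BState (Fin L → D) n r) := by
  simp only [finalNames, List.mem_map, mem_hitsOf]
  constructor
  · rintro ⟨_, ⟨u, v, rfl, p, -, h⟩, rfl⟩
    rw [KindData.accepts_aut] at h
    obtain ⟨⟨x, i, t, ph⟩, h1, rfl⟩ := exists_cell hn fun y => (h.2.1 y).2.1
    obtain rfl : ph = .fin := h1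
    exact ⟨x, i, t, by rw [List.map_ofFn]; rfl⟩
  · rintro ⟨x, i, t, rfl⟩
    refine ⟨_, ⟨cell B (x, i, t, .fin), cell B (x, i, t, .fin), rfl, 0, by omega,
      (KindData.accepts_aut ..).mpr ⟨trivial, fun y => ⟨rfl, rfl, rfl⟩, nofun, nofun, nofun⟩⟩, ?_⟩
    rw [List.map_ofFn]; rfl

/-- The automaton that is computed by the reduction. -/
noncomputable def redVA (a : σ) (z : D) (accD : D → Bool)
    (κ : List (Option Δ × Aut Γ (Fin 2 × (D × D)) S)) (e : Fin (r + 1) ≃ Option Δ) (s₀ : S)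
    (B L : ℕ) [NeZero B] (w : List Γ) : VA σ (List Bool) (List Bool) :=
  letI := Classical.decEq (List Bool)
  letI := Classical.decEq (List Bool × Op σ (List Bool) × List Bool)
  { states := (stateNames a z accD κ e s₀ B L w).toFinset
    init := initName B r z L
    final := (finalNames a accD κ e s₀ B L w).toFinset
    trans := (transNames a accD κ e s₀ B L w).toFinset
    init_mem := by simp [stateNames]
    final_subset := by
      intro q hq
      obtain ⟨s, hs, rfl⟩ := List.mem_map.mp (List.mem_toFinset.mp hq)
      exact List.mem_toFinset.mpr (List.mem_cons_of_mem _ (List.mem_flatMap.mpr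
        ⟨_, mem_kinds .loop, List.mem_flatMap.mpr ⟨s, hs, by simp⟩⟩))
    trans_mem := by
      intro t ht
      obtain ⟨K, hK, ht⟩ := List.mem_flatMap.mp (List.mem_toFinset.mp ht)
      obtain ⟨s, hs, rfl⟩ := List.mem_map.mp ht
      constructor <;> exact List.mem_toFinset.mpr (List.mem_cons_of_mem _ (List.mem_flatMap.mpr
        ⟨K, hK, List.mem_flatMap.mpr ⟨s, hs, by simp⟩⟩)) }

/-- The printed lists contain repetitions, for instance transitions accepted at several input
positions. `IsCode` compares lists and sets by membership only. -/
theorem isCode_redVA (d : List σ) :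
    IsCode (encInput (stateNames a z accD κ e s₀ B L w) (initName B r z L)
      (finalNames a accD κ e s₀ B L w) (transNames a accD κ e s₀ B L w) d)
      (redVA a z accD κ e s₀ B L w) d := by
  refine ⟨_, _, _, fun q => ?_, fun q => ?_, fun t => ?_, rfl⟩ <;> simp [redVA]

theorem spells_redVA (hn : n + 1 = B ^ L) (hL : 0 < L) :
    Spells (redVA a z accD κ e s₀ B L w) a (ofAuts κ w L) (fun u => ∀ y, accD (u y) = true) e
      (fun _ => z) (stName B : BState (Fin L → D) n r → List Bool) (varName B L) where
  nm_inj s s' h := cell_injective hn hL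
    (List.ofFn_injective (oneHot_inj (by simp) h))
  vn_inj i i' h := (dg_inj hn).mp (List.ofFn_injective (oneHot_inj (by simp) h))
  init := by
    refine congrArg oneHot (?_ : List.replicate L _ = List.ofFn _)
    rw [← List.ofFn_const]
    congr 1
    funext y
    simp [cell, dg]
  trans p o q := by
    rw [← mem_transNames (s₀ := s₀) hn hL]
    simp [redVA]
  final q hq := (mem_finalNames (s₀ := s₀) (w := w) (e := e) (κ := κ) (a := a) (accD := accD)
    hn).mp (by simpa [redVA] using hq)
  mem_final s o x _ := by
    simpa [redVA] using (mem_finalNames (s₀ := s₀) (w := w) (e := e) (κ := κ) (a := a)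
      (accD := accD) hn).mpr ⟨x, 0, 0, rfl⟩

end Reduction

/-- The left side is the document length demanded by `Spells.encard_sem`, the right side the one
that is printed: `B` is the size of `D`, `h` the number of phases, and the base of the power the
number of pairs of columns. -/
theorem le_mul_pow_of_succ_eq {B h L r m n : ℕ} (hB : 0 < B) (hL : 0 < L) (hh : r + 1 ≤ h)
    (hn : n + 1 = B ^ L) : n + (n + 1) * (r + n) ≤ (m + 2) * (B * (B * B) * h * (B * (B * B) * h)) ^ L :=
  calc n + (n + 1) * (r + n) ≤ (n + 1) * (n + 1) * (r + 1) := by nlinarith [Nat.zero_le (n * n * r)]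
    _ ≤ (n + 1) * (n + 1) * h ^ L :=
      Nat.mul_le_mul_left _ (hh.trans (Nat.le_self_pow hL.ne' h))
    _ = (B * B * h) ^ L := by rw [hn, mul_pow, mul_pow]
    _ ≤ (B * (B * B) * h * (B * (B * B) * h)) ^ L := by
      have h1 : 1 ≤ B * (B * B * B * h) := Nat.mul_pos hB (Nat.mul_pos (by positivity) (by omega))
      refine Nat.pow_le_pow_left ?_ L
      calc B * B * h = B * B * h * 1 := (mul_one _).symm
        _ ≤ B * B * h * (B * (B * B * B * h)) := Nat.mul_le_mul_left _ h1
        _ = _ := by ring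
    _ ≤ (m + 2) * (B * (B * B) * h * (B * (B * B) * h)) ^ L :=
      Nat.le_mul_of_pos_left _ (by omega)

/-- Counting the output words of a graph recognized by finite automata reduces to counting the
output mappings of a functional automaton. -/
theorem exists_reduction {σ Γ Δ D S : Type} [Finite Δ] [Finite D] [Finite S] (a : σ) (z : D)
    (s₀ : S) (accD : D → Bool) (κ : List (Option Δ × Aut Γ (Fin 2 × (D × D)) S)) (b : ℕ) :
    ∃ f : List Γ → List (Sym σ), LogSpaceComputable f ∧ ∀ w, ∃ x, (CountFVA σ).IsCode (f w) x ∧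
      ∃ n, Nat.card (Fin (strLen b w.length) → D) ≤ n + 1 ∧ (CountFVA σ).value x =
        (words (ofAuts κ w (strLen b w.length)) (fun u => ∀ y, accD (u y) = true) n
          fun _ => z).encard := by
  obtain ⟨r, hr⟩ : ∃ r, Nat.card (Option Δ) = r + 1 :=
    ⟨_, (Nat.succ_pred_eq_of_pos Nat.card_pos).symm⟩
  let e : Fin (r + 1) ≃ Option Δ := (Finite.equivFinOfCardEq hr).symm
  have : Nonempty D := ⟨z⟩
  have : NeZero (Nat.card D) := ⟨Nat.card_pos.ne'⟩
  refine ⟨_, logSpaceComputable_enum b (blocks a z accD κ e s₀ (Nat.card D)), fun w => ?_⟩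
  -- The choice of `n` makes `n + 1` the number of vertices. With base `|D|`, the counters up to `n`
  -- then need exactly as many digits as a vertex has columns.
  have hn : Nat.card D ^ strLen b w.length - 1 + 1 = Nat.card D ^ strLen b w.length :=
    Nat.sub_add_cancel (Nat.pow_pos Nat.card_pos)
  have hs := spells_redVA (a := a) (z := z) (accD := accD) (κ := κ) (e := e) (s₀ := s₀) (w := w) hn
    (strLen_pos _ _)
  rw [printAll_blocks]
  refine ⟨(⟨_, hs.functional⟩, _), isCode_redVA _, _, ?_, hs.encard_sem ?_⟩
  · rw [hn, Nat.card_fun, Nat.card_fin]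
  · have hh : r + 1 ≤ Nat.card (Ph r) := by
      simpa using Nat.card_le_card_of_injective (Ph.run (r := r)) fun _ _ h => Ph.run.inj h
    simp only [Nat.card_prod, Nat.card_fin]
    exact le_mul_pow_of_succ_eq Nat.card_pos (strLen_pos _ _) hh hn

theorem countFVA_spanLHard (σ : Type) [Nonempty σ] : (CountFVA σ).SpanLHard := by
  rintro Γ - g ⟨Δ, _, M, hM, hg⟩
  obtain ⟨b, D, S, _, _, ⟨s₀⟩, z, accD, κ, h⟩ := hM.exists_auts
  obtain ⟨f, hf, hx⟩ := exists_reduction (Classical.arbitrary σ) z s₀ accD κ b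
  refine ⟨f, hf, fun w => ?_⟩
  obtain ⟨x, hx, n, hn, hv⟩ := hx w
  obtain ⟨h1, h2⟩ := h w
  refine ⟨x, hx, ?_⟩
  rw [hv, ← hg w, ← h2]
  refine encard_words (fun u l v hu => h1 u l v hu) hn ?_
  -- The outputs are finitely many because their number is the natural number `g w`; the bound on
  -- the length of outputs rests on this.
  rw [h2, ← Set.encard_ne_top_iff, hg]
  exact ENat.natCast_ne_top _

end Spanner

theorem mainTheorem2 (σ : Type) [Finite σ] [Nonempty σ] :
    (Spanner.CountFVA σ).SpanLComplete :=
  ⟨Spanner.countFVA_memSpanL σ, Spanner.countFVA_spanLHard σ⟩
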